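/- **Setting.** Over the affine line $X=\mathbb C$ with ring $\mathcal O=\mathbb C[z]$ and field of rational functions $\mathcal K=\mathbb C(z)$, let $(\boldsymbol{\mathfrak g},\boldsymbol K)$ be the algebraic family of Harish-Chandra pairs with $$\boldsymbol{\mathfrak g}|_z=\Bigl\{\Bigl(\begin{bmatrix}a&b\\zc&-a\end{bmatrix},\begin{bmatrix}a&zb\\c&-a\end{bmatrix}\Bigr)\Bigr\},\qquad K=\Bigl\{\Bigl(\begin{bmatrix}a&0\\0&a^{-1}\end{bmatrix},\begin{bmatrix}a&0\\0&a^{-1}\end{bmatrix}\Bigr):a\in\mathbb C^*\Bigr\},$$ with sections $H,E,F$ given by $(a,b,c)=(1,0,0),(0,1,0),(0,0,1)$, so that $[H,E]=2E$, $[H,F]=-2F$, $[E,F]=zH$, and Casimir $C=H^2+\frac2z(EF+FE)$ over $z\ne0$. The real structure $\sigma(S,T)=(\Theta(T^{-1})^*,\Theta(S^{-1})^*)$ covering $z\mapsto\bar z$, where $\Theta$ changes the sign of the off-diagonal entries, has the real groups $$\boldsymbol G|_x^\sigma=\Bigl\{\Bigl(\begin{bmatrix}a&b\\x\bar b&\bar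 a\end{bmatrix},\begin{bmatrix}a&xb\\\bar b&\bar a\end{bmatrix}\Bigr):|a|^2-x|b|^2=1\Bigr\}\qquad(x\in\mathbb R),$$ identified with $SU(1,1)$ for $x>0$ and with $SU(2)$ for $x<0$ by $(S,T)\mapsto \begin{bmatrix}S_{11}&y S_{12}\\y^{-1}S_{21}&S_{22}\end{bmatrix}$, $y=\sqrt{|x|}$; $\boldsymbol G|_0^\sigma\cong U(1)\ltimes\mathbb C$ is the motion group. In all of them $K^\sigma=U(1)$ is the group of pairs of equal matrices $\mathrm{diag}(u,\bar u)$. Let $\mathcal F$ be a quasi-admissible, generically irreducible algebraic family of Harish-Chandra modules (a flat $\mathcal O$-module with compatible actions of $\boldsymbol{\mathfrak g}$ and $K$) whose nonzero weight spaces are exactly those of even weight, which is generated by its $0$-weight space, and on which $C$ acts by $-(1+z)/z$. Let $\mathcal F^{\langle\sigma\rangle}$ be its $\sigma$-twisted dual (conjugate-linear functionals $\mathcal F\to\mathcal O$ vanishing on all but finitely many weight spaces). For a $(\boldsymbol{\mathfrak g},K)$-equivariant isomorphism $\varphi:\mathcal K\otimes_{\mathcal O}\mathcal F\to\mathcal K\otimes_{\mathcal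 O}\mathcal F^{\langle\sigma\rangle}$, $x\in\mathbb R$ and $n\in\mathbb Z$, with $\mathcal F_x,\mathcal F^{\langle\sigma\rangle}_x$ the localizations at $x$ and $p=z-x$, let $\mathcal F|_x^n$ be the image of $\{f\in\mathcal F_x:\varphi(f)\in p^n\mathcal F^{\langle\sigma\rangle}_x\}$ in the fibre $\mathcal F|_x$. The Jantzen quotients at $x$ are the $Q_n=\mathcal F|_x^n/\mathcal F|_x^{n+1}$. On $Q_n$ one has the sesquilinear form sending the classes of $f_1,f_2$ to $\bigl(p^{-n}\varphi(f_1)(f_2)\bigr)(x)$; $Q_n$ is infinitesimally unitary if $Q_n\neq0$ and some Hermitian complex multiple $B$ of this form is positive definite. **Theorem.** Such families $\mathcal F$ exist. For every such $\mathcal F$ an isomorphism $\varphi$ exists, and for every $\varphi$ the following holds. On the Hilbert space completion of an infinitesimally unitary Jantzen quotient $Q_n$ at $x$ (with respect to any positive definite $B$ as above) there is exactly one strongly continuous unitary representation of $\boldsymbol G|_x^\sigma$ for which the vectors of $Q_n$ are differentiable, with derivative given by the action of $\boldsymbol{\mathfrak g}|_x^\sigma$ on $Q_n$, and on which $K^\sigma$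 acts on $Q_n$ in the given way. Moreover: (a) For $x>0$ there is a unique infinitesimally unitary Jantzen quotient. The corresponding unitary representation of $\boldsymbol G|_x^\sigma\cong SU(1,1)$ has Casimir $-(x+1)/x$, and it is the unitary spherical principal series representation with that Casimir: it is unitarily equivalent to $\pi_\nu$ for every real $\nu$ with $-(1+\nu^2)=-(x+1)/x$, where for $\nu\in\mathbb R$ the representation $\pi_\nu$ acts on $L^2$ of the unit circle by $(\pi_\nu(g)f)(\zeta)=|\bar b\zeta+\bar a|^{-1-i\nu}f(g^{-1}\zeta)$, $g^{-1}=\begin{bmatrix}a&b\\\bar b&\bar a\end{bmatrix}$. As $x$ varies these exhaust the spherical unitary principal series except for its base: $\pi_\nu$ occurs for some $x>0$ if and only if $\nu\ne0$. (b) At $x=0$ there is a unique nonzero Jantzen quotient, and it is infinitesimally unitary. The corresponding unitary representation of the motion group $\boldsymbol G|_0^\sigma$ is, up to unitary equivalence, the unique irreducible unitary representation $\pi_{-1}$ that is spherical (has a nonzero $U(1)$-fixed vector) and on which $4EF$ acts as $-1$. The element $4EF$ generates the center of the enveloping algebra of $\boldsymbol{\mathfrak g}|_0$. (c) For $x<0$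 infinitesimally unitary Jantzen quotients occur only at $x=-(2m+1)^{-2}$, $m=0,1,2,\dots$. At each such point there is exactly one, and the corresponding unitary representation of $\boldsymbol G|_x^\sigma\cong SU(2)$ is the irreducible representation of highest weight $2m$. These exhaust, up to unitary equivalence, the irreducible unitary representations of $SU(2)$ that contain the $0$-weight of $U(1)$. (d) The representations in (a) and (c) are those that appear in the contractions to $\pi_{-1}$. Write elements of the motion group as $\exp(v)k$ with $k=\mathrm{diag}(u,\bar u)$ and $v$ given by $b\in\mathbb C$, and for $\varepsilon>0$ let $D_\varepsilon(\exp(v)k)=\exp(\varepsilon v)k$ be the contraction map to $SU(1,1)$ (with $v=\begin{bmatrix}0&b\\\bar b&0\end{bmatrix}$) or to $SU(2)$ (with $v=\begin{bmatrix}0&b\\-\bar b&0\end{bmatrix}$). Then $\pi_{1/\varepsilon}$ is the representation occurring at $x=\varepsilon^2$, and $\pi_{1/\varepsilon}\circ D_\varepsilon$ contracts to $\pi_{-1}$ as $\varepsilon\to0^+$; the irreducible representation $\tau_m$ of $SU(2)$ of highest weight $2m$ is the representation occurring at $x=-\varepsilon_m^2$, $\varepsilon_m=1/(2m+1)$, and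 $\tau_m\circ D_{\varepsilon_m}$ contracts to $\pi_{-1}$ as $m\to\infty$. Here unitary representations $\tau_i$ on $H_i$ contract to $\pi$ on $H$ along maps $D_i$ if there are isometric embeddings $J_i:H_i\to H$ such that for every $v\in H$ one has $J_i\tau_i(D_i(g))J_i^*v\to\pi(g)v$, uniformly for $g$ in compact sets. -/

import Mathlib

open Polynomial TensorProduct Filter Topology
open scoped ComplexConjugate InnerProductSpace

universe u v

attribute [local instance 100] LieRing.ofAssociativeRing

noncomputable section

namespace ContractionFamilies

/-! ### The family of complex Lie algebras and its real structure -/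

/-- Two by two matrices. -/
abbrev M2 (R : Type*) := Matrix (Fin 2) (Fin 2) R

/-- The Lie algebra of pairs `([a, b; z c, -a], [a, z b; c, -a])` over a commutative ring.
For `R = ℂ` this is the fibre of the family over `z`; for `R = ℂ[X]` and `z = X` it is the
Lie algebra of global sections of the family over the affine line. -/
def gPairs (R : Type*) [CommRing R] (z : R) : LieSubalgebra R (M2 R × M2 R) where
  carrier := {Y | Y.2 0 0 = Y.1 0 0 ∧ Y.1 1 1 = -Y.1 0 0 ∧ Y.2 1 1 = -Y.1 0 0 ∧
    Y.2 0 1 = z * Y.1 0 1 ∧ Y.1 1 0 = z * Y.2 1 0}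
  zero_mem' := by simp
  add_mem' := by
    rintro A B ⟨h1, h2, h3, h4, h5⟩ ⟨k1, k2, k3, k4, k5⟩
    refine ⟨?_, ?_, ?_, ?_, ?_⟩ <;> simp [*] <;> ring
  smul_mem' := by
    rintro r A ⟨h1, h2, h3, h4, h5⟩
    refine ⟨?_, ?_, ?_, ?_, ?_⟩ <;> simp [*] <;> ring
  lie_mem' := by
    rintro A B ⟨h1, h2, h3, h4, h5⟩ ⟨k1, k2, k3, k4, k5⟩
    refine ⟨?_, ?_, ?_, ?_, ?_⟩ <;>
      simp [Ring.lie_def, Matrix.mul_apply, Fin.sum_univ_two, *] <;> ring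

/-- The element of `gPairs R z` with parameters `a, b, c`. -/
def gElt {R : Type*} [CommRing R] (z a b c : R) : gPairs R z :=
  ⟨(!![a, b; z * c, -a], !![a, z * b; c, -a]), by
    refine ⟨?_, ?_, ?_, ?_, ?_⟩ <;> simp⟩

/-- Global sections over the affine line of the family of Lie algebras. -/
abbrev GSec := gPairs ℂ[X] (X : ℂ[X])

/-- The section `H`. -/
def secH : GSec := gElt X 1 0 0
/-- The section `E`. -/
def secE : GSec := gElt X 0 1 0
/-- The section `F`. -/
def secF : GSec := gElt X 0 0 1

/-- The involution `Θ`. -/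
def theta {R : Type*} [CommRing R] (M : M2 R) : M2 R := !![M 0 0, -M 0 1; -M 1 0, M 1 1]

/-- The differential `(S, T) ↦ (-Θ(T)^*, -Θ(S)^*)` of the real structure
`(S, T) ↦ (Θ(T⁻¹)^*, Θ(S⁻¹)^*)`; the star is transposition together with `τ` on entries. -/
def sigmaPair {R : Type*} [CommRing R] (τ : R →+* R) (Y : M2 R × M2 R) : M2 R × M2 R :=
  (-((theta Y.2).transpose.map τ), -((theta Y.1).transpose.map τ))

lemma sigmaPair_mem {R : Type*} [CommRing R] (τ : R →+* R) {z : R} (hz : τ z = z)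
    {Y : M2 R × M2 R} (hY : Y ∈ gPairs R z) : sigmaPair τ Y ∈ gPairs R z := by
  obtain ⟨h1, h2, h3, h4, h5⟩ := hY
  refine ⟨?_, ?_, ?_, ?_, ?_⟩ <;> simp [sigmaPair, theta, *]

/-- `σ(q)(z) = conj (q (conj z))`, i.e. conjugation of the coefficients. -/
def conjPoly : ℂ[X] →+* ℂ[X] := Polynomial.mapRingHom (starRingEnd ℂ)

/-- The real structure on sections: `σ(Y)(z) = σ(Y(conj z))`. -/
def sigmaSec (Y : GSec) : GSec :=
  ⟨sigmaPair conjPoly Y.1, sigmaPair_mem _ (by simp [conjPoly]) Y.2⟩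

/-- The value of a section at a point. -/
def evalSec (z : ℂ) (Y : GSec) : M2 ℂ × M2 ℂ := (Y.1.1.map (eval z), Y.1.2.map (eval z))

/-- The adjoint action of `a ∈ K = ℂˣ`, embedded as `(diag (a, a⁻¹), diag (a, a⁻¹))`,
on sections. -/
def adSec (a : ℂˣ) (Y : GSec) : GSec :=
  ⟨(Matrix.diagonal ![C (a : ℂ), C ((a⁻¹ : ℂˣ) : ℂ)] * Y.1.1 *
      Matrix.diagonal ![C ((a⁻¹ : ℂˣ) : ℂ), C (a : ℂ)],
    Matrix.diagonal ![C (a : ℂ), C ((a⁻¹ : ℂˣ) : ℂ)] * Y.1.2 *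
      Matrix.diagonal ![C ((a⁻¹ : ℂˣ) : ℂ), C (a : ℂ)]), by
    obtain ⟨h1, h2, h3, h4, h5⟩ := Y.2
    have ha : (C (a : ℂ) : ℂ[X]) * C ((a⁻¹ : ℂˣ) : ℂ) = 1 := by
      rw [← C_mul]; simp
    refine ⟨?_, ?_, ?_, ?_, ?_⟩ <;>
      simp [Matrix.mul_apply, Matrix.diagonal, *] <;> ring⟩

/-! ### Families of Harish-Chandra modules over the affine line -/

/-- A `ℂ[X]`-linear representation of `ℂˣ` is algebraic if it is given by a comodule over the
Laurent polynomials: `a ∈ ℂˣ` acts on every vector by a Laurent polynomial in `a`. -/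
def IsAlgebraicRep {L : Type*} [AddCommGroup L] [Module ℂ[X] L]
    (ρ : Representation ℂ[X] ℂˣ L) : Prop :=
  ∀ f : L, ∃ c : ℤ →₀ L, ∀ a : ℂˣ, ρ a f = c.sum fun k w => C ((a ^ k : ℂˣ) : ℂ) • w

/-- Algebraic families of Harish-Chandra modules over the affine line for the pair
`(𝔤, K)`, presented by global sections: a flat `ℂ[X]`-module with compatible actions. -/
structure HCFamily where
  carrier : Type u
  [addCommGroup : AddCommGroup carrier]
  [module : Module ℂ[X] carrier]
  [lieRingModule : LieRingModule GSec carrier]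
  [lieModule : LieModule ℂ[X] GSec carrier]
  flat : Module.Flat ℂ[X] carrier
  rho : Representation ℂ[X] ℂˣ carrier
  algebraic : IsAlgebraicRep rho
  equivariant : ∀ (a : ℂˣ) (Y : GSec) (f : carrier), rho a ⁅Y, f⁆ = ⁅adSec a Y, rho a f⁆
  /-- The differential of the `K`-action is the action of `H`, the image of `1 ∈ ℂ = Lie K`. -/
  differential : ∀ (f : carrier) (c : ℤ →₀ carrier),
    (∀ a : ℂˣ, rho a f = c.sum fun k w => C ((a ^ k : ℂˣ) : ℂ) • w) →
      ⁅secH, f⁆ = c.sum fun k w => k • w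

namespace HCFamily

variable (F : HCFamily.{u})

instance : AddCommGroup F.carrier := F.addCommGroup
instance : Module ℂ[X] F.carrier := F.module
instance : LieRingModule GSec F.carrier := F.lieRingModule
instance : LieModule ℂ[X] GSec F.carrier := F.lieModule
instance : Module ℂ F.carrier := Module.compHom F.carrier (C : ℂ →+* ℂ[X])
instance : IsScalarTower ℂ ℂ[X] F.carrier :=
  ⟨fun r p f => by
    change (r • p) • f = (C r : ℂ[X]) • (p • f)
    rw [smul_smul, smul_eq_C_mul]⟩

/-- The action of a section as a `ℂ[X]`-linear map. -/
abbrev act (Y : GSec) : F.carrier →ₗ[ℂ[X]] F.carrier :=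
  LieModule.toEnd ℂ[X] GSec F.carrier Y

/-- The `K`-isotypical component of weight `k`. -/
def weightSpace (k : ℤ) : Submodule ℂ[X] F.carrier where
  carrier := {f | ∀ a : ℂˣ, F.rho a f = C ((a ^ k : ℂˣ) : ℂ) • f}
  zero_mem' := by simp
  add_mem' := by
    intro f g hf hg a
    rw [map_add, hf a, hg a, smul_add]
  smul_mem' := by
    intro r f hf a
    rw [map_smul, hf a, smul_comm]

/-- Quasi-admissibility: for every finitely generated, locally free family `L` of
representations of `K`, the invariants of `L ⊗ F` are finitely generated and locally free. -/
def IsQuasiAdmissible : Prop :=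
  ∀ (L : Type) [AddCommGroup L] [Module ℂ[X] L] [Module.Finite ℂ[X] L]
    [Module.Projective ℂ[X] L] (ρL : Representation ℂ[X] ℂˣ L), IsAlgebraicRep ρL →
    Module.Finite ℂ[X] (ρL.tprod F.rho).invariants ∧
    Module.Projective ℂ[X] (ρL.tprod F.rho).invariants

/-- Generic irreducibility: irreducibility over the algebraic closure of the field of rational
functions. -/
def IsGenericallyIrreducible : Prop :=
  LieModule.IsIrreducible (AlgebraicClosure (RatFunc ℂ))
    (AlgebraicClosure (RatFunc ℂ) ⊗[ℂ[X]] GSec)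
    (AlgebraicClosure (RatFunc ℂ) ⊗[ℂ[X]] F.carrier)

/-- The extension of scalars of `F` to the field of rational functions. -/
abbrev generic := RatFunc ℂ ⊗[ℂ[X]] F.carrier

/-- The action of a section on the generic fibre. -/
abbrev genAct (Y : GSec) : F.generic →ₗ[RatFunc ℂ] F.generic :=
  (F.act Y).baseChange (RatFunc ℂ)

/-- The Casimir section `H² + (2/z) EF + (2/z) FE` acts as multiplication by `c`. -/
def CasimirActsBy (c : RatFunc ℂ) : Prop :=
  ∀ w : F.generic,
    F.genAct secH (F.genAct secH w) + (2 / RatFunc.X : RatFunc ℂ) • F.genAct secE (F.genAct secF w)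
      + (2 / RatFunc.X : RatFunc ℂ) • F.genAct secF (F.genAct secE w) = c • w

/-- The families considered: quasi-admissible, generically irreducible, with nonzero weight spaces
exactly for the even weights, generated by the `0`-weight space, and with Casimir `-(1+z)/z`. -/
structure IsContractionFamily : Prop where
  quasiAdmissible : F.IsQuasiAdmissible
  genericallyIrreducible : F.IsGenericallyIrreducible
  evenWeights : ∀ k : ℤ, F.weightSpace k ≠ ⊥ ↔ Even k
  generated : LieSubmodule.lieSpan ℂ[X] GSec (F.weightSpace 0 : Set F.carrier) = ⊤
  casimir : F.CasimirActsBy (-((1 + RatFunc.X) / RatFunc.X))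

/-! ### The twisted dual -/

/-- The conjugate-linear functionals `F → ℂ[X]` that vanish on all but finitely many isotypical
components. -/
def twistedDual : Submodule ℂ[X] (F.carrier →ₛₗ[conjPoly] ℂ[X]) where
  carrier := {e | {k : ℤ | ∃ f ∈ F.weightSpace k, e f ≠ 0}.Finite}
  zero_mem' := by simp
  add_mem' := by
    intro e e' he he'
    refine (he.union he').subset ?_
    rintro k ⟨f, hf, hne⟩
    by_contra hcon
    simp only [Set.mem_union, Set.mem_ofPred_eq, not_or, not_exists, not_and, not_not] at hcon
    exact hne (by simp [hcon.1 f hf, hcon.2 f hf])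
  smul_mem' := by
    intro r e he
    refine he.subset ?_
    rintro k ⟨f, hf, hne⟩
    exact ⟨f, hf, fun h => hne (by simp [h])⟩

/-- The `σ`-twisted dual of `F`, as a `ℂ[X]`-module. -/
def TwistedDual : Type u := F.twistedDual

instance : AddCommGroup F.TwistedDual := inferInstanceAs (AddCommGroup F.twistedDual)
instance : Module ℂ[X] F.TwistedDual := inferInstanceAs (Module ℂ[X] F.twistedDual)

/-- The functional underlying an element of the twisted dual. -/
def TwistedDual.toFun {F : HCFamily.{u}} (e : F.TwistedDual) : F.carrier →ₛₗ[conjPoly] ℂ[X] :=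
  Subtype.val e

variable {F}

lemma gElt_decomp (Y : GSec) :
    Y = Y.1.1 0 0 • secH + Y.1.1 0 1 • secE + Y.1.2 1 0 • secF := by
  obtain ⟨h1, h2, h3, h4, h5⟩ := Y.2
  apply Subtype.ext
  apply Prod.ext <;> ext i j : 1 <;> fin_cases i <;> fin_cases j <;>
    simp [secH, secE, secF, gElt, *] <;> ring

lemma adSec_secH (a : ℂˣ) : adSec a secH = secH := by
  have ha : (C (a : ℂ) : ℂ[X]) * C ((a⁻¹ : ℂˣ) : ℂ) = 1 := by
    rw [← C_mul]; simp
  apply Subtype.ext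
  apply Prod.ext <;> ext i j : 1 <;> fin_cases i <;> fin_cases j <;>
    simp [adSec, secH, gElt, Matrix.mul_apply, Matrix.diagonal] <;>
    simpa [mul_comm] using ha

lemma adSec_secE (a : ℂˣ) : adSec a secE = (C ((a ^ (2 : ℤ) : ℂˣ) : ℂ) : ℂ[X]) • secE := by
  apply Subtype.ext
  apply Prod.ext <;> ext i j : 1 <;> fin_cases i <;> fin_cases j <;>
    simp [adSec, secE, gElt, Matrix.mul_apply, Matrix.diagonal] <;> ring

lemma adSec_secF (a : ℂˣ) : adSec a secF = (C ((a ^ (-2 : ℤ) : ℂˣ) : ℂ) : ℂ[X]) • secF := by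
  apply Subtype.ext
  apply Prod.ext <;> ext i j : 1 <;> fin_cases i <;> fin_cases j <;>
    simp [adSec, secF, gElt, Matrix.mul_apply, Matrix.diagonal, zpow_neg,
      zpow_ofNat, pow_two] <;> ring

lemma lie_mem_weightSpace {Y : GSec} {j : ℤ}
    (hY : ∀ a : ℂˣ, adSec a Y = (C ((a ^ j : ℂˣ) : ℂ) : ℂ[X]) • Y) {k : ℤ} {f : F.carrier}
    (hf : f ∈ F.weightSpace k) : ⁅Y, f⁆ ∈ F.weightSpace (k + j) := by
  intro a
  rw [F.equivariant, hY, hf a, smul_lie, lie_smul, smul_smul, ← C_mul, zpow_add, mul_comm (a ^ k),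
    Units.val_mul]


lemma secH_lie_mem {k : ℤ} {f : F.carrier} (hf : f ∈ F.weightSpace k) :
    ⁅secH, f⁆ ∈ F.weightSpace k := by
  simpa using lie_mem_weightSpace (j := 0) (fun a => by simp [adSec_secH]) hf

lemma rho_mem_weightSpace (a : ℂˣ) {k : ℤ} {f : F.carrier} (hf : f ∈ F.weightSpace k) :
    F.rho a f ∈ F.weightSpace k := by
  rw [hf a]
  exact Submodule.smul_mem _ _ hf

variable (F)

lemma dualAct_mem (Y : GSec) (e : F.carrier →ₛₗ[conjPoly] ℂ[X]) (he : e ∈ F.twistedDual) :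
    -(e.comp (F.act (sigmaSec Y))) ∈ F.twistedDual := by
  have he : {k : ℤ | ∃ f ∈ F.weightSpace k, e f ≠ 0}.Finite := he
  set S := {k : ℤ | ∃ f ∈ F.weightSpace k, e f ≠ 0} with hS
  refine ((he.union (he.image fun k => k - 2)).union (he.image fun k => k + 2)).subset ?_
  rintro k ⟨f, hf, hne⟩
  by_contra hcon
  simp only [Set.mem_union, Set.mem_image, not_or, not_exists, not_and] at hcon
  obtain ⟨⟨h0, h2⟩, h2'⟩ := hcon
  have key : ∀ j : ℤ, j ∉ S → ∀ g ∈ F.weightSpace j, e g = 0 := by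
    intro j hj g hg
    by_contra hg0
    exact hj ⟨g, hg, hg0⟩
  apply hne
  have e1 := key k h0 _ (secH_lie_mem hf)
  have e2 := key (k + 2) (fun h => h2 _ h (by ring)) _
    (lie_mem_weightSpace (adSec_secE) hf)
  have e3 := key (k + -2) (fun h => h2' _ h (by ring)) _
    (lie_mem_weightSpace (adSec_secF) hf)
  have hd := gElt_decomp (sigmaSec Y)
  simp only [LinearMap.neg_apply, LinearMap.comp_apply, LieModule.toEnd_apply_apply]
  rw [hd]
  simp [e1, e2, e3]

/-- The action of sections on the twisted dual: `(Y e)(f) = -e(σ(Y) f)`. -/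
def dualAct (Y : GSec) : F.TwistedDual →ₗ[ℂ[X]] F.TwistedDual where
  toFun e := ⟨-(e.toFun.comp (F.act (sigmaSec Y))), F.dualAct_mem Y e.1 e.2⟩
  map_add' e e' := Subtype.ext (LinearMap.ext fun f => by
    change -(e.1 _ + e'.1 _) = -(e.1 _) + -(e'.1 _)
    exact neg_add _ _)
  map_smul' r e := Subtype.ext (LinearMap.ext fun f => by
    change -(r * e.1 _) = r * -(e.1 _)
    exact (mul_neg _ _).symm)

/-- The action of `K` on the twisted dual: `(a e)(f) = e(σ(a)⁻¹ f)` with `σ(a) = (conj a)⁻¹`. -/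
def dualRho (a : ℂˣ) : F.TwistedDual →ₗ[ℂ[X]] F.TwistedDual where
  toFun e := ⟨e.toFun.comp (F.rho (Units.map (starRingEnd ℂ).toMonoidHom a)), by
    refine Set.Finite.subset (e.2 : {k : ℤ | ∃ f ∈ F.weightSpace k, e.1 f ≠ 0}.Finite) ?_
    rintro k ⟨f, hf, hne⟩
    exact ⟨_, rho_mem_weightSpace _ hf, hne⟩⟩
  map_add' _ _ := rfl
  map_smul' _ _ := rfl

/-- Isomorphisms of `F` with its twisted dual over the field of rational functions,
equivariant for the Lie algebra and for `K`. -/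
structure Intertwiner where
  toEquiv : (RatFunc ℂ ⊗[ℂ[X]] F.carrier) ≃ₗ[RatFunc ℂ] (RatFunc ℂ ⊗[ℂ[X]] F.TwistedDual)
  map_act : ∀ (Y : GSec) (w : RatFunc ℂ ⊗[ℂ[X]] F.carrier),
    toEquiv ((F.act Y).baseChange (RatFunc ℂ) w) =
      (F.dualAct Y).baseChange (RatFunc ℂ) (toEquiv w)
  map_rho : ∀ (a : ℂˣ) (w : RatFunc ℂ ⊗[ℂ[X]] F.carrier),
    toEquiv ((F.rho a).baseChange (RatFunc ℂ) w) =
      (F.dualRho a).baseChange (RatFunc ℂ) (toEquiv w)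

end HCFamily

/-! ### Localizations, fibres and the Jantzen filtration -/

section Localization

variable (M : Type*) [AddCommGroup M] [Module ℂ[X] M]

/-- The localization of `M` at the point `z`, inside the extension of scalars of `M` to rational
functions: the elements `f / s` with `f ∈ M` and `s(z) ≠ 0`. -/
def localAt (z : ℂ) : Submodule ℂ[X] (RatFunc ℂ ⊗[ℂ[X]] M) where
  carrier := {w | ∃ (s : ℂ[X]) (f : M), s.eval z ≠ 0 ∧ s • w = 1 ⊗ₜ[ℂ[X]] f}
  zero_mem' := ⟨1, 0, by simp, by simp⟩
  add_mem' := by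
    rintro w w' ⟨s, f, hs, h⟩ ⟨s', f', hs', h'⟩
    refine ⟨s * s', s' • f + s • f', by simp [hs, hs'], ?_⟩
    rw [smul_add, mul_comm s s', mul_smul, h, mul_comm s' s, mul_smul, h', TensorProduct.tmul_add,
      TensorProduct.tmul_smul, TensorProduct.tmul_smul]
  smul_mem' := by
    rintro r w ⟨s, f, hs, h⟩
    exact ⟨s, r • f, hs, by rw [smul_comm, h, TensorProduct.tmul_smul]⟩

variable {M}

lemma localAt_baseChange (T : M →ₗ[ℂ[X]] M) {w : RatFunc ℂ ⊗[ℂ[X]] M}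
    {s : ℂ[X]} {f : M} (h : s • w = 1 ⊗ₜ[ℂ[X]] f) :
    s • T.baseChange (RatFunc ℂ) w = 1 ⊗ₜ[ℂ[X]] (T f) := by
  rw [← LinearMap.baseChange_tmul, ← h]
  exact (((T.baseChange (RatFunc ℂ)).restrictScalars ℂ[X]).map_smul s w).symm

lemma localAt_baseChange_mem {z : ℂ} (T : M →ₗ[ℂ[X]] M) {w : RatFunc ℂ ⊗[ℂ[X]] M}
    (h : w ∈ localAt M z) : T.baseChange (RatFunc ℂ) w ∈ localAt M z := by
  obtain ⟨s, f, hs, hw⟩ := h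
  exact ⟨s, T f, hs, localAt_baseChange T hw⟩

end Localization

namespace HCFamily

variable (F : HCFamily.{u})

/-- The fibre of `F` at `z`. -/
abbrev Fiber (z : ℂ) :=
  F.carrier ⧸ (Ideal.span {(X - C z : ℂ[X])} • (⊤ : Submodule ℂ[X] F.carrier))

/-- The class in the fibre at `z` of an element of `F`. -/
abbrev toFiber (z : ℂ) (f : F.carrier) : F.Fiber z := Submodule.Quotient.mk f

variable {F}

/-- The `n`-th step `{w ∈ F_z | φ(w) ∈ pⁿ F^σ_z}` of the filtration of the localization, with the
coordinate `p = X - z`. -/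
def locStep (φ : F.Intertwiner) (z : ℂ) (n : ℤ) : Set (RatFunc ℂ ⊗[ℂ[X]] F.carrier) :=
  {w | w ∈ localAt F.carrier z ∧ ∃ h ∈ localAt F.TwistedDual z,
    φ.toEquiv w = (algebraMap ℂ[X] (RatFunc ℂ) (X - C z)) ^ n • h}

/-- `v` is the value at `z` of the element `w` of the localization of `F` at `z`. -/
def IsValueAt (z : ℂ) (w : RatFunc ℂ ⊗[ℂ[X]] F.carrier) (v : F.Fiber z) : Prop :=
  ∃ (s : ℂ[X]) (f : F.carrier), s.eval z ≠ 0 ∧ s • w = 1 ⊗ₜ[ℂ[X]] f ∧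
    v = (s.eval z)⁻¹ • F.toFiber z f


lemma toFiber_smul (z : ℂ) (r : ℂ[X]) (f : F.carrier) :
    F.toFiber z (r • f) = r.eval z • F.toFiber z f := by
  have h1 : (r.eval z) • F.toFiber z f = F.toFiber z ((C (r.eval z) : ℂ[X]) • f) := rfl
  rw [h1, Submodule.Quotient.eq, ← sub_smul]
  refine Submodule.smul_mem_smul ?_ trivial
  rw [Ideal.mem_span_singleton]
  exact Polynomial.X_sub_C_dvd_sub_C_eval

lemma IsValueAt.add {z : ℂ} {w w' : RatFunc ℂ ⊗[ℂ[X]] F.carrier} {v v' : F.Fiber z}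
    (h : IsValueAt z w v) (h' : IsValueAt z w' v') : IsValueAt z (w + w') (v + v') := by
  obtain ⟨s, f, hs, hw, rfl⟩ := h
  obtain ⟨s', f', hs', hw', rfl⟩ := h'
  refine ⟨s * s', s' • f + s • f', by simp [hs, hs'], ?_, ?_⟩
  · rw [smul_add, mul_comm s s', mul_smul, hw, mul_comm s' s, mul_smul, hw', TensorProduct.tmul_add,
      TensorProduct.tmul_smul, TensorProduct.tmul_smul]
  · have : F.toFiber z (s' • f + s • f') = s'.eval z • F.toFiber z f + s.eval z • F.toFiber z f' := by
      rw [← toFiber_smul, ← toFiber_smul]; rfl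
    rw [this, smul_add, smul_smul, smul_smul, eval_mul]
    congr 2 <;> field_simp

lemma IsValueAt.smul {z : ℂ} (r : ℂ) {w : RatFunc ℂ ⊗[ℂ[X]] F.carrier} {v : F.Fiber z}
    (h : IsValueAt z w v) : IsValueAt z ((C r : ℂ[X]) • w) (r • v) := by
  obtain ⟨s, f, hs, hw, rfl⟩ := h
  refine ⟨s, (C r : ℂ[X]) • f, hs, ?_, ?_⟩
  · rw [smul_comm, hw, TensorProduct.tmul_smul]
  · rw [toFiber_smul, eval_C, smul_comm]

lemma locStep_add {φ : F.Intertwiner} {z : ℂ} {n : ℤ} {w w' : RatFunc ℂ ⊗[ℂ[X]] F.carrier}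
    (h : w ∈ locStep φ z n) (h' : w' ∈ locStep φ z n) : w + w' ∈ locStep φ z n := by
  obtain ⟨h1, g, hg, h2⟩ := h
  obtain ⟨h1', g', hg', h2'⟩ := h'
  exact ⟨add_mem h1 h1', g + g', add_mem hg hg', by rw [map_add, h2, h2', smul_add]⟩

lemma locStep_smul {φ : F.Intertwiner} {z : ℂ} {n : ℤ} (r : ℂ[X])
    {w : RatFunc ℂ ⊗[ℂ[X]] F.carrier} (h : w ∈ locStep φ z n) : r • w ∈ locStep φ z n := by
  obtain ⟨h1, g, hg, h2⟩ := h
  refine ⟨Submodule.smul_mem _ _ h1, r • g, Submodule.smul_mem _ _ hg, ?_⟩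
  rw [← algebraMap_smul (RatFunc ℂ) r w, map_smul, h2, ← algebraMap_smul (RatFunc ℂ) r g, smul_comm]

/-- The `n`-th step of the Jantzen filtration of the fibre at `z`: the image of the `n`-th step of
the filtration of the localization. -/
def jStep (φ : F.Intertwiner) (z : ℂ) (n : ℤ) : Submodule ℂ (F.Fiber z) where
  carrier := {v | ∃ w ∈ locStep φ z n, IsValueAt z w v}
  zero_mem' := ⟨0, ⟨zero_mem _, 0, zero_mem _, by simp⟩, 1, 0, by simp, by simp, by simp⟩
  add_mem' := by
    rintro v v' ⟨w, hw, hv⟩ ⟨w', hw', hv'⟩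
    exact ⟨w + w', locStep_add hw hw', hv.add hv'⟩
  smul_mem' := by
    rintro r v ⟨w, hw, hv⟩
    exact ⟨_, locStep_smul _ hw, hv.smul r⟩

/-- The `n`-th Jantzen quotient at `z`. -/
abbrev JQuot (φ : F.Intertwiner) (z : ℂ) (n : ℤ) :=
  jStep φ z n ⧸ (jStep φ z (n + 1)).submoduleOf (jStep φ z n)

/-- The linear map on the fibre at `z` induced by a `ℂ[X]`-linear endomorphism of `F`. -/
def fiberMap (z : ℂ) (T : F.carrier →ₗ[ℂ[X]] F.carrier) : F.Fiber z →ₗ[ℂ] F.Fiber z :=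
  (Submodule.mapQ _ _ T (by
    rw [← Submodule.map_le_iff_le_comap, Submodule.map_smul'']
    exact Submodule.smul_mono le_rfl le_top) : F.Fiber z →ₗ[ℂ[X]] F.Fiber z).restrictScalars ℂ

lemma fiberMap_smul_toFiber (z : ℂ) (T : F.carrier →ₗ[ℂ[X]] F.carrier) (r : ℂ) (f : F.carrier) :
    fiberMap z T (r • F.toFiber z f) = r • F.toFiber z (T f) := by
  rw [map_smul]; rfl

lemma locStep_baseChange {φ : F.Intertwiner} {z : ℂ} {n : ℤ} {T : F.carrier →ₗ[ℂ[X]] F.carrier}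
    {T' : F.TwistedDual →ₗ[ℂ[X]] F.TwistedDual}
    (hT : ∀ w, φ.toEquiv (T.baseChange (RatFunc ℂ) w) = T'.baseChange (RatFunc ℂ) (φ.toEquiv w))
    {w : RatFunc ℂ ⊗[ℂ[X]] F.carrier} (hw : w ∈ locStep φ z n) :
    T.baseChange (RatFunc ℂ) w ∈ locStep φ z n := by
  obtain ⟨h0, h, h1, hφ⟩ := hw
  refine ⟨localAt_baseChange_mem T h0, T'.baseChange (RatFunc ℂ) h,
    localAt_baseChange_mem T' h1, ?_⟩
  rw [hT, hφ]
  exact LinearMap.map_smul _ _ _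

lemma fiberMap_mem_jStep (φ : F.Intertwiner) (z : ℂ) (n : ℤ) (T : F.carrier →ₗ[ℂ[X]] F.carrier)
    (T' : F.TwistedDual →ₗ[ℂ[X]] F.TwistedDual)
    (hT : ∀ w, φ.toEquiv (T.baseChange (RatFunc ℂ) w) = T'.baseChange (RatFunc ℂ) (φ.toEquiv w))
    (v : F.Fiber z) (hv : v ∈ jStep φ z n) : fiberMap z T v ∈ jStep φ z n := by
  obtain ⟨w, hw0, s, f, hs, hw, hv⟩ := hv
  exact ⟨T.baseChange (RatFunc ℂ) w, locStep_baseChange hT hw0,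
    s, T f, hs, localAt_baseChange T hw, by rw [hv, fiberMap_smul_toFiber]⟩

/-- The endomorphism of a Jantzen quotient induced by an endomorphism of the fibre that preserves
the Jantzen filtration. -/
def quotMap (φ : F.Intertwiner) (z : ℂ) (n : ℤ) (T : F.Fiber z →ₗ[ℂ] F.Fiber z)
    (hT : ∀ n, ∀ v ∈ jStep φ z n, T v ∈ jStep φ z n) : JQuot φ z n →ₗ[ℂ] JQuot φ z n :=
  Submodule.mapQ _ _ (T.restrict (hT n)) (by
    rintro v hv
    exact hT (n + 1) v.1 hv)

/-- The action on the Jantzen quotients of (the value at `z` of) a section. -/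
def jAct (φ : F.Intertwiner) (z : ℂ) (n : ℤ) (Y : GSec) : JQuot φ z n →ₗ[ℂ] JQuot φ z n :=
  quotMap φ z n (fiberMap z (F.act Y)) fun n =>
    fiberMap_mem_jStep φ z n _ (F.dualAct Y) (φ.map_act Y)

/-- The action of `K` on the Jantzen quotients. -/
def jRho (φ : F.Intertwiner) (z : ℂ) (n : ℤ) (a : ℂˣ) : JQuot φ z n →ₗ[ℂ] JQuot φ z n :=
  quotMap φ z n (fiberMap z (F.rho a)) fun n =>
    fiberMap_mem_jStep φ z n _ (F.dualRho a) (φ.map_rho a)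

/-- Sesquilinear forms, linear in the first and conjugate-linear in the second variable. -/
abbrev SesqForm (Q : Type*) [AddCommGroup Q] [Module ℂ Q] := Q →ₗ[ℂ] Q →ₛₗ[starRingEnd ℂ] ℂ

/-- `B` belongs to the real line of hermitian forms on the `n`-th Jantzen quotient: it is hermitian,
and a complex multiple of the form `⟨ , ⟩_{x,n}` obtained by following the Jantzen isomorphism
`[w] ↦ [p⁻ⁿ φ(w)]` by the pairing of the fibre of the twisted dual with the fibre of `F`. -/
def IsJantzenForm (φ : F.Intertwiner) (x : ℝ) (n : ℤ) (B : SesqForm (JQuot φ x n)) : Prop :=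
  (∀ q q', B q q' = conj (B q' q)) ∧
  ∃ c : ℂ, ∀ (w : RatFunc ℂ ⊗[ℂ[X]] F.carrier) (h : RatFunc ℂ ⊗[ℂ[X]] F.TwistedDual)
    (s : ℂ[X]) (e : F.TwistedDual) (f : F.carrier) (v v' : jStep φ x n),
    w ∈ locStep φ x n → IsValueAt (x : ℂ) w v.1 →
    φ.toEquiv w = (algebraMap ℂ[X] (RatFunc ℂ) (X - C (x : ℂ))) ^ n • h →
    s.eval (x : ℂ) ≠ 0 → s • h = 1 ⊗ₜ[ℂ[X]] e → v'.1 = F.toFiber x f →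
    B (Submodule.Quotient.mk v) (Submodule.Quotient.mk v') =
      c * ((s.eval (x : ℂ))⁻¹ * (e.toFun f).eval (x : ℂ))

/-- `B` is an inner product. -/
def IsPosDef {Q : Type*} [AddCommGroup Q] [Module ℂ Q] (B : SesqForm Q) : Prop :=
  ∀ q : Q, q ≠ 0 → 0 < (B q q).re

/-- The `n`-th Jantzen quotient at `x` is (nonzero and) infinitesimally unitary. -/
def IsInfUnitary (φ : F.Intertwiner) (x : ℝ) (n : ℤ) : Prop :=
  Nontrivial (JQuot φ x n) ∧ ∃ B : SesqForm (JQuot φ x n), IsJantzenForm φ x n B ∧ IsPosDef B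

end HCFamily

/-! ### The real groups -/

/-- The group `SL(2, ℂ)`. -/
abbrev SL2C := Matrix.SpecialLinearGroup (Fin 2) ℂ

/-- The fibre at `z` of the family of complex groups: the pairs
`([a, b; z c, d], [a, z b; c, d])` of determinant one. -/
def complexGroup (z : ℂ) : Subgroup (SL2C × SL2C) where
  carrier := {g | g.2 0 0 = g.1 0 0 ∧ g.2 1 1 = g.1 1 1 ∧ g.2 0 1 = z * g.1 0 1 ∧
    g.1 1 0 = z * g.2 1 0}
  one_mem' := by simp
  mul_mem' := by
    rintro g h ⟨h1, h2, h3, h4⟩ ⟨k1, k2, k3, k4⟩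
    refine ⟨?_, ?_, ?_, ?_⟩ <;>
      simp [Matrix.mul_apply, Fin.sum_univ_two, *] <;> ring
  inv_mem' := by
    rintro g ⟨h1, h2, h3, h4⟩
    refine ⟨?_, ?_, ?_, ?_⟩ <;>
      simp [Matrix.SpecialLinearGroup.coe_inv, Matrix.adjugate_fin_two, *]

/-- `S ↦ Θ(S⁻¹)^*`. -/
def thetaStar (S : SL2C) : M2 ℂ := (theta (S⁻¹ : SL2C).1).conjTranspose

lemma thetaStar_eq (S : SL2C) :
    thetaStar S = !![conj (S 1 1), conj (S 1 0); conj (S 0 1), conj (S 0 0)] := by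
  ext i j
  fin_cases i <;> fin_cases j <;>
    simp [thetaStar, theta, Matrix.SpecialLinearGroup.coe_inv, Matrix.adjugate_fin_two,
      Matrix.conjTranspose_apply]

/-- The real group over `x`: the elements of the fibre fixed by the real structure
`(S, T) ↦ (Θ(T⁻¹)^*, Θ(S⁻¹)^*)`. -/
def realGroup (x : ℝ) : Subgroup (SL2C × SL2C) where
  carrier := {g | g ∈ complexGroup x ∧ thetaStar g.2 = g.1.1 ∧ thetaStar g.1 = g.2.1}
  one_mem' := by
    refine ⟨one_mem _, ?_, ?_⟩ <;> rw [thetaStar_eq] <;> ext i j <;> fin_cases i <;>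
      fin_cases j <;> simp
  mul_mem' := by
    rintro g h ⟨hg, h1, h2⟩ ⟨hh, k1, k2⟩
    refine ⟨mul_mem hg hh, ?_, ?_⟩
    · change thetaStar (g.2 * h.2) = g.1.1 * h.1.1
      rw [← h1, ← k1, thetaStar_eq, thetaStar_eq, thetaStar_eq]
      ext i j
      fin_cases i <;> fin_cases j <;> simp [Matrix.mul_apply, Fin.sum_univ_two] <;> ring
    · change thetaStar (g.1 * h.1) = g.2.1 * h.2.1
      rw [← h2, ← k2, thetaStar_eq, thetaStar_eq, thetaStar_eq]
      ext i j
      fin_cases i <;> fin_cases j <;> simp [Matrix.mul_apply, Fin.sum_univ_two] <;> ring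
  inv_mem' := by
    rintro g ⟨hg, h1, h2⟩
    refine ⟨inv_mem hg, ?_, ?_⟩
    · change thetaStar g.2⁻¹ = (g.1⁻¹).1
      rw [Matrix.SpecialLinearGroup.coe_inv, ← h1, thetaStar_eq, thetaStar_eq]
      ext i j
      fin_cases i <;> fin_cases j <;>
        simp [Matrix.SpecialLinearGroup.coe_inv, Matrix.adjugate_fin_two]
    · change thetaStar g.1⁻¹ = (g.2⁻¹).1
      rw [Matrix.SpecialLinearGroup.coe_inv, ← h2, thetaStar_eq, thetaStar_eq]
      ext i j
      fin_cases i <;> fin_cases j <;>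
        simp [Matrix.SpecialLinearGroup.coe_inv, Matrix.adjugate_fin_two]

lemma mem_realGroup_iff (x : ℝ) (g : SL2C × SL2C) :
    g ∈ realGroup x ↔ g.1 1 1 = conj (g.1 0 0) ∧ g.1 1 0 = x * conj (g.1 0 1) ∧
      g.2 0 0 = g.1 0 0 ∧ g.2 0 1 = x * g.1 0 1 ∧ g.2 1 0 = conj (g.1 0 1) ∧
      g.2 1 1 = conj (g.1 0 0) := by
  constructor
  · rintro ⟨⟨h1, h2, h3, h4⟩, h5, h6⟩
    rw [thetaStar_eq] at h5 h6
    have a1 := congrFun (congrFun h6 0) 1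
    have a2 := congrFun (congrFun h6 1) 0
    have a3 := congrFun (congrFun h6 1) 1
    simp at a1 a2 a3
    refine ⟨?_, ?_, h1, h3, a2.symm, a3.symm⟩
    · rw [← h2, ← a3]
    · rw [h4, ← a2]
  · rintro ⟨h1, h2, h3, h4, h5, h6⟩
    refine ⟨⟨h3, by rw [h6, h1], h4, by rw [h2, h5]⟩, ?_, ?_⟩ <;> rw [thetaStar_eq] <;> ext i j <;>
      fin_cases i <;> fin_cases j <;> simp [*]

/-- The real Lie algebra over `x`. -/
def realForm (x : ℝ) : Submodule ℝ (M2 ℂ × M2 ℂ) where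
  carrier := {Y | Y ∈ gPairs ℂ (x : ℂ) ∧ sigmaPair (starRingEnd ℂ) Y = Y}
  zero_mem' := ⟨zero_mem _, by
    ext i j <;> fin_cases i <;> fin_cases j <;> simp [sigmaPair, theta]⟩
  add_mem' := by
    rintro A B ⟨hA, hA'⟩ ⟨hB, hB'⟩
    refine ⟨add_mem hA hB, ?_⟩
    conv_rhs => rw [← hA', ← hB']
    ext i j <;> fin_cases i <;> fin_cases j <;> simp [sigmaPair, theta] <;> ring
  smul_mem' := by
    rintro r A ⟨hA, hA'⟩
    refine ⟨?_, ?_⟩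
    · have : r • A = (r : ℂ) • A := by
        ext i j <;> simp
      rw [this]
      exact Submodule.smul_mem (gPairs ℂ (x : ℂ)).toSubmodule _ hA
    · conv_rhs => rw [← hA']
      ext i j <;> fin_cases i <;> fin_cases j <;> simp [sigmaPair, theta]

/-- The element `([i a, b; x conj b, -i a], [i a, x b; conj b, -i a])` of the real Lie algebra. -/
def realElt (x : ℝ) (a : ℝ) (b : ℂ) : realForm x :=
  ⟨(gElt (x : ℂ) (Complex.I * a) b (conj b)).1, (gElt (x : ℂ) (Complex.I * a) b (conj b)).2, by
    ext i j <;> fin_cases i <;> fin_cases j <;> simp [gElt, sigmaPair, theta]⟩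

section Exponential

/-- The symplectic matrix, used to compute inverses of matrices of determinant one. -/
def symp : M2 ℂ := !![0, 1; -1, 0]

lemma symp_isUnit : IsUnit symp := by
  rw [Matrix.isUnit_iff_isUnit_det]; simp [symp, Matrix.det_fin_two]

lemma symp_inv : symp⁻¹ = !![0, -1; 1, 0] := by
  rw [Matrix.inv_def]; simp [symp, Matrix.det_fin_two, Matrix.adjugate_fin_two]

lemma symp_conj (A : M2 ℂ) : symp * A.transpose * symp⁻¹ = A.adjugate := by
  rw [symp_inv, Matrix.adjugate_fin_two]
  ext i j
  fin_cases i <;> fin_cases j <;> simp [symp, Matrix.mul_apply, Matrix.vecMul, dotProduct, Fin.sum_univ_two]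

lemma exp_neg_eq_adjugate (A : M2 ℂ) (hA : A 1 1 = -A 0 0) :
    NormedSpace.exp (-A) = (NormedSpace.exp A).adjugate := by
  have h : -A = symp * A.transpose * symp⁻¹ := by
    rw [symp_conj, Matrix.adjugate_fin_two]
    ext i j
    fin_cases i <;> fin_cases j <;> simp [hA]
  rw [h, Matrix.exp_conj _ _ symp_isUnit, Matrix.exp_transpose, symp_conj]

lemma det_exp_eq_one (A : M2 ℂ) (hA : A 1 1 = -A 0 0) : (NormedSpace.exp A).det = 1 := by
  have h1 : NormedSpace.exp (-A) * NormedSpace.exp A = 1 := by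
    rw [← Matrix.exp_add_of_commute _ _ (Commute.neg_left (Commute.refl A)), neg_add_cancel,
      NormedSpace.exp_zero]
  rw [exp_neg_eq_adjugate A hA, Matrix.adjugate_mul] at h1
  simpa using congrFun (congrFun h1 0) 0

/-- Pairs of matrices of the shape `([a, b; z c, d], [a, z b; c, d])`. -/
def pairAlg (z : ℂ) : Subalgebra ℂ (M2 ℂ × M2 ℂ) where
  carrier := {g | g.2 0 0 = g.1 0 0 ∧ g.2 1 1 = g.1 1 1 ∧ g.2 0 1 = z * g.1 0 1 ∧
    g.1 1 0 = z * g.2 1 0}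
  mul_mem' := by
    rintro g h ⟨h1, h2, h3, h4⟩ ⟨k1, k2, k3, k4⟩
    refine ⟨?_, ?_, ?_, ?_⟩ <;>
      simp [Matrix.mul_apply, Fin.sum_univ_two, *] <;> ring
  add_mem' := by
    rintro g h ⟨h1, h2, h3, h4⟩ ⟨k1, k2, k3, k4⟩
    refine ⟨?_, ?_, ?_, ?_⟩ <;> simp [*] <;> ring
  algebraMap_mem' r := by
    refine ⟨?_, ?_, ?_, ?_⟩ <;> simp [Matrix.algebraMap_matrix_apply, Prod.algebraMap_apply]

lemma fst_exp' (Y : M2 ℂ × M2 ℂ) :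
    (NormedSpace.exp Y).1 = NormedSpace.exp Y.1 := by
  open scoped Matrix.Norms.Operator in exact Prod.fst_exp Y

lemma snd_exp' (Y : M2 ℂ × M2 ℂ) :
    (NormedSpace.exp Y).2 = NormedSpace.exp Y.2 := by
  open scoped Matrix.Norms.Operator in exact Prod.snd_exp Y

lemma exp_pair_mem (z : ℂ) (Y : M2 ℂ × M2 ℂ) (hY : Y ∈ pairAlg z) :
    (NormedSpace.exp Y.1, NormedSpace.exp Y.2) ∈ pairAlg z := by
  have hc : IsClosed (pairAlg z : Set (M2 ℂ × M2 ℂ)) := by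
    have : FiniteDimensional ℂ (M2 ℂ × M2 ℂ) := inferInstance
    exact Submodule.closed_of_finiteDimensional (Subalgebra.toSubmodule (pairAlg z))
  have := NormedSpace.exp_mem (R := ℂ) hc hY
  rwa [← fst_exp', ← snd_exp']

/-- The diagonal matrix `diag (1, -1)`. -/
def refl2 : M2 ℂ := !![1, 0; 0, -1]

lemma refl2_inv : refl2⁻¹ = refl2 := by
  rw [Matrix.inv_def]; simp [refl2, Matrix.det_fin_two, Matrix.adjugate_fin_two]

lemma refl2_isUnit : IsUnit refl2 := by
  rw [Matrix.isUnit_iff_isUnit_det]; simp [refl2, Matrix.det_fin_two]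

lemma theta_eq (A : M2 ℂ) : theta A = refl2 * A * refl2⁻¹ := by
  rw [refl2_inv]
  ext i j
  fin_cases i <;> fin_cases j <;> simp [theta, refl2, Matrix.mul_apply, Matrix.vecMul, dotProduct, Fin.sum_univ_two]

lemma thetaStar_exp (A : M2 ℂ) (hA : A 1 1 = -A 0 0) (hd : (NormedSpace.exp A).det = 1) :
    thetaStar ⟨NormedSpace.exp A, hd⟩ = NormedSpace.exp (-((theta A).transpose.map
      (starRingEnd ℂ))) := by
  have h : thetaStar ⟨NormedSpace.exp A, hd⟩ =
      (theta (NormedSpace.exp A).adjugate).conjTranspose := rfl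
  rw [h, ← exp_neg_eq_adjugate A hA, theta_eq,
    ← Matrix.exp_conj _ _ refl2_isUnit, ← Matrix.exp_conjTranspose, ← theta_eq]
  congr 1
  ext i j
  fin_cases i <;> fin_cases j <;> simp [theta, Matrix.conjTranspose_apply]

/-- The exponential map of the real group over `x`. -/
def expReal (x : ℝ) (Y : realForm x) : realGroup x :=
  ⟨(⟨NormedSpace.exp Y.1.1, det_exp_eq_one _ Y.2.1.2.1⟩,
    ⟨NormedSpace.exp Y.1.2, det_exp_eq_one _ (by rw [Y.2.1.2.2.1, Y.2.1.1])⟩), by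
    obtain ⟨⟨h1, h2, h3, h4, h5⟩, h6⟩ := Y.2
    refine ⟨exp_pair_mem _ Y.1 ⟨h1, by rw [h3, h2], h4, h5⟩, ?_, ?_⟩
    · rw [thetaStar_exp _ (by rw [h3, h1])]
      exact congrArg NormedSpace.exp (congrArg Prod.fst h6)
    · rw [thetaStar_exp _ h2]
      exact congrArg NormedSpace.exp (congrArg Prod.snd h6)⟩

end Exponential

/-- The diagonal matrix `diag (u, conj u)`. -/
def diagMat (u : Circle) : M2 ℂ := !![(u : ℂ), 0; 0, conj (u : ℂ)]

lemma diagMat_det (u : Circle) : (diagMat u).det = 1 := by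
  simp [diagMat, Matrix.det_fin_two, Complex.mul_conj]

lemma diagMat_one : diagMat 1 = 1 := by
  ext i j; fin_cases i <;> fin_cases j <;> simp [diagMat]

lemma diagMat_mul (u w : Circle) : diagMat (u * w) = diagMat u * diagMat w := by
  ext i j; fin_cases i <;> fin_cases j <;> simp [diagMat, Matrix.mul_apply, Fin.sum_univ_two]

/-- The diagonal element `diag (u, conj u)` of `SL(2, ℂ)`, for `u` in the circle. -/
def diagSL : Circle →* SL2C where
  toFun u := ⟨diagMat u, diagMat_det u⟩
  map_one' := Subtype.ext diagMat_one
  map_mul' u w := Subtype.ext (diagMat_mul u w)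

lemma diagSL_coe (u : Circle) : (diagSL u).1 = !![(u : ℂ), 0; 0, conj (u : ℂ)] := rfl

/-- The embedding of the maximal compact torus `K^σ = U(1)` in the real group over `x`. -/
def torus (x : ℝ) : Circle →* realGroup x :=
  ((diagSL.prod diagSL).codRestrict (realGroup x) fun u => by
    rw [mem_realGroup_iff]; simp [diagSL_coe])

/-! ### `SU(1,1)`, `SU(2)` and the identifications of the real groups -/

/-- The group `SU(1,1)` of matrices `[a, b; conj b, conj a]` of determinant one. -/
def SU11 : Subgroup SL2C where
  carrier := {g | g 1 0 = conj (g 0 1) ∧ g 1 1 = conj (g 0 0)}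
  one_mem' := by simp
  mul_mem' := by
    rintro g h ⟨h1, h2⟩ ⟨k1, k2⟩
    refine ⟨?_, ?_⟩ <;> simp [Matrix.mul_apply, Fin.sum_univ_two, *] <;> ring
  inv_mem' := by
    rintro g ⟨h1, h2⟩
    refine ⟨?_, ?_⟩ <;> simp [Matrix.SpecialLinearGroup.coe_inv, Matrix.adjugate_fin_two, *]

/-- The group `SU(2)`. -/
abbrev SU2 := Matrix.specialUnitaryGroup (Fin 2) ℂ

lemma mem_SU2_iff (M : M2 ℂ) :
    M ∈ SU2 ↔ M 1 0 = -conj (M 0 1) ∧ M 1 1 = conj (M 0 0) ∧ M.det = 1 := by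
  rw [Matrix.mem_specialUnitaryGroup_iff, Matrix.mem_unitaryGroup_iff]
  constructor
  · rintro ⟨h, hd⟩
    have h' : star M = M.adjugate := by
      calc star M = (M.adjugate * M) * star M := by rw [Matrix.adjugate_mul, hd]; simp
        _ = M.adjugate := by rw [Matrix.mul_assoc, h, Matrix.mul_one]
    rw [Matrix.adjugate_fin_two] at h'
    have a1 := congrFun (congrFun h' 1) 0
    have a2 := congrFun (congrFun h' 0) 0
    simp [Matrix.star_apply] at a1 a2
    refine ⟨?_, a2.symm, hd⟩
    rw [a1, neg_neg]
  · rintro ⟨h1, h2, h3⟩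
    refine ⟨?_, h3⟩
    have h' : star M = M.adjugate := by
      rw [Matrix.adjugate_fin_two]
      ext i j
      fin_cases i <;> fin_cases j <;> simp [Matrix.star_apply, *]
    rw [h', Matrix.mul_adjugate, h3, one_smul]

/-- The matrix `[a, y b; y⁻¹ c, d]`, conjugate to `[a, b; c, d]` for `y ≠ 0`. -/
def rescale (y : ℝ) (S : M2 ℂ) : M2 ℂ := !![S 0 0, y * S 0 1; (y : ℂ)⁻¹ * S 1 0, S 1 1]

lemma rescale_det {y : ℝ} (hy : y ≠ 0) (S : M2 ℂ) : (rescale y S).det = S.det := by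
  have hy' : (y : ℂ) ≠ 0 := by exact_mod_cast hy
  simp only [rescale, Matrix.det_fin_two, Matrix.of_apply, Matrix.cons_val', Matrix.cons_val_zero,
    Matrix.cons_val_one, Matrix.cons_val_fin_one]
  field_simp

lemma rescale_mul {y : ℝ} (hy : y ≠ 0) (S T : M2 ℂ) :
    rescale y (S * T) = rescale y S * rescale y T := by
  have hy' : (y : ℂ) ≠ 0 := by exact_mod_cast hy
  ext i j
  fin_cases i <;> fin_cases j <;> simp [rescale, Matrix.mul_apply, Fin.sum_univ_two] <;> field_simp

lemma rescale_inv_rescale {y : ℝ} (hy : y ≠ 0) (S : M2 ℂ) : rescale y⁻¹ (rescale y S) = S := by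
  have hy' : (y : ℂ) ≠ 0 := by exact_mod_cast hy
  ext i j
  fin_cases i <;> fin_cases j <;> simp [rescale, hy']

lemma rescale_rescale_inv {y : ℝ} (hy : y ≠ 0) (S : M2 ℂ) : rescale y (rescale y⁻¹ S) = S := by
  have := rescale_inv_rescale (inv_ne_zero hy) S
  rwa [inv_inv] at this

lemma rescale_continuous (y : ℝ) : Continuous (rescale y) := by
  refine continuous_matrix fun i j => ?_
  fin_cases i <;> fin_cases j <;> simp only [rescale] <;> dsimp <;> fun_prop

/-- `rescale y` on `SL(2, ℂ)`. -/
def rescaleSL {y : ℝ} (hy : y ≠ 0) (S : SL2C) : SL2C :=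
  ⟨rescale y S.1, by rw [rescale_det hy, S.2]⟩

lemma rescaleSL_continuous {y : ℝ} (hy : y ≠ 0) : Continuous (rescaleSL hy) :=
  Continuous.subtype_mk ((rescale_continuous y).comp continuous_subtype_val) _

lemma realGroup_snd {x : ℝ} (hx : x ≠ 0) {g : SL2C × SL2C} (hg : g ∈ realGroup x) :
    g.2 = rescaleSL hx g.1 := by
  have hx' : (x : ℂ) ≠ 0 := by exact_mod_cast hx
  obtain ⟨h1, h2, h3, h4, h5, h6⟩ := (mem_realGroup_iff x g).1 hg
  apply Subtype.ext
  ext i j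
  fin_cases i <;> fin_cases j <;> simp [rescaleSL, rescale, h1, h2, h3, h4, h5, h6, hx']

/-- The element of the real group over `x ≠ 0` with a given first component. -/
lemma mk_mem_realGroup {x : ℝ} (hx : x ≠ 0) (S : SL2C) (h1 : S 1 1 = conj (S 0 0))
    (h2 : S 1 0 = x * conj (S 0 1)) : (S, rescaleSL hx S) ∈ realGroup x := by
  have hx' : (x : ℂ) ≠ 0 := by exact_mod_cast hx
  rw [mem_realGroup_iff]
  refine ⟨h1, h2, ?_, ?_, ?_, ?_⟩ <;> simp [rescaleSL, rescale, h1, h2, hx']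

/-- The identification `[a, b; x conj b, conj a] ↦ [a, √x b; √x conj b, conj a]` of the real group
over `x > 0` with `SU(1,1)`. -/
def isoSU11 (x : ℝ) (hx : 0 < x) : realGroup x ≃ₜ* SU11 where
  toFun g := ⟨rescaleSL (Real.sqrt_pos.2 hx).ne' g.1.1, by
    obtain ⟨h1, h2, h3, h4, h5, h6⟩ := (mem_realGroup_iff x g.1).1 g.2
    have hs : ((√x : ℝ) : ℂ) ≠ 0 := by exact_mod_cast (Real.sqrt_pos.2 hx).ne'
    have hss : (x : ℂ) = (√x : ℝ) * (√x : ℝ) := by exact_mod_cast (Real.mul_self_sqrt hx.le).symm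
    refine ⟨?_, ?_⟩
    · simp [rescaleSL, rescale, h2]
      rw [← mul_assoc, hss, inv_mul_cancel_left₀ hs]
    · simp [rescaleSL, rescale, h1]⟩
  invFun S := ⟨(rescaleSL (inv_ne_zero (Real.sqrt_pos.2 hx).ne') S.1,
      rescaleSL hx.ne' (rescaleSL (inv_ne_zero (Real.sqrt_pos.2 hx).ne') S.1)), by
    obtain ⟨h1, h2⟩ := S.2
    have hs : ((√x : ℝ) : ℂ) ≠ 0 := by exact_mod_cast (Real.sqrt_pos.2 hx).ne'
    have hss : (x : ℂ) = (√x : ℝ) * (√x : ℝ) := by exact_mod_cast (Real.mul_self_sqrt hx.le).symm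
    refine mk_mem_realGroup hx.ne' _ ?_ ?_
    · simp [rescaleSL, rescale, h2]
    · simp [rescaleSL, rescale, h1]
      rw [← mul_assoc, hss, mul_inv_cancel_right₀ hs]⟩
  left_inv g := by
    have h := realGroup_snd hx.ne' g.2
    have h1 : rescaleSL (inv_ne_zero (Real.sqrt_pos.2 hx).ne')
        (rescaleSL (Real.sqrt_pos.2 hx).ne' g.1.1) = g.1.1 :=
      Subtype.ext (rescale_inv_rescale (Real.sqrt_pos.2 hx).ne' _)
    apply Subtype.ext
    refine Prod.ext h1 ?_
    rw [h]
    exact congrArg (rescaleSL _) h1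
  right_inv S := Subtype.ext (Subtype.ext (rescale_rescale_inv (Real.sqrt_pos.2 hx).ne' _))
  map_mul' g h := Subtype.ext (Subtype.ext (rescale_mul (Real.sqrt_pos.2 hx).ne' _ _))
  continuous_toFun := Continuous.subtype_mk ((rescaleSL_continuous _).comp
    (continuous_fst.comp continuous_subtype_val)) _
  continuous_invFun := Continuous.subtype_mk (Continuous.prodMk
    ((rescaleSL_continuous _).comp continuous_subtype_val)
    ((rescaleSL_continuous _).comp ((rescaleSL_continuous _).comp continuous_subtype_val))) _

/-- The identification `[a, b; x conj b, conj a] ↦ [a, √(-x) b; -√(-x) conj b, conj a]` of the real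
group over `x < 0` with `SU(2)`. -/
def isoSU2 (x : ℝ) (hx : x < 0) : realGroup x ≃ₜ* SU2 where
  toFun g := ⟨rescale √(-x) g.1.1.1, by
    obtain ⟨h1, h2, h3, h4, h5, h6⟩ := (mem_realGroup_iff x g.1).1 g.2
    have hy : √(-x) ≠ 0 := (Real.sqrt_pos.2 (neg_pos.2 hx)).ne'
    have hs : ((√(-x) : ℝ) : ℂ) ≠ 0 := by exact_mod_cast hy
    have hss : (x : ℂ) = -((√(-x) : ℝ) * (√(-x) : ℝ)) := by
      have := Real.mul_self_sqrt (neg_pos.2 hx).le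
      rw [← Complex.ofReal_mul, this]; simp
    rw [mem_SU2_iff]
    refine ⟨?_, ?_, ?_⟩
    · simp [rescale, h2]
      rw [← mul_assoc, hss, mul_neg, inv_mul_cancel_left₀ hs, neg_mul]
    · simp [rescale, h1]
    · rw [rescale_det hy, g.1.1.2]⟩
  invFun S := ⟨(⟨rescale (√(-x))⁻¹ S.1, by
        rw [rescale_det (inv_ne_zero (Real.sqrt_pos.2 (neg_pos.2 hx)).ne')]
        exact ((mem_SU2_iff _).1 S.2).2.2⟩,
      rescaleSL hx.ne ⟨rescale (√(-x))⁻¹ S.1, by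
        rw [rescale_det (inv_ne_zero (Real.sqrt_pos.2 (neg_pos.2 hx)).ne')]
        exact ((mem_SU2_iff _).1 S.2).2.2⟩), by
    obtain ⟨h1, h2, h3⟩ := (mem_SU2_iff _).1 S.2
    have hy : √(-x) ≠ 0 := (Real.sqrt_pos.2 (neg_pos.2 hx)).ne'
    have hs : ((√(-x) : ℝ) : ℂ) ≠ 0 := by exact_mod_cast hy
    have hss : (x : ℂ) = -((√(-x) : ℝ) * (√(-x) : ℝ)) := by
      have := Real.mul_self_sqrt (neg_pos.2 hx).le
      rw [← Complex.ofReal_mul, this]; simp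
    refine mk_mem_realGroup hx.ne _ ?_ ?_
    · simp [rescale, h2]
    · simp [rescale, h1]
      rw [← mul_assoc, hss, neg_mul, mul_inv_cancel_right₀ hs, neg_mul]⟩
  left_inv g := by
    have hy : √(-x) ≠ 0 := (Real.sqrt_pos.2 (neg_pos.2 hx)).ne'
    have h := realGroup_snd hx.ne g.2
    have hd : (rescale (√(-x))⁻¹ (rescale √(-x) g.1.1.1)).det = 1 := by
      rw [rescale_det (inv_ne_zero hy), rescale_det hy, g.1.1.2]
    have h1 : (⟨rescale (√(-x))⁻¹ (rescale √(-x) g.1.1.1), hd⟩ : SL2C) = g.1.1 :=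
      Subtype.ext (rescale_inv_rescale hy _)
    apply Subtype.ext
    refine Prod.ext h1 ?_
    rw [h]
    exact congrArg (rescaleSL _) h1
  right_inv S := Subtype.ext (rescale_rescale_inv (Real.sqrt_pos.2 (neg_pos.2 hx)).ne' _)
  map_mul' g h := Subtype.ext (rescale_mul (Real.sqrt_pos.2 (neg_pos.2 hx)).ne' _ _)
  continuous_toFun := by
    refine Continuous.subtype_mk ?_ _
    exact (rescale_continuous _).comp
      (continuous_subtype_val.comp (continuous_fst.comp continuous_subtype_val))
  continuous_invFun := by
    refine Continuous.subtype_mk (Continuous.prodMk ?_ ((rescaleSL_continuous _).comp ?_)) _ <;>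
    exact Continuous.subtype_mk ((rescale_continuous _).comp continuous_subtype_val) _

/-- The diagonal torus `diag (u, conj u)` of `SU(2)`. -/
def torusSU2 : Circle →* SU2 where
  toFun u := ⟨diagMat u, by
    rw [mem_SU2_iff]; exact ⟨by simp [diagMat], by simp [diagMat], diagMat_det u⟩⟩
  map_one' := Subtype.ext diagMat_one
  map_mul' u w := Subtype.ext (diagMat_mul u w)

/-! ### Unitary representations -/

/-- Strongly continuous unitary representations. -/
structure UnitaryRep (G : Type*) [Group G] [TopologicalSpace G] (H : Type*) [NormedAddCommGroup H]
    [InnerProductSpace ℂ H] where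
  toHom : G →* (H ≃ₗᵢ[ℂ] H)
  continuous_orbit : ∀ v : H, Continuous fun g => toHom g v

namespace UnitaryRep

variable {G G' : Type*} [Group G] [TopologicalSpace G] [Group G'] [TopologicalSpace G']
  {H H' : Type*} [NormedAddCommGroup H] [InnerProductSpace ℂ H]
  [NormedAddCommGroup H'] [InnerProductSpace ℂ H']

/-- Restriction along an isomorphism of topological groups. -/
def comp (π : UnitaryRep G H) (j : G' ≃ₜ* G) : UnitaryRep G' H where
  toHom := π.toHom.comp j.toMulEquiv.toMonoidHom
  continuous_orbit v := (π.continuous_orbit v).comp j.continuous_toFun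

/-- Unitary equivalence. -/
def Equivalent (π : UnitaryRep G H) (π' : UnitaryRep G H') : Prop :=
  ∃ U : H ≃ₗᵢ[ℂ] H', ∀ g v, U (π.toHom g v) = π'.toHom g (U v)

/-- Irreducibility: the space is nonzero and has no proper nonzero closed invariant subspace. -/
def IsIrreducible (π : UnitaryRep G H) : Prop :=
  Nontrivial H ∧ ∀ W : Submodule ℂ H, IsClosed (W : Set H) →
    (∀ g, ∀ v ∈ W, π.toHom g v ∈ W) → W = ⊥ ∨ W = ⊤

/-- `v` is a vector of weight `k` for the circle subgroup `κ`. -/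
def IsWeightVector (π : UnitaryRep G H) (κ : Circle →* G) (k : ℤ) (v : H) : Prop :=
  ∀ u : Circle, π.toHom (κ u) v = ((u : ℂ) ^ k) • v

/-- The weight `k` of the circle subgroup `κ` occurs in `π`. -/
def HasWeight (π : UnitaryRep G H) (κ : Circle →* G) (k : ℤ) : Prop :=
  ∃ v : H, v ≠ 0 ∧ π.IsWeightVector κ k v

/-- `w` is the derivative of `v` in the direction `Y` of the real Lie algebra over `x`. -/
def IsDerivative {x : ℝ} (π : UnitaryRep (realGroup x) H) (Y : realForm x) (v w : H) : Prop :=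
  HasDerivAt (fun t : ℝ => π.toHom (expReal x (t • Y)) v) w 0

/-- The element `α H² + β (2EF + 2FE)` of the enveloping algebra acts as multiplication by `c` (on
all vectors that are twice differentiable in the directions of the basis
`Y₀ = iH`, `Y₁ = E + F`, `Y₂ = i(E - F)` of the real Lie algebra, so in particular on all smooth
vectors); here `H² = -Y₀²` and `2EF + 2FE = Y₁² + Y₂²`. -/
def QuadraticActsBy {x : ℝ} (π : UnitaryRep (realGroup x) H) (α β c : ℝ) : Prop :=
  ∀ v v₀ v₁ v₂ w₀ w₁ w₂ : H,
    π.IsDerivative (realElt x 1 0) v v₀ → π.IsDerivative (realElt x 1 0) v₀ w₀ →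
    π.IsDerivative (realElt x 0 1) v v₁ → π.IsDerivative (realElt x 0 1) v₁ w₁ →
    π.IsDerivative (realElt x 0 Complex.I) v v₂ → π.IsDerivative (realElt x 0 Complex.I) v₂ w₂ →
    -((α : ℂ) • w₀) + (β : ℂ) • (w₁ + w₂) = (c : ℂ) • v

/-- The Casimir `H² + (2/x) EF + (2/x) FE` acts as multiplication by `c` (for `x ≠ 0`). -/
def CasimirActsBy {x : ℝ} (π : UnitaryRep (realGroup x) H) (c : ℝ) : Prop :=
  π.QuadraticActsBy 1 (1 / x) c

/-- The Casimir `4EF` of the motion group acts as multiplication by `c`. -/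
def MotionCasimirActsBy (π : UnitaryRep (realGroup 0) H) (c : ℝ) : Prop :=
  π.QuadraticActsBy 0 1 c

end UnitaryRep

/-! ### The spherical principal series of `SU(1,1)` -/

/-- The automorphy factor of the action of `SU(1,1)` on the unit circle. -/
def autFactor (g : SU11) (ζ : Circle) : ℂ := g.1 1 0 * ζ + g.1 1 1

lemma autFactor_ne_zero (g : SU11) (ζ : Circle) : autFactor g ζ ≠ 0 := by
  obtain ⟨h1, h2⟩ := g.2
  intro h
  have hdet : g.1 0 0 * g.1 1 1 - g.1 0 1 * g.1 1 0 = 1 := by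
    have := g.1.2
    rwa [Matrix.det_fin_two] at this
  have e : g.1 1 1 = -(g.1 1 0 * ζ) := by
    have : g.1 1 0 * ζ + g.1 1 1 = 0 := h
    linear_combination this
  have n1 : Complex.normSq (g.1 1 1) = Complex.normSq (g.1 1 0) := by
    rw [e, Complex.normSq_neg, Complex.normSq_mul, Circle.normSq_coe, mul_one]
  have n2 : g.1 0 0 * g.1 1 1 = Complex.normSq (g.1 1 1) := by
    rw [h2, Complex.mul_conj, Complex.normSq_conj]
  have n3 : g.1 0 1 * g.1 1 0 = Complex.normSq (g.1 1 0) := by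
    rw [h1, Complex.mul_conj, Complex.normSq_conj]
  rw [n2, n3, n1, sub_self] at hdet
  exact zero_ne_one hdet

/-- The action `ζ ↦ (a ζ + b) / (conj b ζ + conj a)` of `SU(1,1)` on the unit circle. -/
def moebius (g : SU11) (ζ : Circle) : Circle :=
  ζ * Circle.ofConjDivSelf (autFactor g ζ) (autFactor_ne_zero g ζ)

lemma moebius_coe (g : SU11) (ζ : Circle) :
    (moebius g ζ : ℂ) = (g.1 0 0 * ζ + g.1 0 1) / (g.1 1 0 * ζ + g.1 1 1) := by
  obtain ⟨h1, h2⟩ := g.2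
  have hz : (ζ : ℂ) * conj (ζ : ℂ) = 1 := by simp [Complex.mul_conj]
  simp only [moebius, Circle.coe_mul, Circle.ofConjDivSelf_coe, autFactor]
  rw [← mul_div_assoc]
  congr 1
  rw [map_add, map_mul, h1, h2, Complex.conj_conj, Complex.conj_conj]
  linear_combination (g.1 0 1) * hz

/-- The identification of `ℝ / ℤ` with the unit circle. -/
def angle : AddCircle (1 : ℝ) ≃ₜ Circle := AddCircle.homeomorphCircle one_ne_zero

/-- `π` is (unitarily equivalent to) the unitary spherical principal series representation
`(π(g) f)(ζ) = |conj b' ζ + conj a'|^(-1 - iν) f(g⁻¹ ζ)` of `SU(1,1)` on `L²` of the unit circle,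
where `g⁻¹ = [a', b'; conj b', conj a']`; here `|conj b' ζ + conj a'|⁻²` is the Jacobian of
`ζ ↦ g⁻¹ ζ`. The value `ν = 0` is the base of the spherical principal series. -/
def IsSphericalPrincipalSeries {H : Type*} [NormedAddCommGroup H] [InnerProductSpace ℂ H]
    (ν : ℝ) (π : UnitaryRep SU11 H) : Prop :=
  ∃ U : H ≃ₗᵢ[ℂ] MeasureTheory.Lp ℂ 2 (AddCircle.haarAddCircle (T := (1 : ℝ))),
    ∀ (g : SU11) (v : H),
      (U (π.toHom g v) : AddCircle (1 : ℝ) → ℂ) =ᵐ[AddCircle.haarAddCircle] fun θ =>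
        ((‖autFactor g⁻¹ (angle θ)‖ : ℝ) : ℂ) ^ (-(1 + Complex.I * ν)) *
          (U v : AddCircle (1 : ℝ) → ℂ) (angle.symm (moebius g⁻¹ (angle θ)))

/-! ### Integration of Jantzen quotients -/

namespace HCFamily

variable {F : HCFamily.{u}}

/-- The Hilbert space `H`, together with the map `ι : Q → H`, is the completion of `Q` for the
inner product `B`. -/
def IsCompletion {Q : Type*} [AddCommGroup Q] [Module ℂ Q] (B : SesqForm Q) {H : Type*}
    [NormedAddCommGroup H] [InnerProductSpace ℂ H] (ι : Q →ₗ[ℂ] H) : Prop :=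
  DenseRange ι ∧ ∀ q q', ⟪ι q', ι q⟫_ℂ = B q q'

/-- The unitary representation `π` integrates the actions of the real Lie algebra over `x` and of
`K^σ = U(1)` on the `n`-th Jantzen quotient `Q`: the vectors `ι q` are differentiable, the
derivative in the direction of the value at `x` of a section `Y` is `ι (Y q)`, and `U(1)` acts on
them through `Q`. -/
def Integrates (φ : F.Intertwiner) (x : ℝ) (n : ℤ) {H : Type*} [NormedAddCommGroup H]
    [InnerProductSpace ℂ H] (ι : JQuot φ x n →ₗ[ℂ] H) (π : UnitaryRep (realGroup x) H) : Prop :=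
  (∀ (Y : GSec) (hY : evalSec x Y ∈ realForm x) (q : JQuot φ x n),
    π.IsDerivative ⟨evalSec x Y, hY⟩ (ι q) (ι (jAct φ x n Y q))) ∧
  ∀ (u : Circle) (q : JQuot φ x n),
    π.toHom (torus x u) (ι q) = ι (jRho φ x n (Circle.toUnits u) q)

/-- `π` is the unitary representation of the real group over `x` on the completion of an
infinitesimally unitary Jantzen quotient. -/
def IsJantzenRep (φ : F.Intertwiner) (x : ℝ) {H : Type*} [NormedAddCommGroup H]
    [InnerProductSpace ℂ H] (π : UnitaryRep (realGroup x) H) : Prop :=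
  ∃ (n : ℤ) (B : SesqForm (JQuot φ x n)) (ι : JQuot φ x n →ₗ[ℂ] H),
    Nontrivial (JQuot φ x n) ∧ IsJantzenForm φ x n B ∧ IsPosDef B ∧ IsCompletion B ι ∧
      Integrates φ x n ι π

end HCFamily

/-! ### Contractions -/

/-- The rotation part of an element of the motion group. -/
def rotPart (g : realGroup 0) : Circle :=
  ⟨g.1.1 0 0, by
    obtain ⟨h1, h2, h3, h4, h5, h6⟩ := (mem_realGroup_iff 0 g.1).1 g.2
    have hdet : g.1.1 0 0 * g.1.1 1 1 - g.1.1 0 1 * g.1.1 1 0 = 1 := by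
      have := g.1.1.2
      rwa [Matrix.det_fin_two] at this
    rw [h1, h2, Complex.mul_conj] at hdet
    have h : Complex.normSq (g.1.1 0 0) = 1 := by
      have h' : ((Complex.normSq (g.1.1 0 0) : ℝ) : ℂ) = ((1 : ℝ) : ℂ) := by
        simpa using hdet
      exact_mod_cast h'
    refine mem_sphere_zero_iff_norm.2 ?_
    rw [Complex.norm_def, h, Real.sqrt_one]⟩

/-- The translation part `b ∈ ℂ` of an element of the motion group: the element is
`exp([0, b; 0, 0], [0, 0; conj b, 0])` times its rotation part. -/
def transPart (g : realGroup 0) : ℂ := g.1.1 0 1 * g.1.1 0 0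

/-- The contraction maps from the motion group to `SU(1,1)`: `exp(v) k ↦ exp(ε v) k` for `k ∈ U(1)`
and `v = [0, b; conj b, 0]`. -/
def contractSU11 (ε : ℝ) (g : realGroup 0) : SU11 :=
  isoSU11 1 one_pos (expReal 1 (realElt 1 0 (ε * transPart g)) * torus 1 (rotPart g))

/-- The contraction maps from the motion group to `SU(2)`: `exp(v) k ↦ exp(ε v) k` for `k ∈ U(1)`
and `v = [0, b; -conj b, 0]`. -/
def contractSU2 (ε : ℝ) (g : realGroup 0) : SU2 :=
  isoSU2 (-1) (by norm_num)
    (expReal (-1) (realElt (-1) 0 (ε * transPart g)) * torus (-1) (rotPart g))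

/-- The representations `π i` of `G` contract, along the filter `l` and the contraction maps
`D i : M → G`, to the representation `π₀` of `M`: after isometric embeddings `J i` of the
representation spaces in that of `π₀`, the operators `π i (D i g)` converge strongly to `π₀ g`,
uniformly for `g` in compact sets. -/
def ContractsTo {G M : Type*} [Group G] [TopologicalSpace G] [Group M] [TopologicalSpace M]
    {I : Type*} (l : Filter I) (D : I → M → G)
    {H : I → Type*} [∀ i, NormedAddCommGroup (H i)] [∀ i, InnerProductSpace ℂ (H i)]
    [∀ i, CompleteSpace (H i)] (π : ∀ i, UnitaryRep G (H i))
    {H₀ : Type*} [NormedAddCommGroup H₀] [InnerProductSpace ℂ H₀] [CompleteSpace H₀]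
    (π₀ : UnitaryRep M H₀) : Prop :=
  ∃ J : ∀ i, H i →ₗᵢ[ℂ] H₀, ∀ (v : H₀) (S : Set M), IsCompact S →
    TendstoUniformlyOn
      (fun i g => J i ((π i).toHom (D i g)
        (ContinuousLinearMap.adjoint (J i).toContinuousLinearMap v)))
      (fun g => π₀.toHom g v) l S

/-- The points `-(2m+1)⁻²`. -/
def discretePoint (m : ℕ) : ℝ := -((2 * (m : ℝ) + 1) ^ 2)⁻¹

lemma discretePoint_neg (m : ℕ) : discretePoint m < 0 := by
  unfold discretePoint
  have : (0 : ℝ) < ((2 * (m : ℝ) + 1) ^ 2)⁻¹ := by positivity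
  linarith

end ContractionFamilies

end

open ContractionFamilies ContractionFamilies.HCFamily

/-!
A family `F` as in the theorem has a standard basis `e_j`, `j ∈ ℤ`, over `ℂ[z]`, with `e_j` of
weight `2j`: the `0`-weight space is free of rank one, `e_j = E^j e_0` and `e_{-j} = F^j e_0`
generate, and the Casimir determines the remaining coefficients, which are `-q_j` with
`q_j = (1 + (2j+1)² z) / 4` (`IsContractionFamily.exists_isStandard`, `qPoly`). Conversely these
coefficients define a family (`modelFamily_isContractionFamily`). Weights force an isomorphism with
the twisted dual to be diagonal, and compatibility with `E` makes its entries `c₀ ∏_{i < |j|} q_i`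
with a rational function `c₀ ≠ 0` (`exists_intertwiner_eq`). Hence the Jantzen filtration at `x` is
read off from the orders of vanishing of the `q_i` at `x`, and the forms on the quotients from the
signs of their leading coefficients (`exists_diagonalAt`). For `x ≥ 0` all `q_i(x)` are positive, and
there is a single nonzero, positive quotient. For `x < 0` almost all `q_i(x)` are negative; a quotient
containing `e_k` and `e_{k+1}` with `q_k(x) < 0` is not definite. So some `q_m` must vanish at `x`,
that is `x = -(2m+1)⁻²`, and then the span of the `e_j` with `|j| ≤ m` is the only
positive quotient (`exists_isQuotBasis`, `isInfUnitary_imp`).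

Everything about the representations goes through ladders (`HasLadder`): orthonormal weight vectors
`u_j` on which the real Lie algebra acts by the normalized coefficients
`s_j(x) = √(1 + (2j+1)² x) / 2`. A representation integrates the positive quotient at `x` if and only
if the normalized basis vectors are a ladder (`IsQuotBasis.integrates_iff`). Ladder vectors are
analytic: by Taylor's formula (`norm_toHom_sub_taylor_le`) the matrices of the group elements near
the identity are determined by the `s_j(x)`, with estimates that are uniform in `x`. Thus two
representations with dense ladders over `x` are equivalent, and they are irreducible
(`HasLadder.equivalent`, `HasLadder.isIrreducible`), which gives uniqueness; a representation
occurs at `x` if and only if it has a dense ladder (`isJantzenRep_iff`). Existence comes from models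
(`exists_model`). For `x > 0` these are the Fourier monomials in the principal series, multiplied by
phases (`principalSeries_exists_hasLadder`); for `x = 0` they are the Fourier monomials in `L²` of
the circle, on which translations of the plane act by characters (`motionModel_hasLadder`); and for
`x = -(2m+1)⁻²` they come from a power of a matrix entry in `L²(SU(2))`, which is a highest weight
vector (`exists_model_discretePoint`).

For the converse statements, an arbitrary irreducible representation has to be given a ladder. For
the motion group, a `U(1)`-fixed vector is averaged over translations against a smooth radial
function of small support, and the raising and lowering operators are applied to the resulting
smooth vector; they are isometric up to the factor `1/2` because `4EF` acts as `-1`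
(`exists_hasLadder_motion`). For `SU(2)`, some average of a given vector against a monomial in the
matrix entries is nonzero by the theorem of Stone and Weierstrass; applying `E` to it leads to a
highest weight vector, which generates a ladder (`exists_hasLadder_SU2`,
`IsSl2Map.exists_hasLadder`).

The center of the enveloping algebra is computed on normal forms `∑ p(H) E^b F^c`: to commute with
`H` and `E` leaves only constant multiples of the `E^b F^b` (`center_motionU`).

The contraction to the motion group is continuity of the ladders in `x`: `J` takes ladder vectors to
ladder vectors, `s_j(x) → s_j(0) = 1/2`, and the uniform Taylor estimates give convergence of the
compressions near the identity. Convergence is multiplicative, since the operators are bounded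
by `1`, and so extends to all group elements, uniformly on compact sets (`exists_contraction`).
-/

noncomputable section

namespace ContractionFamilies

/-! ### Weight vectors of algebraic representations of `ℂˣ` -/

section Weights

variable {L : Type*} [AddCommGroup L] [Module ℂ[X] L]

/-- The weight `k` isotypical component of a representation of `ℂˣ`. -/
def repWeight (ρ : Representation ℂ[X] ℂˣ L) (k : ℤ) : Submodule ℂ[X] L where
  carrier := {f | ∀ a : ℂˣ, ρ a f = C ((a ^ k : ℂˣ) : ℂ) • f}
  zero_mem' := by simp
  add_mem' := by
    intro f g hf hg a
    rw [map_add, hf a, hg a, smul_add]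
  smul_mem' := by
    intro r f hf a
    rw [map_smul, hf a, smul_comm]

/-- The characters `a ↦ a ^ k` of `ℂˣ` are linearly independent, with coefficients in any complex
vector space. -/
lemma eq_zero_of_forall_sum_zpow {c : ℤ →₀ L}
    (h : ∀ a : ℂˣ, (c.sum fun k w => (C ((a ^ k : ℂˣ) : ℂ) : ℂ[X]) • w) = 0) : c = 0 := by
  let _ : Module ℂ L := Module.compHom L (C : ℂ →+* ℂ[X])
  have hinj : Function.Injective (fun k : ℤ =>
      ((Units.coeHom ℂ).comp (zpowGroupHom k) : ℂˣ →* ℂ)) := by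
    intro k l hkl
    have h2 := DFunLike.congr_fun hkl (Units.mk0 (2 : ℂ) two_ne_zero)
    simp only [MonoidHom.comp_apply, zpowGroupHom_apply, Units.coeHom_apply,
      Units.val_zpow_eq_zpow_val, Units.val_mk0] at h2
    have h3 : (2 : ℝ) ^ k = (2 : ℝ) ^ l := by simpa using congrArg norm h2
    exact zpow_right_injective₀ (by norm_num) (by norm_num) h3
  have hli := (linearIndependent_monoidHom ℂˣ ℂ).comp _ hinj
  ext k
  rw [Finsupp.zero_apply, ← Module.forall_dual_apply_eq_zero_iff ℂ]
  intro ℓ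
  have hsum : (c.mapRange ℓ (map_zero ℓ)).sum (fun k r =>
      r • (((Units.coeHom ℂ).comp (zpowGroupHom k) : ℂˣ →* ℂ) : ℂˣ → ℂ)) = 0 := by
    rw [Finsupp.sum_mapRange_index (by simp)]
    ext a
    have := congrArg ℓ (h a)
    rw [map_zero, Finsupp.sum, map_sum] at this
    rw [Finsupp.sum, Finset.sum_apply, Pi.zero_apply, ← this]
    refine Finset.sum_congr rfl fun k _ => ?_
    have : ℓ ((C ((a ^ k : ℂˣ) : ℂ) : ℂ[X]) • c k) = ((a ^ k : ℂˣ) : ℂ) • ℓ (c k) :=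
      map_smul ℓ _ _
    rw [this]
    simp [mul_comm]
  have := (linearIndependent_iff.1 hli) (c.mapRange ℓ (map_zero ℓ)) (by
    rw [Finsupp.linearCombination_apply]; exact hsum)
  simpa using DFunLike.congr_fun this k

variable {ρ : Representation ℂ[X] ℂˣ L}

lemma repWeight_indep {c : ℤ →₀ L} (hc : ∀ k, c k ∈ repWeight ρ k)
    (h : (c.sum fun _ w => w) = 0) : c = 0 := by
  refine eq_zero_of_forall_sum_zpow fun a => ?_
  have := congrArg (ρ a) h
  rw [map_zero, Finsupp.sum, map_sum] at this
  rw [← this]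
  exact Finset.sum_congr rfl fun k _ => (hc k a).symm

lemma repWeight_indep_of_injective {ι : Type*} {g : ι → ℤ} (hg : Function.Injective g)
    {c : ι →₀ L} (hc : ∀ i, c i ∈ repWeight ρ (g i)) (h : (c.sum fun _ w => w) = 0) : c = 0 := by
  refine Finsupp.mapDomain_injective hg ?_
  rw [Finsupp.mapDomain_zero]
  refine repWeight_indep (ρ := ρ) (fun k => ?_) ?_
  · by_cases hk : k ∈ Set.range g
    · obtain ⟨i, rfl⟩ := hk
      rw [Finsupp.mapDomain_apply hg]
      exact hc i
    · rw [Finsupp.mapDomain_of_notMem_range _ _ hk]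
      exact zero_mem _
  · rwa [Finsupp.sum_mapDomain_index (by simp) (by simp)]

/-- Every vector of an algebraic representation is a finite sum of weight vectors. -/
lemma exists_weight_decomp (hρ : IsAlgebraicRep ρ) (f : L) :
    ∃ c : ℤ →₀ L, (∀ k, c k ∈ repWeight ρ k) ∧ (c.sum fun _ w => w) = f ∧
      ∀ a : ℂˣ, ρ a f = c.sum fun k w => C ((a ^ k : ℂˣ) : ℂ) • w := by
  obtain ⟨c, hc⟩ := hρ f
  refine ⟨c, fun k b => ?_, ?_, hc⟩
  · have key : (c.mapRange (ρ b) (map_zero _) -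
        Finsupp.onFinset c.support (fun k => (C ((b ^ k : ℂˣ) : ℂ) : ℂ[X]) • c k)
          (fun k hk => by
            rw [Finsupp.mem_support_iff]; rintro h; exact hk (by simp [h]))) = 0 := by
      refine eq_zero_of_forall_sum_zpow fun a => ?_
      rw [Finsupp.sum_of_support_subset (s := c.support) _ ?_ _ (by simp)]
      · simp only [Finsupp.sub_apply, Finsupp.mapRange_apply, Finsupp.onFinset_apply, smul_sub,
          Finset.sum_sub_distrib]
        have h1 := hc (b * a)
        rw [map_mul, Module.End.mul_apply, hc a, Finsupp.sum, map_sum, Finsupp.sum] at h1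
        rw [sub_eq_zero]
        convert h1 using 2 with k _ k _
        · rw [map_smul]
        · rw [smul_smul, ← C_mul, mul_zpow, Units.val_mul, mul_comm]
      · intro k
        contrapose!
        simp +contextual
    have := DFunLike.congr_fun key k
    simpa [sub_eq_zero] using this
  · have := hc 1
    simpa using this.symm

end Weights

namespace HCFamily

variable {F : HCFamily.{u}}

instance : Module.IsTorsionFree ℂ[X] F.carrier := by
  have := F.flat
  infer_instance

lemma secH_lie_of_mem {k : ℤ} {f : F.carrier} (hf : f ∈ F.weightSpace k) :
    ⁅secH, f⁆ = k • f := by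
  have := F.differential f (Finsupp.single k f) (fun a => by
    rw [Finsupp.sum_single_index (by simp)]; exact hf a)
  rwa [Finsupp.sum_single_index (by simp)] at this

lemma lie_secE_secF : ⁅secE, secF⁆ = (X : ℂ[X]) • secH := by
  apply Subtype.ext
  apply Prod.ext <;> ext i j : 1 <;> fin_cases i <;> fin_cases j <;>
    simp [secE, secF, secH, gElt, Ring.lie_def]

lemma one_tmul_injective : Function.Injective fun f : F.carrier => (1 : RatFunc ℂ) ⊗ₜ[ℂ[X]] f := by
  have := F.flat
  have h := Module.Flat.rTensor_preserves_injective_linearMap (M := F.carrier)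
    (Algebra.linearMap ℂ[X] (RatFunc ℂ)) (IsFractionRing.injective ℂ[X] (RatFunc ℂ))
  intro f g hfg
  have : (1 : ℂ[X]) ⊗ₜ[ℂ[X]] f = (1 : ℂ[X]) ⊗ₜ[ℂ[X]] g := h (by simpa using hfg)
  simpa using congrArg (TensorProduct.lid ℂ[X] F.carrier) this

/-- The polynomial `(1 + (2 j + 1)² z) / 4`, by which `-F E` acts on the vectors of weight `2 j`. -/
def qPoly (j : ℤ) : ℂ[X] := C (1 / 4) * (1 + C ((2 * (j : ℂ) + 1) ^ 2) * X)

lemma qPoly_ne_zero (j : ℤ) : qPoly j ≠ 0 := by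
  intro h
  have := congrArg (eval 0) h
  simp [qPoly] at this

/-- The Casimir relation on the generic fibre, without denominators. -/
lemma casimir_integral (hF : F.CasimirActsBy (-((1 + RatFunc.X) / RatFunc.X))) (f : F.carrier) :
    (X : ℂ[X]) • ⁅secH, ⁅secH, f⁆⁆ + (2 : ℂ[X]) • ⁅secE, ⁅secF, f⁆⁆ +
      (2 : ℂ[X]) • ⁅secF, ⁅secE, f⁆⁆ = (-(1 + X) : ℂ[X]) • f := by
  apply one_tmul_injective
  have h := congrArg (fun w => (RatFunc.X : RatFunc ℂ) • w) (hF (1 ⊗ₜ f))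
  have hX : (RatFunc.X : RatFunc ℂ) ≠ 0 := RatFunc.X_ne_zero
  simp only [smul_add, smul_smul, mul_div_cancel₀ _ hX, mul_neg, LinearMap.baseChange_tmul,
    LieModule.toEnd_apply_apply] at h
  have key : ∀ (p : ℂ[X]) (m : F.carrier),
      (algebraMap ℂ[X] (RatFunc ℂ) p) • (1 ⊗ₜ[ℂ[X]] m : F.generic) = 1 ⊗ₜ (p • m) := by
    intro p m
    rw [algebraMap_smul, TensorProduct.tmul_smul]
  simp only [TensorProduct.tmul_add, ← key]
  simpa [map_ofNat] using h

lemma lie_secF_secE_of_mem (hF : F.CasimirActsBy (-((1 + RatFunc.X) / RatFunc.X))) {j : ℤ}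
    {f : F.carrier} (hf : f ∈ F.weightSpace (2 * j)) :
    ⁅secF, ⁅secE, f⁆⁆ = -(qPoly j) • f ∧ ⁅secE, ⁅secF, f⁆⁆ = -(qPoly (j - 1)) • f := by
  have h1 := casimir_integral hF f
  have h2 : ⁅secE, ⁅secF, f⁆⁆ = (X : ℂ[X]) • ⁅secH, f⁆ + ⁅secF, ⁅secE, f⁆⁆ := by
    rw [leibniz_lie, lie_secE_secF, smul_lie]
  have hH : ∀ g : F.carrier, ((2 * j : ℤ)) • g = (2 * (j : ℂ[X])) • g := by
    intro g
    rw [← Int.cast_smul_eq_zsmul ℂ[X]]; simp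
  rw [secH_lie_of_mem hf, lie_zsmul, secH_lie_of_mem hf] at h1
  rw [secH_lie_of_mem hf] at h2
  simp only [hH, smul_smul] at h1 h2
  have h4 : ∀ m : F.carrier, (C (1 / 4) : ℂ[X]) • (4 : ℂ[X]) • m = m := by
    intro m
    rw [smul_smul, show (C (1 / 4) : ℂ[X]) * 4 = 1 by
      rw [show (4 : ℂ[X]) = C 4 from rfl, ← C_mul]; norm_num, one_smul]
  have hq : ∀ i : ℤ, -(qPoly i) = C (1 / 4) * -(1 + (2 * (i : ℂ[X]) + 1) ^ 2 * X) := by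
    intro i
    simp only [qPoly, C_pow, C_add, C_mul, C_1, map_intCast, map_ofNat]
    ring
  constructor
  · rw [hq, mul_smul, ← h4 ⁅secF, ⁅secE, f⁆⁆]
    congr 1
    rw [h2] at h1
    linear_combination (norm := module) h1
  · rw [hq, mul_smul, ← h4 ⁅secE, ⁅secF, f⁆⁆]
    congr 1
    have h3 : ⁅secF, ⁅secE, f⁆⁆ = ⁅secE, ⁅secF, f⁆⁆ - ((X : ℂ[X]) * (2 * (j : ℂ[X]))) • f := by
      rw [h2]; abel
    rw [h3] at h1
    push_cast
    linear_combination (norm := module) h1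

end HCFamily
end ContractionFamilies
end

noncomputable section

namespace ContractionFamilies
namespace HCFamily

variable {F : HCFamily.{u}}

/-! ### The standard basis of a contraction family -/

/-- The coefficient of `E e_j = eCoef j • e_{j+1}` in the standard basis. -/
def eCoef (j : ℤ) : ℂ[X] := if 0 ≤ j then 1 else -qPoly j

/-- The coefficient of `F e_j = fCoef j • e_{j-1}` in the standard basis. -/
def fCoef (j : ℤ) : ℂ[X] := if j ≤ 0 then 1 else -qPoly (j - 1)

/-- A basis `e_j`, `j ∈ ℤ`, of `F` is standard if `e_j` has weight `2 j` and `E`, `F` act by the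
coefficients `eCoef`, `fCoef`; so `e_j = E^j e_0` and `e_{-j} = F^j e_0` for `j ≥ 0`. -/
structure IsStandard (b : Module.Basis ℤ ℂ[X] F.carrier) : Prop where
  rho : ∀ (a : ℂˣ) (j : ℤ), F.rho a (b j) = (C ((a ^ (2 * j) : ℂˣ) : ℂ) : ℂ[X]) • b j
  lie_secH : ∀ j, ⁅secH, b j⁆ = (2 * (j : ℂ[X])) • b j
  lie_secE : ∀ j, ⁅secE, b j⁆ = eCoef j • b (j + 1)
  lie_secF : ∀ j, ⁅secF, b j⁆ = fCoef j • b (j - 1)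

/-- The map `E^j` for `j ≥ 0`, and `F^{-j}` for `j ≤ 0`. -/
def chainMap (F : HCFamily.{u}) (j : ℤ) : F.carrier →ₗ[ℂ[X]] F.carrier :=
  (F.act secE) ^ j.toNat * (F.act secF) ^ (-j).toNat

lemma chainMap_zero : chainMap F 0 = 1 := by simp [chainMap]

lemma secE_chainMap_nonneg {j : ℤ} (hj : 0 ≤ j) (v : F.carrier) :
    ⁅secE, chainMap F j v⁆ = chainMap F (j + 1) v := by
  lift j to ℕ using hj
  have h1 : ((j : ℤ) + 1).toNat = j + 1 := by omega
  have h2 : (-((j : ℤ) + 1)).toNat = 0 := by omega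
  simp only [chainMap, h1, h2, pow_succ', Int.toNat_neg_natCast, Int.toNat_natCast]
  simp

lemma secF_chainMap_nonpos {j : ℤ} (hj : j ≤ 0) (v : F.carrier) :
    ⁅secF, chainMap F j v⁆ = chainMap F (j - 1) v := by
  obtain ⟨n, rfl⟩ : ∃ n : ℕ, j = -n := ⟨(-j).toNat, by omega⟩
  have h1 : (-(n : ℤ) - 1).toNat = 0 := by omega
  have h2 : (-(-(n : ℤ) - 1)).toNat = n + 1 := by omega
  simp only [chainMap, h1, h2, pow_succ', neg_neg, Int.toNat_natCast, pow_zero, one_mul]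
  simp

lemma secE_lie_mem {j : ℤ} {f : F.carrier} (hf : f ∈ F.weightSpace (2 * j)) :
    ⁅secE, f⁆ ∈ F.weightSpace (2 * (j + 1)) := by
  have := lie_mem_weightSpace adSec_secE hf
  rwa [show 2 * j + 2 = 2 * (j + 1) by ring] at this

lemma secF_lie_mem {j : ℤ} {f : F.carrier} (hf : f ∈ F.weightSpace (2 * j)) :
    ⁅secF, f⁆ ∈ F.weightSpace (2 * (j - 1)) := by
  have := lie_mem_weightSpace adSec_secF hf
  rwa [show 2 * j + -2 = 2 * (j - 1) by ring] at this

lemma chainMap_mem {v : F.carrier} (hv : v ∈ F.weightSpace 0) (j : ℤ) :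
    chainMap F j v ∈ F.weightSpace (2 * j) := by
  induction j using Int.induction_on with
  | zero => simpa [chainMap_zero] using hv
  | succ n ih => rw [← secE_chainMap_nonneg (by omega)]; exact secE_lie_mem ih
  | pred n ih => rw [← secF_chainMap_nonpos (by omega)]; exact secF_lie_mem ih

section
variable (hF : F.CasimirActsBy (-((1 + RatFunc.X) / RatFunc.X))) {v : F.carrier}
  (hv : v ∈ F.weightSpace 0)
include hF hv

lemma secE_chainMap (j : ℤ) : ⁅secE, chainMap F j v⁆ = eCoef j • chainMap F (j + 1) v := by
  by_cases hj : 0 ≤ j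
  · rw [secE_chainMap_nonneg hj, eCoef, if_pos hj, one_smul]
  · have := (lie_secF_secE_of_mem hF (chainMap_mem hv (j + 1))).2
    rw [secF_chainMap_nonpos (by omega), add_sub_cancel_right] at this
    rw [this, eCoef, if_neg hj]

lemma secF_chainMap (j : ℤ) : ⁅secF, chainMap F j v⁆ = fCoef j • chainMap F (j - 1) v := by
  by_cases hj : j ≤ 0
  · rw [secF_chainMap_nonpos hj, fCoef, if_pos hj, one_smul]
  · have := (lie_secF_secE_of_mem hF (chainMap_mem hv (j - 1))).1
    rw [secE_chainMap_nonneg (by omega), sub_add_cancel] at this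
    rw [this, fCoef, if_neg hj]

lemma chainMap_eq_zero {j : ℤ} (h : chainMap F j v = 0) : v = 0 := by
  induction j using Int.induction_on with
  | zero => simpa [chainMap_zero] using h
  | succ n ih =>
    apply ih
    have := (lie_secF_secE_of_mem hF (chainMap_mem hv n)).1
    rw [secE_chainMap_nonneg (by omega), h, lie_zero] at this
    exact (smul_eq_zero.1 this.symm).resolve_left (neg_ne_zero.2 (qPoly_ne_zero _))
  | pred n ih =>
    apply ih
    have := (lie_secF_secE_of_mem hF (chainMap_mem hv (-n))).2
    rw [secF_chainMap_nonpos (by omega), h, lie_zero] at this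
    exact (smul_eq_zero.1 this.symm).resolve_left (neg_ne_zero.2 (qPoly_ne_zero _))

end

lemma lie_mem_of_lie_mem {S : Submodule ℂ[X] F.carrier}
    {m : F.carrier} (hH : ⁅secH, m⁆ ∈ S) (hE : ⁅secE, m⁆ ∈ S) (hFm : ⁅secF, m⁆ ∈ S) (Y : GSec) :
    ⁅Y, m⁆ ∈ S := by
  rw [gElt_decomp Y]
  simp only [add_lie, smul_lie]
  exact add_mem (add_mem (S.smul_mem _ hH) (S.smul_mem _ hE)) (S.smul_mem _ hFm)

/-- The Lie submodule generated by a set of vectors of weight zero. -/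
def chainSpan (hF : F.CasimirActsBy (-((1 + RatFunc.X) / RatFunc.X))) {ι : Type*}
    (v : ι → F.carrier) (hv : ∀ i, v i ∈ F.weightSpace 0) : LieSubmodule ℂ[X] GSec F.carrier where
  __ := Submodule.span ℂ[X] (Set.range fun p : ℤ × ι => chainMap F p.1 (v p.2))
  lie_mem := by
    intro Y m hm
    change m ∈ Submodule.span _ _ at hm
    change ⁅Y, m⁆ ∈ Submodule.span _ _
    induction hm using Submodule.span_induction with
    | mem m hm =>
      obtain ⟨⟨j, i⟩, rfl⟩ := hm
      refine lie_mem_of_lie_mem ?_ ?_ ?_ Y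
      · rw [secH_lie_of_mem (chainMap_mem (hv i) j)]
        exact zsmul_mem (Submodule.subset_span (Set.mem_range_self (j, i))) _
      · dsimp only
        rw [secE_chainMap hF (hv i) j]
        exact Submodule.smul_mem _ _ (Submodule.subset_span ⟨(j + 1, i), rfl⟩)
      · dsimp only
        rw [secF_chainMap hF (hv i) j]
        exact Submodule.smul_mem _ _ (Submodule.subset_span ⟨(j - 1, i), rfl⟩)
    | zero => simp
    | add x y _ _ hx hy => rw [lie_add]; exact add_mem hx hy
    | smul r x _ hx => rw [lie_smul]; exact Submodule.smul_mem _ _ hx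

lemma mem_chainSpan {hF : F.CasimirActsBy (-((1 + RatFunc.X) / RatFunc.X))} {ι : Type*}
    {v : ι → F.carrier} {hv : ∀ i, v i ∈ F.weightSpace 0} {m : F.carrier} :
    m ∈ chainSpan hF v hv ↔
      m ∈ Submodule.span ℂ[X] (Set.range fun p : ℤ × ι => chainMap F p.1 (v p.2)) := Iff.rfl

/-- A basis of the `0`-weight space extends along the chains `E^j`, `F^j` to a basis of `F`. -/
def chainBasis (hF : F.CasimirActsBy (-((1 + RatFunc.X) / RatFunc.X)))
    (hgen : LieSubmodule.lieSpan ℂ[X] GSec (F.weightSpace 0 : Set F.carrier) = ⊤) {ι : Type*}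
    (b : Module.Basis ι ℂ[X] (F.weightSpace 0)) : Module.Basis (ℤ × ι) ℂ[X] F.carrier :=
  Module.Basis.mk (v := fun p : ℤ × ι => chainMap F p.1 (b p.2 : F.carrier)) (by
    classical
    rw [linearIndependent_iff]
    intro l hl
    -- the coefficients belonging to one weight give a combination of basis vectors of weight zero
    set w : ℤ → F.weightSpace 0 := fun j =>
      l.sum fun p r => if p.1 = j then r • b p.2 else 0 with hw
    set c : ℤ →₀ F.carrier := Finsupp.onFinset (l.support.image Prod.fst)
      (fun j => chainMap F j (w j : F.carrier)) (by
        intro j hj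
        contrapose! hj
        have : w j = 0 := by
          refine Finset.sum_eq_zero fun p hp => if_neg ?_
          rintro rfl
          exact hj (Finset.mem_image_of_mem _ hp)
        rw [this]; simp) with hc
    have hcsum : (c.sum fun _ m => m) = 0 := by
      rw [← hl, Finsupp.linearCombination_apply, Finsupp.onFinset_sum _ (by simp)]
      simp only [hw, Finsupp.sum, AddSubmonoidClass.coe_finsetSum, map_sum]
      rw [Finset.sum_comm]
      refine Finset.sum_congr rfl fun p hp => ?_
      rw [Finset.sum_eq_single p.1]
      · simp
      · intro j _ hj
        rw [if_neg hj.symm]; simp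
      · intro h
        exact absurd (Finset.mem_image_of_mem _ hp) h
    have hc0 : c = 0 := by
      refine repWeight_indep_of_injective (ρ := F.rho) (g := fun j : ℤ => 2 * j)
        (fun i j h => by simpa using h) (fun j => ?_) hcsum
      exact chainMap_mem (w j).2 j
    refine Finsupp.ext ?_
    rintro ⟨j, i⟩
    have h0 : w j = 0 := by
      have : chainMap F j (w j : F.carrier) = 0 := DFunLike.congr_fun hc0 j
      exact Subtype.ext (chainMap_eq_zero hF (w j).2 this)
    have h1 := congrArg (fun m => b.repr m i) h0
    simp only [hw, Finsupp.sum, map_sum, Finsupp.finsetSum_apply, map_zero,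
      Finsupp.zero_apply] at h1
    rw [Finset.sum_eq_single (j, i)] at h1
    · simpa using h1
    · rintro ⟨j', i'⟩ - hne
      by_cases hj : j' = j
      · subst hj
        have : i' ≠ i := fun h => hne (by rw [h])
        simp [this]
      · simp [hj]
    · intro h
      simp [Finsupp.notMem_support_iff.1 h]) (by
    have h : LieSubmodule.lieSpan ℂ[X] GSec (F.weightSpace 0 : Set F.carrier) ≤
        chainSpan hF (fun i => (b i : F.carrier)) (fun i => (b i).2) := by
      rw [LieSubmodule.lieSpan_le]
      intro m hm
      have hb : (⟨m, hm⟩ : F.weightSpace 0) ∈ Submodule.span ℂ[X] (Set.range b) := by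
        rw [b.span_eq]; trivial
      have := Submodule.mem_map_of_mem (f := (F.weightSpace 0).subtype) hb
      rw [Submodule.map_span, ← Set.range_comp] at this
      refine Submodule.span_mono ?_ this
      rintro _ ⟨i, rfl⟩
      exact ⟨(0, i), by simp [chainMap_zero]⟩
    rw [hgen] at h
    intro m _
    exact h trivial)

lemma chainBasis_apply (hF : F.CasimirActsBy (-((1 + RatFunc.X) / RatFunc.X)))
    (hgen : LieSubmodule.lieSpan ℂ[X] GSec (F.weightSpace 0 : Set F.carrier) = ⊤) {ι : Type*}
    (b : Module.Basis ι ℂ[X] (F.weightSpace 0)) (p : ℤ × ι) :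
    chainBasis hF hgen b p = chainMap F p.1 (b p.2 : F.carrier) := by
  exact Module.Basis.mk_apply _ _ _

lemma finite_weightSpace_zero (h : F.IsQuasiAdmissible) :
    Module.Finite ℂ[X] (F.weightSpace 0) := by
  have h1 := (h ℂ[X] (Representation.trivial ℂ[X] ℂˣ ℂ[X]) (fun f =>
    ⟨Finsupp.single 0 f, fun a => by simp⟩)).1
  set e := TensorProduct.lid ℂ[X] F.carrier
  have h2 : (F.weightSpace 0) = Submodule.map e.toLinearMap
      ((Representation.trivial ℂ[X] ℂˣ ℂ[X]).tprod F.rho).invariants := by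
    ext m
    have key : ∀ w : ℂ[X] ⊗[ℂ[X]] F.carrier,
        w ∈ ((Representation.trivial ℂ[X] ℂˣ ℂ[X]).tprod F.rho).invariants ↔
          e w ∈ F.weightSpace 0 := by
      intro w
      rw [Representation.mem_invariants]
      refine forall_congr' fun a => ?_
      have h3 : e (((Representation.trivial ℂ[X] ℂˣ ℂ[X]).tprod F.rho) a w) = F.rho a (e w) := by
        induction w using TensorProduct.induction_on with
        | zero => simp
        | tmul r m => simp [e, Representation.tprod_apply]
        | add x y hx hy => rw [map_add, map_add, hx, hy, map_add, map_add]
      rw [← e.injective.eq_iff, h3]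
      simp
    constructor
    · intro hm
      exact ⟨e.symm m, (key _).2 (by simpa using hm), by simp⟩
    · rintro ⟨w, hw, rfl⟩
      exact (key w).1 hw
  rw [h2]
  exact Module.Finite.map _ _

/-- The `0`-weight space of a generically irreducible family has rank at most one: the functionals
that pick out one element of a basis vanish on the submodule generated by another one. -/
lemma subsingleton_of_basis (hF : F.CasimirActsBy (-((1 + RatFunc.X) / RatFunc.X)))
    (hgen : LieSubmodule.lieSpan ℂ[X] GSec (F.weightSpace 0 : Set F.carrier) = ⊤)
    (hirr : F.IsGenericallyIrreducible) {ι : Type*} (b : Module.Basis ι ℂ[X] (F.weightSpace 0))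
    (i i' : ι) : i = i' := by
  by_contra hne
  set K := AlgebraicClosure (RatFunc ℂ)
  set B := chainBasis hF hgen b
  set N := chainSpan hF (fun _ : Unit => (b i : F.carrier)) (fun _ => (b i).2)
  have hmem : (b i : F.carrier) ∈ N :=
    mem_chainSpan.2 (Submodule.subset_span ⟨(0, ()), by simp [chainMap_zero]⟩)
  have hB : ∀ i, (b i : F.carrier) = B (0, i) := fun i => by
    simp [B, chainBasis_apply, chainMap_zero]
  have hN : ∀ m ∈ N, B.coord (0, i') m = 0 := by
    intro m hm
    refine Submodule.span_induction (p := fun m _ => B.coord (0, i') m = 0) ?_ (by simp) ?_ ?_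
      (mem_chainSpan.1 hm)
    · rintro _ ⟨⟨j, -⟩, rfl⟩
      have : chainMap F j (b i : F.carrier) = B (j, i) := by simp [B, chainBasis_apply]
      simp only [this, Module.Basis.coord_apply, Module.Basis.repr_self]
      exact Finsupp.single_eq_of_ne' fun h => hne (congrArg Prod.snd h)
    · intro x y _ _ hx hy
      rw [map_add, hx, hy, add_zero]
    · intro r x _ hx
      rw [map_smul, hx, smul_zero]
  have hfun : ∀ w ∈ N.baseChange K, (B.coord (0, i')).baseChange K w = 0 := by
    intro w hw
    rw [LieSubmodule.mem_baseChange_iff] at hw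
    refine Submodule.span_induction (p := fun w _ => (B.coord (0, i')).baseChange K w = 0) ?_
      (by simp) ?_ ?_ hw
    · rintro _ ⟨m, hm, rfl⟩
      have : (B.coord (0, i')).baseChange K ((1 : K) ⊗ₜ m) = 0 := by
        rw [LinearMap.baseChange_tmul, hN m hm, TensorProduct.tmul_zero]
      exact this
    · intro x y _ _ hx hy
      rw [map_add, hx, hy, add_zero]
    · intro r x _ hx
      rw [map_smul, hx, smul_zero]
  have hone : ∀ i, (B.coord (0, i)).baseChange K ((1 : K) ⊗ₜ (b i : F.carrier)) ≠ 0 := by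
    intro i h
    rw [LinearMap.baseChange_tmul, hB, Module.Basis.coord_apply, Module.Basis.repr_self,
      Finsupp.single_eq_same] at h
    have := congrArg (TensorProduct.rid ℂ[X] K) h
    simp at this
  have : LieModule.IsIrreducible K (K ⊗[ℂ[X]] GSec) (K ⊗[ℂ[X]] F.carrier) := hirr
  rcases eq_bot_or_eq_top (N.baseChange K) with h | h
  · have h1 : (1 : K) ⊗ₜ[ℂ[X]] (b i : F.carrier) ∈ N.baseChange K :=
      LieSubmodule.tmul_mem_baseChange_of_mem _ hmem
    rw [h, LieSubmodule.mem_bot] at h1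
    exact hone i (by rw [h1, map_zero])
  · exact hone i' (hfun _ (by rw [h]; trivial))

/-- A contraction family has a standard basis. -/
theorem IsContractionFamily.exists_isStandard (hF : F.IsContractionFamily) :
    ∃ b : Module.Basis ℤ ℂ[X] F.carrier, IsStandard b := by
  have := finite_weightSpace_zero hF.quasiAdmissible
  let b := Module.Free.chooseBasis ℂ[X] (F.weightSpace 0)
  have hne : Nontrivial (F.weightSpace 0) :=
    (Submodule.nontrivial_iff_ne_bot).2 ((hF.evenWeights 0).2 (by simp))
  have : Nonempty (Module.Free.ChooseBasisIndex ℂ[X] (F.weightSpace 0)) := b.index_nonempty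
  have : Subsingleton (Module.Free.ChooseBasisIndex ℂ[X] (F.weightSpace 0)) :=
    ⟨subsingleton_of_basis hF.casimir hF.generated hF.genericallyIrreducible b⟩
  let i₀ := Classical.arbitrary (Module.Free.ChooseBasisIndex ℂ[X] (F.weightSpace 0))
  have : Unique (Module.Free.ChooseBasisIndex ℂ[X] (F.weightSpace 0)) := ⟨⟨i₀⟩, fun _ =>
    Subsingleton.elim _ _⟩
  let B := (chainBasis hF.casimir hF.generated b).reindex (Equiv.prodUnique ℤ _)
  have hB : ∀ j, B j = chainMap F j (b default : F.carrier) := fun j => by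
    simp [B, chainBasis_apply]
  have hv := (b default).2
  refine ⟨B, ⟨fun a j => ?_, fun j => ?_, fun j => ?_, fun j => ?_⟩⟩
  · rw [hB]; exact chainMap_mem hv j a
  · rw [hB, secH_lie_of_mem (chainMap_mem hv j), ← Int.cast_smul_eq_zsmul ℂ[X]]; simp
  · rw [hB, hB]; exact secE_chainMap hF.casimir hv j
  · rw [hB, hB]; exact secF_chainMap hF.casimir hv j

end HCFamily
end ContractionFamilies
end

noncomputable section

namespace ContractionFamilies

/-! ### The model family -/

/-- The free module on `e_j`, `j ∈ ℤ`, underlying the model family. -/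
def ModelCarrier : Type := ℤ →₀ ℂ[X]

namespace ModelCarrier

instance : AddCommGroup ModelCarrier := inferInstanceAs (AddCommGroup (ℤ →₀ ℂ[X]))
instance : Module ℂ[X] ModelCarrier := inferInstanceAs (Module ℂ[X] (ℤ →₀ ℂ[X]))

/-- The standard basis of the model family. -/
def basis : Module.Basis ℤ ℂ[X] ModelCarrier := Module.Basis.ofRepr (LinearEquiv.refl _ _)

instance : Module.Free ℂ[X] ModelCarrier := Module.Free.of_basis basis

/-- The operator `H`. -/
def opH : ModelCarrier →ₗ[ℂ[X]] ModelCarrier :=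
  basis.constr ℂ[X] fun j => (2 * (j : ℂ[X])) • basis j
/-- The operator `E`. -/
def opE : ModelCarrier →ₗ[ℂ[X]] ModelCarrier :=
  basis.constr ℂ[X] fun j => HCFamily.eCoef j • basis (j + 1)
/-- The operator `F`. -/
def opF : ModelCarrier →ₗ[ℂ[X]] ModelCarrier :=
  basis.constr ℂ[X] fun j => HCFamily.fCoef j • basis (j - 1)

lemma opH_basis (j : ℤ) : opH (basis j) = (2 * (j : ℂ[X])) • basis j := by simp [opH]
lemma opE_basis (j : ℤ) : opE (basis j) = HCFamily.eCoef j • basis (j + 1) := by simp [opE]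
lemma opF_basis (j : ℤ) : opF (basis j) = HCFamily.fCoef j • basis (j - 1) := by simp [opF]

lemma opH_opE (m : ModelCarrier) : opH (opE m) = opE (opH m) + (2 : ℂ[X]) • opE m := by
  have : opH ∘ₗ opE = opE ∘ₗ opH + (2 : ℂ[X]) • opE := by
    refine basis.ext fun j => ?_
    simp only [LinearMap.comp_apply, LinearMap.add_apply, LinearMap.smul_apply, opH_basis,
      opE_basis, map_smul]
    push_cast
    module
  exact LinearMap.congr_fun this m

lemma opH_opF (m : ModelCarrier) : opH (opF m) = opF (opH m) - (2 : ℂ[X]) • opF m := by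
  have : opH ∘ₗ opF = opF ∘ₗ opH - (2 : ℂ[X]) • opF := by
    refine basis.ext fun j => ?_
    simp only [LinearMap.comp_apply, LinearMap.sub_apply, LinearMap.smul_apply, opH_basis,
      opF_basis, map_smul]
    push_cast
    module
  exact LinearMap.congr_fun this m

lemma fCoef_mul_eCoef (j : ℤ) :
    HCFamily.fCoef (j + 1) * HCFamily.eCoef j = -HCFamily.qPoly j := by
  by_cases h : 0 ≤ j
  · have h' : ¬ j + 1 ≤ 0 := by omega
    simp [HCFamily.eCoef, HCFamily.fCoef, h, h']
  · have h' : j + 1 ≤ 0 := by omega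
    simp [HCFamily.eCoef, HCFamily.fCoef, h, h']

lemma opF_opE_basis (j : ℤ) : opF (opE (basis j)) = -HCFamily.qPoly j • basis j := by
  rw [opE_basis, map_smul, opF_basis, smul_smul, mul_comm, fCoef_mul_eCoef, add_sub_cancel_right]

lemma opE_opF_basis (j : ℤ) : opE (opF (basis j)) = -HCFamily.qPoly (j - 1) • basis j := by
  have := fCoef_mul_eCoef (j - 1)
  rw [sub_add_cancel] at this
  rw [opF_basis, map_smul, opE_basis, smul_smul, this, sub_add_cancel]

lemma qPoly_sub (j : ℤ) :
    HCFamily.qPoly j - HCFamily.qPoly (j - 1) = (X : ℂ[X]) * (2 * (j : ℂ[X])) := by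
  have h4 : (C (1 / 4) : ℂ[X]) * 4 = 1 := by
    rw [show (4 : ℂ[X]) = C 4 from rfl, ← C_mul]; norm_num
  simp only [HCFamily.qPoly, C_pow, C_add, C_mul, C_1, map_intCast, map_ofNat]
  push_cast
  linear_combination (2 * X * (j : ℂ[X])) * h4

lemma opE_opF (m : ModelCarrier) : opE (opF m) = opF (opE m) + (X : ℂ[X]) • opH m := by
  have : opE ∘ₗ opF = opF ∘ₗ opE + (X : ℂ[X]) • opH := by
    refine basis.ext fun j => ?_
    simp only [LinearMap.comp_apply, LinearMap.add_apply, LinearMap.smul_apply, opH_basis,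
      opF_opE_basis, opE_opF_basis]
    rw [smul_smul, ← qPoly_sub]
    module
  exact LinearMap.congr_fun this m

instance : LieRingModule GSec ModelCarrier where
  bracket Y m := Y.1.1 0 0 • opH m + Y.1.1 0 1 • opE m + Y.1.2 1 0 • opF m
  add_lie Y Z m := by
    simp only [AddMemClass.coe_add, Prod.fst_add, Prod.snd_add, Matrix.add_apply]
    module
  lie_add Y m m' := by simp only [map_add]; module
  leibniz_lie Y Z m := by
    obtain ⟨h1, h2, h3, -, h5⟩ := Y.2
    obtain ⟨k1, k2, k3, -, k5⟩ := Z.2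
    simp only [map_add, map_smul, LieSubalgebra.coe_bracket, Ring.lie_def, Prod.fst_sub,
      Prod.snd_sub, Prod.fst_mul, Prod.snd_mul, Matrix.sub_apply, Matrix.mul_apply,
      Fin.sum_univ_two, h1, h2, h3, h5, k1, k2, k3, k5, opH_opE, opH_opF, opE_opF]
    module

lemma bracket_def (Y : GSec) (m : ModelCarrier) :
    ⁅Y, m⁆ = Y.1.1 0 0 • opH m + Y.1.1 0 1 • opE m + Y.1.2 1 0 • opF m := rfl

instance : LieModule ℂ[X] GSec ModelCarrier where
  smul_lie r Y m := by
    simp only [bracket_def, SetLike.val_smul, Prod.smul_fst, Prod.smul_snd, Matrix.smul_apply,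
      smul_eq_mul]
    module
  lie_smul r Y m := by simp only [bracket_def, map_smul]; module

lemma secH_bracket (m : ModelCarrier) : ⁅secH, m⁆ = opH m := by
  simp [bracket_def, secH, gElt]
lemma secE_bracket (m : ModelCarrier) : ⁅secE, m⁆ = opE m := by
  simp [bracket_def, secE, gElt]
lemma secF_bracket (m : ModelCarrier) : ⁅secF, m⁆ = opF m := by
  simp [bracket_def, secF, gElt]

/-- The action of `K`. -/
def rho : Representation ℂ[X] ℂˣ ModelCarrier where
  toFun a := basis.constr ℂ[X] fun j => (C ((a ^ (2 * j) : ℂˣ) : ℂ) : ℂ[X]) • basis j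
  map_one' := basis.ext fun j => by simp
  map_mul' a b := basis.ext fun j => by
    simp only [Module.Basis.constr_basis, Module.End.mul_apply, map_smul, smul_smul, ← C_mul,
      ← Units.val_mul, mul_zpow, mul_comm]

lemma rho_basis (a : ℂˣ) (j : ℤ) :
    rho a (basis j) = (C ((a ^ (2 * j) : ℂˣ) : ℂ) : ℂ[X]) • basis j :=
  Module.Basis.constr_basis _ _ _ _

lemma basis_induction {P : ModelCarrier → Prop} (h0 : P 0) (hadd : ∀ f g, P f → P g → P (f + g))
    (hs : ∀ (r : ℂ[X]) (j : ℤ), P (r • basis j)) (f : ModelCarrier) : P f := by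
  rw [← basis.linearCombination_repr f, Finsupp.linearCombination_apply]
  exact Finset.sum_induction _ P hadd h0 fun j _ => hs _ j

lemma exists_comodule (f : ModelCarrier) : ∃ c : ℤ →₀ ModelCarrier,
    (∀ a : ℂˣ, rho a f = c.sum fun k w => (C ((a ^ k : ℂˣ) : ℂ) : ℂ[X]) • w) ∧
      opH f = c.sum fun k w => k • w := by
  induction f using basis_induction with
  | h0 => exact ⟨0, by simp, by simp⟩
  | hadd f g hf hg =>
    obtain ⟨c, hc, hc'⟩ := hf
    obtain ⟨d, hd, hd'⟩ := hg
    refine ⟨c + d, fun a => ?_, ?_⟩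
    · rw [map_add, hc, hd, Finsupp.sum_add_index' (by simp) (by simp)]
    · rw [map_add, hc', hd', Finsupp.sum_add_index' (by simp) (by simp)]
  | hs r j =>
    refine ⟨Finsupp.single (2 * j) (r • basis j), fun a => ?_, ?_⟩
    · rw [Finsupp.sum_single_index (by simp), map_smul, rho_basis, smul_comm]
    · rw [Finsupp.sum_single_index (by simp), map_smul, opH_basis, smul_comm r,
        ← Int.cast_smul_eq_zsmul ℂ[X]]
      simp

end ModelCarrier

open ModelCarrier

/-- The model of a contraction family: the free module on `e_j`, `j ∈ ℤ`, on which `H`, `E` and `F`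
act by `2 j`, `eCoef` and `fCoef`. -/
def modelFamily : HCFamily.{0} where
  carrier := ModelCarrier
  flat := inferInstance
  rho := ModelCarrier.rho
  algebraic f := (exists_comodule f).imp fun _ h => h.1
  equivariant a Y f := by
    induction f using basis_induction with
    | h0 => simp
    | hadd f g hf hg => simp only [lie_add, map_add, hf, hg]
    | hs r j =>
      simp only [lie_smul, map_smul, rho_basis, bracket_def, map_add, opH_basis, opE_basis,
        opF_basis]
      have ha : (C (a : ℂ) : ℂ[X]) * C ((a⁻¹ : ℂˣ) : ℂ) = 1 := by
        rw [← C_mul]; simp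
      have e1 : (adSec a Y).1.1 0 0 = Y.1.1 0 0 := by
        simp [adSec, Matrix.mul_apply, Matrix.diagonal]
        linear_combination Y.1.1 0 0 * (by simpa using ha : (C (a : ℂ) : ℂ[X]) * C ((a : ℂ)⁻¹) = 1)
      have e2 : (adSec a Y).1.1 0 1 = (C ((a ^ (2 : ℤ) : ℂˣ) : ℂ) : ℂ[X]) * Y.1.1 0 1 := by
        simp [adSec, Matrix.mul_apply, Matrix.diagonal]
        ring
      have e3 : (adSec a Y).1.2 1 0 = (C ((a ^ (-2 : ℤ) : ℂˣ) : ℂ) : ℂ[X]) * Y.1.2 1 0 := by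
        simp [adSec, Matrix.mul_apply, Matrix.diagonal, zpow_neg, zpow_ofNat, pow_two]
        ring
      have f1 : 2 * (j + 1) = 2 + 2 * j := by ring
      have f2 : 2 * (j - 1) = -2 + 2 * j := by ring
      rw [e1, e2, e3, f1, f2, zpow_add, zpow_add, Units.val_mul, Units.val_mul, C_mul, C_mul]
      module
  differential f c hc := by
    obtain ⟨d, hd, hd'⟩ := exists_comodule f
    have : c - d = 0 := by
      refine eq_zero_of_forall_sum_zpow fun a => ?_
      rw [Finsupp.sum_sub_index (fun _ _ _ => smul_sub _ _ _)]
      exact sub_eq_zero.2 ((hc a).symm.trans (hd a))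
    rw [sub_eq_zero.1 this, secH_bracket, hd']

namespace ModelCarrier

lemma rho_repr (a : ℂˣ) (f : ModelCarrier) (j : ℤ) :
    basis.repr (rho a f) j = (C ((a ^ (2 * j) : ℂˣ) : ℂ) : ℂ[X]) * basis.repr f j := by
  induction f using basis_induction with
  | h0 => simp
  | hadd f g hf hg => simp only [map_add, Finsupp.add_apply, hf, hg, mul_add]
  | hs r i =>
    simp only [map_smul, rho_basis, Finsupp.smul_apply, Module.Basis.repr_self, smul_eq_mul]
    by_cases h : i = j
    · subst h; ring
    · simp [Finsupp.single_eq_of_ne' h]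

lemma zpow_two_eq {k l : ℤ} (h : ((Units.mk0 (2 : ℂ) two_ne_zero) ^ k : ℂˣ) =
    (Units.mk0 (2 : ℂ) two_ne_zero) ^ l) : k = l := by
  have h3 : (2 : ℝ) ^ k = (2 : ℝ) ^ l := by
    simpa using congrArg (fun u : ℂˣ => ‖(u : ℂ)‖) h
  exact zpow_right_injective₀ (by norm_num) (by norm_num) h3

lemma evenWeights (k : ℤ) : modelFamily.weightSpace k ≠ ⊥ ↔ Even k := by
  constructor
  · intro h
    obtain ⟨f, hf, hne⟩ : ∃ f : ModelCarrier,
        (∀ a, rho a f = (C ((a ^ k : ℂˣ) : ℂ) : ℂ[X]) • f) ∧ f ≠ 0 :=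
      Submodule.exists_mem_ne_zero_of_ne_bot h
    have : basis.repr f ≠ 0 := fun h0 => hne (by simpa using h0)
    obtain ⟨j, hj⟩ := Finsupp.ne_iff.1 this
    have h2 := congrArg (fun g => basis.repr g j) (hf (Units.mk0 (2 : ℂ) two_ne_zero))
    simp only [rho_repr, map_smul, Finsupp.smul_apply, smul_eq_mul] at h2
    have h4 := zpow_two_eq (Units.ext (C_injective (mul_right_cancel₀ hj h2)))
    exact ⟨j, by omega⟩
  · rintro ⟨j, rfl⟩
    exact (Submodule.ne_bot_iff _).2 ⟨basis j, fun a => by rw [← two_mul]; exact rho_basis a j,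
      basis.ne_zero j⟩

lemma generated :
    LieSubmodule.lieSpan ℂ[X] GSec (modelFamily.weightSpace 0 : Set modelFamily.carrier) = ⊤ := by
  set N := LieSubmodule.lieSpan ℂ[X] GSec (modelFamily.weightSpace 0 : Set modelFamily.carrier)
  have hmem : ∀ j : ℤ, (basis j : modelFamily.carrier) ∈ N := by
    intro j
    induction j using Int.induction_on with
    | zero => exact LieSubmodule.subset_lieSpan fun a => rho_basis a 0
    | succ n ih =>
      have h : ⁅secE, basis (n : ℤ)⁆ = basis ((n : ℤ) + 1) := by
        rw [secE_bracket, opE_basis, eCoef, if_pos (by omega), one_smul]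
      rw [← h]; exact N.lie_mem ih
    | pred n ih =>
      have h : ⁅secF, basis (-(n : ℤ))⁆ = basis (-(n : ℤ) - 1) := by
        rw [secF_bracket, opF_basis, fCoef, if_pos (by omega), one_smul]
      rw [← h]; exact N.lie_mem ih
  rw [eq_top_iff]
  intro f _
  refine basis_induction (P := fun f => (f : modelFamily.carrier) ∈ N) (zero_mem _)
    (fun _ _ hf hg => add_mem hf hg) (fun r j => N.smul_mem r (hmem j)) f

lemma casimir_relation (f : ModelCarrier) : (X : ℂ[X]) • ⁅secH, ⁅secH, f⁆⁆ +
    (2 : ℂ[X]) • ⁅secE, ⁅secF, f⁆⁆ + (2 : ℂ[X]) • ⁅secF, ⁅secE, f⁆⁆ =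
      (-(1 + X) : ℂ[X]) • f := by
  induction f using basis_induction with
  | h0 => simp
  | hadd f g hf hg =>
    rw [smul_add, ← hf, ← hg]
    simp only [lie_add, smul_add]
    abel
  | hs r j =>
    simp only [secH_bracket, secE_bracket, secF_bracket, map_smul, opE_opF_basis, opF_opE_basis,
      opH_basis]
    have h1 := qPoly_sub j
    have h4 : (C (1 / 4) : ℂ[X]) * 4 = 1 := by
      rw [show (4 : ℂ[X]) = C 4 from rfl, ← C_mul]; norm_num
    have h2 : HCFamily.qPoly j * 4 = 1 + (2 * (j : ℂ[X]) + 1) ^ 2 * X := by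
      simp only [HCFamily.qPoly, C_pow, C_add, C_mul, C_1, map_intCast, map_ofNat]
      linear_combination (1 + (2 * (j : ℂ[X]) + 1) ^ 2 * X) * h4
    have h3 : HCFamily.qPoly (j - 1) = HCFamily.qPoly j - (X : ℂ[X]) * (2 * (j : ℂ[X])) := by
      rw [← h1]; ring
    rw [h3]
    have : (-(1 + X) : ℂ[X]) = X * ((2 * (j : ℂ[X])) * (2 * (j : ℂ[X])))
        - 2 * (HCFamily.qPoly j - (X : ℂ[X]) * (2 * (j : ℂ[X]))) - 2 * HCFamily.qPoly j := by
      linear_combination h2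
    rw [this]
    module

end ModelCarrier

lemma HCFamily.casimirActsBy_of_integral {F : HCFamily.{u}}
    (h : ∀ f : F.carrier, (X : ℂ[X]) • ⁅secH, ⁅secH, f⁆⁆ + (2 : ℂ[X]) • ⁅secE, ⁅secF, f⁆⁆ +
      (2 : ℂ[X]) • ⁅secF, ⁅secE, f⁆⁆ = (-(1 + X) : ℂ[X]) • f) :
    F.CasimirActsBy (-((1 + RatFunc.X) / RatFunc.X)) := by
  intro w
  have hX : (RatFunc.X : RatFunc ℂ) ≠ 0 := RatFunc.X_ne_zero
  induction w using TensorProduct.induction_on with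
  | zero => simp
  | add x y hx hy =>
    rw [smul_add, ← hx, ← hy]
    simp only [map_add, smul_add]
    abel
  | tmul r f =>
    have h1 := congrArg (fun m : F.carrier =>
      ((r / RatFunc.X : RatFunc ℂ) ⊗ₜ[ℂ[X]] m : F.generic)) (h f)
    simp only [TensorProduct.tmul_add, ← TensorProduct.smul_tmul] at h1
    rw [Algebra.smul_def, Algebra.smul_def, Algebra.smul_def] at h1
    simp only [map_neg, map_add, map_one, map_ofNat, RatFunc.algebraMap_X] at h1
    rw [mul_div_cancel₀ _ hX] at h1
    have e1 : (-((1 + RatFunc.X) / RatFunc.X) : RatFunc ℂ) • (r ⊗ₜ[ℂ[X]] f : F.generic) =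
        (-(1 + RatFunc.X) * (r / RatFunc.X) : RatFunc ℂ) ⊗ₜ[ℂ[X]] f := by
      rw [TensorProduct.smul_tmul', smul_eq_mul]; congr 1; ring
    have e2 : ∀ m : F.carrier, ((2 / RatFunc.X : RatFunc ℂ)) •
        (r ⊗ₜ[ℂ[X]] m : F.generic) = (2 * (r / RatFunc.X) : RatFunc ℂ) ⊗ₜ[ℂ[X]] m := by
      intro m
      rw [TensorProduct.smul_tmul', smul_eq_mul]; congr 1; ring
    simp only [HCFamily.genAct, LinearMap.baseChange_tmul, LieModule.toEnd_apply_apply, e1, e2,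
      ← h1]

lemma modelFamily_casimir : modelFamily.CasimirActsBy (-((1 + RatFunc.X) / RatFunc.X)) :=
  HCFamily.casimirActsBy_of_integral fun f => ModelCarrier.casimir_relation f

end ContractionFamilies
end

noncomputable section

namespace ContractionFamilies
/-! ### Finiteness and generic irreducibility -/

namespace HCFamily

variable {F : HCFamily.{u}} {b : Module.Basis ℤ ℂ[X] F.carrier}

lemma eCoef_ne_zero (j : ℤ) : eCoef j ≠ 0 := by
  unfold eCoef; split_ifs
  · exact one_ne_zero
  · exact neg_ne_zero.2 (qPoly_ne_zero _)

lemma fCoef_ne_zero (j : ℤ) : fCoef j ≠ 0 := by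
  unfold fCoef; split_ifs
  · exact one_ne_zero
  · exact neg_ne_zero.2 (qPoly_ne_zero _)

/-- A family with a standard basis is generically irreducible: a nonzero submodule contains, by an
argument with a vector of minimal support, some `e_j`, and `E`, `F` move it to all the others. -/
lemma IsStandard.genericallyIrreducible (hb : IsStandard b) : F.IsGenericallyIrreducible := by
  unfold IsGenericallyIrreducible
  set K := AlgebraicClosure (RatFunc ℂ)
  have hinj : Function.Injective (algebraMap ℂ[X] K) := by
    rw [IsScalarTower.algebraMap_eq ℂ[X] (RatFunc ℂ) K]
    exact (algebraMap (RatFunc ℂ) K).injective.comp (IsFractionRing.injective ℂ[X] (RatFunc ℂ))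
  let B : Module.Basis ℤ K (K ⊗[ℂ[X]] F.carrier) := Algebra.TensorProduct.basis K b
  have hB : ∀ j, B j = 1 ⊗ₜ b j := fun j => Algebra.TensorProduct.basis_apply b j
  have hsm : ∀ (p : ℂ[X]) (j : ℤ), (1 : K) ⊗ₜ[ℂ[X]] (p • b j) = algebraMap ℂ[X] K p • B j := by
    intro p j
    rw [hB, TensorProduct.tmul_smul, algebraMap_smul]
  have : Nontrivial (K ⊗[ℂ[X]] F.carrier) := ⟨B 0, 0, B.ne_zero 0⟩
  refine LieModule.IsIrreducible.mk fun N hN => ?_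
  have hHrepr : ∀ (w : K ⊗[ℂ[X]] F.carrier) (j : ℤ),
      B.repr ⁅(1 : K) ⊗ₜ[ℂ[X]] secH, w⁆ j = (2 * (j : K)) * B.repr w j := by
    intro w j
    have : B.coord j ∘ₗ LieModule.toEnd K (K ⊗[ℂ[X]] GSec) (K ⊗[ℂ[X]] F.carrier)
        ((1 : K) ⊗ₜ[ℂ[X]] secH) = (2 * (j : K)) • B.coord j := by
      refine B.ext fun i => ?_
      rw [LinearMap.comp_apply, LieModule.toEnd_apply_apply, hB,
        LieAlgebra.ExtendScalars.bracket_tmul, hb.lie_secH, mul_one, hsm, ← hB, map_smul,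
        LinearMap.smul_apply, Module.Basis.coord_apply, Module.Basis.repr_self]
      by_cases h : i = j
      · subst h; simp [map_ofNat]
      · simp [Finsupp.single_eq_of_ne' h]
    exact LinearMap.congr_fun this w
  -- a nonzero vector of minimal support in `N` is a multiple of a basis vector
  have hex : ∃ j, B j ∈ N := by
    have hne : ∃ n : ℕ, ∃ w ∈ N, w ≠ 0 ∧ (B.repr w).support.card = n := by
      obtain ⟨w, hw, h0⟩ := (Submodule.ne_bot_iff N.toSubmodule).1
        (fun h => hN (N.toSubmodule_eq_bot.1 h))
      exact ⟨_, w, hw, h0, rfl⟩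
    classical
    obtain ⟨w, hw, h0, hcard⟩ := Nat.find_spec hne
    have hmin := fun m => @Nat.find_min _ _ hne m
    have hw0 : B.repr w ≠ 0 := fun h => h0 (by simpa using h)
    obtain ⟨j, hj⟩ := Finsupp.support_nonempty_iff.2 hw0
    -- `H - 2j` removes `j` from the support, so it annihilates a vector of minimal support
    set w' := ⁅(1 : K) ⊗ₜ[ℂ[X]] secH, w⁆ - (2 * (j : K)) • w with hw'
    have hw'N : w' ∈ N := sub_mem (N.lie_mem hw) (N.smul_mem _ hw)
    have hrepr' : ∀ i, B.repr w' i = (2 * (i - j : K)) * B.repr w i := by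
      intro i
      simp only [hw', map_sub, map_smul, Finsupp.sub_apply, Finsupp.smul_apply, smul_eq_mul,
        hHrepr]
      ring
    have hlt : (B.repr w').support.card < Nat.find hne := by
      rw [← hcard]
      refine Finset.card_lt_card (Finset.ssubset_iff_subset_ne.2 ⟨fun i hi => ?_, fun h => ?_⟩)
      · rw [Finsupp.mem_support_iff, hrepr'] at hi
        exact Finsupp.mem_support_iff.2 (right_ne_zero_of_mul hi)
      · rw [← h, Finsupp.mem_support_iff, hrepr'] at hj
        simp at hj
    have hw'0 : w' = 0 := by
      by_contra h
      exact hmin _ hlt ⟨w', hw'N, h, rfl⟩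
    have hsupp : ∀ i, i ≠ j → B.repr w i = 0 := by
      intro i hi
      have := hrepr' i
      rw [hw'0, map_zero, Finsupp.zero_apply] at this
      refine (mul_eq_zero.1 this.symm).resolve_left ?_
      refine mul_ne_zero two_ne_zero ?_
      rw [sub_ne_zero]
      exact_mod_cast hi
    have hwj : w = B.repr w j • B j := by
      apply B.repr.injective
      ext i
      by_cases hi : i = j
      · subst hi; simp
      · simp [hsupp i hi, Finsupp.single_eq_of_ne hi]
    refine ⟨j, ?_⟩
    rw [hwj] at hw
    have := N.smul_mem (B.repr w j)⁻¹ hw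
    rwa [smul_smul, inv_mul_cancel₀ (Finsupp.mem_support_iff.1 hj), one_smul] at this
  have hE : ∀ j, B j ∈ N → B (j + 1) ∈ N := by
    intro j hj
    have := N.lie_mem (x := (1 : K) ⊗ₜ[ℂ[X]] secE) hj
    rw [hB, LieAlgebra.ExtendScalars.bracket_tmul, hb.lie_secE, mul_one, hsm] at this
    have h2 := N.smul_mem (algebraMap ℂ[X] K (eCoef j))⁻¹ this
    rwa [smul_smul, inv_mul_cancel₀ ((map_ne_zero_iff _ hinj).2 (eCoef_ne_zero j)),
      one_smul] at h2
  have hFm : ∀ j, B j ∈ N → B (j - 1) ∈ N := by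
    intro j hj
    have := N.lie_mem (x := (1 : K) ⊗ₜ[ℂ[X]] secF) hj
    rw [hB, LieAlgebra.ExtendScalars.bracket_tmul, hb.lie_secF, mul_one, hsm] at this
    have h2 := N.smul_mem (algebraMap ℂ[X] K (fCoef j))⁻¹ this
    rwa [smul_smul, inv_mul_cancel₀ ((map_ne_zero_iff _ hinj).2 (fCoef_ne_zero j)),
      one_smul] at h2
  obtain ⟨j₀, h₀⟩ := hex
  have hall : ∀ j, B j ∈ N := fun j =>
    Int.inductionOn' (motive := fun j => B j ∈ N) j j₀ h₀ (fun k _ => hE k) (fun k _ => hFm k)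
  rw [← LieSubmodule.toSubmodule_inj, LieSubmodule.top_toSubmodule, eq_top_iff, ← B.span_eq,
    Submodule.span_le]
  rintro _ ⟨j, rfl⟩
  exact hall j

/-- A finitely generated algebraic representation has only finitely many weights. -/
lemma exists_finset_weights {L : Type*} [AddCommGroup L] [Module ℂ[X] L] [Module.Finite ℂ[X] L]
    {ρ : Representation ℂ[X] ℂˣ L} (hρ : IsAlgebraicRep ρ) :
    ∃ S : Finset ℤ, ∀ k, ∀ v ∈ repWeight ρ k, v ≠ 0 → k ∈ S := by
  classical
  obtain ⟨G, hG⟩ := Module.Finite.fg_top (R := ℂ[X]) (M := L)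
  choose c hc hsum _ using fun f : L => exists_weight_decomp hρ f
  set S := G.biUnion fun g => (c g).support with hS
  have key : ∀ f : L, ∃ d : ℤ →₀ L, (∀ k, d k ∈ repWeight ρ k) ∧ (d.sum fun _ w => w) = f ∧
      ∀ k, k ∉ S → d k = 0 := by
    intro f
    have hf : f ∈ Submodule.span ℂ[X] (G : Set L) := by rw [hG]; trivial
    induction hf using Submodule.span_induction with
    | mem g hg =>
      refine ⟨c g, hc g, hsum g, fun k hk => ?_⟩
      by_contra h
      exact hk (Finset.mem_biUnion.2 ⟨g, hg, Finsupp.mem_support_iff.2 h⟩)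
    | zero => exact ⟨0, by simp, by simp, by simp⟩
    | add x y _ _ hx hy =>
      obtain ⟨d, h1, h2, h3⟩ := hx
      obtain ⟨d', h1', h2', h3'⟩ := hy
      refine ⟨d + d', fun k => add_mem (h1 k) (h1' k), ?_, fun k hk => by simp [h3 k hk, h3' k hk]⟩
      rw [Finsupp.sum_add_index' (by simp) (by simp), h2, h2']
    | smul r x _ hx =>
      obtain ⟨d, h1, h2, h3⟩ := hx
      refine ⟨r • d, fun k => Submodule.smul_mem _ _ (h1 k), ?_, fun k hk => by simp [h3 k hk]⟩
      rw [Finsupp.sum_smul_index' (by simp), ← Finsupp.smul_sum, h2]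
  refine ⟨S, fun k v hv h0 => ?_⟩
  by_contra hk
  obtain ⟨d, h1, h2, h3⟩ := key v
  have h4 : d - Finsupp.single k v = 0 := by
    refine repWeight_indep (ρ := ρ) (fun l => ?_) ?_
    · refine sub_mem (h1 l) ?_
      by_cases hl : k = l
      · subst hl; simpa using hv
      · rw [Finsupp.single_eq_of_ne' hl]; exact zero_mem _
    · rw [Finsupp.sum_sub_index (by simp), h2, Finsupp.sum_single_index rfl, sub_self]
  have h5 := DFunLike.congr_fun h4 k
  rw [Finsupp.sub_apply, h3 k hk, Finsupp.single_eq_same, Finsupp.zero_apply, zero_sub,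
    neg_eq_zero] at h5
  exact h0 h5

lemma IsStandard.quasiAdmissible (hb : IsStandard b) : F.IsQuasiAdmissible := by
  intro L _ _ _ _ ρL hρL
  have hproj : Module.Finite ℂ[X] (ρL.tprod F.rho).invariants := by
    classical
    obtain ⟨S, hS⟩ := exists_finset_weights hρL
    let e : L ⊗[ℂ[X]] F.carrier ≃ₗ[ℂ[X]] (ℤ →₀ L) :=
      (TensorProduct.congr (LinearEquiv.refl _ _) b.repr) ≪≫ₗ
        TensorProduct.finsuppScalarRight ℂ[X] ℂ[X] L ℤ
    have he : ∀ (a : ℂˣ) (w : L ⊗[ℂ[X]] F.carrier) (j : ℤ),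
        e ((ρL.tprod F.rho) a w) j = (C ((a ^ (2 * j) : ℂˣ) : ℂ) : ℂ[X]) • ρL a (e w j) := by
      intro a w j
      induction w using TensorProduct.induction_on with
      | zero => simp
      | add x y hx hy => simp only [map_add, Finsupp.add_apply, hx, hy, smul_add]
      | tmul l m =>
        have h1 : b.repr (F.rho a m) j = C ((a ^ (2 * j) : ℂˣ) : ℂ) * b.repr m j := by
          have : b.coord j ∘ₗ F.rho a = (C ((a ^ (2 * j) : ℂˣ) : ℂ) : ℂ[X]) • b.coord j := by
            refine b.ext fun i => ?_
            rw [LinearMap.comp_apply, hb.rho, map_smul, LinearMap.smul_apply,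
              Module.Basis.coord_apply, Module.Basis.repr_self]
            by_cases h : i = j
            · subst h; rfl
            · simp [Finsupp.single_eq_of_ne' h]
          exact LinearMap.congr_fun this m
        simp only [Representation.tprod_apply, TensorProduct.map_tmul, e, LinearEquiv.trans_apply,
          TensorProduct.congr_tmul, LinearEquiv.refl_apply,
          TensorProduct.finsuppScalarRight_apply_tmul_apply, h1, map_smul, smul_smul]
    have hinv : ∀ w ∈ (ρL.tprod F.rho).invariants, ∀ j, e w j ∈ repWeight ρL (-(2 * j)) := by
      intro w hw j a
      have h1 := he a w j
      rw [(Representation.mem_invariants _ w).1 hw a] at h1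
      have h2 := congrArg (fun l => (C ((a ^ (-(2 * j)) : ℂˣ) : ℂ) : ℂ[X]) • l) h1
      simp only [smul_smul, ← C_mul, ← Units.val_mul, ← zpow_add] at h2
      simpa using h2.symm
    let S' : Finset ℤ := S.image fun k => -k / 2
    let T : (ρL.tprod F.rho).invariants →ₗ[ℂ[X]] (S' → L) :=
      LinearMap.pi fun j => Finsupp.lapply (j : ℤ) ∘ₗ e.toLinearMap ∘ₗ Submodule.subtype _
    refine Module.Finite.of_injective T ?_
    rw [← LinearMap.ker_eq_bot, LinearMap.ker_eq_bot']
    intro w hw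
    have h0 : e w = 0 := by
      ext j
      by_contra hne
      have hj : j ∈ S' := Finset.mem_image.2 ⟨_, hS _ _ (hinv w.1 w.2 j) hne, by omega⟩
      exact hne (congrFun hw ⟨j, hj⟩)
    exact Subtype.ext (by simpa using h0)
  have := F.flat
  exact ⟨hproj, inferInstance⟩

end HCFamily

/-- Contraction families exist. -/
theorem modelFamily_isContractionFamily : modelFamily.IsContractionFamily := by
  have hb : HCFamily.IsStandard (F := modelFamily) ModelCarrier.basis :=
    ⟨ModelCarrier.rho_basis, fun j => (ModelCarrier.secH_bracket _).trans
        (ModelCarrier.opH_basis j),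
      fun j => (ModelCarrier.secE_bracket _).trans (ModelCarrier.opE_basis j),
      fun j => (ModelCarrier.secF_bracket _).trans (ModelCarrier.opF_basis j)⟩
  exact ⟨hb.quasiAdmissible, hb.genericallyIrreducible, ModelCarrier.evenWeights,
    ModelCarrier.generated, modelFamily_casimir⟩

end ContractionFamilies
end

noncomputable section

namespace ContractionFamilies
namespace HCFamily

variable {F : HCFamily.{u}} {b : Module.Basis ℤ ℂ[X] F.carrier}

/-! ### The twisted dual and the intertwiners in the standard basis -/

lemma IsStandard.repr_rho (hb : IsStandard b) (a : ℂˣ) (m : F.carrier) (j : ℤ) :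
    b.repr (F.rho a m) j = C ((a ^ (2 * j) : ℂˣ) : ℂ) * b.repr m j := by
  have : b.coord j ∘ₗ F.rho a = (C ((a ^ (2 * j) : ℂˣ) : ℂ) : ℂ[X]) • b.coord j := by
    refine b.ext fun i => ?_
    rw [LinearMap.comp_apply, hb.rho, map_smul, LinearMap.smul_apply,
      Module.Basis.coord_apply, Module.Basis.repr_self]
    by_cases h : i = j
    · subst h; rfl
    · simp [Finsupp.single_eq_of_ne' h]
  exact LinearMap.congr_fun this m

lemma IsStandard.mem_weightSpace (hb : IsStandard b) (j : ℤ) : b j ∈ F.weightSpace (2 * j) :=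
  fun a => hb.rho a j

lemma IsStandard.repr_eq_zero (hb : IsStandard b) {k : ℤ} {f : F.carrier}
    (hf : f ∈ F.weightSpace k) {j : ℤ} (hj : 2 * j ≠ k) : b.repr f j = 0 := by
  by_contra h
  have h2 := congrArg (fun g => b.repr g j) (hf (Units.mk0 (2 : ℂ) two_ne_zero))
  simp only [hb.repr_rho, map_smul, Finsupp.smul_apply, smul_eq_mul] at h2
  exact hj (ModelCarrier.zpow_two_eq (Units.ext (C_injective (mul_right_cancel₀ h h2))))

lemma conjPoly_conjPoly (p : ℂ[X]) : conjPoly (conjPoly p) = p := by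
  ext n; simp [conjPoly]

lemma conjPoly_qPoly (j : ℤ) : conjPoly (qPoly j) = qPoly j := by
  simp [conjPoly, qPoly, Polynomial.map_intCast, map_ofNat]

lemma conjPoly_eCoef (j : ℤ) : conjPoly (eCoef j) = eCoef j := by
  unfold eCoef; split_ifs
  · simp
  · rw [map_neg, conjPoly_qPoly]

lemma conjPoly_fCoef (j : ℤ) : conjPoly (fCoef j) = fCoef j := by
  unfold fCoef; split_ifs
  · simp
  · rw [map_neg, conjPoly_qPoly]

lemma eval_conjPoly (x : ℝ) (p : ℂ[X]) : (conjPoly p).eval (x : ℂ) = conj (p.eval (x : ℂ)) := by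
  have h := Polynomial.hom_eval₂ p (RingHom.id ℂ) (starRingEnd ℂ) (x : ℂ)
  rw [RingHom.comp_id, Complex.conj_ofReal, eval₂_id] at h
  simp only [conjPoly, coe_mapRingHom, eval_map]
  exact h.symm

lemma sigmaSec_eq (Y : GSec) :
    sigmaSec Y = -conjPoly (Y.1.1 0 0) • secH + conjPoly (Y.1.2 1 0) • secE +
      conjPoly (Y.1.1 0 1) • secF := by
  rw [gElt_decomp (sigmaSec Y)]
  obtain ⟨h1, h2, h3, h4, h5⟩ := Y.2
  simp [sigmaSec, sigmaPair, theta, h1]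

lemma sigmaSec_secH : sigmaSec secH = -secH := by
  rw [sigmaSec_eq]; simp [secH, secE, secF, gElt]

lemma sigmaSec_secE : sigmaSec secE = secF := by
  rw [sigmaSec_eq]; simp [secH, secE, secF, gElt]

lemma sigmaSec_secF : sigmaSec secF = secE := by
  rw [sigmaSec_eq]; simp [secH, secE, secF, gElt]

lemma TwistedDual.ext' {e e' : F.TwistedDual} (h : ∀ f, e.toFun f = e'.toFun f) : e = e' :=
  Subtype.ext (LinearMap.ext h)

lemma TwistedDual.toFun_add (e e' : F.TwistedDual) (f : F.carrier) :
    (e + e').toFun f = e.toFun f + e'.toFun f := rfl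

lemma TwistedDual.toFun_smul (r : ℂ[X]) (e : F.TwistedDual) (f : F.carrier) :
    (r • e).toFun f = r * e.toFun f := rfl

lemma dualAct_toFun (Y : GSec) (e : F.TwistedDual) (f : F.carrier) :
    (F.dualAct Y e).toFun f = -(e.toFun ⁅sigmaSec Y, f⁆) := rfl

lemma dualRho_toFun (a : ℂˣ) (e : F.TwistedDual) (f : F.carrier) :
    (F.dualRho a e).toFun f =
      e.toFun (F.rho (Units.map (starRingEnd ℂ).toMonoidHom a) f) := rfl

lemma dualAct_decomp (Y : GSec) : F.dualAct Y = Y.1.1 0 0 • F.dualAct secH +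
    Y.1.1 0 1 • F.dualAct secE + Y.1.2 1 0 • F.dualAct secF := by
  refine LinearMap.ext fun e => TwistedDual.ext' fun f => ?_
  simp only [LinearMap.add_apply, LinearMap.smul_apply, TwistedDual.toFun_add,
    TwistedDual.toFun_smul, dualAct_toFun]
  rw [sigmaSec_eq Y, sigmaSec_secH, sigmaSec_secE, sigmaSec_secF]
  simp only [add_lie, smul_lie, neg_lie, map_add, LinearMap.map_smulₛₗ, map_neg, conjPoly_conjPoly,
    smul_eq_mul]
  ring

lemma act_decomp (Y : GSec) : F.act Y = Y.1.1 0 0 • F.act secH +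
    Y.1.1 0 1 • F.act secE + Y.1.2 1 0 • F.act secF := by
  conv_lhs => rw [gElt_decomp Y]
  simp [act]

/-- The coordinates of a functional with respect to the dual of a standard basis. -/
def dualRepr (hb : IsStandard b) : F.TwistedDual ≃ₗ[ℂ[X]] (ℤ →₀ ℂ[X]) where
  toFun e := Finsupp.ofSupportFinite (fun j => e.toFun (b j)) (by
    have h : {k : ℤ | ∃ f ∈ F.weightSpace k, e.toFun f ≠ 0}.Finite := e.2
    refine (h.preimage (f := fun j : ℤ => 2 * j) (fun i _ j _ h => by simpa using h)).subset ?_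
    intro j hj
    exact ⟨b j, hb.mem_weightSpace j, hj⟩)
  map_add' e e' := by ext j : 1; rfl
  map_smul' r e := by ext j : 1; rfl
  invFun c := ⟨
    { toFun := fun f => c.sum fun j r => r * conjPoly (b.repr f j)
      map_add' := fun f g => by
        simp only [map_add, Finsupp.add_apply, mul_add, Finsupp.sum_add]
      map_smul' := fun r f => by
        simp only [map_smul, Finsupp.smul_apply, smul_eq_mul, map_mul, Finsupp.sum,
          Finset.mul_sum]
        exact Finset.sum_congr rfl fun _ _ => by ring }, by
    refine (c.support.image (fun j : ℤ => 2 * j)).finite_toSet.subset ?_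
    rintro k ⟨f, hf, hne⟩
    contrapose! hne
    refine Finset.sum_eq_zero fun j hj => ?_
    have hjk : 2 * j ≠ k := by
      rintro rfl
      exact hne (Finset.mem_coe.2 (Finset.mem_image_of_mem _ hj))
    simp only [hb.repr_eq_zero hf hjk, map_zero, mul_zero]⟩
  left_inv e := by
    refine Subtype.ext (b.ext fun j => ?_)
    change (Finsupp.sum _ fun i r => r * conjPoly (b.repr (b j) i)) = e.toFun (b j)
    rw [Finsupp.sum, Finset.sum_eq_single j]
    · simp [Finsupp.ofSupportFinite_coe]
    · intro i _ hi
      simp [Finsupp.single_eq_of_ne hi]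
    · intro h
      rw [Finsupp.notMem_support_iff.1 h, zero_mul]
  right_inv c := by
    ext j : 1
    change (c.sum fun i r => r * conjPoly (b.repr (b j) i)) = c j
    rw [Finsupp.sum, Finset.sum_eq_single j]
    · simp
    · intro i _ hi
      simp [Finsupp.single_eq_of_ne hi]
    · intro h
      rw [Finsupp.notMem_support_iff.1 h, zero_mul]

/-- The basis of the twisted dual that is dual to a standard basis. -/
def dualBasis (hb : IsStandard b) : Module.Basis ℤ ℂ[X] F.TwistedDual :=
  Module.Basis.ofRepr (dualRepr hb)

lemma dualBasis_repr (hb : IsStandard b) (e : F.TwistedDual) (j : ℤ) :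
    (dualBasis hb).repr e j = e.toFun (b j) := rfl

lemma toFun_eq_sum (hb : IsStandard b) (e : F.TwistedDual) (f : F.carrier) :
    e.toFun f = (b.repr f).sum fun j r => conjPoly r * (dualBasis hb).repr e j := by
  conv_lhs => rw [← b.linearCombination_repr f, Finsupp.linearCombination_apply, Finsupp.sum,
    map_sum]
  refine Finset.sum_congr rfl fun j _ => ?_
  rw [LinearMap.map_smulₛₗ, smul_eq_mul]
  rfl

variable (hb : IsStandard b)
include hb

lemma dualAct_secH (j : ℤ) :
    F.dualAct secH (dualBasis hb j) = (2 * (j : ℂ[X])) • dualBasis hb j := by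
  refine (dualBasis hb).repr.injective (Finsupp.ext fun i => ?_)
  rw [dualBasis_repr, dualAct_toFun, sigmaSec_secH, neg_lie, map_neg, neg_neg, hb.lie_secH,
    LinearMap.map_smulₛₗ, ← dualBasis_repr hb, map_smul, Finsupp.smul_apply]
  by_cases h : j = i
  · subst h; simp [map_ofNat]
  · simp [Finsupp.single_eq_of_ne' h]

lemma dualAct_secE (j : ℤ) :
    F.dualAct secE (dualBasis hb j) = (-fCoef (j + 1)) • dualBasis hb (j + 1) := by
  refine (dualBasis hb).repr.injective (Finsupp.ext fun i => ?_)
  rw [dualBasis_repr, dualAct_toFun, sigmaSec_secE, hb.lie_secF,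
    LinearMap.map_smulₛₗ, ← dualBasis_repr hb, map_smul, Finsupp.smul_apply]
  by_cases h : j + 1 = i
  · subst h; simp [conjPoly_fCoef]
  · have h' : j ≠ i - 1 := fun h' => h (by omega)
    simp [Finsupp.single_eq_of_ne' h, Finsupp.single_eq_of_ne' h']

lemma dualAct_secF (j : ℤ) :
    F.dualAct secF (dualBasis hb j) = (-eCoef (j - 1)) • dualBasis hb (j - 1) := by
  refine (dualBasis hb).repr.injective (Finsupp.ext fun i => ?_)
  rw [dualBasis_repr, dualAct_toFun, sigmaSec_secF, hb.lie_secE,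
    LinearMap.map_smulₛₗ, ← dualBasis_repr hb, map_smul, Finsupp.smul_apply]
  by_cases h : j - 1 = i
  · subst h; simp [conjPoly_eCoef]
  · have h' : j ≠ i + 1 := fun h' => h (by omega)
    simp [Finsupp.single_eq_of_ne' h, Finsupp.single_eq_of_ne' h']

lemma dualRho_dualBasis (a : ℂˣ) (j : ℤ) :
    F.dualRho a (dualBasis hb j) = (C ((a ^ (2 * j) : ℂˣ) : ℂ) : ℂ[X]) • dualBasis hb j := by
  refine (dualBasis hb).repr.injective (Finsupp.ext fun i => ?_)
  rw [dualBasis_repr, dualRho_toFun, hb.rho,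
    LinearMap.map_smulₛₗ, ← dualBasis_repr hb, map_smul, Finsupp.smul_apply]
  by_cases h : j = i
  · subst h
    simp [conjPoly]
  · simp [Finsupp.single_eq_of_ne' h]

omit hb in
/-- The polynomials `d_j = ∏_{i < |j|} (1 + (2 i + 1)² z) / 4`, the squared lengths of the standard
basis vectors. -/
def dPoly (j : ℤ) : ℂ[X] := ∏ i ∈ Finset.range j.natAbs, qPoly i

omit hb in
lemma dPoly_zero : dPoly 0 = 1 := by simp [dPoly]

omit hb in
lemma qPoly_neg_sub_one (j : ℤ) : qPoly (-j - 1) = qPoly j := by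
  unfold qPoly
  congr 4
  push_cast
  ring

omit hb in
lemma dPoly_succ_of_nonneg {j : ℤ} (hj : 0 ≤ j) : dPoly (j + 1) = dPoly j * qPoly j := by
  lift j to ℕ using hj
  have : ((j : ℤ) + 1).natAbs = j + 1 := by omega
  simp [dPoly, this, Finset.prod_range_succ]

omit hb in
lemma dPoly_of_neg {j : ℤ} (hj : j < 0) : dPoly j = dPoly (j + 1) * qPoly j := by
  obtain ⟨n, rfl⟩ : ∃ n : ℕ, j = -n - 1 := ⟨(-j - 1).toNat, by omega⟩
  have h1 : (-(n : ℤ) - 1).natAbs = n + 1 := by omega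
  have h2 : (-(n : ℤ) - 1 + 1).natAbs = n := by omega
  rw [qPoly_neg_sub_one, dPoly, dPoly, h1, h2, Finset.prod_range_succ]

omit hb in
lemma dPoly_ne_zero (j : ℤ) : dPoly j ≠ 0 := Finset.prod_ne_zero_iff.2 fun _ _ => qPoly_ne_zero _

omit hb in
lemma eCoef_mul_dPoly (j : ℤ) : eCoef j * dPoly (j + 1) = -fCoef (j + 1) * dPoly j := by
  by_cases hj : 0 ≤ j
  · rw [eCoef, fCoef, if_pos hj, if_neg (by omega), dPoly_succ_of_nonneg hj, add_sub_cancel_right]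
    ring
  · rw [eCoef, fCoef, if_neg hj, if_pos (by omega), dPoly_of_neg (not_le.1 hj)]
    ring

/-- The basis of the generic fibre of `F` given by a standard basis. -/
abbrev genBasis (b : Module.Basis ℤ ℂ[X] F.carrier) :
    Module.Basis ℤ (RatFunc ℂ) (RatFunc ℂ ⊗[ℂ[X]] F.carrier) :=
  Algebra.TensorProduct.basis (RatFunc ℂ) b

/-- The basis of the generic fibre of the twisted dual given by the dual basis. -/
abbrev genDualBasis : Module.Basis ℤ (RatFunc ℂ) (RatFunc ℂ ⊗[ℂ[X]] F.TwistedDual) :=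
  Algebra.TensorProduct.basis (RatFunc ℂ) (dualBasis hb)

omit hb in
lemma baseChange_basis {M : Type*} [AddCommGroup M] [Module ℂ[X] M]
    (B : Module.Basis ℤ ℂ[X] M) (T : M →ₗ[ℂ[X]] M) {i j : ℤ} {p : ℂ[X]} (h : T (B i) = p • B j) :
    T.baseChange (RatFunc ℂ) (Algebra.TensorProduct.basis (RatFunc ℂ) B i) =
      algebraMap ℂ[X] (RatFunc ℂ) p • Algebra.TensorProduct.basis (RatFunc ℂ) B j := by
  rw [Algebra.TensorProduct.basis_apply, Algebra.TensorProduct.basis_apply,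
    LinearMap.baseChange_tmul, h, TensorProduct.tmul_smul, algebraMap_smul]

omit hb in
lemma IsStandard.act_secH (hb : IsStandard b) (j : ℤ) :
    F.act secH (b j) = (2 * (j : ℂ[X])) • b j := hb.lie_secH j

/-- The intertwiner that sends `e_j` to `d_j e_j^*`. -/
def stdIntertwiner : F.Intertwiner :=
  have hd : ∀ j, algebraMap ℂ[X] (RatFunc ℂ) (dPoly j) ≠ 0 := fun j =>
    (map_ne_zero_iff _ (IsFractionRing.injective ℂ[X] (RatFunc ℂ))).2 (dPoly_ne_zero j)
  let e := (genBasis b).equiv ((genDualBasis hb).unitsSMul fun j => Units.mk0 _ (hd j))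
    (Equiv.refl ℤ)
  have he : ∀ j, e (genBasis b j) = algebraMap ℂ[X] (RatFunc ℂ) (dPoly j) • genDualBasis hb j := by
    intro j
    simp only [e, Module.Basis.equiv_apply, Equiv.refl_apply, Module.Basis.unitsSMul_apply,
      Units.smul_mk0]
  have hlin : ∀ (T : F.carrier →ₗ[ℂ[X]] F.carrier) (T' : F.TwistedDual →ₗ[ℂ[X]] F.TwistedDual),
      (∀ j, e (T.baseChange (RatFunc ℂ) (genBasis b j)) =
        T'.baseChange (RatFunc ℂ) (e (genBasis b j))) →
      ∀ w, e (T.baseChange (RatFunc ℂ) w) = T'.baseChange (RatFunc ℂ) (e w) := by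
    intro T T' h w
    exact LinearMap.congr_fun ((genBasis b).ext (f₁ := e.toLinearMap ∘ₗ T.baseChange (RatFunc ℂ))
      (f₂ := T'.baseChange (RatFunc ℂ) ∘ₗ e.toLinearMap) h) w
  have hstep : ∀ (T : F.carrier →ₗ[ℂ[X]] F.carrier) (T' : F.TwistedDual →ₗ[ℂ[X]] F.TwistedDual)
      (s : ℤ → ℤ) (p p' : ℤ → ℂ[X]), (∀ j, T (b j) = p j • b (s j)) →
      (∀ j, T' (dualBasis hb j) = p' j • dualBasis hb (s j)) →
      (∀ j, p j * dPoly (s j) = p' j * dPoly j) →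
      ∀ w, e (T.baseChange (RatFunc ℂ) w) = T'.baseChange (RatFunc ℂ) (e w) := by
    intro T T' s p p' h1 h2 h3
    refine hlin T T' fun j => ?_
    rw [baseChange_basis b T (h1 j), map_smul, he, he, map_smul,
      baseChange_basis (dualBasis hb) T' (h2 j), smul_smul, smul_smul, ← map_mul, ← map_mul, h3 j,
      mul_comm]
  have hH := hstep (F.act secH) (F.dualAct secH) id _ _ hb.act_secH (dualAct_secH hb) fun _ => rfl
  have hE := hstep (F.act secE) (F.dualAct secE) (· + 1) _ _ hb.lie_secE (dualAct_secE hb)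
    fun j => eCoef_mul_dPoly j
  have hFm := hstep (F.act secF) (F.dualAct secF) (· - 1) _ _ hb.lie_secF (dualAct_secF hb)
    fun j => by
      have := eCoef_mul_dPoly (j - 1)
      rw [sub_add_cancel] at this
      linear_combination this
  { toEquiv := e
    map_act := fun Y w => by
      rw [act_decomp, dualAct_decomp]
      simp only [LinearMap.baseChange_add, LinearMap.baseChange_smul, LinearMap.add_apply,
        LinearMap.smul_apply, map_add]
      rw [← hH, ← hE, ← hFm]
      have hs : ∀ (p : ℂ[X]) w, e (p • w) = p • e w := fun p w => by
        rw [← algebraMap_smul (RatFunc ℂ) p w, map_smul, algebraMap_smul]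
      rw [hs, hs, hs]
    map_rho := fun a => hstep _ _ id _ _ (hb.rho a) (dualRho_dualBasis hb a) fun _ => rfl }

/-- In the standard bases every intertwiner is diagonal, with entries `c₀ d_j`. -/
theorem exists_intertwiner_eq (φ : F.Intertwiner) : ∃ c₀ : RatFunc ℂ, c₀ ≠ 0 ∧ ∀ j,
    φ.toEquiv (genBasis b j) =
      (c₀ * algebraMap ℂ[X] (RatFunc ℂ) (dPoly j)) • genDualBasis hb j := by
  have hinj := IsFractionRing.injective ℂ[X] (RatFunc ℂ)
  have hcoord : ∀ w i, (genDualBasis hb).repr ((F.dualAct secH).baseChange (RatFunc ℂ) w) i =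
      (2 * (i : RatFunc ℂ)) * (genDualBasis hb).repr w i := by
    intro w i
    have : (genDualBasis hb).coord i ∘ₗ (F.dualAct secH).baseChange (RatFunc ℂ) =
        (2 * (i : RatFunc ℂ)) • (genDualBasis hb).coord i := by
      refine (genDualBasis hb).ext fun j => ?_
      rw [LinearMap.comp_apply, baseChange_basis _ _ (dualAct_secH hb j), map_smul,
        LinearMap.smul_apply, Module.Basis.coord_apply, Module.Basis.repr_self]
      by_cases h : j = i
      · subst h; simp [map_ofNat]
      · simp [Finsupp.single_eq_of_ne' h]
    exact LinearMap.congr_fun this w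
  -- the weight spaces have dimension one, so `φ` is diagonal
  have hdiag : ∀ j, ∃ c : RatFunc ℂ, φ.toEquiv (genBasis b j) = c • genDualBasis hb j := by
    intro j
    refine ⟨(genDualBasis hb).repr (φ.toEquiv (genBasis b j)) j, ?_⟩
    apply (genDualBasis hb).repr.injective
    ext i : 1
    rw [map_smul, Finsupp.smul_apply, Module.Basis.repr_self]
    by_cases h : i = j
    · subst h; simp
    · have h1 := congrArg (fun w => (genDualBasis hb).repr w i) (φ.map_act secH (genBasis b j))
      simp only [hcoord] at h1
      rw [baseChange_basis b _ (hb.act_secH j), map_smul, map_smul, Finsupp.smul_apply,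
        smul_eq_mul] at h1
      have h2 : (2 * ((j : RatFunc ℂ) - i)) *
          (genDualBasis hb).repr (φ.toEquiv (genBasis b j)) i = 0 := by
        simp only [map_mul, map_ofNat, map_intCast] at h1
        linear_combination h1
      have h3 : (2 * ((j : RatFunc ℂ) - i)) ≠ 0 := by
        refine mul_ne_zero two_ne_zero (sub_ne_zero.2 ?_)
        exact_mod_cast Ne.symm h
      rw [(mul_eq_zero.1 h2).resolve_left h3, Finsupp.single_eq_of_ne h, smul_zero]
  choose c hc using hdiag
  -- equivariance under `E` gives a recursion for the entries
  have hrec : ∀ j, algebraMap ℂ[X] (RatFunc ℂ) (eCoef j) * c (j + 1) =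
      algebraMap ℂ[X] (RatFunc ℂ) (-fCoef (j + 1)) * c j := by
    intro j
    have h1 := φ.map_act secE (genBasis b j)
    rw [baseChange_basis b _ (hb.lie_secE j : F.act secE (b j) = _), map_smul, hc, hc, map_smul,
      baseChange_basis _ _ (dualAct_secE hb j), smul_smul, smul_smul] at h1
    have h2 := congrArg (fun w => (genDualBasis hb).repr w (j + 1)) h1
    simp only [map_smul, Finsupp.smul_apply, Module.Basis.repr_self, Finsupp.single_eq_same,
      smul_eq_mul, mul_one] at h2
    rw [h2, mul_comm]
  have hd := fun j => congrArg (algebraMap ℂ[X] (RatFunc ℂ)) (eCoef_mul_dPoly j)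
  simp only [map_mul] at hd
  have hform : ∀ j, c j = c 0 * algebraMap ℂ[X] (RatFunc ℂ) (dPoly j) := by
    intro j
    induction j using Int.induction_on with
    | zero => rw [dPoly_zero, map_one, mul_one]
    | succ n ih =>
      have h0 := (map_ne_zero_iff _ hinj).2 (eCoef_ne_zero (n : ℤ))
      refine mul_left_cancel₀ h0 ?_
      rw [hrec, ih]
      linear_combination -c 0 * hd n
    | pred n ih =>
      have h0 : algebraMap ℂ[X] (RatFunc ℂ) (-fCoef (-(n : ℤ) - 1 + 1)) ≠ 0 :=
        (map_ne_zero_iff _ hinj).2 (neg_ne_zero.2 (fCoef_ne_zero _))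
      refine mul_left_cancel₀ h0 ?_
      rw [← hrec, sub_add_cancel, ih]
      have := hd (-(n : ℤ) - 1)
      rw [sub_add_cancel] at this
      linear_combination c 0 * this
  refine ⟨c 0, ?_, fun j => by rw [hc, hform]⟩
  intro h0
  have := hc 0
  rw [h0, zero_smul, map_eq_zero_iff _ φ.toEquiv.injective] at this
  exact (genBasis b).ne_zero 0 this

end HCFamily
end ContractionFamilies
end

noncomputable section

namespace ContractionFamilies
namespace HCFamily

variable {F : HCFamily.{u}} {b : Module.Basis ℤ ℂ[X] F.carrier}

/-! ### The Jantzen filtration in the standard basis -/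

/-- The coordinates on the fibre at `z` given by a basis of `F`. -/
def fibRepr (b : Module.Basis ℤ ℂ[X] F.carrier) (z : ℂ) : F.Fiber z →ₗ[ℂ] (ℤ →₀ ℂ) where
  toFun := QuotientAddGroup.lift
    (Ideal.span {(X - C z : ℂ[X])} • (⊤ : Submodule ℂ[X] F.carrier)).toAddSubgroup
    { toFun := fun f => (b.repr f).mapRange (eval z) eval_zero
      map_zero' := by simp
      map_add' := fun f g => by ext j; simp } (by
      intro f hf
      refine Submodule.smul_induction_on (p := fun f => (b.repr f).mapRange (eval z) eval_zero = 0)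
        hf ?_ ?_
      · intro r hr m _
        obtain ⟨s, rfl⟩ := Ideal.mem_span_singleton.1 hr
        ext j
        simp
      · intro f g hf hg
        have : (b.repr (f + g)).mapRange (eval z) eval_zero =
            (b.repr f).mapRange (eval z) eval_zero + (b.repr g).mapRange (eval z) eval_zero := by
          ext j; simp
        rw [this, hf, hg, add_zero])
  map_add' := map_add _
  map_smul' r v := by
    obtain ⟨f, rfl⟩ := Submodule.Quotient.mk_surjective _ v
    change (b.repr ((C r : ℂ[X]) • f)).mapRange (eval z) eval_zero =
      r • (b.repr f).mapRange (eval z) eval_zero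
    ext j
    simp

lemma fibRepr_toFiber (z : ℂ) (f : F.carrier) (j : ℤ) :
    fibRepr b z (F.toFiber z f) j = (b.repr f j).eval z := rfl

lemma fibRepr_injective (z : ℂ) : Function.Injective (fibRepr b z) := by
  rw [← LinearMap.ker_eq_bot, LinearMap.ker_eq_bot']
  intro v hv
  obtain ⟨f, rfl⟩ := Submodule.Quotient.mk_surjective _ v
  rw [Submodule.Quotient.mk_eq_zero, ← b.linearCombination_repr f,
    Finsupp.linearCombination_apply]
  refine Submodule.sum_mem _ fun j _ => ?_
  have hj : (b.repr f j).eval z = 0 := DFunLike.congr_fun hv j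
  exact Submodule.smul_mem_smul (Ideal.mem_span_singleton.2 (dvd_iff_isRoot.2 hj)) trivial

/-- The basis vectors of the fibre. -/
abbrev fibVec (b : Module.Basis ℤ ℂ[X] F.carrier) (z : ℂ) (j : ℤ) : F.Fiber z :=
  F.toFiber z (b j)

lemma fibRepr_fibVec (z : ℂ) (j : ℤ) : fibRepr b z (fibVec b z j) = Finsupp.single j 1 := by
  ext i
  rw [fibRepr_toFiber, b.repr_self]
  by_cases h : j = i
  · subst h; simp
  · simp [Finsupp.single_eq_of_ne' h]

lemma fib_eq_sum (z : ℂ) (v : F.Fiber z) :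
    v = (fibRepr b z v).sum fun j r => r • fibVec b z j := by
  apply fibRepr_injective (b := b) z
  rw [Finsupp.sum, map_sum]
  simp only [map_smul, fibRepr_fibVec, Finsupp.smul_single, smul_eq_mul, mul_one]
  exact (Finsupp.sum_single _).symm

/-- `φ` is diagonal in the standard bases, with `j`-th entry of order `lev j` and leading
coefficient `num j / den` at `z`. -/
structure DiagonalAt (hb : IsStandard b) (φ : F.Intertwiner) (z : ℂ) (lev : ℤ → ℤ)
    (num : ℤ → ℂ[X]) (den : ℂ[X]) : Prop where
  num_ne : ∀ j, (num j).eval z ≠ 0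
  den_ne : den.eval z ≠ 0
  eq : ∀ j, φ.toEquiv (genBasis b j) = ((algebraMap ℂ[X] (RatFunc ℂ) (X - C z)) ^ lev j *
    (algebraMap ℂ[X] (RatFunc ℂ) (num j) / algebraMap ℂ[X] (RatFunc ℂ) den)) • genDualBasis hb j

namespace DiagonalAt

variable {hb : IsStandard b} {φ : F.Intertwiner} {z : ℂ} {lev : ℤ → ℤ} {num : ℤ → ℂ[X]}
  {den : ℂ[X]} (hd : DiagonalAt hb φ z lev num den)
include hd

lemma repr_apply (w : RatFunc ℂ ⊗[ℂ[X]] F.carrier) (j : ℤ) :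
    (genDualBasis hb).repr (φ.toEquiv w) j = ((algebraMap ℂ[X] (RatFunc ℂ) (X - C z)) ^ lev j *
      (algebraMap ℂ[X] (RatFunc ℂ) (num j) / algebraMap ℂ[X] (RatFunc ℂ) den)) *
        (genBasis b).repr w j := by
  have : (genDualBasis hb).coord j ∘ₗ φ.toEquiv.toLinearMap =
      ((algebraMap ℂ[X] (RatFunc ℂ) (X - C z)) ^ lev j *
        (algebraMap ℂ[X] (RatFunc ℂ) (num j) / algebraMap ℂ[X] (RatFunc ℂ) den)) •
        (genBasis b).coord j := by
    refine (genBasis b).ext fun i => ?_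
    rw [LinearMap.comp_apply, LinearEquiv.coe_coe, hd.eq, map_smul, LinearMap.smul_apply,
      Module.Basis.coord_apply, Module.Basis.coord_apply, Module.Basis.repr_self,
      Module.Basis.repr_self]
    by_cases h : i = j
    · subst h; rfl
    · simp [Finsupp.single_eq_of_ne' h]
  exact LinearMap.congr_fun this w

/-- The relation between the coordinates of `w` and those of `p⁻ⁿ φ(w)`. -/
lemma coord_relation {n : ℤ} {w : RatFunc ℂ ⊗[ℂ[X]] F.carrier}
    {h : RatFunc ℂ ⊗[ℂ[X]] F.TwistedDual}
    (hw : φ.toEquiv w = (algebraMap ℂ[X] (RatFunc ℂ) (X - C z)) ^ n • h)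
    {s s' : ℂ[X]} {f : F.carrier} {e : F.TwistedDual} (hs : s.eval z ≠ 0) (hs' : s'.eval z ≠ 0)
    (hf : s • w = 1 ⊗ₜ[ℂ[X]] f) (he : s' • h = 1 ⊗ₜ[ℂ[X]] e) (j : ℤ) :
    (lev j = n → (num j).eval z * (b.repr f j).eval z * s'.eval z =
        (e.toFun (b j)).eval z * s.eval z * den.eval z) ∧
      (n < lev j → (e.toFun (b j)).eval z = 0) ∧ (lev j < n → (b.repr f j).eval z = 0) := by
  have hinj := IsFractionRing.injective ℂ[X] (RatFunc ℂ)
  have hne : ∀ {p : ℂ[X]}, p.eval z ≠ 0 → algebraMap ℂ[X] (RatFunc ℂ) p ≠ 0 := by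
    intro p hp h0
    rw [map_eq_zero_iff _ hinj] at h0
    exact hp (by rw [h0, eval_zero])
  have hp0 : algebraMap ℂ[X] (RatFunc ℂ) (X - C z) ≠ 0 :=
    (map_ne_zero_iff _ hinj).2 (X_sub_C_ne_zero z)
  have h1 : algebraMap ℂ[X] (RatFunc ℂ) s * (genBasis b).repr w j =
      algebraMap ℂ[X] (RatFunc ℂ) (b.repr f j) := by
    have := congrArg (fun w => (genBasis b).repr w j) hf
    simp only [← algebraMap_smul (RatFunc ℂ) s w, map_smul, Finsupp.smul_apply, smul_eq_mul,
      Algebra.TensorProduct.basis_repr_tmul, one_smul] at this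
    rw [this]; simp
  have h2 : algebraMap ℂ[X] (RatFunc ℂ) s' * (genDualBasis hb).repr h j =
      algebraMap ℂ[X] (RatFunc ℂ) (e.toFun (b j)) := by
    have := congrArg (fun w => (genDualBasis hb).repr w j) he
    simp only [← algebraMap_smul (RatFunc ℂ) s' h, map_smul, Finsupp.smul_apply, smul_eq_mul,
      Algebra.TensorProduct.basis_repr_tmul, one_smul] at this
    rw [this]; simp [dualBasis_repr]
  have h3 := congrArg (fun w => (genDualBasis hb).repr w j) hw
  simp only [hd.repr_apply, map_smul, Finsupp.smul_apply, smul_eq_mul] at h3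
  -- clear the denominators
  have key : (algebraMap ℂ[X] (RatFunc ℂ) (X - C z)) ^ lev j *
      algebraMap ℂ[X] (RatFunc ℂ) (num j * b.repr f j * s') =
      (algebraMap ℂ[X] (RatFunc ℂ) (X - C z)) ^ n *
        algebraMap ℂ[X] (RatFunc ℂ) (e.toFun (b j) * s * den) := by
    have hden := hne hd.den_ne
    simp only [map_mul, ← h1, ← h2]
    field_simp at h3
    linear_combination (algebraMap ℂ[X] (RatFunc ℂ) s * algebraMap ℂ[X] (RatFunc ℂ) s') * h3
  refine ⟨fun hl => ?_, fun hl => ?_, fun hl => ?_⟩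
  · rw [hl] at key
    have := hinj (mul_left_cancel₀ (zpow_ne_zero n hp0) key)
    simpa using congrArg (eval z) this
  · obtain ⟨k, hk⟩ : ∃ k : ℕ, lev j = n + (k + 1 : ℕ) := ⟨(lev j - n - 1).toNat, by omega⟩
    rw [hk, zpow_add₀ hp0, zpow_natCast, mul_assoc, ← map_pow, ← map_mul] at key
    have := congrArg (eval z) (hinj (mul_left_cancel₀ (zpow_ne_zero n hp0) key))
    simp only [eval_mul, eval_pow, eval_sub, eval_X, eval_C, sub_self, pow_succ, mul_zero,
      zero_mul] at this
    simpa [hs, hd.den_ne] using this.symm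
  · obtain ⟨k, hk⟩ : ∃ k : ℕ, n = lev j + (k + 1 : ℕ) := ⟨(n - lev j - 1).toNat, by omega⟩
    rw [hk, zpow_add₀ hp0, zpow_natCast, mul_assoc (_ ^ lev j) (_ ^ (k + 1)), ← map_pow,
      ← map_mul] at key
    have := congrArg (eval z) (hinj (mul_left_cancel₀ (zpow_ne_zero _ hp0) key))
    simp only [eval_mul, eval_pow, eval_sub, eval_X, eval_C, sub_self, pow_succ, mul_zero,
      zero_mul] at this
    simpa [hs', hd.num_ne j] using this

/-- The functional `p⁻ⁿ φ(e_j)` on the localization, with denominator `den`. -/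
lemma basis_eq {n j : ℤ} (hj : n ≤ lev j) : ∃ h : RatFunc ℂ ⊗[ℂ[X]] F.TwistedDual,
    φ.toEquiv (1 ⊗ₜ b j) = (algebraMap ℂ[X] (RatFunc ℂ) (X - C z)) ^ n • h ∧
    den • h = 1 ⊗ₜ[ℂ[X]] (((X - C z) ^ (lev j - n).toNat * num j) • dualBasis hb j) := by
  have hinj := IsFractionRing.injective ℂ[X] (RatFunc ℂ)
  have hp0 : algebraMap ℂ[X] (RatFunc ℂ) (X - C z) ≠ 0 :=
    (map_ne_zero_iff _ hinj).2 (X_sub_C_ne_zero z)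
  have hden : algebraMap ℂ[X] (RatFunc ℂ) den ≠ 0 := by
    intro h0
    rw [map_eq_zero_iff _ hinj] at h0
    exact hd.den_ne (by rw [h0, eval_zero])
  refine ⟨(algebraMap ℂ[X] (RatFunc ℂ) ((X - C z) ^ (lev j - n).toNat * num j) /
    algebraMap ℂ[X] (RatFunc ℂ) den) • genDualBasis hb j, ?_, ?_⟩
  · rw [← Algebra.TensorProduct.basis_apply, hd.eq, smul_smul]
    congr 1
    rw [map_mul, map_pow, ← zpow_natCast, Int.toNat_of_nonneg (by omega), zpow_sub₀ hp0]
    field_simp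
  · rw [← algebraMap_smul (RatFunc ℂ) den, smul_smul, mul_div_cancel₀ _ hden, algebraMap_smul,
      Algebra.TensorProduct.basis_apply, TensorProduct.tmul_smul]

lemma fibVec_mem {n j : ℤ} (hj : n ≤ lev j) : fibVec b z j ∈ jStep φ z n := by
  obtain ⟨h, h1, h2⟩ := hd.basis_eq hj
  exact ⟨1 ⊗ₜ b j, ⟨⟨1, b j, by simp, by simp⟩, h, ⟨den, _, hd.den_ne, h2⟩, h1⟩, 1, b j, by simp,
    by simp, by simp⟩

lemma mem_jStep_iff {n : ℤ} {v : F.Fiber z} :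
    v ∈ jStep φ z n ↔ ∀ j, fibRepr b z v j ≠ 0 → n ≤ lev j := by
  constructor
  · rintro ⟨w, ⟨-, h, ⟨s', e, hs', he⟩, hw⟩, s, f, hs, hf, rfl⟩ j hj
    by_contra hlt
    refine hj ?_
    rw [map_smul, Finsupp.smul_apply, fibRepr_toFiber,
      (hd.coord_relation hw hs hs' hf he j).2.2 (not_le.1 hlt), smul_zero]
  · intro h
    rw [fib_eq_sum (b := b) z v]
    exact Submodule.sum_mem _ fun j hj =>
      Submodule.smul_mem _ _ (hd.fibVec_mem (h j (Finsupp.mem_support_iff.1 hj)))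

/-- The class of a basis vector in a Jantzen quotient. -/
def quotVec {n j : ℤ} (hj : n ≤ lev j) : JQuot φ z n :=
  Submodule.Quotient.mk ⟨fibVec b z j, hd.fibVec_mem hj⟩

/-- The coordinates on the `n`-th Jantzen quotient: the coordinates on the fibre whose index has
level `n`. -/
def quotRepr (n : ℤ) : JQuot φ z n →ₗ[ℂ] (ℤ →₀ ℂ) :=
  Submodule.liftQ _ (((Finsupp.supported ℂ ℂ {j | lev j = n}).subtype ∘ₗ
    Finsupp.restrictDom ℂ ℂ {j | lev j = n}) ∘ₗ fibRepr b z ∘ₗ Submodule.subtype _) (by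
    rintro v hv
    ext j
    change (Finsupp.filter (· ∈ {j | lev j = n}) (fibRepr b z v.1)) j = 0
    by_cases hj : lev j = n
    · rw [Finsupp.filter_apply_pos (· ∈ {j | lev j = n}) _ hj]
      by_contra h0
      have := hd.mem_jStep_iff.1 (hv : v.1 ∈ jStep φ z (n + 1)) j h0
      omega
    · rw [Finsupp.filter_apply_neg (· ∈ {j | lev j = n}) _ hj])

lemma quotRepr_mk {n j : ℤ} (v : jStep φ z n) (hj : lev j = n) :
    hd.quotRepr n (Submodule.Quotient.mk v) j = fibRepr b z v.1 j :=
  Finsupp.filter_apply_pos (· ∈ {j | lev j = n}) _ hj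

lemma quotRepr_eq_zero {n j : ℤ} (q : JQuot φ z n) (hj : lev j ≠ n) : hd.quotRepr n q j = 0 := by
  obtain ⟨v, rfl⟩ := Submodule.Quotient.mk_surjective _ q
  exact Finsupp.filter_apply_neg (· ∈ {j | lev j = n}) _ hj

lemma quotRepr_injective (n : ℤ) : Function.Injective (hd.quotRepr n) := by
  rw [← LinearMap.ker_eq_bot, LinearMap.ker_eq_bot']
  intro q hq
  obtain ⟨v, rfl⟩ := Submodule.Quotient.mk_surjective _ q
  rw [Submodule.Quotient.mk_eq_zero]
  refine hd.mem_jStep_iff.2 fun j hj => ?_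
  have h1 := hd.mem_jStep_iff.1 v.2 j hj
  have h2 : lev j ≠ n := fun h => hj ((hd.quotRepr_mk v h).symm.trans (by rw [hq]; rfl))
  omega

lemma quotRepr_quotVec {n j : ℤ} (hj : lev j = n) :
    hd.quotRepr n (hd.quotVec hj.ge) = Finsupp.single j 1 := by
  ext i
  by_cases hi : lev i = n
  · rw [quotVec, hd.quotRepr_mk _ hi, fibRepr_fibVec]
  · rw [hd.quotRepr_eq_zero _ hi, Finsupp.single_eq_of_ne]
    rintro rfl
    exact hi hj

lemma quotVec_eq_zero {n j : ℤ} (hj : n < lev j) : hd.quotVec hj.le = 0 := by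
  apply hd.quotRepr_injective
  ext i
  rw [map_zero, Finsupp.zero_apply]
  by_cases hi : lev i = n
  · rw [quotVec, hd.quotRepr_mk _ hi, fibRepr_fibVec, Finsupp.single_eq_of_ne]
    rintro rfl
    omega
  · exact hd.quotRepr_eq_zero _ hi

lemma exists_lev_eq {n : ℤ} (hn : Nontrivial (JQuot φ z n)) : ∃ j, lev j = n := by
  by_contra! h
  obtain ⟨q, hq⟩ := exists_ne (0 : JQuot φ z n)
  exact hq (hd.quotRepr_injective n (Finsupp.ext fun j => by
    rw [hd.quotRepr_eq_zero _ (h j), map_zero, Finsupp.zero_apply]))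

end DiagonalAt

section RealPoint

variable {hb : IsStandard b} {φ : F.Intertwiner} {x : ℝ} {lev : ℤ → ℤ} {num : ℤ → ℂ[X]}
  {den : ℂ[X]} (hd : DiagonalAt hb φ x lev num den)
include hd

/-- A Jantzen form is diagonal on the basis vectors of its level, with entries proportional to
the leading coefficients of `φ`. -/
lemma DiagonalAt.jantzenForm_apply {n : ℤ} {B : SesqForm (JQuot φ x n)}
    (hB : IsJantzenForm φ x n B) : ∃ C : ℂ, ∀ i j (hi : lev i = n) (hj : n ≤ lev j),
      B (hd.quotVec hi.ge) (hd.quotVec hj) = if i = j then C * (num i).eval (x : ℂ) else 0 := by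
  obtain ⟨c, hc⟩ := hB.2
  refine ⟨c * (den.eval (x : ℂ))⁻¹, fun i j hi hj => ?_⟩
  obtain ⟨h, h1, h2⟩ := hd.basis_eq hi.ge
  have := hc (1 ⊗ₜ b i) h den _ (b j) ⟨fibVec b x i, hd.fibVec_mem hi.ge⟩
    ⟨fibVec b x j, hd.fibVec_mem hj⟩
    ⟨⟨1, b i, by simp, by simp⟩, h, ⟨den, _, hd.den_ne, h2⟩, h1⟩ ⟨1, b i, by simp, by simp, by simp⟩
    h1 hd.den_ne h2 rfl
  rw [quotVec, quotVec, this, ← dualBasis_repr hb, map_smul, Finsupp.smul_apply,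
    Module.Basis.repr_self, hi]
  by_cases hij : i = j
  · subst hij
    simp
    ring
  · simp [hij]

end RealPoint

/-- The squared length `∏_{i < |j|} (1 + (2 i + 1)² x) / 4` of the `j`-th standard basis vector. -/
def dv (x : ℝ) (j : ℤ) : ℝ := ∏ i ∈ Finset.range j.natAbs, (1 + (2 * (i : ℝ) + 1) ^ 2 * x) / 4

/-- The order of vanishing at `x` of `qPoly i`. -/
def qOrd (x : ℝ) (i : ℕ) : ℤ := if 1 + (2 * (i : ℝ) + 1) ^ 2 * x = 0 then 1 else 0

/-- The leading coefficient at `x` of `qPoly i`. -/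
def qLead (x : ℝ) (i : ℕ) : ℝ :=
  if 1 + (2 * (i : ℝ) + 1) ^ 2 * x = 0 then (2 * (i : ℝ) + 1) ^ 2 / 4
  else (1 + (2 * (i : ℝ) + 1) ^ 2 * x) / 4

lemma qLead_ne_zero (x : ℝ) (i : ℕ) : qLead x i ≠ 0 := by
  unfold qLead
  split_ifs with h
  · positivity
  · exact div_ne_zero h (by norm_num)

lemma exists_qPoly_eq (x : ℝ) (i : ℕ) : ∃ r : ℂ[X], r.eval (x : ℂ) = qLead x i ∧
    algebraMap ℂ[X] (RatFunc ℂ) (qPoly i) =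
      (algebraMap ℂ[X] (RatFunc ℂ) (X - C (x : ℂ))) ^ qOrd x i * algebraMap ℂ[X] (RatFunc ℂ) r := by
  by_cases h : 1 + (2 * (i : ℝ) + 1) ^ 2 * x = 0
  · refine ⟨C (((2 * (i : ℂ) + 1) ^ 2) / 4), by simp [qLead, h], ?_⟩
    rw [qOrd, if_pos h, zpow_one, ← map_mul]
    congr 1
    have h' : 1 + (2 * (i : ℂ) + 1) ^ 2 * x = 0 := by exact_mod_cast h
    have h2 : C (1 + (2 * (i : ℂ) + 1) ^ 2 * x) = (0 : ℂ[X]) := by rw [h', C_0]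
    rw [qPoly]
    simp only [C_add, C_mul, C_1] at h2
    simp only [Int.cast_natCast, div_eq_mul_inv, C_mul, one_mul]
    linear_combination C 4⁻¹ * h2
  · refine ⟨qPoly i, ?_, by simp [qOrd, h]⟩
    simp [qLead, h, qPoly]
    ring

/-- The order at `x` of the `j`-th entry of an intertwiner is that of the common factor `c₀` plus the
order of `∏_{i < |j|} q_i`, and its leading coefficient is a multiple of the product of those of the
`q_i`. -/
theorem exists_diagonalAt (hb : IsStandard b) (φ : F.Intertwiner) (x : ℝ) :
    ∃ (n₀ : ℤ) (c : ℂ) (num : ℤ → ℂ[X]) (den : ℂ[X]), c ≠ 0 ∧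
      (∀ j, (num j).eval (x : ℂ) = c * ∏ i ∈ Finset.range j.natAbs, (qLead x i : ℂ)) ∧
      DiagonalAt hb φ x (fun j => n₀ + ∑ i ∈ Finset.range j.natAbs, qOrd x i) num den := by
  obtain ⟨c₀, hc₀, hφ⟩ := exists_intertwiner_eq hb φ
  have hinj := IsFractionRing.injective ℂ[X] (RatFunc ℂ)
  have hp0 : algebraMap ℂ[X] (RatFunc ℂ) (X - C (x : ℂ)) ≠ 0 :=
    (map_ne_zero_iff _ hinj).2 (X_sub_C_ne_zero _)
  obtain ⟨a, ha, han⟩ := exists_eq_pow_rootMultiplicity_mul_and_not_dvd _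
    (RatFunc.num_ne_zero hc₀) (x : ℂ)
  obtain ⟨d, hdd, hdn⟩ := exists_eq_pow_rootMultiplicity_mul_and_not_dvd _
    (RatFunc.denom_ne_zero c₀) (x : ℂ)
  rw [dvd_iff_isRoot] at han hdn
  choose r hr1 hr2 using exists_qPoly_eq x
  refine ⟨(rootMultiplicity (x : ℂ) c₀.num : ℤ) - rootMultiplicity (x : ℂ) c₀.denom,
    a.eval (x : ℂ), fun j => a * ∏ i ∈ Finset.range j.natAbs, r i, d, han, ?_, ?_, hdn, ?_⟩
  · intro j
    simp [eval_prod, hr1]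
  · intro j
    simp only [eval_mul, eval_prod, hr1]
    exact mul_ne_zero han (Finset.prod_ne_zero_iff.2 fun i _ =>
      Complex.ofReal_ne_zero.2 (qLead_ne_zero x i))
  · intro j
    rw [hφ j]
    congr 1
    have h1 : ∀ s : Finset ℕ, algebraMap ℂ[X] (RatFunc ℂ) (∏ i ∈ s, qPoly i) =
        (algebraMap ℂ[X] (RatFunc ℂ) (X - C (x : ℂ))) ^ (∑ i ∈ s, qOrd x i) *
          algebraMap ℂ[X] (RatFunc ℂ) (∏ i ∈ s, r i) := by
      intro s
      induction s using Finset.cons_induction with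
      | empty => simp
      | cons i s hi ih =>
        rw [Finset.prod_cons, Finset.prod_cons, Finset.sum_cons, map_mul, map_mul, ih, hr2,
          zpow_add₀ hp0]
        ring
    rw [dPoly, h1]
    have h2 : c₀ = (algebraMap ℂ[X] (RatFunc ℂ) (X - C (x : ℂ))) ^
        ((rootMultiplicity (x : ℂ) c₀.num : ℤ) - rootMultiplicity (x : ℂ) c₀.denom) *
        (algebraMap ℂ[X] (RatFunc ℂ) a / algebraMap ℂ[X] (RatFunc ℂ) d) := by
      conv_lhs => rw [← RatFunc.num_div_denom c₀, ha, hdd]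
      rw [map_mul, map_mul, map_pow, map_pow, zpow_sub₀ hp0, zpow_natCast, zpow_natCast]
      rw [mul_div_mul_comm]
    conv_lhs => rw [h2]
    rw [map_mul, zpow_add₀ hp0]
    ring

end HCFamily
end ContractionFamilies
end

noncomputable section

namespace ContractionFamilies
namespace HCFamily

/-! ### The points at which a Jantzen quotient is infinitesimally unitary -/

/-- The points at which the squared lengths of the standard basis vectors are nonnegative. -/
def IsUnitaryPoint (x : ℝ) : Prop := ∀ j, 0 ≤ dv x j

lemma dv_zero (x : ℝ) : dv x 0 = 1 := by simp [dv]

lemma dv_neg (x : ℝ) (j : ℤ) : dv x (-j) = dv x j := by simp [dv]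

lemma dv_succ (x : ℝ) {j : ℤ} (hj : 0 ≤ j) :
    dv x (j + 1) = dv x j * ((1 + (2 * (j : ℝ) + 1) ^ 2 * x) / 4) := by
  lift j to ℕ using hj
  have : ((j : ℤ) + 1).natAbs = j + 1 := by omega
  rw [dv, dv, this, Finset.prod_range_succ]
  rfl

lemma dv_of_neg (x : ℝ) {j : ℤ} (hj : j < 0) :
    dv x j = dv x (j + 1) * ((1 + (2 * (j : ℝ) + 1) ^ 2 * x) / 4) := by
  have h := dv_succ x (j := -j - 1) (by omega)
  rw [sub_add_cancel, dv_neg] at h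
  rw [h, ← dv_neg, neg_sub, sub_neg_eq_add, add_comm (1 : ℤ)]
  push_cast
  ring

lemma isUnitaryPoint_of_nonneg {x : ℝ} (hx : 0 ≤ x) : IsUnitaryPoint x :=
  fun _ => Finset.prod_nonneg fun _ _ => by positivity

lemma dv_pos {x : ℝ} (hx : 0 ≤ x) (j : ℤ) : 0 < dv x j :=
  Finset.prod_pos fun _ _ => by positivity

lemma discretePoint_factor (m : ℕ) (y : ℝ) : 1 + (2 * y + 1) ^ 2 * discretePoint m =
    4 * ((m - y) * (m + y + 1)) / (2 * (m : ℝ) + 1) ^ 2 := by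
  have : (2 * (m : ℝ) + 1) ≠ 0 := by positivity
  unfold discretePoint
  field_simp
  ring

lemma dv_discretePoint_pos {m : ℕ} {j : ℤ} (hj : j.natAbs ≤ m) : 0 < dv (discretePoint m) j := by
  refine Finset.prod_pos fun i hi => ?_
  have hi' : (i : ℝ) < m := by
    have := Finset.mem_range.1 hi
    exact_mod_cast lt_of_lt_of_le this hj
  rw [discretePoint_factor]
  have : 0 < (m : ℝ) - i := sub_pos.2 hi'
  positivity

lemma dv_discretePoint_eq_zero {m : ℕ} {j : ℤ} (hj : m < j.natAbs) :
    dv (discretePoint m) j = 0 :=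
  Finset.prod_eq_zero (Finset.mem_range.2 hj) (by rw [discretePoint_factor]; simp)

lemma isUnitaryPoint_discretePoint (m : ℕ) : IsUnitaryPoint (discretePoint m) := fun j => by
  rcases le_or_gt j.natAbs m with h | h
  · exact (dv_discretePoint_pos h).le
  · exact (dv_discretePoint_eq_zero h).ge

lemma dv_eq_zero_iff (x : ℝ) (j : ℤ) :
    dv x j = 0 ↔ 0 < ∑ i ∈ Finset.range j.natAbs, qOrd x i := by
  have hn : ∀ i ∈ Finset.range j.natAbs, 0 ≤ qOrd x i := fun i _ => by
    unfold qOrd; split_ifs <;> norm_num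
  rw [Finset.sum_pos_iff_of_nonneg hn, dv, Finset.prod_eq_zero_iff]
  refine exists_congr fun i => and_congr_right fun _ => ?_
  rw [div_eq_zero_iff, or_iff_left (by norm_num : (4 : ℝ) ≠ 0), qOrd]
  split_ifs with h <;> simp [h]

lemma prod_qLead {x : ℝ} {j : ℤ} (hj : dv x j ≠ 0) :
    ∏ i ∈ Finset.range j.natAbs, qLead x i = dv x j := by
  refine Finset.prod_congr rfl fun i hi => ?_
  have := Finset.prod_ne_zero_iff.1 hj i hi
  rw [qLead, if_neg fun h => this (by rw [h, zero_div])]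

/-- The vectors `q j` span the `n`-th Jantzen quotient at `x`; they are linearly independent as far
as they are nonzero, and have weight `2 j`, squared length `dv x j` and the given images under the
sections `H`, `E` and `F`. -/
structure IsQuotBasis {F : HCFamily.{u}} (φ : F.Intertwiner) (x : ℝ) (n : ℤ)
    (q : ℤ → JQuot φ x n) : Prop where
  span_eq_top : Submodule.span ℂ (Set.range q) = ⊤
  exists_lift : ∀ {V : Type v} [AddCommGroup V] [Module ℂ V] (e : ℤ → V),
    (∀ j, dv x j = 0 → e j = 0) → ∃ ι : JQuot φ x n →ₗ[ℂ] V, ∀ j, ι (q j) = e j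
  eq_zero : ∀ j, dv x j = 0 → q j = 0
  act_secH : ∀ j, jAct φ x n secH (q j) = (2 * j : ℂ) • q j
  act_secE : ∀ j, jAct φ x n secE (q j) = (eCoef j).eval (x : ℂ) • q (j + 1)
  act_secF : ∀ j, jAct φ x n secF (q j) = (fCoef j).eval (x : ℂ) • q (j - 1)
  rho : ∀ a j, jRho φ x n a (q j) = ((a ^ (2 * j) : ℂˣ) : ℂ) • q j
  form : ∀ B, IsJantzenForm φ x n B → ∃ C : ℂ, ∀ i j, B (q i) (q j) =
    if i = j then C * dv x j else 0
  exists_form : ∃ B, IsJantzenForm φ x n B ∧ ∀ i j, B (q i) (q j) =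
    if i = j then (dv x j : ℂ) else 0

section

variable {F : HCFamily.{u}} {b : Module.Basis ℤ ℂ[X] F.carrier} (hb : IsStandard b)
  (φ : F.Intertwiner) {x : ℝ}
include hb

/-- The first nonzero Jantzen quotient, which contains the class of the generating vector, is spanned
by the classes of the standard basis vectors with `dv x j ≠ 0`; the others lie deeper in the
filtration. -/
theorem exists_isQuotBasis (x : ℝ) : ∃ (n : ℤ) (q : ℤ → JQuot φ x n),
    IsQuotBasis.{u, v} φ x n q := by
  obtain ⟨n, c, num, den, hc, hnum, hd⟩ := exists_diagonalAt hb φ x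
  have hnn : ∀ j : ℤ, 0 ≤ ∑ i ∈ Finset.range j.natAbs, qOrd x i := fun j =>
    Finset.sum_nonneg fun i _ => by unfold qOrd; split_ifs <;> norm_num
  -- the level at which the `j`-th basis vector has a nonzero class; it is `n` exactly for `dv x j ≠ 0`
  set lev : ℤ → ℤ := fun j => n + ∑ i ∈ Finset.range j.natAbs, qOrd x i with hlev
  have hle : ∀ j, n ≤ lev j := fun j => le_add_of_nonneg_right (hnn j)
  have hlev0 : ∀ j, dv x j ≠ 0 → lev j = n := fun j hj => by
    have h1 := (not_congr (dv_eq_zero_iff x j)).1 hj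
    have h2 := hnn j
    simp only [hlev]
    omega
  have hlev1 : ∀ j, dv x j = 0 → n < lev j := fun j hj => by
    have h1 := (dv_eq_zero_iff x j).1 hj
    simp only [hlev]
    omega
  have hq0 : ∀ j, dv x j = 0 → hd.quotVec (hle j) = 0 := fun j hj => hd.quotVec_eq_zero (hlev1 j hj)
  have hnum' : ∀ j, dv x j ≠ 0 → (num j).eval (x : ℂ) = c * dv x j := fun j hj => by
    rw [hnum, ← prod_qLead hj]
    push_cast
    rfl
  have hrepr : ∀ j, hd.quotRepr n (hd.quotVec (hle j)) =
      if dv x j = 0 then 0 else Finsupp.single j 1 := fun j => by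
    split_ifs with h
    · rw [hq0 j h, map_zero]
    · exact hd.quotRepr_quotVec (hlev0 j h)
  have hact : ∀ (Y : GSec) (j k : ℤ) (p : ℂ[X]), ⁅Y, b j⁆ = p • b k →
      jAct φ x n Y (hd.quotVec (hle j)) = p.eval (x : ℂ) • hd.quotVec (hle k) := by
    intro Y j k p h
    refine congrArg (Submodule.Quotient.mk) (Subtype.ext ?_)
    change F.toFiber x ⁅Y, b j⁆ = _
    rw [h, toFiber_smul]
    rfl
  refine ⟨n, fun j => hd.quotVec (hle j), ?_, ?_, hq0, ?_, ?_, ?_, ?_, ?_, ?_⟩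
  · rw [eq_top_iff]
    rintro q -
    obtain ⟨v, rfl⟩ := Submodule.Quotient.mk_surjective _ q
    have hv : (Submodule.Quotient.mk v : JQuot φ x n) =
        ∑ j ∈ (fibRepr b x v.1).support, fibRepr b x v.1 j • hd.quotVec (hle j) := by
      have : v = ∑ j ∈ (fibRepr b x v.1).support,
          fibRepr b x v.1 j • (⟨fibVec b x j, hd.fibVec_mem (hle j)⟩ : jStep φ x n) := by
        apply Subtype.ext
        conv_lhs => rw [fib_eq_sum (b := b) (x : ℂ) v.1]
        simp [Finsupp.sum]
      conv_lhs => rw [this]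
      rw [← Submodule.mkQ_apply, map_sum]
      rfl
    rw [hv]
    exact Submodule.sum_mem _ fun j _ => Submodule.smul_mem _ _ (Submodule.subset_span ⟨j, rfl⟩)
  · intro V _ _ e he
    refine ⟨Finsupp.linearCombination ℂ e ∘ₗ hd.quotRepr n, fun j => ?_⟩
    rw [LinearMap.comp_apply, hrepr]
    split_ifs with h
    · rw [map_zero, he j h]
    · simp
  · intro j
    rw [hact secH j j _ (hb.lie_secH j)]
    simp
  · exact fun j => hact secE j _ _ (hb.lie_secE j)
  · exact fun j => hact secF j _ _ (hb.lie_secF j)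
  · intro a j
    refine congrArg (Submodule.Quotient.mk) (Subtype.ext ?_)
    change F.toFiber x (F.rho a (b j)) = _
    rw [hb.rho, toFiber_smul, eval_C]
    rfl
  · intro B hB
    obtain ⟨C, hC⟩ := hd.jantzenForm_apply hB
    refine ⟨C * c, fun i j => ?_⟩
    by_cases hi : dv x i = 0
    · rw [hq0 i hi, map_zero, LinearMap.zero_apply]
      split_ifs with h
      · rw [← h, hi]; simp
      · rfl
    · rw [hC i j (hlev0 i hi) (hle j)]
      split_ifs with h
      · subst h
        rw [hnum' _ hi]
        ring
      · rfl
  · -- the form with the diagonal entries `dv x j` is the Jantzen form multiplied by `den / c`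
    let B : SesqForm (JQuot φ x n) := LinearMap.mk₂'ₛₗ (RingHom.id ℂ) (starRingEnd ℂ)
      (fun v v' => (hd.quotRepr n v').sum fun j r => dv x j * hd.quotRepr n v j * conj r)
      (fun v w v' => by simp [mul_add, add_mul, Finsupp.sum, Finset.sum_add_distrib])
      (fun r v v' => by
        simp only [map_smul, Finsupp.smul_apply, smul_eq_mul, Finsupp.sum, Finset.mul_sum,
          RingHom.id_apply]
        exact Finset.sum_congr rfl fun _ _ => by ring)
      (fun v w w' => by
        rw [map_add, Finsupp.sum_add_index'] <;> simp [mul_add])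
      (fun r v w => by
        rw [map_smul, Finsupp.sum_smul_index' (by simp)]
        simp only [Finsupp.sum, Finset.mul_sum, smul_eq_mul, map_mul]
        exact Finset.sum_congr rfl fun _ _ => by ring)
    have hBdef : ∀ v v', B v v' = (hd.quotRepr n v').sum fun j r =>
      (dv x j : ℂ) * hd.quotRepr n v j * conj r := fun _ _ => rfl
    refine ⟨B, ⟨fun v v' => ?_, den.eval (x : ℂ) / c, ?_⟩, fun i j => ?_⟩
    · rw [hBdef, hBdef, Finsupp.sum_of_support_subset (s := (hd.quotRepr n v').support ∪
          (hd.quotRepr n v).support) _ Finset.subset_union_left _ (by simp),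
        Finsupp.sum_of_support_subset (s := (hd.quotRepr n v').support ∪
          (hd.quotRepr n v).support) _ Finset.subset_union_right _ (by simp), map_sum]
      refine Finset.sum_congr rfl fun j _ => ?_
      simp only [map_mul, Complex.conj_ofReal, Complex.conj_conj]
      ring
    · rintro w h s' e f v v' - ⟨s, f', hs, hf', hv⟩ hw hs' he hv'
      rw [hBdef, toFun_eq_sum hb, Finsupp.sum_of_support_subset (s := (b.repr f).support) _ ?_ _ (by simp),
        Finsupp.sum, eval_finsetSum, Finset.mul_sum, Finset.mul_sum]
      · refine Finset.sum_congr rfl fun j _ => ?_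
        rw [eval_mul, eval_conjPoly, dualBasis_repr]
        obtain ⟨h1, h2, -⟩ := hd.coord_relation hw hs hs' hf' he j
        by_cases hj : dv x j = 0
        · rw [h2 (hlev1 j hj), hj]
          simp
        · have h1' := h1 (hlev0 j hj)
          rw [hnum' j hj] at h1'
          rw [hd.quotRepr_mk _ (hlev0 j hj), hd.quotRepr_mk _ (hlev0 j hj), hv, hv', map_smul,
            Finsupp.smul_apply, fibRepr_toFiber, fibRepr_toFiber, smul_eq_mul]
          field_simp
          linear_combination (conj (eval (x : ℂ) ((b.repr f) j))) * h1'
      · intro j hj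
        rw [Finsupp.mem_support_iff] at hj ⊢
        intro h0
        refine hj ?_
        by_cases hj' : lev j = n
        · rw [hd.quotRepr_mk _ hj', hv', fibRepr_toFiber, h0, eval_zero]
        · exact hd.quotRepr_eq_zero _ hj'
    · rw [hBdef, hrepr, hrepr]
      by_cases hi : dv x i = 0 <;> by_cases hj : dv x j = 0 <;> by_cases hij : i = j
      all_goals (try subst hij); simp_all [Finsupp.sum_single_index]

/-- A Jantzen quotient at `x` can be infinitesimally unitary only if it is the one that contains
the class of the generating vector, and `x ≥ 0` or `x` is one of the points `-(2m+1)⁻²`: otherwise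
the quotient contains neighbouring basis vectors whose squared lengths have opposite signs. -/
theorem isInfUnitary_imp : ∃ n₀ : ℤ, (0 ≤ x → ∀ n, Nontrivial (JQuot φ x n) → n = n₀) ∧
    (x < 0 → ∀ n, IsInfUnitary φ x n → n = n₀ ∧ ∃ m : ℕ, x = discretePoint m) := by
  obtain ⟨n₀, c, num, den, hc, hnum, hd⟩ := exists_diagonalAt hb φ x
  refine ⟨n₀, fun hx n hn => ?_, fun hx n hn => ?_⟩
  · obtain ⟨j, hj⟩ := hd.exists_lev_eq hn
    rw [← hj, Finset.sum_eq_zero, add_zero]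
    intro i _
    rw [qOrd, if_neg]
    positivity
  · -- two consecutive vectors at the same level have ratio of squared lengths `qLead`
    have key : ∀ k : ℕ, 1 + (2 * (k : ℝ) + 1) ^ 2 * x < 0 →
        n ≠ n₀ + ∑ i ∈ Finset.range k, qOrd x i := by
      intro k hk hl
      obtain ⟨-, B, hB, hpos⟩ := hn
      obtain ⟨C, hC⟩ := hd.jantzenForm_apply hB
      have hk1 : qOrd x k = 0 := by rw [qOrd, if_neg hk.ne]
      have l1 : n₀ + ∑ i ∈ Finset.range (k : ℤ).natAbs, qOrd x i = n := by
        rw [hl, Int.natAbs_natCast]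
      have l2 : n₀ + ∑ i ∈ Finset.range ((k : ℤ) + 1).natAbs, qOrd x i = n := by
        rw [hl, show ((k : ℤ) + 1).natAbs = k + 1 by omega, Finset.sum_range_succ, hk1, add_zero]
      have n1 := hC k k l1 l1.ge
      have n2 := hC (k + 1) (k + 1) l2 l2.ge
      rw [if_pos rfl] at n1 n2
      have hne : ∀ (j : ℤ) (hj : n₀ + ∑ i ∈ Finset.range j.natAbs, qOrd x i = n),
          hd.quotVec hj.ge ≠ 0 := by
        intro j hj h0
        have := hd.quotRepr_quotVec hj
        rw [h0, map_zero] at this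
        exact one_ne_zero (Finsupp.single_eq_zero.1 this.symm)
      have p1 := hpos _ (hne _ l1)
      have p2 := hpos _ (hne _ l2)
      rw [n1, hnum, Int.natAbs_natCast] at p1
      rw [n2, hnum, show ((k : ℤ) + 1).natAbs = k + 1 by omega, Finset.prod_range_succ] at p2
      have hneg : qLead x k < 0 := by
        rw [qLead, if_neg hk.ne]
        linarith
      have : (C * (c * ((∏ i ∈ Finset.range k, (qLead x i : ℂ)) * (qLead x k : ℂ)))).re =
          (C * (c * ∏ i ∈ Finset.range k, (qLead x i : ℂ))).re * qLead x k := by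
        rw [← Complex.re_mul_ofReal]
        congr 1
        ring
      rw [this] at p2
      nlinarith
    have hgrow : ∃ k : ℕ, 1 + (2 * (k : ℝ) + 1) ^ 2 * x < 0 := by
      obtain ⟨k, hk⟩ := exists_nat_gt (1 / -x)
      refine ⟨k, ?_⟩
      rw [div_lt_iff₀ (by linarith)] at hk
      nlinarith [sq_nonneg (k : ℝ), (Nat.cast_nonneg k : (0 : ℝ) ≤ k)]
    obtain ⟨j, hj⟩ := hd.exists_lev_eq hn.1
    -- if some `q_m` vanishes at `x`, the levels are `n₀` for `|j| ≤ m` and `n₀ + 1` for `|j| > m`, and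
    -- the second one is excluded by the sign of `q_{m+1}`; if none vanishes, all levels are `n₀`
    by_cases hz : ∃ m : ℕ, 1 + (2 * (m : ℝ) + 1) ^ 2 * x = 0
    · obtain ⟨m, hm⟩ := hz
      have hxm : x = discretePoint m := by
        have : (2 * (m : ℝ) + 1) ^ 2 ≠ 0 := by positivity
        unfold discretePoint
        field_simp
        linarith
      have hq : ∀ i : ℕ, qOrd x i = if i = m then 1 else 0 := by
        intro i
        rw [qOrd]
        have : (1 + (2 * (i : ℝ) + 1) ^ 2 * x = 0) ↔ i = m := by
          constructor
          · intro h
            have h2 : ((2 * (i : ℝ) + 1) ^ 2 - (2 * (m : ℝ) + 1) ^ 2) * x = 0 := by linarith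
            have h3 := (mul_eq_zero.1 h2).resolve_right hx.ne
            have h4 := (pow_left_inj₀ (by positivity) (by positivity) two_ne_zero).1
              (sub_eq_zero.1 h3)
            have h5 : (i : ℝ) = m := by linarith
            exact_mod_cast h5
          · rintro rfl; exact hm
        simp only [this]
      refine ⟨?_, m, hxm⟩
      have hs : ∑ i ∈ Finset.range j.natAbs, qOrd x i = if m < j.natAbs then 1 else 0 := by
        simp [hq, Finset.sum_ite_eq']
      rw [hs] at hj
      split_ifs at hj with h
      · exfalso
        refine key (m + 1) ?_ ?_
        · push_cast
          nlinarith [(Nat.cast_nonneg m : (0 : ℝ) ≤ m)]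
        · rw [← hj]
          simp [hq]
      · rw [← hj, add_zero]
    · exfalso
      push Not at hz
      have hq : ∀ i : ℕ, qOrd x i = 0 := fun i => by rw [qOrd, if_neg (hz i)]
      obtain ⟨k, hk⟩ := hgrow
      refine key k hk ?_
      rw [← hj]
      simp [hq]

end

end HCFamily
end ContractionFamilies
end

noncomputable section

namespace ContractionFamilies

/-! ### Exponentials and polar decomposition in the real groups -/

/-- The entire function `sinh μ / μ`. -/
def sinhc (μ : ℂ) : ℂ := if μ = 0 then 1 else Complex.sinh μ / μ

lemma sinhc_zero : sinhc 0 = 1 := if_pos rfl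

lemma sinhc_mul (μ : ℂ) : sinhc μ * μ = Complex.sinh μ := by
  unfold sinhc
  split_ifs with h
  · simp [h]
  · field_simp

lemma hasSum_sinhc (μ : ℂ) :
    HasSum (fun n : ℕ => μ ^ (2 * n) / ((2 * n + 1).factorial : ℂ)) (sinhc μ) := by
  unfold sinhc
  split_ifs with h
  · subst h
    convert hasSum_single (0 : ℕ) (f := fun n : ℕ => (0 : ℂ) ^ (2 * n) /
      ((2 * n + 1).factorial : ℂ)) ?_ using 1
    · simp
    · intro n hn
      simp [hn]
  · have := (Complex.hasSum_sinh μ).div_const μ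
    refine this.congr_fun ?_ |> id
    intro n
    field_simp
    ring

/-- The exponential of a matrix with scalar square. -/
lemma exp_of_sq_eq {A : M2 ℂ} {μ : ℂ} (hA : A * A = (μ ^ 2) • (1 : M2 ℂ)) :
    NormedSpace.exp A = Complex.cosh μ • (1 : M2 ℂ) + sinhc μ • A := by
  have he : ∀ n : ℕ, A ^ (2 * n) = (μ ^ (2 * n)) • (1 : M2 ℂ) := by
    intro n
    rw [pow_mul, sq, hA, _root_.smul_pow, one_pow, pow_mul]
  open scoped Matrix.Norms.Operator in
  have h := NormedSpace.exp_series_hasSum_exp' (𝕂 := ℂ) A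
  refine h.unique (HasSum.even_add_odd ?_ ?_)
  · have := (Complex.hasSum_cosh μ).smul_const (1 : M2 ℂ)
    refine this.congr_fun ?_ |> id
    intro n
    rw [he, smul_smul, div_eq_inv_mul]
  · have := (hasSum_sinhc μ).smul_const A
    refine this.congr_fun ?_ |> id
    intro n
    rw [pow_succ, he, smul_mul_assoc, one_mul, smul_smul, div_eq_inv_mul]

variable {x : ℝ}

lemma realGroup_ext {g h : realGroup x} (h0 : g.1.1 0 0 = h.1.1 0 0)
    (h1 : g.1.1 0 1 = h.1.1 0 1) : g = h := by
  obtain ⟨a1, a2, a3, a4, a5, a6⟩ := (mem_realGroup_iff x g.1).1 g.2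
  obtain ⟨b1, b2, b3, b4, b5, b6⟩ := (mem_realGroup_iff x h.1).1 h.2
  refine Subtype.ext (Prod.ext (Subtype.ext ?_) (Subtype.ext ?_)) <;> ext i j <;> fin_cases i <;>
    fin_cases j <;> simp [a1, a2, a3, a4, a5, a6, b1, b2, b3, b4, b5, b6, h0, h1]

lemma realElt_fst (a : ℝ) (b : ℂ) : (realElt x a b).1.1 =
    !![Complex.I * a, b; x * conj b, -(Complex.I * a)] := rfl

lemma expReal_fst (Y : realForm x) : (expReal x Y).1.1.1 = NormedSpace.exp Y.1.1 := rfl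

lemma expReal_realElt (a : ℝ) (b : ℂ) {μ : ℂ} (hμ : μ ^ 2 = x * Complex.normSq b - a ^ 2) :
    (expReal x (realElt x a b)).1.1.1 0 0 = Complex.cosh μ + sinhc μ * (Complex.I * a) ∧
    (expReal x (realElt x a b)).1.1.1 0 1 = sinhc μ * b := by
  rw [expReal_fst, exp_of_sq_eq (μ := μ)]
  · simp [realElt_fst]
  · rw [realElt_fst, hμ]
    ext i j
    fin_cases i <;> fin_cases j <;> simp [Matrix.mul_apply, Fin.sum_univ_two, ← Complex.mul_conj] <;>
      ring_nf <;> (simp [Complex.I_sq]; try ring)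

lemma smul_realElt (t a : ℝ) (b : ℂ) : t • realElt x a b = realElt x (t * a) (t * b) := by
  apply Subtype.ext
  ext i j <;> fin_cases i <;> fin_cases j <;> simp [realElt, gElt] <;> ring

lemma eq_realElt (Y : realForm x) : Y = realElt x (Y.1.1 0 0).im (Y.1.1 0 1) := by
  obtain ⟨⟨h1, h2, h3, h4, h5⟩, h6⟩ := Y.2
  have e1 := congrFun (congrFun (congrArg Prod.fst h6) 0) 0
  have e2 := congrFun (congrFun (congrArg Prod.fst h6) 0) 1
  have e3 := congrFun (congrFun (congrArg Prod.snd h6) 1) 0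
  simp [sigmaPair, theta] at e1 e2 e3
  have hre : (Y.1.1 0 0).re = 0 := by
    have := congrArg Complex.re e1
    rw [h1] at this
    simp at this
    linarith
  have h0 : Y.1.1 0 0 = Complex.I * ((Y.1.1 0 0).im : ℝ) := by
    apply Complex.ext <;> simp [hre]
  apply Subtype.ext
  ext i j <;> fin_cases i <;> fin_cases j <;> simp [realElt, gElt, h1, h2, h3, h4, h5, ← h0, e3]

lemma expReal_zero : expReal x 0 = 1 := by
  refine realGroup_ext ?_ ?_ <;> rw [expReal_fst] <;> simp

lemma expReal_add_smul (Y : realForm x) (s t : ℝ) :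
    expReal x ((s + t) • Y) = expReal x (s • Y) * expReal x (t • Y) := by
  have h : NormedSpace.exp ((s + t) • Y.1.1) =
      NormedSpace.exp (s • Y.1.1) * NormedSpace.exp (t • Y.1.1) := by
    rw [add_smul, Matrix.exp_add_of_commute _ _ (((Commute.refl Y.1.1).smul_left s).smul_right t)]
  refine realGroup_ext ?_ ?_
  · exact congrFun (congrFun h 0) 0
  · exact congrFun (congrFun h 0) 1

lemma expReal_nsmul (Y : realForm x) (n : ℕ) : expReal x ((n : ℝ) • Y) = expReal x Y ^ n := by
  induction n with
  | zero => simp [expReal_zero]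
  | succ n ih => rw [Nat.cast_succ, expReal_add_smul, ih, one_smul, pow_succ]

lemma expReal_smul_one (t : ℝ) : expReal x (t • realElt x 1 0) = torus x (Circle.exp t) := by
  rw [smul_realElt]
  obtain ⟨h0, h1⟩ := expReal_realElt (x := x) (t * 1) (t * 0) (μ := Complex.I * t)
    (by simp [mul_pow])
  refine realGroup_ext (h0.trans ?_) (h1.trans ?_)
  · have := sinhc_mul (Complex.I * t)
    rw [mul_one, this, Complex.cosh_add_sinh]
    change _ = (Circle.exp t : ℂ)
    rw [Circle.coe_exp, mul_comm]
  · change _ = (0 : ℂ)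
    simp

lemma torus_apply (w : Circle) : (torus x w).1.1.1 = !![(w : ℂ), 0; 0, conj (w : ℂ)] := rfl

lemma polar_entries (b : ℂ) (w : Circle) {μ : ℂ} (hμ : μ ^ 2 = x * Complex.normSq b) :
    (expReal x (realElt x 0 b) * torus x w).1.1.1 0 0 = Complex.cosh μ * w ∧
    (expReal x (realElt x 0 b) * torus x w).1.1.1 0 1 = sinhc μ * b * conj (w : ℂ) := by
  obtain ⟨h0, h1⟩ := expReal_realElt (x := x) 0 b (μ := μ) (by simpa using hμ)
  have : (expReal x (realElt x 0 b) * torus x w).1.1.1 =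
    (expReal x (realElt x 0 b)).1.1.1 * (torus x w).1.1.1 := rfl
  rw [this, torus_apply]
  simp [Matrix.mul_apply, Fin.sum_univ_two, h0, h1]

lemma realGroup_det (g : realGroup x) :
    Complex.normSq (g.1.1 0 0) - x * Complex.normSq (g.1.1 0 1) = 1 := by
  obtain ⟨h1, h2, -⟩ := (mem_realGroup_iff x g.1).1 g.2
  have hdet : g.1.1 0 0 * g.1.1 1 1 - g.1.1 0 1 * g.1.1 1 0 = 1 := by
    have := g.1.1.2
    rwa [Matrix.det_fin_two] at this
  rw [h1, h2, mul_left_comm, Complex.mul_conj, Complex.mul_conj] at hdet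
  exact_mod_cast hdet

lemma exists_circle_mul_norm (z : ℂ) : ∃ w : Circle, z = ‖z‖ * w := by
  by_cases h : z = 0
  · exact ⟨1, by simp [h]⟩
  · refine ⟨⟨z / ‖z‖, ?_⟩, ?_⟩
    · exact mem_sphere_zero_iff_norm.2 (by simp [h])
    · have : (‖z‖ : ℂ) ≠ 0 := by exact_mod_cast norm_ne_zero_iff.2 h
      change z = ‖z‖ * (z / ‖z‖)
      field_simp

/-- Polar decomposition. -/
theorem exists_polar (g : realGroup x) : ∃ (b : ℂ) (w : Circle),
    g = expReal x (realElt x 0 b) * torus x w := by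
  have hdet := realGroup_det g
  obtain ⟨w, hw⟩ := exists_circle_mul_norm (g.1.1 0 0)
  set β : ℂ := g.1.1 0 1 with hβ
  have hww : (w : ℂ) * conj (w : ℂ) = 1 := by simp [Complex.mul_conj]
  rw [Complex.normSq_eq_norm_sq, Complex.normSq_eq_norm_sq] at hdet
  -- it suffices to find `μ` with `cosh μ = |α|` and `sinh μ ^ 2 = x |β| ^ 2`
  suffices h : ∃ μ : ℂ, Complex.cosh μ = ‖g.1.1 0 0‖ ∧
      ∃ r : ℝ, (r : ℂ) * sinhc μ = 1 ∧ μ ^ 2 = x * (r * ‖β‖) ^ 2 by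
    obtain ⟨μ, h1, r, hr, h3⟩ := h
    refine ⟨r * β * w, w, ?_⟩
    obtain ⟨e0, e1⟩ := polar_entries (x := x) (r * β * w) w (μ := μ) (by
      rw [h3, Complex.normSq_eq_norm_sq]
      simp [mul_pow, Circle.norm_coe])
    refine realGroup_ext ?_ ?_
    · rw [e0, h1]; exact hw
    · rw [e1]
      change β = _
      linear_combination (-β) * hr - sinhc μ * r * β * hww
  have hsinh : ∀ {μ : ℂ} {t s : ℝ}, μ ≠ 0 → s ≠ 0 → (t : ℂ) * Complex.sinh μ = s * μ →
      ((t / s : ℝ) : ℂ) * sinhc μ = 1 := by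
    intro μ t s hμ hs h
    have hs' : (s : ℂ) ≠ 0 := by exact_mod_cast hs
    refine mul_right_cancel₀ hμ ?_
    rw [mul_assoc, sinhc_mul, one_mul, Complex.ofReal_div, div_mul_eq_mul_div, h]
    field_simp
  by_cases hβ0 : x * ‖β‖ ^ 2 = 0
  · refine ⟨0, ?_, 1, by simp [sinhc_zero], ?_⟩
    · rw [hβ0, sub_zero, pow_eq_one_iff_of_nonneg (norm_nonneg _) two_ne_zero] at hdet
      rw [Complex.cosh_zero, hdet, Complex.ofReal_one]
    · have : (x : ℂ) * (‖β‖ : ℂ) ^ 2 = 0 := by exact_mod_cast hβ0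
      simp [this]
  · have hx : x ≠ 0 := fun h => hβ0 (by simp [h])
    have hβ' : 0 < ‖β‖ := norm_pos_iff.2 fun h => hβ0 (by simp [h])
    rcases lt_or_gt_of_ne hx with hx | hx
    -- for `x < 0` take `μ = i θ` with `cos θ = |α|`, for `x > 0` take `μ = θ` with
    -- `sinh θ = √x |β|`; in both cases `r = θ / (√|x| |β|)`
    · have hy : 0 < √(-x) := Real.sqrt_pos.2 (neg_pos.2 hx)
      have hy2 : √(-x) ^ 2 = -x := Real.sq_sqrt (neg_pos.2 hx).le
      have hs : 0 < √(-x) * ‖β‖ := mul_pos hy hβ'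
      have hsin : Real.sin (Real.arccos ‖g.1.1 0 0‖) = √(-x) * ‖β‖ := by
        rw [Real.sin_arccos, Real.sqrt_eq_iff_mul_self_eq_of_pos hs, ← sq, mul_pow, hy2]
        linarith
      have hθ : Real.arccos ‖g.1.1 0 0‖ ≠ 0 := by
        intro h
        rw [h, Real.sin_zero] at hsin
        exact hs.ne hsin
      have hle : ‖g.1.1 0 0‖ ≤ 1 := by
        have : ‖g.1.1 0 0‖ ^ 2 ≤ 1 ^ 2 := by nlinarith [sq_nonneg ‖β‖]
        exact (pow_le_pow_iff_left₀ (norm_nonneg _) zero_le_one two_ne_zero).1 this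
      set θ := Real.arccos ‖g.1.1 0 0‖ with hθd
      refine ⟨θ * Complex.I, ?_, θ / (√(-x) * ‖β‖), hsinh ?_ hs.ne' ?_, ?_⟩
      · rw [Complex.cosh_mul_I, ← Complex.ofReal_cos, hθd,
          Real.cos_arccos (by linarith [norm_nonneg (g.1.1 0 0)]) hle]
      · exact mul_ne_zero (by exact_mod_cast hθ) Complex.I_ne_zero
      · rw [Complex.sinh_mul_I, ← Complex.ofReal_sin, hsin]
        ring
      · rw [mul_pow, Complex.I_sq]
        have : (θ / (√(-x) * ‖β‖) * ‖β‖) ^ 2 * x = -θ ^ 2 := by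
          field_simp
          rw [hy2]
          ring
        have h' := congrArg (fun r : ℝ => (r : ℂ)) this
        push_cast at h' ⊢
        linear_combination -h'
    · have hy : 0 < √x := Real.sqrt_pos.2 hx
      have hy2 : √x ^ 2 = x := Real.sq_sqrt hx.le
      have hs : 0 < √x * ‖β‖ := mul_pos hy hβ'
      have hθ : 0 < Real.arsinh (√x * ‖β‖) := Real.arsinh_pos_iff.2 hs
      set θ := Real.arsinh (√x * ‖β‖) with hθd
      refine ⟨θ, ?_, θ / (√x * ‖β‖), hsinh ?_ hs.ne' ?_, ?_⟩
      · rw [← Complex.ofReal_cosh, hθd, Real.cosh_arsinh, mul_pow, hy2]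
        congr 1
        rw [Real.sqrt_eq_iff_mul_self_eq (by positivity) (norm_nonneg _)]
        linarith
      · exact_mod_cast hθ.ne'
      · rw [← Complex.ofReal_sinh, hθd, Real.sinh_arsinh, mul_comm]
      · have : (θ / (√x * ‖β‖) * ‖β‖) ^ 2 * x = θ ^ 2 := by
          field_simp
          rw [hy2]
        have h' := congrArg (fun r : ℝ => (r : ℂ)) this
        push_cast at h' ⊢
        linear_combination -h'

/-- Conjugation by the torus rotates the off-diagonal part of the real Lie algebra. -/
lemma torus_mul_expReal (w : Circle) (b : ℂ) :
    torus x w * expReal x (realElt x 0 b) = expReal x (realElt x 0 ((w : ℂ) ^ 2 * b)) * torus x w := by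
  have hw : (w : ℂ) * conj (w : ℂ) = 1 := by simp [Complex.mul_conj]
  obtain ⟨μ, hμ⟩ := IsAlgClosed.exists_pow_nat_eq ((x : ℂ) * Complex.normSq b) two_pos
  have hn : (Complex.normSq ((w : ℂ) ^ 2 * b) : ℂ) = Complex.normSq b := by simp
  obtain ⟨h0, h1⟩ := expReal_realElt (x := x) 0 b (μ := μ) (by simpa using hμ)
  obtain ⟨k0, k1⟩ := polar_entries (x := x) ((w : ℂ) ^ 2 * b) w (μ := μ) (by rw [hn]; exact hμ)
  have : (torus x w * expReal x (realElt x 0 b)).1.1.1 =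
    (torus x w).1.1.1 * (expReal x (realElt x 0 b)).1.1.1 := rfl
  refine realGroup_ext ?_ ?_
  · rw [k0, this, torus_apply]
    simp [Matrix.mul_apply, Fin.sum_univ_two, h0, mul_comm]
  · rw [k1, this, torus_apply]
    simp only [Matrix.mul_apply, Fin.sum_univ_two, h1]
    simp
    linear_combination (-(w : ℂ) * sinhc μ * b) * hw

/-! ### The motion group and the contraction maps -/

lemma motion_entries (b : ℂ) (w : Circle) :
    (expReal 0 (realElt 0 0 b) * torus 0 w).1.1.1 0 0 = w ∧
    (expReal 0 (realElt 0 0 b) * torus 0 w).1.1.1 0 1 = b * conj (w : ℂ) := by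
  have := polar_entries (x := 0) b w (μ := 0) (by simp)
  simpa [sinhc_zero] using this

lemma rotPart_mul_torus (b : ℂ) (w : Circle) :
    rotPart (expReal 0 (realElt 0 0 b) * torus 0 w) = w :=
  Circle.ext (motion_entries b w).1

lemma transPart_mul_torus (b : ℂ) (w : Circle) :
    transPart (expReal 0 (realElt 0 0 b) * torus 0 w) = b := by
  obtain ⟨h0, h1⟩ := motion_entries b w
  have hw : (w : ℂ) * conj (w : ℂ) = 1 := by simp [Complex.mul_conj]
  have e : transPart (expReal 0 (realElt 0 0 b) * torus 0 w) =
    (expReal 0 (realElt 0 0 b) * torus 0 w).1.1.1 0 1 *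
      (expReal 0 (realElt 0 0 b) * torus 0 w).1.1.1 0 0 := rfl
  rw [e, h0, h1]
  linear_combination b * hw

lemma motion_polar (g : realGroup 0) :
    g = expReal 0 (realElt 0 0 (transPart g)) * torus 0 (rotPart g) := by
  obtain ⟨b, w, rfl⟩ := exists_polar g
  rw [rotPart_mul_torus, transPart_mul_torus]

lemma motion_add (b c : ℂ) : expReal 0 (realElt 0 0 (b + c)) =
    expReal 0 (realElt 0 0 b) * expReal 0 (realElt 0 0 c) := by
  have h : ∀ b, (expReal 0 (realElt 0 0 b)).1.1.1 0 0 = 1 ∧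
      (expReal 0 (realElt 0 0 b)).1.1.1 0 1 = b := fun b => by
    simpa using motion_entries b 1
  have h' : (expReal 0 (realElt 0 0 c)).1.1.1 1 1 = 1 := by
    obtain ⟨a1, -⟩ := (mem_realGroup_iff 0 _).1 (expReal 0 (realElt 0 0 c)).2
    have := (h c).1
    change (expReal 0 (realElt 0 0 c)).1.1.1 1 1 = _ at a1
    rw [a1]
    change conj ((expReal 0 (realElt 0 0 c)).1.1.1 0 0) = 1
    rw [this, map_one]
  have h'' : (expReal 0 (realElt 0 0 c)).1.1.1 1 0 = 0 := by
    obtain ⟨-, a2, -⟩ := (mem_realGroup_iff 0 _).1 (expReal 0 (realElt 0 0 c)).2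
    exact a2.trans (by simp)
  have hm : (expReal 0 (realElt 0 0 b) * expReal 0 (realElt 0 0 c)).1.1.1 =
    (expReal 0 (realElt 0 0 b)).1.1.1 * (expReal 0 (realElt 0 0 c)).1.1.1 := rfl
  refine realGroup_ext ?_ ?_
  · rw [hm, Matrix.mul_apply, Fin.sum_univ_two, (h _).1, (h _).1, (h _).1, h'']
    simp
  · rw [hm, Matrix.mul_apply, Fin.sum_univ_two, (h _).2, (h b).2, (h b).1, (h c).2, h']
    ring

lemma continuous_entry (i j : Fin 2) : Continuous fun g : realGroup x => g.1.1.1 i j := by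
  have h1 : Continuous fun g : realGroup x => g.1.1 := continuous_fst.comp continuous_subtype_val
  have h2 : Continuous fun S : SL2C => S.1 := continuous_subtype_val
  exact (h2.comp h1).matrix_elem i j

lemma continuous_transPart : Continuous transPart :=
  (continuous_entry 0 1).mul (continuous_entry 0 0)

lemma continuous_rotPart : Continuous rotPart :=
  Continuous.subtype_mk (continuous_entry 0 0) _

lemma isoSU11_entries (hx : 0 < x) (g : realGroup x) :
    (isoSU11 x hx g).1.1 0 0 = g.1.1.1 0 0 ∧ (isoSU11 x hx g).1.1 0 1 = √x * g.1.1.1 0 1 :=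
  ⟨rfl, rfl⟩

lemma isoSU2_entries (hx : x < 0) (g : realGroup x) :
    (isoSU2 x hx g).1 0 0 = g.1.1.1 0 0 ∧ (isoSU2 x hx g).1 0 1 = √(-x) * g.1.1.1 0 1 :=
  ⟨rfl, rfl⟩

lemma SU11_ext {g h : SU11} (h0 : g.1.1 0 0 = h.1.1 0 0) (h1 : g.1.1 0 1 = h.1.1 0 1) : g = h := by
  obtain ⟨a1, a2⟩ := g.2
  obtain ⟨b1, b2⟩ := h.2
  refine Subtype.ext (Subtype.ext ?_)
  ext i j
  fin_cases i <;> fin_cases j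
  · exact h0
  · exact h1
  · exact a1.trans ((congrArg _ h1).trans b1.symm)
  · exact a2.trans ((congrArg _ h0).trans b2.symm)

lemma SU2_ext {g h : SU2} (h0 : g.1 0 0 = h.1 0 0) (h1 : g.1 0 1 = h.1 0 1) : g = h := by
  obtain ⟨a1, a2, -⟩ := (mem_SU2_iff _).1 g.2
  obtain ⟨b1, b2, -⟩ := (mem_SU2_iff _).1 h.2
  refine Subtype.ext ?_
  ext i j
  fin_cases i <;> fin_cases j
  · exact h0
  · exact h1
  · exact a1.trans ((congrArg (fun z => -conj z) h1).trans b1.symm)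
  · exact a2.trans ((congrArg _ h0).trans b2.symm)

/-- The contraction to `SU(1,1)` is, after the identification with the real group over `ε²`, the
identity in polar coordinates. -/
lemma contractSU11_eq {ε : ℝ} (hε : 0 < ε) (g : realGroup 0) :
    contractSU11 ε g = isoSU11 (ε ^ 2) (pow_pos hε 2)
      (expReal (ε ^ 2) (realElt (ε ^ 2) 0 (transPart g)) * torus (ε ^ 2) (rotPart g)) := by
  obtain ⟨μ, hμ⟩ := IsAlgClosed.exists_pow_nat_eq
    (((ε ^ 2 : ℝ) : ℂ) * Complex.normSq (transPart g)) two_pos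
  obtain ⟨h0, h1⟩ := polar_entries (x := ε ^ 2) (transPart g) (rotPart g) hμ
  obtain ⟨k0, k1⟩ := polar_entries (x := 1) (ε * transPart g) (rotPart g) (μ := μ) (by
    rw [hμ]; simp only [map_mul, Complex.normSq_ofReal]; push_cast; ring)
  refine SU11_ext ?_ ?_
  · exact k0.trans h0.symm
  · refine ((isoSU11_entries _ _).2.trans ?_).trans (isoSU11_entries _ _).2.symm
    rw [k1, h1, Real.sqrt_one, Real.sqrt_sq hε.le, Complex.ofReal_one]
    ring

lemma contractSU2_eq {ε : ℝ} (hε : 0 < ε) {y : ℝ} (hy : y < 0) (h : y = -ε ^ 2) (g : realGroup 0) :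
    contractSU2 ε g = isoSU2 y hy (expReal y (realElt y 0 (transPart g)) *
      torus y (rotPart g)) := by
  obtain ⟨μ, hμ⟩ := IsAlgClosed.exists_pow_nat_eq
    ((y : ℂ) * Complex.normSq (transPart g)) two_pos
  obtain ⟨h0, h1⟩ := polar_entries (x := y) (transPart g) (rotPart g) hμ
  obtain ⟨k0, k1⟩ := polar_entries (x := -1) (ε * transPart g) (rotPart g) (μ := μ) (by
    rw [hμ, h]; simp only [map_mul, Complex.normSq_ofReal]; push_cast; ring)
  refine SU2_ext ?_ ?_
  · exact k0.trans h0.symm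
  · refine ((isoSU2_entries _ _).2.trans ?_).trans (isoSU2_entries _ _).2.symm
    rw [k1, h1, neg_neg, h, neg_neg, Real.sqrt_one, Real.sqrt_sq hε.le, Complex.ofReal_one]
    ring

end ContractionFamilies
end

noncomputable section

namespace ContractionFamilies

/-! ### Differentiable vectors -/

namespace UnitaryRep

section Basic

variable {G : Type*} [Group G] [TopologicalSpace G] {H : Type*} [NormedAddCommGroup H]
  [InnerProductSpace ℂ H] (π : UnitaryRep G H)

lemma toHom_mul (g h : G) (v : H) : π.toHom (g * h) v = π.toHom g (π.toHom h v) := by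
  rw [map_mul]; rfl

lemma toHom_one (v : H) : π.toHom 1 v = v := by
  rw [map_one]; rfl

lemma toHom_inv_apply (g : G) (v : H) : π.toHom g⁻¹ (π.toHom g v) = v := by
  rw [← toHom_mul, inv_mul_cancel, toHom_one]

lemma inner_toHom_left (g : G) (v w : H) : ⟪π.toHom g v, w⟫_ℂ = ⟪v, π.toHom g⁻¹ w⟫_ℂ := by
  rw [← (π.toHom g⁻¹).inner_map_map, toHom_inv_apply]

lemma ext {π π' : UnitaryRep G H} (h : ∀ g v, π.toHom g v = π'.toHom g v) : π = π' := by
  cases π; cases π'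
  congr
  ext g v
  exact h g v

end Basic

variable {x : ℝ} {H : Type*} [NormedAddCommGroup H] [InnerProductSpace ℂ H]
  {π : UnitaryRep (realGroup x) H} {Y : realForm x}

lemma IsDerivative.hasDerivAt {v w : H} (h : π.IsDerivative Y v w) (t : ℝ) :
    HasDerivAt (fun t : ℝ => π.toHom (expReal x (t • Y)) v) (π.toHom (expReal x (t • Y)) w) t := by
  have h1 : HasDerivAt (fun s : ℝ => π.toHom (expReal x ((s - t) • Y)) v) w t := by
    have : HasDerivAt (fun t : ℝ => π.toHom (expReal x (t • Y)) v) w (t - t) := by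
      rw [sub_self]; exact h
    exact this.comp_sub_const t t
  have h2 := ((π.toHom (expReal x (t • Y))).toContinuousLinearEquiv.toContinuousLinearMap
    |>.restrictScalars ℝ).hasFDerivAt.comp_hasDerivAt t h1
  refine h2.congr_of_eventuallyEq (Eventually.of_forall fun s => ?_)
  change _ = π.toHom (expReal x (t • Y)) (π.toHom (expReal x ((s - t) • Y)) v)
  rw [← toHom_mul, ← expReal_add_smul, add_sub_cancel]

lemma IsDerivative.add {v v' w w' : H} (h : π.IsDerivative Y v w) (h' : π.IsDerivative Y v' w') :
    π.IsDerivative Y (v + v') (w + w') := by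
  unfold IsDerivative
  simp only [map_add]
  exact HasDerivAt.add h h'

lemma IsDerivative.smul {v w : H} (c : ℂ) (h : π.IsDerivative Y v w) :
    π.IsDerivative Y (c • v) (c • w) := by
  unfold IsDerivative
  simp only [map_smul]
  exact HasDerivAt.const_smul c h

lemma isDerivative_zero : π.IsDerivative Y 0 0 := by
  unfold IsDerivative
  simp only [map_zero]
  exact hasDerivAt_const _ _

lemma isDerivative_sum {ι : Type*} (s : Finset ι) {v w : ι → H}
    (h : ∀ i ∈ s, π.IsDerivative Y (v i) (w i)) :
    π.IsDerivative Y (∑ i ∈ s, v i) (∑ i ∈ s, w i) := by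
  unfold IsDerivative
  simp only [map_sum]
  exact HasDerivAt.fun_sum h

/-- The real Lie algebra acts by skew-symmetric operators. -/
lemma IsDerivative.inner_left {v v' w w' : H} (h : π.IsDerivative Y v v')
    (h' : π.IsDerivative Y w w') : ⟪v, w'⟫_ℂ = -⟪v', w⟫_ℂ := by
  have h1 := HasDerivAt.inner ℂ h h'
  have h2 : (fun t : ℝ => ⟪π.toHom (expReal x (t • Y)) v, π.toHom (expReal x (t • Y)) w⟫_ℂ) =
      fun _ => ⟪v, w⟫_ℂ := funext fun t => LinearIsometryEquiv.inner_map_map _ _ _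
  rw [h2] at h1
  have h3 := h1.unique (hasDerivAt_const _ _)
  rw [zero_smul, expReal_zero, toHom_one, toHom_one] at h3
  exact eq_neg_of_add_eq_zero_left h3

lemma IsDerivative.mem {v w : H} (h : π.IsDerivative Y v w) {W : Submodule ℂ H}
    (hW : IsClosed (W : Set H)) (hinv : ∀ g, ∀ v ∈ W, π.toHom g v ∈ W) (hv : v ∈ W) : w ∈ W := by
  refine hW.mem_of_tendsto (hasDerivAt_iff_tendsto_slope.1 h) (Eventually.of_forall fun t => ?_)
  rw [slope_def_module]
  exact (W.restrictScalars ℝ).smul_mem _ (W.sub_mem (hinv _ _ hv) (hinv _ _ hv))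

/-- Taylor's formula for the one-parameter group generated by `Y`, on a space of vectors that are
differentiable in the direction of `Y` infinitely often. -/
theorem norm_toHom_sub_taylor_le {V : Type*} [AddCommGroup V] [Module ℂ V] (Φ : V →ₗ[ℂ] H)
    (T : V →ₗ[ℂ] V) (hT : ∀ v, π.IsDerivative Y (Φ v) (Φ (T v))) (n : ℕ) (v : V) {t : ℝ}
    (ht : 0 ≤ t) : ‖π.toHom (expReal x (t • Y)) (Φ v) -
      ∑ k ∈ Finset.range n, ((t ^ k / k.factorial : ℝ) : ℂ) • Φ ((T ^ k) v)‖ ≤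
        t ^ n / n.factorial * ‖Φ ((T ^ n) v)‖ := by
  induction n generalizing v t with
  | zero => simp
  | succ n ih =>
    have hd : ∀ s : ℝ, HasDerivAt (fun s : ℝ => π.toHom (expReal x (s • Y)) (Φ v) -
        ∑ k ∈ Finset.range (n + 1), ((s ^ k / k.factorial : ℝ) : ℂ) • Φ ((T ^ k) v))
        (π.toHom (expReal x (s • Y)) (Φ (T v)) -
          ∑ k ∈ Finset.range n, ((s ^ k / k.factorial : ℝ) : ℂ) • Φ ((T ^ k) (T v))) s := by
      intro s
      refine ((hT v).hasDerivAt s).sub ?_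
      simp only [Finset.sum_range_succ']
      rw [← add_zero (∑ k ∈ Finset.range n, _)]
      refine HasDerivAt.add (HasDerivAt.fun_sum fun k _ => ?_) (by simpa using hasDerivAt_const _ _)
      have h1 : HasDerivAt (fun s : ℝ => s ^ (k + 1) / ((k + 1).factorial : ℝ))
          (s ^ k / k.factorial) s := by
        have := (hasDerivAt_pow (k + 1) s).div_const ((k + 1).factorial : ℝ)
        refine this.congr_deriv ?_
        rw [Nat.factorial_succ]
        push_cast
        field_simp
      exact h1.ofReal_comp.smul_const _
    have hB : ∀ s : ℝ, HasDerivAt (fun s : ℝ => s ^ (n + 1) / ((n + 1).factorial : ℝ) *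
        ‖Φ ((T ^ (n + 1)) v)‖) (s ^ n / n.factorial * ‖Φ ((T ^ (n + 1)) v)‖) s := by
      intro s
      have := ((hasDerivAt_pow (n + 1) s).div_const ((n + 1).factorial : ℝ)).mul_const
        ‖Φ ((T ^ (n + 1)) v)‖
      refine this.congr_deriv ?_
      rw [Nat.factorial_succ]
      push_cast
      field_simp
    refine image_norm_le_of_norm_deriv_right_le_deriv_boundary (a := 0) (b := t)
      (f := fun s : ℝ => π.toHom (expReal x (s • Y)) (Φ v) -
        ∑ k ∈ Finset.range (n + 1), ((s ^ k / k.factorial : ℝ) : ℂ) • Φ ((T ^ k) v))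
      (fun s _ => (hd s).continuousAt.continuousWithinAt) (fun s _ => (hd s).hasDerivWithinAt)
      ?_ hB ?_ (Set.right_mem_Icc.2 ht)
    · simp [Finset.sum_range_succ', expReal_zero]
    · intro s hs
      have := ih (T v) hs.1
      rwa [← Module.End.mul_apply, ← pow_succ] at this

/-- An eigenvector of the generator of the torus is a weight vector. -/
lemma IsDerivative.toHom_torus {v : H} {k : ℤ}
    (h : π.IsDerivative (realElt x 1 0) v ((Complex.I * k) • v)) (w : Circle) :
    π.toHom (torus x w) v = ((w : ℂ) ^ k) • v := by
  obtain ⟨t, rfl⟩ := Circle.exp_surjective w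
  have hexp : ∀ s : ℝ, HasDerivAt (fun s : ℝ => Complex.exp (-(Complex.I * k) * s))
      (Complex.exp (-(Complex.I * k) * s) * -(Complex.I * k)) s := fun s => by
    have := ((hasDerivAt_id (s : ℂ)).const_mul (-(Complex.I * k))).cexp.comp_ofReal
    simpa using this
  have hconst : ∀ s : ℝ, HasDerivAt (fun s : ℝ => Complex.exp (-(Complex.I * k) * s) •
      π.toHom (expReal x (s • realElt x 1 0)) v) 0 s := by
    intro s
    refine ((hexp s).smul (h.hasDerivAt s)).congr_deriv ?_
    rw [map_smul]
    module
  have h0 := is_const_of_deriv_eq_zero (fun s => (hconst s).differentiableAt)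
    (fun s => (hconst s).deriv) t 0
  simp only [Complex.ofReal_zero, mul_zero, Complex.exp_zero, one_smul, zero_smul, expReal_zero,
    toHom_one] at h0
  rw [← expReal_smul_one, ← h0, Circle.coe_exp, smul_smul, ← Complex.exp_int_mul, ← Complex.exp_add]
  have : (k : ℂ) * (t * Complex.I) + -(Complex.I * k) * t = 0 := by ring
  rw [h0, this, Complex.exp_zero, one_smul]

end UnitaryRep

/-- To prove a multiplicative property of the elements of a real group, it suffices to consider the
torus and small elements `exp [0, b; x conj b, 0]`. -/
lemma realGroup_induction {x : ℝ} {p : realGroup x → Prop} (hmul : ∀ g h, p g → p h → p (g * h))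
    (htorus : ∀ w, p (torus x w)) {δ : ℝ} (hδ : 0 < δ)
    (hsmall : ∀ b : ℂ, ‖b‖ < δ → p (expReal x (realElt x 0 b))) (g : realGroup x) : p g := by
  obtain ⟨b, w, rfl⟩ := exists_polar g
  refine hmul _ _ ?_ (htorus w)
  obtain ⟨n, hn⟩ := exists_nat_gt (‖b‖ / δ)
  have hn0 : 0 < (n : ℝ) := lt_of_le_of_lt (by positivity) hn
  have h1 : realElt x 0 b = (n : ℝ) • realElt x 0 (b / n) := by
    have : (n : ℂ) ≠ 0 := by exact_mod_cast hn0.ne'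
    rw [smul_realElt, mul_zero]
    congr 1
    push_cast
    field_simp
  rw [h1, expReal_nsmul]
  have h2 : p (expReal x (realElt x 0 (b / n))) := by
    refine hsmall _ ?_
    rw [norm_div, Complex.norm_natCast, div_lt_iff₀ hn0]
    rwa [div_lt_iff₀ hδ, mul_comm] at hn
  have h3 : ∀ k : ℕ, p (expReal x (realElt x 0 (b / n)) ^ k) := by
    intro k
    induction k with
    | zero => simpa using htorus 1
    | succ k ih => rw [pow_succ]; exact hmul _ _ ih h2
  exact h3 n

end ContractionFamilies
end

noncomputable section

namespace ContractionFamilies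

/-! ### Ladders of weight vectors -/

/-- The coefficient `√(1 + (2 j + 1)² x) / 2` of the raising operator between normalized weight
vectors. -/
def sCoef (x : ℝ) (j : ℤ) : ℝ := √(1 + (2 * (j : ℝ) + 1) ^ 2 * x) / 2

lemma sCoef_nonneg (x : ℝ) (j : ℤ) : 0 ≤ sCoef x j := by unfold sCoef; positivity

lemma sCoef_neg_sub_one (x : ℝ) (j : ℤ) : sCoef x (-j - 1) = sCoef x j := by
  unfold sCoef
  congr 3
  push_cast
  ring

lemma sCoef_le (x : ℝ) (j : ℤ) {m : ℕ} (h : j ≤ m) (h' : -(m + 1 : ℤ) ≤ j) :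
    sCoef x j ≤ (m + 1) * (1 + |x|) := by
  have h1 : √(1 + (2 * (j : ℝ) + 1) ^ 2 * x) ≤ 2 * (m + 1) * (1 + |x|) := by
    rw [Real.sqrt_le_left (by positivity)]
    have h2 : (2 * (j : ℝ) + 1) ^ 2 ≤ (2 * (m : ℝ) + 1) ^ 2 := by
      rw [sq_le_sq, abs_of_nonneg (by positivity : (0 : ℝ) ≤ 2 * m + 1)]
      have : |2 * j + 1| ≤ 2 * m + 1 := abs_le.2 ⟨by omega, by omega⟩
      exact_mod_cast this
    have h3 : (2 * (j : ℝ) + 1) ^ 2 * x ≤ (2 * (m : ℝ) + 1) ^ 2 * |x| :=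
      (mul_le_mul_of_nonneg_left (le_abs_self x) (sq_nonneg _)).trans
        (mul_le_mul_of_nonneg_right h2 (abs_nonneg x))
    have hx := abs_nonneg x
    have hm : (0 : ℝ) ≤ m := Nat.cast_nonneg m
    have h4 : (2 * (m : ℝ) + 1) ^ 2 * |x| ≤ (2 * (m + 1)) ^ 2 * |x| :=
      mul_le_mul_of_nonneg_right (by nlinarith) hx
    have h5 : (1 : ℝ) ≤ (2 * (m + 1)) ^ 2 := by nlinarith
    rw [mul_pow]
    nlinarith [mul_nonneg hx hx]
  unfold sCoef
  linarith

/-- The action of the element `realElt x a b` on a ladder. -/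
def ladderOp (x a : ℝ) (b : ℂ) : (ℤ →₀ ℂ) →ₗ[ℂ] (ℤ →₀ ℂ) :=
  Finsupp.linearCombination ℂ fun j => Finsupp.single j (2 * Complex.I * a * j) +
    (Finsupp.single (j + 1) (b * sCoef x j) - Finsupp.single (j - 1) (conj b * sCoef x (j - 1)))

lemma ladderOp_single (x a : ℝ) (b : ℂ) (j : ℤ) : ladderOp x a b (Finsupp.single j 1) =
    (2 * Complex.I * a * j) • Finsupp.single j 1 + ((b * sCoef x j) • Finsupp.single (j + 1) 1 -
      (conj b * sCoef x (j - 1)) • Finsupp.single (j - 1) 1) := by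
  simp [ladderOp, Finsupp.smul_single]

/-- A ladder for a unitary representation of the real group over `x`: a family of vectors `u j` of
weight `2 j` that are orthogonal, of length one if `dv x j ≠ 0` and zero otherwise, on which the
real Lie algebra acts as on the normalized standard basis of the Jantzen quotient. -/
structure HasLadder {x : ℝ} {H : Type*} [NormedAddCommGroup H] [InnerProductSpace ℂ H]
    (π : UnitaryRep (realGroup x) H) (u : ℤ → H) : Prop where
  inner_eq : ∀ i j, ⟪u i, u j⟫_ℂ = if i = j ∧ dv x j ≠ 0 then 1 else 0
  deriv : ∀ (a : ℝ) (b : ℂ) (j : ℤ), π.IsDerivative (realElt x a b) (u j)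
    ((2 * Complex.I * a * j) • u j + ((b * sCoef x j) • u (j + 1) -
      (conj b * sCoef x (j - 1)) • u (j - 1)))

/-- The span of the family is dense. -/
def DenseSpan {H : Type*} [NormedAddCommGroup H] [InnerProductSpace ℂ H] (u : ℤ → H) : Prop :=
  (Submodule.span ℂ (Set.range u)).topologicalClosure = ⊤

section Dense

variable {H H' : Type*} [NormedAddCommGroup H] [InnerProductSpace ℂ H]
  [NormedAddCommGroup H'] [InnerProductSpace ℂ H'] {u : ℤ → H}

lemma DenseSpan.induction (hu : DenseSpan u) {p : H → Prop} (hp : ∀ j, p (u j))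
    (hadd : ∀ v w, p v → p w → p (v + w)) (hsmul : ∀ (c : ℂ) v, p v → p (c • v))
    (hclosed : IsClosed {v | p v}) (v : H) : p v := by
  have hv : v ∈ (Submodule.span ℂ (Set.range u)).topologicalClosure := by rw [hu]; trivial
  rw [← SetLike.mem_coe, Submodule.topologicalClosure_coe] at hv
  refine closure_minimal (fun w hw => ?_) hclosed hv
  refine Submodule.span_induction (p := fun w _ => p w) ?_ ?_ (fun _ _ _ _ => hadd _ _)
    (fun c _ _ => hsmul c _) hw
  · rintro _ ⟨j, rfl⟩
    exact hp j
  · have := hsmul 0 _ (hp 0)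
    rwa [zero_smul] at this

lemma DenseSpan.eq_top (hu : DenseSpan u) {W : Submodule ℂ H} (hW : IsClosed (W : Set H))
    (h : ∀ j, u j ∈ W) : W = ⊤ := by
  rw [eq_top_iff]
  rintro v -
  exact hu.induction (p := (· ∈ W)) h (fun _ _ => W.add_mem) (fun c _ => W.smul_mem c) hW v

lemma DenseSpan.eq_zero (hu : DenseSpan u) {v : H} (h : ∀ j, ⟪u j, v⟫_ℂ = 0) : v = 0 := by
  have : ⟪v, v⟫_ℂ = 0 := by
    refine hu.induction (p := fun w => ⟪w, v⟫_ℂ = 0) h ?_ ?_ ?_ v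
    · intro a b ha hb
      rw [inner_add_left, ha, hb, add_zero]
    · intro c a ha
      rw [inner_smul_left, ha, mul_zero]
    · exact isClosed_eq (by fun_prop) continuous_const
  exact inner_self_eq_zero.1 this

lemma denseSpan_of_eq_zero [CompleteSpace H] (h : ∀ v, (∀ j, ⟪u j, v⟫_ℂ = 0) → v = 0) :
    DenseSpan u := by
  unfold DenseSpan
  rw [Submodule.topologicalClosure_eq_top_iff, Submodule.eq_bot_iff]
  intro v hv
  exact h v fun j => (Submodule.mem_orthogonal _ v).1 hv _ (Submodule.subset_span ⟨j, rfl⟩)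

lemma DenseSpan.map (hu : DenseSpan u) (U : H ≃ₗᵢ[ℂ] H') {u' : ℤ → H'} (h : ∀ j, U (u j) = u' j) :
    DenseSpan u' := by
  unfold DenseSpan
  rw [eq_top_iff]
  rintro v -
  have := hu.induction (p := fun w => U w ∈ (Submodule.span ℂ (Set.range u')).topologicalClosure)
    (fun j => by rw [h]; exact Submodule.le_topologicalClosure _ (Submodule.subset_span ⟨j, rfl⟩))
    (fun v w hv hw => by rw [map_add]; exact Submodule.add_mem _ hv hw)
    (fun c v hv => by rw [map_smul]; exact Submodule.smul_mem _ _ hv)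
    ((Submodule.isClosed_topologicalClosure _).preimage U.continuous) (U.symm v)
  simpa using this

/-- A dense family and a second family that is orthonormal where the first does not vanish are
related by an isometry. -/
lemma DenseSpan.exists_isometry [CompleteSpace H] [CompleteSpace H'] (hu : DenseSpan u)
    {S : Set ℤ} (hz : ∀ j, j ∉ S → u j = 0)
    (h1 : ∀ i ∈ S, ∀ j ∈ S, ⟪u i, u j⟫_ℂ = if i = j then 1 else 0) {u' : ℤ → H'}
    (h2 : ∀ i ∈ S, ∀ j ∈ S, ⟪u' i, u' j⟫_ℂ = if i = j then 1 else 0) :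
    ∃ U : H →ₗᵢ[ℂ] H', ∀ j ∈ S, U (u j) = u' j := by
  classical
  have o1 : Orthonormal ℂ fun j : S => u j := by
    rw [orthonormal_iff_ite]
    rintro ⟨i, hi⟩ ⟨j, hj⟩
    simp [h1 i hi j hj]
  have o2 : Orthonormal ℂ fun j : S => u' j := by
    rw [orthonormal_iff_ite]
    rintro ⟨i, hi⟩ ⟨j, hj⟩
    simp [h2 i hi j hj]
  have hsp : ⊤ ≤ (Submodule.span ℂ (Set.range fun j : S => u j)).topologicalClosure := by
    rw [← hu]
    refine Submodule.topologicalClosure_mono (Submodule.span_le.2 ?_)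
    rintro _ ⟨j, rfl⟩
    by_cases hj : j ∈ S
    · exact Submodule.subset_span ⟨⟨j, hj⟩, rfl⟩
    · rw [hz j hj]; exact Submodule.zero_mem _
  let B := HilbertBasis.mk o1 hsp
  refine ⟨o2.orthogonalFamily.linearIsometry.comp B.repr.toLinearIsometry, fun j hj => ?_⟩
  have : u j = B ⟨j, hj⟩ := by rw [HilbertBasis.coe_mk]
  rw [this]
  change o2.orthogonalFamily.linearIsometry (B.repr (B ⟨j, hj⟩)) = _
  rw [HilbertBasis.repr_self, OrthogonalFamily.linearIsometry_apply_single]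
  simp

end Dense

namespace HasLadder

variable {x : ℝ} {H : Type*} [NormedAddCommGroup H] [InnerProductSpace ℂ H]
  {π : UnitaryRep (realGroup x) H} {u : ℤ → H} (hu : HasLadder π u)
include hu

lemma eq_zero {j : ℤ} (hj : dv x j = 0) : u j = 0 := by
  rw [← inner_self_eq_zero (𝕜 := ℂ), hu.inner_eq, if_neg fun h => h.2 hj]

lemma ne_zero {j : ℤ} (hj : dv x j ≠ 0) : u j ≠ 0 := fun h => by
  have := hu.inner_eq j j
  rw [h, inner_zero_left, if_pos ⟨rfl, hj⟩] at this
  exact zero_ne_one this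

lemma norm_le (j : ℤ) : ‖u j‖ ≤ 1 := by
  have := norm_sq_eq_re_inner (𝕜 := ℂ) (u j)
  rw [hu.inner_eq] at this
  by_cases hj : dv x j = 0
  · rw [hu.eq_zero hj, norm_zero]; exact zero_le_one
  · rw [if_pos ⟨rfl, hj⟩] at this
    have h2 : ‖u j‖ ^ 2 = 1 := by simpa using this
    nlinarith [norm_nonneg (u j)]

lemma torus (w : Circle) (j : ℤ) :
    π.toHom (torus x w) (u j) = ((w : ℂ) ^ (2 * j)) • u j := by
  refine UnitaryRep.IsDerivative.toHom_torus ?_ w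
  have := hu.deriv 1 0 j
  simp only [Complex.ofReal_one, mul_one, zero_mul, zero_smul, map_zero, sub_self, add_zero] at this
  convert this using 2
  push_cast
  ring

lemma isDerivative (a : ℝ) (b : ℂ) (c : ℤ →₀ ℂ) : π.IsDerivative (realElt x a b)
    (Finsupp.linearCombination ℂ u c) (Finsupp.linearCombination ℂ u (ladderOp x a b c)) := by
  have h1 : ∀ j, π.IsDerivative (realElt x a b) (Finsupp.linearCombination ℂ u (Finsupp.single j 1))
      (Finsupp.linearCombination ℂ u (ladderOp x a b (Finsupp.single j 1))) := by
    intro j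
    rw [ladderOp_single]
    simp only [map_add, map_sub, map_smul, Finsupp.linearCombination_single, one_smul]
    exact hu.deriv a b j
  obtain ⟨s, hs⟩ : ∃ s : Finset ℤ, c = ∑ j ∈ s, Finsupp.single j (c j) :=
    ⟨_, (Finsupp.sum_single c).symm⟩
  rw [hs]
  simp only [map_sum]
  refine UnitaryRep.isDerivative_sum _ fun j _ => ?_
  have := (h1 j).smul (c j)
  rwa [← map_smul, ← map_smul, ← map_smul, Finsupp.smul_single, smul_eq_mul, mul_one] at this

omit hu in
lemma norm_ladderOp_pow_le (hn : ∀ j, ‖u j‖ ≤ 1) (b : ℂ) (n : ℕ) {m : ℕ} {j : ℤ}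
    (hj : j.natAbs ≤ m) :
    ‖Finsupp.linearCombination ℂ u ((ladderOp x 0 b ^ n) (Finsupp.single j 1))‖ ≤
      (2 * ‖b‖ * (1 + |x|)) ^ n * ((m + 1).ascFactorial n : ℝ) := by
  induction n generalizing m j with
  | zero => simpa using hn j
  | succ n ih =>
    rw [pow_succ, Module.End.mul_apply, ladderOp_single]
    simp only [Complex.ofReal_zero, mul_zero, zero_mul, zero_smul, zero_add, map_sub, map_smul]
    have i1 := ih (m := m + 1) (j := j + 1) (by omega)
    have i2 := ih (m := m + 1) (j := j - 1) (by omega)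
    have s1 := sCoef_le x j (m := m) (by omega) (by omega)
    have s2 := sCoef_le x (j - 1) (m := m) (by omega) (by omega)
    have e : ((m + 1).ascFactorial (n + 1) : ℝ) = (m + 1) * ((m + 1 + 1).ascFactorial n : ℝ) := by
      have h1 := Nat.succ_ascFactorial (m + 1) n
      rw [Nat.ascFactorial_succ, ← h1]
      push_cast
      ring
    have hA : (0 : ℝ) ≤ (2 * ‖b‖ * (1 + |x|)) ^ n * ((m + 1 + 1).ascFactorial n : ℝ) := by
      positivity
    refine (norm_sub_le _ _).trans ?_
    rw [norm_smul, norm_smul, norm_mul, norm_mul, RCLike.norm_conj, Complex.norm_real,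
      Complex.norm_real, Real.norm_of_nonneg (sCoef_nonneg _ _),
      Real.norm_of_nonneg (sCoef_nonneg _ _), e]
    calc _ ≤ ‖b‖ * ((m + 1) * (1 + |x|)) *
            ((2 * ‖b‖ * (1 + |x|)) ^ n * ((m + 1 + 1).ascFactorial n : ℝ)) +
          ‖b‖ * ((m + 1) * (1 + |x|)) *
            ((2 * ‖b‖ * (1 + |x|)) ^ n * ((m + 1 + 1).ascFactorial n : ℝ)) := by
          gcongr
      _ = _ := by ring

/-- Near the identity, the Taylor expansion at a ladder vector converges, uniformly in `x`. -/
theorem norm_toHom_sub_le (b : ℂ) (n : ℕ) (j : ℤ) :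
    ‖π.toHom (expReal x (realElt x 0 b)) (u j) - ∑ k ∈ Finset.range n, ((k.factorial : ℂ)⁻¹) •
      Finsupp.linearCombination ℂ u ((ladderOp x 0 b ^ k) (Finsupp.single j 1))‖ ≤
        2 ^ j.natAbs * (4 * ‖b‖ * (1 + |x|)) ^ n := by
  have h1 := UnitaryRep.norm_toHom_sub_taylor_le (Finsupp.linearCombination ℂ u) (ladderOp x 0 b)
    (hu.isDerivative 0 b) n (Finsupp.single j 1) zero_le_one
  simp only [one_smul, one_pow, Finsupp.linearCombination_single] at h1
  have h2 := norm_ladderOp_pow_le (x := x) hu.norm_le b n (le_refl j.natAbs)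
  have h3 : ((j.natAbs + 1).ascFactorial n : ℝ) ≤ n.factorial * 2 ^ (j.natAbs + n) := by
    have h4 : (j.natAbs + 1).ascFactorial n ≤ n.factorial * 2 ^ (j.natAbs + n) := by
      rw [Nat.ascFactorial_eq_factorial_mul_choose]
      exact Nat.mul_le_mul_left _ (Nat.choose_le_two_pow _ _)
    exact_mod_cast h4
  have hf : (0 : ℝ) < n.factorial := by positivity
  calc _ = _ := by
        congr 3
        ext k
        simp
    _ ≤ _ := h1
    _ ≤ 1 / n.factorial * ((2 * ‖b‖ * (1 + |x|)) ^ n * (n.factorial * 2 ^ (j.natAbs + n))) := by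
        gcongr
        exact h2.trans (by gcongr)
    _ = _ := by
        rw [pow_add, show (4 : ℝ) = 2 * 2 by norm_num, mul_assoc 2 2 ‖b‖, mul_assoc 2 (2 * ‖b‖),
          mul_pow 2 (2 * ‖b‖ * (1 + |x|))]
        field_simp

end HasLadder

end ContractionFamilies
end

noncomputable section

namespace ContractionFamilies

/-! ### Representations with a dense ladder -/

namespace UnitaryRep

section

variable {G : Type*} [Group G] [TopologicalSpace G] {H H' : Type*} [NormedAddCommGroup H]
  [InnerProductSpace ℂ H] [NormedAddCommGroup H'] [InnerProductSpace ℂ H']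

/-- Transport of a unitary representation to an isometric space. -/
def transport (π : UnitaryRep G H) (U : H ≃ₗᵢ[ℂ] H') : UnitaryRep G H' where
  toHom :=
    { toFun := fun g => (U.symm.trans (π.toHom g)).trans U
      map_one' := by ext v; simp
      map_mul' := fun g h => by ext v; simp }
  continuous_orbit v := U.continuous.comp (π.continuous_orbit (U.symm v))

lemma transport_apply (π : UnitaryRep G H) (U : H ≃ₗᵢ[ℂ] H') (g : G) (v : H') :
    (π.transport U).toHom g v = U (π.toHom g (U.symm v)) := rfl

/-- The restriction of a unitary representation to an invariant subspace. -/
def restrict (π : UnitaryRep G H) (W : Submodule ℂ H) (hW : ∀ g, ∀ v ∈ W, π.toHom g v ∈ W) :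
    UnitaryRep G W where
  toHom :=
    { toFun := fun g =>
        { toFun := fun v => ⟨π.toHom g v, hW g v v.2⟩
          invFun := fun v => ⟨π.toHom g⁻¹ v, hW g⁻¹ v v.2⟩
          left_inv := fun v => Subtype.ext (π.toHom_inv_apply g v)
          right_inv := fun v => Subtype.ext (by
            have := π.toHom_inv_apply g⁻¹ v
            rwa [inv_inv] at this)
          map_add' := fun v w => Subtype.ext (map_add _ _ _)
          map_smul' := fun c v => Subtype.ext (map_smul _ _ _)
          norm_map' := fun v => (π.toHom g).norm_map v }
      map_one' := by ext v; exact π.toHom_one v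
      map_mul' := fun g h => by ext v; exact π.toHom_mul g h v }
  continuous_orbit v := (π.continuous_orbit v).subtype_mk _

lemma orthogonal_invariant (π : UnitaryRep G H) {W : Submodule ℂ H}
    (hW : ∀ g, ∀ v ∈ W, π.toHom g v ∈ W) (g : G) {v : H} (hv : v ∈ Wᗮ) : π.toHom g v ∈ Wᗮ := by
  intro w hw
  have := hv _ (hW g⁻¹ w hw)
  rwa [inner_toHom_left, inv_inv] at this

end

section

variable {x : ℝ} {H H' : Type*} [NormedAddCommGroup H] [InnerProductSpace ℂ H]
  [NormedAddCommGroup H'] [InnerProductSpace ℂ H'] {π : UnitaryRep (realGroup x) H}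

lemma IsDerivative.transport {Y : realForm x} {v w : H} (h : π.IsDerivative Y v w)
    (U : H ≃ₗᵢ[ℂ] H') : (π.transport U).IsDerivative Y (U v) (U w) := by
  have := (U.toContinuousLinearEquiv.toContinuousLinearMap.restrictScalars
    ℝ).hasFDerivAt.comp_hasDerivAt (0 : ℝ) h
  refine this.congr_of_eventuallyEq (Eventually.of_forall fun t => ?_)
  change (π.transport U).toHom _ (U v) = U (π.toHom _ v)
  rw [transport_apply, U.symm_apply_apply]

lemma IsDerivative.restrict {Y : realForm x} {W : Submodule ℂ H} {v w : W}
    (h : π.IsDerivative Y (v : H) (w : H)) (hW : ∀ g, ∀ v ∈ W, π.toHom g v ∈ W) :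
    (π.restrict W hW).IsDerivative Y v w := by
  refine hasDerivAt_iff_tendsto_slope.2 (tendsto_subtype_rng.2 ?_)
  refine (hasDerivAt_iff_tendsto_slope.1 h).congr fun t => ?_
  rw [slope_def_module, slope_def_module]
  rfl

lemma isDerivative_of_weight {v : H} {k : ℤ}
    (h : ∀ w, π.toHom (torus x w) v = ((w : ℂ) ^ k) • v) :
    π.IsDerivative (realElt x 1 0) v ((Complex.I * k) • v) := by
  have h1 : ∀ t : ℝ, π.toHom (expReal x (t • realElt x 1 0)) v =
      Complex.exp (Complex.I * k * t) • v := by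
    intro t
    rw [expReal_smul_one, h, Circle.coe_exp, ← Complex.exp_int_mul]
    congr 2
    ring
  unfold IsDerivative
  simp only [h1]
  have := (((hasDerivAt_id ((0 : ℝ) : ℂ)).const_mul (Complex.I * k)).cexp.comp_ofReal).smul_const v
  simpa using this

end

end UnitaryRep

namespace HasLadder

section

variable {x : ℝ} {H : Type*} [NormedAddCommGroup H] [InnerProductSpace ℂ H]
  {π : UnitaryRep (realGroup x) H} {u : ℤ → H} (hu : HasLadder π u)
include hu

lemma tendsto_taylor {b : ℂ} (hb : ‖b‖ < 1 / (4 * (1 + |x|))) (j : ℤ) :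
    Tendsto (fun n => ∑ k ∈ Finset.range n, ((k.factorial : ℂ)⁻¹) •
      Finsupp.linearCombination ℂ u ((ladderOp x 0 b ^ k) (Finsupp.single j 1))) atTop
      (𝓝 (π.toHom (expReal x (realElt x 0 b)) (u j))) := by
  rw [tendsto_iff_norm_sub_tendsto_zero]
  have h0 : 0 < 1 + |x| := by positivity
  have h1 : 4 * ‖b‖ * (1 + |x|) < 1 := by
    rw [lt_div_iff₀ (by positivity)] at hb
    linarith
  have h2 := (tendsto_pow_atTop_nhds_zero_of_lt_one (by positivity) h1).const_mul
    ((2 : ℝ) ^ j.natAbs)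
  rw [mul_zero] at h2
  refine squeeze_zero (fun _ => norm_nonneg _) (fun n => ?_) h2
  rw [norm_sub_rev]
  exact hu.norm_toHom_sub_le b n j

theorem closure_invariant (g : realGroup x) {v : H}
    (hv : v ∈ (Submodule.span ℂ (Set.range u)).topologicalClosure) :
    π.toHom g v ∈ (Submodule.span ℂ (Set.range u)).topologicalClosure := by
  set W := (Submodule.span ℂ (Set.range u)).topologicalClosure with hW
  have hWc : IsClosed (W : Set H) := Submodule.isClosed_topologicalClosure _
  have hmem : ∀ c, Finsupp.linearCombination ℂ u c ∈ W := fun c => by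
    refine Submodule.le_topologicalClosure _ ?_
    rw [Finsupp.mem_span_range_iff_exists_finsupp]
    exact ⟨c, rfl⟩
  have hext : ∀ g, (∀ j, π.toHom g (u j) ∈ W) → ∀ v ∈ W, π.toHom g v ∈ W := by
    intro g h v hv
    refine closure_minimal (s := (Submodule.span ℂ (Set.range u) : Set H))
      (t := {v | π.toHom g v ∈ W}) (fun w hw => ?_) (hWc.preimage (π.toHom g).continuous) hv
    refine Submodule.span_le (p := W.comap (π.toHom g).toLinearEquiv.toLinearMap).2 ?_ hw
    rintro _ ⟨j, rfl⟩
    exact h j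
  refine realGroup_induction (p := fun g => ∀ v ∈ W, π.toHom g v ∈ W) ?_ ?_
    (δ := 1 / (4 * (1 + |x|))) (by positivity) ?_ g v hv
  · intro g h hg hh v hv
    rw [UnitaryRep.toHom_mul]
    exact hg _ (hh _ hv)
  · intro w
    refine hext _ fun j => ?_
    rw [hu.torus]
    exact W.smul_mem _ (Submodule.le_topologicalClosure _ (Submodule.subset_span ⟨j, rfl⟩))
  · intro b hb
    refine hext _ fun j => ?_
    exact hWc.mem_of_tendsto (hu.tendsto_taylor hb j) (Eventually.of_forall fun n =>
      W.sum_mem fun k _ => W.smul_mem _ (hmem _))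

/-- The restriction of a representation with a ladder to the closed span of the ladder. -/
theorem exists_restrict [CompleteSpace H] : ∃ (W : Submodule ℂ H) (_ : CompleteSpace W)
    (π' : UnitaryRep (realGroup x) W) (u' : ℤ → W), HasLadder π' u' ∧ DenseSpan u' ∧
      (∀ j, (u' j : H) = u j) ∧ (∀ g v, (π'.toHom g v : H) = π.toHom g v) := by
  have hmem : ∀ j, u j ∈ (Submodule.span ℂ (Set.range u)).topologicalClosure := fun j =>
    Submodule.le_topologicalClosure _ (Submodule.subset_span ⟨j, rfl⟩)
  have hc : CompleteSpace (Submodule.span ℂ (Set.range u)).topologicalClosure :=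
    (Submodule.isClosed_topologicalClosure _).completeSpace_coe
  refine ⟨_, hc, π.restrict _ fun g v hv => hu.closure_invariant g hv, fun j => ⟨u j, hmem j⟩,
    ⟨fun i j => hu.inner_eq i j, fun a b j => UnitaryRep.IsDerivative.restrict (hu.deriv a b j) _⟩,
    denseSpan_of_eq_zero fun v hv => ?_, fun _ => rfl, fun _ _ => rfl⟩
  have h1 : (v : H) ∈ (Submodule.span ℂ (Set.range u))ᗮ := by
    rw [Submodule.mem_orthogonal]
    intro w hw
    refine Submodule.span_induction (p := fun w _ => ⟪w, (v : H)⟫_ℂ = 0) ?_ (inner_zero_left _)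
      (fun a b _ _ ha hb => by rw [inner_add_left, ha, hb, add_zero])
      (fun c a _ ha => by rw [inner_smul_left, ha, mul_zero]) hw
    rintro _ ⟨j, rfl⟩
    exact hv j
  rw [← Submodule.orthogonal_closure] at h1
  exact Subtype.ext (inner_self_eq_zero.1 (Submodule.inner_right_of_mem_orthogonal v.2 h1))

variable {H' : Type*} [NormedAddCommGroup H'] [InnerProductSpace ℂ H']
  {π' : UnitaryRep (realGroup x) H'} {u' : ℤ → H'}

/-- An isometry that maps a dense ladder to a ladder is equivariant. -/
theorem intertwines (hd : DenseSpan u) (hu' : HasLadder π' u') (U : H →ₗᵢ[ℂ] H')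
    (hU : ∀ j, U (u j) = u' j) (g : realGroup x) (v : H) :
    U (π.toHom g v) = π'.toHom g (U v) := by
  have hext : ∀ g, (∀ j, U (π.toHom g (u j)) = π'.toHom g (U (u j))) →
      ∀ v, U (π.toHom g v) = π'.toHom g (U v) := by
    intro g h v
    refine hd.induction (p := fun v => U (π.toHom g v) = π'.toHom g (U v)) h ?_ ?_ ?_ v
    · intro v w hv hw
      simp only [map_add, hv, hw]
    · intro c v hv
      simp only [map_smul, hv]
    · exact isClosed_eq (U.continuous.comp (π.toHom g).continuous)
        ((π'.toHom g).continuous.comp U.continuous)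
  refine realGroup_induction (p := fun g => ∀ v, U (π.toHom g v) = π'.toHom g (U v)) ?_ ?_
    (δ := 1 / (4 * (1 + |x|))) (by positivity) ?_ g v
  · intro g h hg hh v
    rw [UnitaryRep.toHom_mul, UnitaryRep.toHom_mul, hg, hh]
  · intro w
    refine hext _ fun j => ?_
    rw [hu.torus, map_smul, hU, hu'.torus]
  · intro b hb
    refine hext _ fun j => ?_
    have hUc : ∀ c, U (Finsupp.linearCombination ℂ u c) = Finsupp.linearCombination ℂ u' c := by
      intro c
      rw [Finsupp.linearCombination_apply, Finsupp.linearCombination_apply, Finsupp.sum, map_sum]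
      exact Finset.sum_congr rfl fun i _ => by rw [map_smul, hU]
    have h1 := (U.continuous.tendsto _).comp (hu.tendsto_taylor hb j)
    have h2 := hu'.tendsto_taylor hb j
    rw [← hU] at h2
    refine tendsto_nhds_unique h1 (h2.congr fun n => ?_)
    rw [Function.comp_apply, map_sum]
    exact Finset.sum_congr rfl fun k _ => by rw [map_smul, hUc]

theorem exists_equiv [CompleteSpace H] [CompleteSpace H'] (hd : DenseSpan u)
    (hinner : ∀ i j, ⟪u' i, u' j⟫_ℂ = if i = j ∧ dv x j ≠ 0 then 1 else 0) (hd' : DenseSpan u') :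
    ∃ U : H ≃ₗᵢ[ℂ] H', ∀ j, U (u j) = u' j := by
  obtain ⟨U, hU⟩ := hd.exists_isometry (S := {j | dv x j ≠ 0}) (u' := u')
    (fun j hj => hu.eq_zero (not_not.1 hj))
    (fun i hi j hj => by rw [hu.inner_eq]; simp [show dv x j ≠ 0 from hj])
    (fun i hi j hj => by rw [hinner]; simp [show dv x j ≠ 0 from hj])
  have hU' : ∀ j, U (u j) = u' j := by
    intro j
    by_cases hj : dv x j = 0
    · rw [hu.eq_zero hj, map_zero]
      refine (inner_self_eq_zero (𝕜 := ℂ)).1 ?_ |>.symm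
      rw [hinner, if_neg fun h => h.2 hj]
    · exact hU j hj
  have hrange : LinearMap.range U.toLinearMap = ⊤ := by
    refine hd'.eq_top ?_ fun j => ⟨u j, hU' j⟩
    rw [LinearMap.coe_range]
    exact U.isometry.isClosedEmbedding.isClosed_range
  exact ⟨LinearIsometryEquiv.ofSurjective U (LinearMap.range_eq_top.1 hrange), hU'⟩

theorem equivalent [CompleteSpace H] [CompleteSpace H'] (hd : DenseSpan u) (hu' : HasLadder π' u')
    (hd' : DenseSpan u') : π.Equivalent π' := by
  obtain ⟨U, hU⟩ := hu.exists_equiv hd hu'.inner_eq hd'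
  exact ⟨U, hu.intertwines hd hu' U.toLinearIsometry hU⟩

omit hu in
lemma unique {π₁ π₂ : UnitaryRep (realGroup x) H} (h₁ : HasLadder π₁ u) (h₂ : HasLadder π₂ u)
    (hd : DenseSpan u) : π₁ = π₂ :=
  UnitaryRep.ext (h₁.intertwines hd h₂ LinearIsometry.id fun _ => rfl)

lemma transport (U : H ≃ₗᵢ[ℂ] H') (hU : ∀ j, U (u j) = u' j) : HasLadder (π.transport U) u' where
  inner_eq i j := by rw [← hU, ← hU, U.inner_map_map, hu.inner_eq]
  deriv a b j := by
    have := (hu.deriv a b j).transport U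
    simpa only [map_add, map_sub, map_smul, hU] using this

omit hu in
/-- Neighbouring ladder vectors that are connected by a nonzero coefficient
vanish simultaneously. -/
lemma dv_eq_zero_iff_succ {j : ℤ} (hj : sCoef x j ≠ 0) :
    dv x j = 0 ↔ dv x (j + 1) = 0 := by
  have hq : (1 + (2 * (j : ℝ) + 1) ^ 2 * x) / 4 ≠ 0 := by
    intro h
    refine hj ?_
    have : 1 + (2 * (j : ℝ) + 1) ^ 2 * x = 0 := by linarith
    rw [sCoef, this, Real.sqrt_zero, zero_div]
  rcases le_or_gt 0 j with h | h
  · rw [dv_succ x h, mul_eq_zero, or_iff_left hq]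
  · rw [dv_of_neg x h, mul_eq_zero, or_iff_left hq]

omit hu in
lemma sCoef_eq_zero (hx : IsUnitaryPoint x) {j : ℤ} (h0 : dv x j ≠ 0) (hj : 0 ≤ j)
    (hs : sCoef x j = 0) : dv x (j + 1) = 0 := by
  have h1 : 1 + (2 * (j : ℝ) + 1) ^ 2 * x ≤ 0 := by
    unfold sCoef at hs
    exact Real.sqrt_eq_zero'.1 (by linarith)
  have h2 := dv_succ x hj
  have h3 := hx (j + 1)
  have h4 := lt_of_le_of_ne (hx j) h0.symm
  nlinarith

omit hu in
lemma sCoef_eq_zero' (hx : IsUnitaryPoint x) {j : ℤ} (h0 : dv x (j + 1) ≠ 0) (hj : j < 0)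
    (hs : sCoef x j = 0) : dv x j = 0 := by
  have h1 : 1 + (2 * (j : ℝ) + 1) ^ 2 * x ≤ 0 := by
    unfold sCoef at hs
    exact Real.sqrt_eq_zero'.1 (by linarith)
  have h2 := dv_of_neg x hj
  have h3 := hx j
  have h4 := lt_of_le_of_ne (hx (j + 1)) h0.symm
  nlinarith

/-- The vector `u 0` is cyclic for the ladder. -/
lemma mem_of_zero_mem (hx : IsUnitaryPoint x) {W : Submodule ℂ H} (hW : IsClosed (W : Set H))
    (hinv : ∀ g, ∀ v ∈ W, π.toHom g v ∈ W) (h0 : u 0 ∈ W) (j : ℤ) : u j ∈ W := by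
  have hstep : ∀ j, u j ∈ W → (sCoef x j : ℂ) • u (j + 1) ∈ W ∧
      (sCoef x (j - 1) : ℂ) • u (j - 1) ∈ W := by
    intro j hj
    have h1 := (hu.deriv 0 1 j).mem hW hinv hj
    have h2 := (hu.deriv 0 Complex.I j).mem hW hinv hj
    have hI : Complex.I * Complex.I = -1 := Complex.I_mul_I
    constructor
    · have := W.sub_mem (W.smul_mem (1 / 2 : ℂ) h1) (W.smul_mem (Complex.I / 2) h2)
      convert this using 1
      simp only [map_one, Complex.conj_I, Complex.ofReal_zero]
      linear_combination (norm := module) ((1 / 2 : ℂ) * sCoef x j) • (congrArg (· • u (j + 1)) hI)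
        + ((1 / 2 : ℂ) * sCoef x (j - 1)) • (congrArg (· • u (j - 1)) hI)
    · have := W.sub_mem (W.smul_mem (-1 / 2 : ℂ) h1) (W.smul_mem (Complex.I / 2) h2)
      convert this using 1
      simp only [map_one, Complex.conj_I, Complex.ofReal_zero]
      linear_combination (norm := module) ((1 / 2 : ℂ) * sCoef x j) • (congrArg (· • u (j + 1)) hI)
        + ((1 / 2 : ℂ) * sCoef x (j - 1)) • (congrArg (· • u (j - 1)) hI)
  induction j using Int.induction_on with
  | zero => exact h0
  | succ n ih =>
    by_cases hn : dv x ((n : ℤ) + 1) = 0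
    · rw [hu.eq_zero hn]; exact W.zero_mem
    · have hs : (sCoef x n : ℂ) ≠ 0 := by
        intro hs
        have hs' : sCoef x (n : ℤ) = 0 := by exact_mod_cast hs
        by_cases h0 : dv x n = 0
        · refine hn ?_
          rw [dv_succ x (Int.natCast_nonneg n), h0, zero_mul]
        · exact hn (sCoef_eq_zero hx h0 (Int.natCast_nonneg n) hs')
      exact (W.smul_mem_iff hs).1 (hstep _ ih).1
  | pred n ih =>
    by_cases hn : dv x (-(n : ℤ) - 1) = 0
    · rw [hu.eq_zero hn]; exact W.zero_mem
    · have hs : (sCoef x (-(n : ℤ) - 1) : ℂ) ≠ 0 := by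
        intro hs
        have hs' : sCoef x (-(n : ℤ) - 1) = 0 := by exact_mod_cast hs
        by_cases h0 : dv x (-(n : ℤ) - 1 + 1) = 0
        · refine hn ?_
          rw [dv_of_neg x (by omega), h0, zero_mul]
        · exact hn (sCoef_eq_zero' hx h0 (by omega) hs')
      exact (W.smul_mem_iff hs).1 (hstep _ ih).2

theorem isIrreducible [CompleteSpace H] (hd : DenseSpan u) (hx : IsUnitaryPoint x) :
    π.IsIrreducible := by
  have hd0 : dv x 0 ≠ 0 := by rw [dv_zero]; exact one_ne_zero
  refine ⟨⟨u 0, 0, hu.ne_zero hd0⟩, fun W hW hinv => ?_⟩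
  have : CompleteSpace W := hW.completeSpace_coe
  -- the projection of `u 0` to `W` has weight `0`, and is therefore a multiple of `u 0`
  obtain ⟨y, hy, z, hz, hyz⟩ := W.exists_add_mem_mem_orthogonal (u 0)
  have hyw : ∀ w, π.toHom (ContractionFamilies.torus x w) y = y := by
    intro w
    have h1 : π.toHom (ContractionFamilies.torus x w) y +
        π.toHom (ContractionFamilies.torus x w) z = y + z := by
      rw [← map_add, ← hyz, hu.torus]
      simp
    have h2 : π.toHom (ContractionFamilies.torus x w) y - y =
        z - π.toHom (ContractionFamilies.torus x w) z := by
      linear_combination (norm := module) h1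
    have h3 : π.toHom (ContractionFamilies.torus x w) y - y ∈ W := W.sub_mem (hinv _ _ hy) hy
    have h4 : π.toHom (ContractionFamilies.torus x w) y - y ∈ Wᗮ := by
      rw [h2]
      exact Wᗮ.sub_mem hz (π.orthogonal_invariant hinv _ hz)
    exact sub_eq_zero.1 (inner_self_eq_zero.1 (Submodule.inner_right_of_mem_orthogonal h3 h4))
  have hyj : ∀ j ≠ 0, ⟪u j, y⟫_ℂ = 0 := by
    intro j hj
    have h1 := (hu.deriv 1 0 j).inner_left (UnitaryRep.isDerivative_of_weight (k := 0)
      (v := y) (by simpa using hyw))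
    simpa [inner_smul_left, hj] using h1
  have hyc : y = ⟪u 0, y⟫_ℂ • u 0 := by
    rw [← sub_eq_zero]
    refine hd.eq_zero fun j => ?_
    rw [inner_sub_right, inner_smul_right, hu.inner_eq]
    by_cases hj : j = 0
    · subst hj; simp [hd0]
    · rw [hyj j hj]; simp [hj]
  by_cases hc : ⟪u 0, y⟫_ℂ = 0
  · left
    have hz0 : u 0 ∈ Wᗮ := by
      rw [hyz, hyc, hc, zero_smul, zero_add]
      exact hz
    have := hd.eq_top W.isClosed_orthogonal (hu.mem_of_zero_mem hx W.isClosed_orthogonal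
      (fun g v hv => π.orthogonal_invariant hinv g hv) hz0)
    rw [← W.orthogonal_orthogonal, this, Submodule.top_orthogonal_eq_bot]
  · right
    refine hd.eq_top hW (hu.mem_of_zero_mem hx hW hinv ?_)
    rw [← W.smul_mem_iff hc, ← hyc]
    exact hy

end

end HasLadder

end ContractionFamilies
end

noncomputable section

namespace ContractionFamilies

/-! ### The Casimir operator on a ladder -/

theorem HasLadder.quadraticActsBy {x : ℝ} {H : Type*} [NormedAddCommGroup H]
    [InnerProductSpace ℂ H] {π : UnitaryRep (realGroup x) H} {u : ℤ → H} (hu : HasLadder π u)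
    (hd : DenseSpan u) (hx : 0 ≤ x) {α β c : ℝ}
    (hc : ∀ j : ℤ, 4 * α * (j : ℝ) ^ 2 - β * (1 + (4 * (j : ℝ) ^ 2 + 1) * x) = c) :
    π.QuadraticActsBy α β c := by
  intro v v₀ v₁ v₂ w₀ w₁ w₂ h00 h01 h10 h11 h20 h21
  -- both sides have the same inner products with the ladder vectors, because the Lie algebra acts
  -- by skew-symmetric operators
  rw [← sub_eq_zero]
  refine hd.eq_zero fun j => ?_
  have key : ∀ (a : ℝ) (b : ℂ) (v v' v'' : H), π.IsDerivative (realElt x a b) v v' →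
      π.IsDerivative (realElt x a b) v' v'' → ⟪u j, v''⟫_ℂ =
        ⟪Finsupp.linearCombination ℂ u
          ((ladderOp x a b) ((ladderOp x a b) (Finsupp.single j 1))), v⟫_ℂ := by
    intro a b v v' v'' h h'
    have h1 := (hu.isDerivative a b (Finsupp.single j 1)).inner_left h'
    have h2 := (hu.isDerivative a b (ladderOp x a b (Finsupp.single j 1))).inner_left h
    rw [Finsupp.linearCombination_single, one_smul] at h1
    rw [h1, h2, neg_neg]
  have hs : ∀ i : ℤ, (sCoef x i : ℂ) ^ 2 = (1 + (2 * (i : ℂ) + 1) ^ 2 * x) / 4 := by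
    intro i
    have : sCoef x i ^ 2 = (1 + (2 * (i : ℝ) + 1) ^ 2 * x) / 4 := by
      rw [sCoef, div_pow, Real.sq_sqrt (by positivity)]
      norm_num
    exact_mod_cast this
  have hA : ladderOp x 1 0 (ladderOp x 1 0 (Finsupp.single j 1)) =
      (-(4 * (j : ℂ) ^ 2)) • Finsupp.single j 1 := by
    simp only [ladderOp_single, map_add, map_sub, map_smul]
    simp only [map_zero, zero_mul, zero_smul, sub_self, add_zero, smul_smul, Complex.ofReal_one]
    congr 1
    linear_combination (4 * (j : ℂ) ^ 2) * Complex.I_mul_I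
  have hB : ladderOp x 0 1 (ladderOp x 0 1 (Finsupp.single j 1)) +
      ladderOp x 0 Complex.I (ladderOp x 0 Complex.I (Finsupp.single j 1)) =
      (-(1 + (4 * (j : ℂ) ^ 2 + 1) * x)) • Finsupp.single j 1 := by
    simp only [ladderOp_single, map_sub, map_smul, map_one, Complex.conj_I,
      Complex.ofReal_zero, mul_zero, zero_mul, zero_smul, zero_add, add_sub_cancel_right,
      sub_add_cancel]
    have h1 := hs j
    have h2 := hs (j - 1)
    have hI := Complex.I_mul_I
    push_cast at h2
    have h3 : (-2 : ℂ) * ((sCoef x j : ℂ) ^ 2 + (sCoef x (j - 1) : ℂ) ^ 2) =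
        -(1 + (4 * (j : ℂ) ^ 2 + 1) * x) := by
      rw [h1, h2]; ring
    rw [← h3]
    linear_combination (norm := module)
      (congrArg (fun z : ℂ => (z * (sCoef x j * sCoef x (j + 1))) •
        (Finsupp.single (j + 1 + 1) 1 : ℤ →₀ ℂ)) hI) +
      (congrArg (fun z : ℂ => (z * (sCoef x (j - 1) * sCoef x (j - 1 - 1))) •
        (Finsupp.single (j - 1 - 1) 1 : ℤ →₀ ℂ)) hI) +
      (congrArg (fun z : ℂ => (z * (sCoef x j ^ 2 + sCoef x (j - 1) ^ 2)) •
        (Finsupp.single j 1 : ℤ →₀ ℂ)) hI)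
  rw [inner_sub_right, inner_add_right, inner_neg_right, inner_smul_right, inner_smul_right,
    inner_add_right, inner_smul_right, key 1 0 v v₀ w₀ h00 h01, key 0 1 v v₁ w₁ h10 h11,
    key 0 Complex.I v v₂ w₂ h20 h21, ← inner_add_left, ← map_add, hA, hB, map_smul, map_smul,
    Finsupp.linearCombination_single, one_smul, inner_smul_left, inner_smul_left]
  have hc' : (4 * (α : ℂ) * (j : ℂ) ^ 2 - β * (1 + (4 * (j : ℂ) ^ 2 + 1) * x)) = c := by
    exact_mod_cast hc j
  simp only [map_neg, map_mul, map_add, map_pow, map_one, map_ofNat, Complex.conj_ofReal,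
    map_intCast]
  linear_combination ⟪u j, v⟫_ℂ * hc'

theorem HasLadder.casimirActsBy {x : ℝ} {H : Type*} [NormedAddCommGroup H]
    [InnerProductSpace ℂ H] {π : UnitaryRep (realGroup x) H} {u : ℤ → H} (hu : HasLadder π u)
    (hd : DenseSpan u) (hx : 0 < x) : π.CasimirActsBy (-(x + 1) / x) := by
  refine hu.quadraticActsBy hd hx.le fun j => ?_
  field_simp
  ring

theorem HasLadder.motionCasimirActsBy {H : Type*} [NormedAddCommGroup H]
    [InnerProductSpace ℂ H] {π : UnitaryRep (realGroup 0) H} {u : ℤ → H} (hu : HasLadder π u)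
    (hd : DenseSpan u) : π.MotionCasimirActsBy (-1) := by
  refine hu.quadraticActsBy hd le_rfl fun j => ?_
  ring

/-! ### Ladders and Jantzen quotients -/

/-- The factor between the standard basis vector and the normalized vector of the same weight. -/
def rCoef (x : ℝ) (j : ℤ) : ℝ := (if 0 ≤ j then 1 else (-1) ^ j.natAbs) * √(dv x j)

section

variable {x : ℝ} (hx : IsUnitaryPoint x)
include hx

lemma rCoef_eq_zero_iff (j : ℤ) : rCoef x j = 0 ↔ dv x j = 0 := by
  rw [rCoef, mul_eq_zero, Real.sqrt_eq_zero (hx j), or_iff_right]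
  split_ifs
  · exact one_ne_zero
  · exact pow_ne_zero _ (by norm_num)

lemma rCoef_sq (j : ℤ) : rCoef x j ^ 2 = dv x j := by
  rw [rCoef, mul_pow, Real.sq_sqrt (hx j)]
  split_ifs
  · simp
  · rw [← pow_mul, mul_comm _ 2, pow_mul]; simp

lemma sqrt_dv_succ {j : ℤ} (hj : 0 ≤ j) : √(dv x (j + 1)) = √(dv x j) * sCoef x j := by
  rw [dv_succ x hj, Real.sqrt_mul (hx j), Real.sqrt_div' _ (by norm_num), sCoef]
  congr 2
  rw [show (4 : ℝ) = 2 ^ 2 by norm_num, Real.sqrt_sq (by norm_num)]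

/-- The action of `E` on the normalized vectors. -/
lemma eCoef_mul_rCoef (j : ℤ) :
    (eCoef j).eval (x : ℂ) * rCoef x (j + 1) = rCoef x j * sCoef x j := by
  by_cases hj : 0 ≤ j
  · rw [eCoef, if_pos hj, rCoef, rCoef, if_pos hj, if_pos (by omega), sqrt_dv_succ hx hj]
    simp
  · obtain ⟨n, rfl⟩ : ∃ n : ℕ, j = -n - 1 := ⟨(-j - 1).toNat, by omega⟩
    have e1 : (eCoef (-(n : ℤ) - 1)).eval (x : ℂ) =
        -(((1 + (2 * (n : ℝ) + 1) ^ 2 * x) / 4 : ℝ) : ℂ) := by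
      rw [eCoef, if_neg hj, qPoly_neg_sub_one]
      simp [qPoly]
      ring
    have e2 : rCoef x (-(n : ℤ) - 1) = (-1) ^ (n + 1) * (√(dv x n) * sCoef x n) := by
      rw [rCoef, if_neg hj, ← sqrt_dv_succ hx (Int.natCast_nonneg n), ← dv_neg x (n + 1)]
      congr 3
      · omega
      · ring
    have e3 : rCoef x (-(n : ℤ) - 1 + 1) = (-1) ^ n * √(dv x n) := by
      rw [sub_add_cancel, rCoef, dv_neg]
      split_ifs with h
      · have : n = 0 := by omega
        simp [this]
      · simp
    rw [e1, e2, e3, sCoef_neg_sub_one]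
    have e4 : (1 + (2 * (n : ℝ) + 1) ^ 2 * x) / 4 * √(dv x n) =
        √(dv x n) * sCoef x n * sCoef x n := by
      by_cases h0 : √(dv x n) = 0
      · rw [h0]; simp
      · have h1 : 0 ≤ 1 + (2 * (n : ℝ) + 1) ^ 2 * x := by
          by_contra hneg
          have h2 := dv_succ x (Int.natCast_nonneg n)
          have h3 := hx (n + 1)
          have h4 : 0 < dv x n := Real.sqrt_pos.1 (lt_of_le_of_ne (Real.sqrt_nonneg _) (Ne.symm h0))
          push_cast at h2
          nlinarith
        have h2 : sCoef x n * sCoef x n = (1 + (2 * (n : ℝ) + 1) ^ 2 * x) / 4 := by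
          rw [sCoef, div_mul_div_comm]
          push_cast
          rw [Real.mul_self_sqrt h1]
          norm_num
        rw [mul_assoc, h2]
        ring
    have e5 := congrArg (fun r : ℝ => (r : ℂ)) e4
    push_cast at e5 ⊢
    linear_combination (-(-1 : ℂ) ^ n) * e5

omit hx in
lemma rCoef_neg (j : ℤ) : rCoef x (-j) = (-1) ^ j * rCoef x j := by
  have h1 : ((-1 : ℝ) ^ j) * (-1) ^ j = 1 := by
    rw [← mul_zpow]; simp
  have h2 : ∀ j : ℤ, ((-1 : ℝ) ^ j.natAbs) = (-1) ^ j := by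
    intro j
    obtain ⟨n, rfl | rfl⟩ := j.eq_nat_or_neg
    · simp
    · rw [Int.natAbs_neg, Int.natAbs_natCast, zpow_neg, zpow_natCast, ← inv_pow]
      norm_num
  unfold rCoef
  rw [dv_neg, Int.natAbs_neg, h2]
  rcases lt_trichotomy j 0 with h | rfl | h
  · rw [if_pos (by omega), if_neg (by omega)]
    linear_combination -√(dv x j) * h1
  · simp
  · rw [if_neg (by omega), if_pos (by omega), one_mul]

/-- The action of `F` on the normalized vectors. -/
lemma fCoef_mul_rCoef (j : ℤ) :
    (fCoef j).eval (x : ℂ) * rCoef x (j - 1) = -(rCoef x j * sCoef x (j - 1)) := by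
  have h := eCoef_mul_rCoef hx (-j)
  have hs : sCoef x (-j) = sCoef x (j - 1) := by
    rw [← sCoef_neg_sub_one]; congr 1; ring
  have he : eCoef (-j) = fCoef j := by
    unfold eCoef fCoef
    have : qPoly (-j) = qPoly (j - 1) := by
      rw [← qPoly_neg_sub_one]; congr 1; ring
    rw [this]
    simp only [neg_nonneg]
  have h1 : ((-1 : ℂ) ^ j) ≠ 0 := zpow_ne_zero _ (by norm_num)
  rw [hs, he, show -j + 1 = -(j - 1) by ring, rCoef_neg, rCoef_neg,
    zpow_sub₀ (by norm_num : (-1 : ℝ) ≠ 0)] at h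
  push_cast at h
  refine mul_left_cancel₀ h1 ?_
  rw [zpow_one] at h
  linear_combination -h

end

namespace HCFamily

section

variable {F : HCFamily.{u}} {φ : F.Intertwiner} {x : ℝ} {n : ℤ}

lemma jAct_decomp (Y : GSec) (w : JQuot φ x n) : jAct φ x n Y w =
    (Y.1.1 0 0).eval (x : ℂ) • jAct φ x n secH w + (Y.1.1 0 1).eval (x : ℂ) • jAct φ x n secE w +
      (Y.1.2 1 0).eval (x : ℂ) • jAct φ x n secF w := by
  obtain ⟨⟨v, hv⟩, rfl⟩ := Submodule.Quotient.mk_surjective _ w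
  obtain ⟨f, rfl⟩ := Submodule.Quotient.mk_surjective _ v
  refine congrArg Submodule.Quotient.mk (Subtype.ext ?_)
  change F.toFiber x (F.act Y f) = (Y.1.1 0 0).eval (x : ℂ) • F.toFiber x (F.act secH f) +
    (Y.1.1 0 1).eval (x : ℂ) • F.toFiber x (F.act secE f) +
      (Y.1.2 1 0).eval (x : ℂ) • F.toFiber x (F.act secF f)
  rw [act_decomp, ← toFiber_smul, ← toFiber_smul, ← toFiber_smul]
  rfl

/-- The section with constant coefficients and given value in the real Lie algebra over `x`. -/
def constSec (a : ℝ) (b : ℂ) : GSec := gElt X (C (Complex.I * a)) (C b) (C (conj b))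

lemma evalSec_constSec (x a : ℝ) (b : ℂ) : evalSec x (constSec a b) = (realElt x a b).1 := by
  ext i j <;> fin_cases i <;> fin_cases j <;>
    simp [evalSec, constSec, gElt, realElt, -X_mul_C, mul_comm (x : ℂ)]

variable {q : ℤ → JQuot φ x n} (hq : IsQuotBasis.{u, v} φ x n q)
include hq

lemma IsQuotBasis.induction {p : JQuot φ x n → Prop} (hp : ∀ j, p (q j))
    (hadd : ∀ v w, p v → p w → p (v + w)) (hsmul : ∀ (c : ℂ) v, p v → p (c • v))
    (v : JQuot φ x n) : p v := by
  have hv : v ∈ Submodule.span ℂ (Set.range q) := by rw [hq.span_eq_top]; trivial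
  refine Submodule.span_induction (p := fun w _ => p w) ?_ ?_ (fun _ _ _ _ => hadd _ _)
    (fun c _ _ => hsmul c _) hv
  · rintro _ ⟨j, rfl⟩
    exact hp j
  · have := hsmul 0 _ (hp 0)
    rwa [zero_smul] at this

lemma IsQuotBasis.exists_eq_sum (v : JQuot φ x n) : ∃ c : ℤ →₀ ℂ, v = c.sum fun j r => r • q j := by
  have hv : v ∈ Submodule.span ℂ (Set.range q) := by rw [hq.span_eq_top]; trivial
  obtain ⟨c, rfl⟩ := Finsupp.mem_span_range_iff_exists_finsupp.1 hv
  exact ⟨c, rfl⟩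

lemma IsQuotBasis.isPosDef (hx : IsUnitaryPoint x) {B : SesqForm (JQuot φ x n)} {c : ℝ}
    (hc : 0 < c) (hB : ∀ i j, B (q i) (q j) = if i = j then (c * dv x j : ℂ) else 0) :
    IsPosDef B := by
  intro v hv
  obtain ⟨a, ha⟩ := hq.exists_eq_sum v
  have h1 : B v v = ∑ j ∈ a.support, ((c * (Complex.normSq (a j) * dv x j) : ℝ) : ℂ) := by
    rw [ha, Finsupp.sum, map_sum]
    refine Finset.sum_congr rfl fun i hi => ?_
    rw [map_sum, LinearMap.sum_apply, Finset.sum_eq_single i]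
    · rw [LinearMap.map_smulₛₗ, map_smul B, LinearMap.smul_apply, hB, if_pos rfl]
      push_cast
      rw [← Complex.mul_conj]
      simp only [smul_eq_mul]
      ring
    · intro j _ hji
      rw [LinearMap.map_smulₛₗ, map_smul B, LinearMap.smul_apply, hB, if_neg hji]
      simp
    · intro h; exact absurd hi h
  have h2 : ∃ j ∈ a.support, q j ≠ 0 := by
    by_contra! h
    refine hv ?_
    rw [ha]
    exact Finset.sum_eq_zero fun j hj => by
      simp only [h j hj, smul_zero]
  obtain ⟨j, hj, hqj⟩ := h2
  rw [h1, ← Complex.ofReal_sum, Complex.ofReal_re]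
  refine Finset.sum_pos' (fun i _ => ?_) ⟨j, hj, ?_⟩
  · have := hx i
    have := Complex.normSq_nonneg (a i)
    positivity
  · have h3 : 0 < dv x j := lt_of_le_of_ne (hx j) fun h => hqj (hq.eq_zero j h.symm)
    have h4 : 0 < Complex.normSq (a j) := Complex.normSq_pos.2 (Finsupp.mem_support_iff.1 hj)
    positivity

lemma IsQuotBasis.ne_zero {j : ℤ} (hj : dv x j ≠ 0) : q j ≠ 0 := by
  obtain ⟨B, -, hB⟩ := hq.exists_form
  intro h
  have := hB j j
  rw [if_pos rfl, h, map_zero] at this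
  exact hj (by exact_mod_cast this.symm)

lemma IsQuotBasis.nontrivial : Nontrivial (JQuot φ x n) :=
  ⟨q 0, 0, hq.ne_zero (by rw [dv_zero]; exact one_ne_zero)⟩

lemma IsQuotBasis.isInfUnitary (hx : IsUnitaryPoint x) : IsInfUnitary φ x n := by
  obtain ⟨B, hB, hB'⟩ := hq.exists_form
  exact ⟨hq.nontrivial, B, hB, hq.isPosDef hx one_pos (by simpa using hB')⟩

variable {H : Type*} [NormedAddCommGroup H] [InnerProductSpace ℂ H]

/-- The representation integrates the Jantzen quotient if and only if the normalized images of the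
basis vectors form a ladder. -/
theorem IsQuotBasis.integrates_iff (hx : IsUnitaryPoint x) {π : UnitaryRep (realGroup x) H}
    {ι : JQuot φ x n →ₗ[ℂ] H} {u : ℤ → H} {κ : ℝ} (hκ : κ ≠ 0)
    (hι : ∀ j, ι (q j) = ((κ * rCoef x j : ℝ) : ℂ) • u j)
    (hu : ∀ i j, ⟪u i, u j⟫_ℂ = if i = j ∧ dv x j ≠ 0 then 1 else 0) :
    Integrates φ x n ι π ↔ HasLadder π u := by
  have hu0 : ∀ j, dv x j = 0 → u j = 0 := fun j hj => by
    rw [← inner_self_eq_zero (𝕜 := ℂ), hu, if_neg fun h => h.2 hj]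
  -- the action on the quotient of a section whose value at `x` is real, in terms of the `u j`
  have hact : ∀ (Y : GSec) (hY : evalSec x Y ∈ realForm x), ∃ (a : ℝ) (b : ℂ),
      (⟨evalSec x Y, hY⟩ : realForm x) = realElt x a b ∧ ∀ j, ι (jAct φ x n Y (q j)) =
        ((κ * rCoef x j : ℝ) : ℂ) • ((2 * Complex.I * a * j) • u j +
          ((b * sCoef x j) • u (j + 1) - (conj b * sCoef x (j - 1)) • u (j - 1))) := by
    intro Y hY
    refine ⟨_, _, eq_realElt _, fun j => ?_⟩
    have h := congrArg Subtype.val (eq_realElt (⟨evalSec x Y, hY⟩ : realForm x))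
    have h0 : (Y.1.1 0 0).eval (x : ℂ) = _ := congrFun (congrFun (congrArg Prod.fst h) 0) 0
    have h1 : (Y.1.1 0 1).eval (x : ℂ) = _ := congrFun (congrFun (congrArg Prod.fst h) 0) 1
    have h2 : (Y.1.2 1 0).eval (x : ℂ) = _ := congrFun (congrFun (congrArg Prod.snd h) 1) 0
    set a : ℝ := (((⟨evalSec x Y, hY⟩ : realForm x) : M2 ℂ × M2 ℂ).1 0 0).im
    set b : ℂ := ((⟨evalSec x Y, hY⟩ : realForm x) : M2 ℂ × M2 ℂ).1 0 1
    have h0' : (Y.1.1 0 0).eval (x : ℂ) = Complex.I * a := h0.trans (by simp [realElt, gElt])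
    have h1' : (Y.1.1 0 1).eval (x : ℂ) = b := h1.trans (by simp [realElt, gElt])
    have h2' : (Y.1.2 1 0).eval (x : ℂ) = conj b := h2.trans (by simp [realElt, gElt])
    rw [jAct_decomp, h0', h1', h2', hq.act_secH, hq.act_secE, hq.act_secF]
    simp only [map_add, map_smul, hι]
    have e1 := eCoef_mul_rCoef hx j
    have e2 := fCoef_mul_rCoef hx j
    push_cast
    linear_combination (norm := module) congrArg (fun z : ℂ => (z * (κ * b)) • u (j + 1)) e1 +
      congrArg (fun z : ℂ => (z * (κ * conj b)) • u (j - 1)) e2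
  have hκr : ∀ j, dv x j ≠ 0 → ((κ * rCoef x j : ℝ) : ℂ) ≠ 0 := fun j hj => by
    have := mul_ne_zero hκ (mt (rCoef_eq_zero_iff hx j).1 hj)
    exact_mod_cast this
  constructor
  · rintro ⟨h1, -⟩
    refine ⟨hu, fun a b j => ?_⟩
    have hY : evalSec x (constSec a b) ∈ realForm x := by
      rw [evalSec_constSec]; exact (realElt x a b).2
    by_cases hj : dv x j = 0
    · -- a vanishing vector is connected only to vanishing vectors
      have s1 : (sCoef x j : ℂ) • u (j + 1) = 0 := by
        by_cases hs : sCoef x j = 0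
        · rw [hs]; simp
        · rw [hu0 _ ((HasLadder.dv_eq_zero_iff_succ hs).1 hj), smul_zero]
      have s2 : (sCoef x (j - 1) : ℂ) • u (j - 1) = 0 := by
        by_cases hs : sCoef x (j - 1) = 0
        · rw [hs]; simp
        · rw [hu0 _ ((HasLadder.dv_eq_zero_iff_succ hs).2 (by rwa [sub_add_cancel])), smul_zero]
      rw [hu0 j hj, mul_smul b, s1, mul_smul (conj b), s2]
      simpa using UnitaryRep.isDerivative_zero
    · obtain ⟨a', b', hab, h⟩ := hact (constSec a b) hY
      have h2 := h1 (constSec a b) hY (q j)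
      rw [h j, hι] at h2
      have h3 := h2.smul (((κ * rCoef x j : ℝ) : ℂ)⁻¹)
      rw [inv_smul_smul₀ (hκr j hj), inv_smul_smul₀ (hκr j hj)] at h3
      have h4 : (⟨evalSec x (constSec a b), hY⟩ : realForm x) = realElt x a b :=
        Subtype.ext (evalSec_constSec x a b)
      rw [h4] at h3 hab
      have hb : b = b' := by
        simpa [realElt, gElt] using congrArg (fun Y : realForm x => Y.1.1 0 1) hab
      have ha : a = a' := by
        simpa [realElt, gElt] using congrArg (fun Y : realForm x => Y.1.1 0 0) hab
      rwa [← hb, ← ha] at h3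
  · intro hl
    refine ⟨fun Y hY w => ?_, fun w v => ?_⟩
    · obtain ⟨a, b, hab, h⟩ := hact Y hY
      rw [hab]
      refine hq.induction (p := fun w => π.IsDerivative (realElt x a b) (ι w)
        (ι (jAct φ x n Y w))) (fun j => ?_) (fun v w hv hw => ?_) (fun c v hv => ?_) w
      · rw [h, hι]
        exact (hl.deriv a b j).smul _
      · rw [map_add, map_add, map_add]
        exact hv.add hw
      · rw [map_smul, map_smul, map_smul]
        exact hv.smul c
    · refine hq.induction (p := fun v => π.toHom (torus x w) (ι v) =
        ι (jRho φ x n (Circle.toUnits w) v)) (fun j => ?_) (fun v w hv hw => ?_)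
        (fun c v hv => ?_) v
      · rw [hq.rho, map_smul, hι, map_smul, hl.torus, smul_comm]
        simp
      · simp only [map_add, hv, hw]
      · simp only [map_smul, hv]

lemma IsQuotBasis.exists_normalized (hx : IsUnitaryPoint x) {B : SesqForm (JQuot φ x n)}
    (hB : IsJantzenForm φ x n B) (hpos : IsPosDef B) {ι : JQuot φ x n →ₗ[ℂ] H}
    (hι : IsCompletion B ι) : ∃ (u : ℤ → H) (κ : ℝ), κ ≠ 0 ∧
      (∀ j, ι (q j) = ((κ * rCoef x j : ℝ) : ℂ) • u j) ∧
      (∀ i j, ⟪u i, u j⟫_ℂ = if i = j ∧ dv x j ≠ 0 then 1 else 0) ∧ DenseSpan u := by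
  obtain ⟨c, hc⟩ := hq.form B hB
  have h0 : q 0 ≠ 0 := hq.ne_zero (by rw [dv_zero]; exact one_ne_zero)
  have hBc : B (q 0) (q 0) = c := by rw [hc, dv_zero]; simp
  have hcpos : 0 < c.re := by rw [← hBc]; exact hpos _ h0
  have hcre : ((c.re : ℝ) : ℂ) = c := by
    refine Complex.conj_eq_iff_re.1 ?_
    rw [← hBc, ← hB.1]
  have hκ : √c.re ≠ 0 := (Real.sqrt_pos.2 hcpos).ne'
  have hκr : ∀ j, dv x j ≠ 0 → √c.re * rCoef x j ≠ 0 := fun j hj =>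
    mul_ne_zero hκ (mt (rCoef_eq_zero_iff hx j).1 hj)
  have hιq : ∀ j, ι (q j) = ((√c.re * rCoef x j : ℝ) : ℂ) •
      (((√c.re * rCoef x j : ℝ) : ℂ)⁻¹ • ι (q j)) := by
    intro j
    by_cases hj : dv x j = 0
    · rw [hq.eq_zero j hj]; simp
    · rw [smul_inv_smul₀]
      exact_mod_cast hκr j hj
  refine ⟨fun j => ((√c.re * rCoef x j : ℝ) : ℂ)⁻¹ • ι (q j), √c.re, hκ, hιq, fun i j => ?_, ?_⟩
  · rw [inner_smul_left, inner_smul_right, hι.2, hc]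
    by_cases hij : i = j
    · subst hij
      by_cases hj : dv x i = 0
      · simp [hj]
      · rw [if_pos rfl, if_pos ⟨rfl, hj⟩, ← rCoef_sq hx, map_inv₀, Complex.conj_ofReal]
        have h1 : ((√c.re * rCoef x i : ℝ) : ℂ) ≠ 0 := by exact_mod_cast hκr i hj
        field_simp
        rw [← hcre]
        norm_cast
        rw [mul_pow, Real.sq_sqrt (by simpa using hcpos.le)]
    · rw [if_neg fun h => hij h.symm, if_neg fun h => hij h.1]
      simp
  · unfold DenseSpan
    rw [eq_top_iff]
    rintro v -
    rw [← SetLike.mem_coe, Submodule.topologicalClosure_coe]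
    refine closure_mono ?_ (hι.1 v)
    rintro _ ⟨w, rfl⟩
    refine hq.induction (p := fun w => ι w ∈ Submodule.span ℂ (Set.range fun j =>
      ((√c.re * rCoef x j : ℝ) : ℂ)⁻¹ • ι (q j))) (fun j => ?_) (fun v w hv hw => ?_)
      (fun c v hv => ?_) w
    · rw [hιq]
      exact Submodule.smul_mem _ _ (Submodule.subset_span ⟨j, rfl⟩)
    · rw [map_add]; exact Submodule.add_mem _ hv hw
    · rw [map_smul]; exact Submodule.smul_mem _ _ hv

end

end HCFamily

end ContractionFamilies
end

noncomputable section

namespace ContractionFamilies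

namespace HCFamily

/-! ### Integration of infinitesimally unitary Jantzen quotients -/

/-- The points at which some Jantzen quotient is infinitesimally unitary. -/
def IsSpecialPoint (x : ℝ) : Prop := 0 ≤ x ∨ ∃ m : ℕ, x = discretePoint m

lemma IsSpecialPoint.isUnitaryPoint {x : ℝ} (hx : IsSpecialPoint x) : IsUnitaryPoint x := by
  rcases hx with hx | ⟨m, rfl⟩
  · exact isUnitaryPoint_of_nonneg hx
  · exact isUnitaryPoint_discretePoint m

variable {F : HCFamily.{u}} (hF : F.IsContractionFamily) (φ : F.Intertwiner) {x : ℝ}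
include hF

/-- The points that carry an infinitesimally unitary quotient are special; `existsUnique_isInfUnitary`
is the converse. -/
theorem isSpecialPoint_of_isInfUnitary {n : ℤ} (h : IsInfUnitary φ x n) : IsSpecialPoint x := by
  obtain ⟨b, hb⟩ := hF.exists_isStandard
  obtain ⟨n₀, -, h1⟩ := isInfUnitary_imp hb φ (x := x)
  rcases le_or_gt 0 x with hx | hx
  · exact Or.inl hx
  · exact Or.inr (h1 hx n h).2

lemma isInfUnitary_unique {n n' : ℤ} (h : IsInfUnitary φ x n) (h' : IsInfUnitary φ x n') :
    n = n' := by
  obtain ⟨b, hb⟩ := hF.exists_isStandard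
  obtain ⟨n₀, h0, h1⟩ := isInfUnitary_imp hb φ (x := x)
  rcases le_or_gt 0 x with hx | hx
  · rw [h0 hx n h.1, h0 hx n' h'.1]
  · rw [(h1 hx n h).1, (h1 hx n' h').1]

theorem existsUnique_isInfUnitary (hx : IsSpecialPoint x) : ∃! n : ℤ, IsInfUnitary φ x n := by
  obtain ⟨b, hb⟩ := hF.exists_isStandard
  obtain ⟨n, q, hq⟩ := exists_isQuotBasis.{u, 0} hb φ x
  exact ⟨n, hq.isInfUnitary hx.isUnitaryPoint, fun n' h' =>
    isInfUnitary_unique hF φ h' (hq.isInfUnitary hx.isUnitaryPoint)⟩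

theorem exists_nontrivial_of_nonneg (hx : 0 ≤ x) : ∃ n₀ : ℤ, IsInfUnitary φ x n₀ ∧
    ∀ n, Nontrivial (JQuot φ x n) → n = n₀ := by
  obtain ⟨b, hb⟩ := hF.exists_isStandard
  obtain ⟨n, q, hq⟩ := exists_isQuotBasis.{u, 0} hb φ x
  obtain ⟨n₀, h0, -⟩ := isInfUnitary_imp hb φ (x := x)
  refine ⟨n, hq.isInfUnitary (isUnitaryPoint_of_nonneg hx), fun n' h' => ?_⟩
  rw [h0 hx n' h', h0 hx n hq.nontrivial]

variable {H : Type v} [NormedAddCommGroup H] [InnerProductSpace ℂ H]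

/-- The representations on the completions of infinitesimally unitary Jantzen quotients are those
with a dense ladder. -/
theorem isJantzenRep_iff (hx : IsSpecialPoint x) (π : UnitaryRep (realGroup x) H) :
    IsJantzenRep φ x π ↔ ∃ u, HasLadder π u ∧ DenseSpan u := by
  obtain ⟨b, hb⟩ := hF.exists_isStandard
  obtain ⟨n, q, hq⟩ := exists_isQuotBasis.{u, v} hb φ x
  have hx' := hx.isUnitaryPoint
  constructor
  · rintro ⟨n', B, ι, hnt, hB, hpos, hι, hint⟩
    obtain rfl := isInfUnitary_unique hF φ ⟨hnt, B, hB, hpos⟩ (hq.isInfUnitary hx')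
    obtain ⟨u, κ, hκ, hιq, hu, hd⟩ := hq.exists_normalized hx' hB hpos hι
    exact ⟨u, (hq.integrates_iff hx' hκ hιq hu).1 hint, hd⟩
  · rintro ⟨u, hu, hd⟩
    obtain ⟨B, hB, hBq⟩ := hq.exists_form
    obtain ⟨ι, hι⟩ := hq.exists_lift (fun j => (rCoef x j : ℂ) • u j) (fun j hj => by
      rw [hu.eq_zero hj, smul_zero])
    have hint := (hq.integrates_iff hx' (π := π) (ι := ι) one_ne_zero
      (by simpa using hι) hu.inner_eq).2 hu
    refine ⟨n, B, ι, hq.nontrivial, hB, hq.isPosDef hx' one_pos (by simpa using hBq),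
      ⟨?_, ?_⟩, hint⟩
    · intro v
      refine hd.induction (p := fun v => v ∈ closure (Set.range ι)) (fun j => ?_) ?_ ?_
        isClosed_closure v
      · refine subset_closure ?_
        by_cases hj : dv x j = 0
        · exact ⟨0, by rw [map_zero, hu.eq_zero hj]⟩
        · refine ⟨(rCoef x j : ℂ)⁻¹ • q j, ?_⟩
          have : (rCoef x j : ℂ) ≠ 0 := by exact_mod_cast mt (rCoef_eq_zero_iff hx' j).1 hj
          rw [map_smul, hι, inv_smul_smul₀ this]
      · intro v w hv hw
        exact (LinearMap.range ι).topologicalClosure.add_mem hv hw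
      · intro c v hv
        exact (LinearMap.range ι).topologicalClosure.smul_mem c hv
    · intro v w
      refine hq.induction (p := fun v => ⟪ι w, ι v⟫_ℂ = B v w) (fun i => ?_)
        (fun v v' hv hv' => ?_) (fun c v hv => ?_) v
      · refine hq.induction (p := fun w => ⟪ι w, ι (q i)⟫_ℂ = B (q i) w) (fun j => ?_)
          (fun v v' hv hv' => ?_) (fun c v hv => ?_) w
        · rw [hι, hι, inner_smul_left, inner_smul_right, hu.inner_eq, hBq, Complex.conj_ofReal]
          by_cases hij : i = j
          · subst hij
            by_cases hj : dv x i = 0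
            · simp [hj]
            · rw [if_pos ⟨rfl, hj⟩, if_pos rfl, ← rCoef_sq hx']
              push_cast
              ring
          · rw [if_neg fun h => hij h.1.symm, if_neg hij]
            simp
        · rw [map_add, map_add, inner_add_left, hv, hv']
        · rw [map_smul, inner_smul_left, hv, LinearMap.map_smulₛₗ, smul_eq_mul]
      · rw [map_add, map_add, inner_add_right, hv, hv', LinearMap.add_apply]
      · rw [map_smul, map_smul, inner_smul_right, hv, LinearMap.smul_apply, smul_eq_mul]

/-- An infinitesimally unitary Jantzen quotient integrates uniquely, if there is a representation
with a dense ladder. -/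
theorem existsUnique_integrates [CompleteSpace H] {n : ℤ} {B : SesqForm (JQuot φ x n)}
    (hn : IsInfUnitary φ x n) (hB : IsJantzenForm φ x n B) (hpos : IsPosDef B)
    {ι : JQuot φ x n →ₗ[ℂ] H} (hι : IsCompletion B ι)
    {H' : Type} [NormedAddCommGroup H'] [InnerProductSpace ℂ H'] [CompleteSpace H']
    {π' : UnitaryRep (realGroup x) H'} {u' : ℤ → H'} (hu' : HasLadder π' u') (hd' : DenseSpan u') :
    ∃! π : UnitaryRep (realGroup x) H, Integrates φ x n ι π := by
  obtain ⟨b, hb⟩ := hF.exists_isStandard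
  obtain ⟨n', q, hq⟩ := exists_isQuotBasis.{u, v} hb φ x
  have hx' := (isSpecialPoint_of_isInfUnitary hF φ hn).isUnitaryPoint
  obtain rfl := isInfUnitary_unique hF φ hn (hq.isInfUnitary hx')
  obtain ⟨u, κ, hκ, hιq, hu, hd⟩ := hq.exists_normalized hx' hB hpos hι
  obtain ⟨U, hU⟩ := hu'.exists_equiv hd' hu hd
  refine ⟨π'.transport U, (hq.integrates_iff hx' hκ hιq hu).2 (hu'.transport U hU), fun π hπ => ?_⟩
  exact ((hq.integrates_iff hx' hκ hιq hu).1 hπ).unique (hu'.transport U hU) hd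

end HCFamily

/-! ### Contraction of ladders -/

section Contraction

variable {I : Type*} {l : Filter I} {H₀ : Type*} [NormedAddCommGroup H₀] [InnerProductSpace ℂ H₀]
  [CompleteSpace H₀]

omit [InnerProductSpace ℂ H₀] [CompleteSpace H₀] in
/-- Uniform convergence on compact sets follows from continuous convergence. -/
lemma tendstoUniformlyOn_of_tendsto_prod {G : Type*} [TopologicalSpace G] {f : I → G → H₀}
    {f₀ : G → H₀} (hf₀ : Continuous f₀)
    (h : ∀ g, Tendsto (fun p : I × G => f p.1 p.2) (l ×ˢ 𝓝 g) (𝓝 (f₀ g))) {S : Set G}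
    (hS : IsCompact S) : TendstoUniformlyOn f f₀ l S := by
  refine (tendstoLocallyUniformlyOn_iff_tendstoUniformlyOn_of_compact hS).1 ?_
  intro s hs g _
  obtain ⟨t, ht, htsymm, hts⟩ := comp_symm_mem_uniformity_sets hs
  have h1 : ∀ᶠ p in l ×ˢ 𝓝 g, (f₀ g, f p.1 p.2) ∈ t :=
    (Uniform.tendsto_nhds_right.1 (h g)).eventually ht
  have h2 : ∀ᶠ y in 𝓝 g, (f₀ g, f₀ y) ∈ t :=
    (Uniform.tendsto_nhds_right.1 hf₀.continuousAt).eventually ht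
  have h3 := h1.and (tendsto_snd.eventually h2)
  obtain ⟨pa, hpa, pb, hpb, hp⟩ := eventually_prod_iff.1 h3
  refine ⟨{y | pb y}, mem_nhdsWithin_of_mem_nhds hpb, ?_⟩
  filter_upwards [hpa] with i hi y hy
  obtain ⟨k1, k2⟩ := hp hi hy
  exact hts ⟨f₀ g, htsymm.symm _ _ k2, k1⟩

variable {H : I → Type*} [∀ i, NormedAddCommGroup (H i)] [∀ i, InnerProductSpace ℂ (H i)]
  [∀ i, CompleteSpace (H i)]

variable {P : Type*} {L : Filter P}

omit [CompleteSpace H₀] in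
/-- Contraction operators that converge strongly on a dense ladder converge strongly. -/
lemma tendsto_apply_of_dense {u₀ : ℤ → H₀} (hd : DenseSpan u₀) {A : P → H₀ →L[ℂ] H₀}
    {A₀ : H₀ →L[ℂ] H₀} (hA : ∀ p, ‖A p‖ ≤ 1)
    (h : ∀ j, Tendsto (fun p => A p (u₀ j)) L (𝓝 (A₀ (u₀ j)))) (v : H₀) :
    Tendsto (fun p => A p v) L (𝓝 (A₀ v)) := by
  refine hd.induction (p := fun v => Tendsto (fun p => A p v) L (𝓝 (A₀ v))) h ?_ ?_ ?_ v
  · intro v w hv hw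
    simpa only [map_add] using hv.add hw
  · intro c v hv
    simpa only [map_smul] using hv.const_smul c
  · refine isClosed_of_closure_subset fun v hv => ?_
    rw [Set.mem_ofPred_eq, Metric.tendsto_nhds]
    intro ε hε
    have hpos : 0 < ε / (2 * (‖A₀‖ + 2)) := by positivity
    obtain ⟨w, hw, hvw⟩ := Metric.mem_closure_iff.1 hv _ hpos
    filter_upwards [(Metric.tendsto_nhds.1 hw) (ε / 2) (by positivity)] with p hp
    rw [dist_eq_norm] at hp hvw ⊢
    have e : A p v - A₀ v = A p (v - w) + (A p w - A₀ w) + A₀ (w - v) := by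
      simp only [map_sub]; abel
    have h1 : ‖A p (v - w)‖ ≤ ‖v - w‖ := by
      simpa using (A p).le_of_opNorm_le (hA p) (v - w)
    have h2 : ‖A₀ (w - v)‖ ≤ ‖A₀‖ * ‖v - w‖ := by
      rw [norm_sub_rev v w]; exact A₀.le_opNorm _
    have h3 : (‖A₀‖ + 1) * ‖v - w‖ < ε / 2 := by
      rw [lt_div_iff₀ (by positivity)] at hvw
      have h0 := norm_nonneg A₀
      have hvw0 := norm_nonneg (v - w)
      nlinarith
    rw [e]
    calc _ ≤ ‖A p (v - w)‖ + ‖A p w - A₀ w‖ + ‖A₀ (w - v)‖ := norm_add₃_le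
      _ < ε := by linarith

omit [CompleteSpace H₀] in
lemma tendsto_apply_apply {A : P → H₀ →L[ℂ] H₀} (hA : ∀ p, ‖A p‖ ≤ 1)
    {v : P → H₀} {v₀ w₀ : H₀} (h : Tendsto (fun p => A p v₀) L (𝓝 w₀)) (hv : Tendsto v L (𝓝 v₀)) :
    Tendsto (fun p => A p (v p)) L (𝓝 w₀) := by
  have h1 : Tendsto (fun p => A p (v p - v₀)) L (𝓝 0) := by
    refine squeeze_zero_norm (fun p => ?_) (tendsto_iff_norm_sub_tendsto_zero.1 hv)
    simpa using (A p).le_of_opNorm_le (hA p) (v p - v₀)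
  simpa using h1.add h

/-- The compression of a unitary operator along an isometry. -/
def compression {H : Type*} [NormedAddCommGroup H] [InnerProductSpace ℂ H] [CompleteSpace H]
    (J : H →ₗᵢ[ℂ] H₀) (V : H ≃ₗᵢ[ℂ] H) : H₀ →L[ℂ] H₀ :=
  J.toContinuousLinearMap ∘L V.toLinearIsometry.toContinuousLinearMap ∘L
    ContinuousLinearMap.adjoint J.toContinuousLinearMap

section Compression

variable {H : Type*} [NormedAddCommGroup H] [InnerProductSpace ℂ H] [CompleteSpace H]
  (J : H →ₗᵢ[ℂ] H₀) (V V' : H ≃ₗᵢ[ℂ] H)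

lemma compression_apply (v : H₀) : compression J V v =
    J (V (ContinuousLinearMap.adjoint J.toContinuousLinearMap v)) := rfl

lemma adjoint_apply_apply (v : H) :
    ContinuousLinearMap.adjoint J.toContinuousLinearMap (J v) = v := by
  refine ext_inner_left ℂ fun w => ?_
  rw [ContinuousLinearMap.adjoint_inner_right]
  exact J.inner_map_map w v

lemma compression_norm_le : ‖compression J V‖ ≤ 1 := by
  refine ContinuousLinearMap.opNorm_le_bound _ zero_le_one fun v => ?_
  rw [compression_apply, J.norm_map, V.norm_map]
  refine ContinuousLinearMap.le_of_opNorm_le _ ?_ v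
  rw [LinearIsometryEquiv.norm_map]
  exact J.norm_toContinuousLinearMap_le

lemma compression_mul (v : H₀) :
    compression J (V * V') v = compression J V (compression J V' v) := by
  rw [compression_apply, compression_apply, compression_apply, adjoint_apply_apply]
  rfl

lemma tendsto_compression_mul {K : P → Type*} [∀ p, NormedAddCommGroup (K p)]
    [∀ p, InnerProductSpace ℂ (K p)] [∀ p, CompleteSpace (K p)] {J : ∀ p, K p →ₗᵢ[ℂ] H₀}
    {V V' : ∀ p, K p ≃ₗᵢ[ℂ] K p} {V₀ V₀' : H₀ ≃ₗᵢ[ℂ] H₀}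
    (h : ∀ v, Tendsto (fun p => compression (J p) (V p) v) L (𝓝 (V₀ v)))
    (h' : ∀ v, Tendsto (fun p => compression (J p) (V' p) v) L (𝓝 (V₀' v))) (v : H₀) :
    Tendsto (fun p => compression (J p) (V p * V' p) v) L (𝓝 ((V₀ * V₀') v)) := by
  have h1 := tendsto_apply_apply (fun p => compression_norm_le (J p) (V p)) (h (V₀' v)) (h' v)
  exact h1.congr fun p => (compression_mul (J p) (V p) (V' p) v).symm

lemma tendsto_compression_pow {K : P → Type*} [∀ p, NormedAddCommGroup (K p)]
    [∀ p, InnerProductSpace ℂ (K p)] [∀ p, CompleteSpace (K p)] {J : ∀ p, K p →ₗᵢ[ℂ] H₀}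
    {V : ∀ p, K p ≃ₗᵢ[ℂ] K p} {V₀ : H₀ ≃ₗᵢ[ℂ] H₀}
    (h : ∀ v, Tendsto (fun p => compression (J p) (V p) v) L (𝓝 (V₀ v))) (k : ℕ) (v : H₀) :
    Tendsto (fun p => compression (J p) (V p ^ (k + 1)) v) L (𝓝 ((V₀ ^ (k + 1)) v)) := by
  induction k generalizing v with
  | zero => simpa only [zero_add, pow_one] using h v
  | succ k ih =>
    simp only [pow_succ' _ (k + 1)]
    exact tendsto_compression_mul h ih v

end Compression

/-- Strong convergence of compressions at `exp (b)` for `b` near `0`, by Taylor expansion on the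
ladder vectors. -/
lemma tendsto_compression_expReal_small {x : I → ℝ} (hx : Tendsto x l (𝓝 0))
    {π : ∀ i, UnitaryRep (realGroup (x i)) (H i)} {u : ∀ i, ℤ → H i}
    (hu : ∀ i, HasLadder (π i) (u i))
    {π₀ : UnitaryRep (realGroup 0) H₀} {u₀ : ℤ → H₀} (hu₀ : HasLadder π₀ u₀)
    (hd₀ : DenseSpan u₀) {J : ∀ i, H i →ₗᵢ[ℂ] H₀}
    (hJ : ∀ i j, dv (x i) j ≠ 0 → J i (u i j) = u₀ j)
    (hev : ∀ j, ∀ᶠ i in l, dv (x i) j ≠ 0)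
    {b₀ : ℂ} (hb₀ : ‖b₀‖ < 1 / 16) (v : H₀) :
    Tendsto (fun p : I × ℂ =>
      compression (J p.1) ((π p.1).toHom (expReal (x p.1) (realElt (x p.1) 0 p.2))) v)
      (l ×ˢ 𝓝 b₀) (𝓝 (π₀.toHom (expReal 0 (realElt 0 0 b₀)) v)) := by
  -- convergence at the ladder vectors, for the elements near the identity
  have hpow : ∀ (b₀ : ℂ) (k : ℕ) (j : ℤ), Tendsto (fun p : I × ℂ => J p.1
      (Finsupp.linearCombination ℂ (u p.1) ((ladderOp (x p.1) 0 p.2 ^ k) (Finsupp.single j 1))))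
      (l ×ˢ 𝓝 b₀) (𝓝 (Finsupp.linearCombination ℂ u₀
        ((ladderOp 0 0 b₀ ^ k) (Finsupp.single j 1)))) := by
    intro b₀ k
    have hb : Tendsto (fun p : I × ℂ => p.2) (l ×ˢ 𝓝 b₀) (𝓝 b₀) := tendsto_snd
    have hs : ∀ j, Tendsto (fun p : I × ℂ => (sCoef (x p.1) j : ℂ)) (l ×ˢ 𝓝 b₀)
        (𝓝 (sCoef 0 j : ℂ)) := by
      intro j
      have hc : Continuous fun y => (sCoef y j : ℂ) := by unfold sCoef; fun_prop
      exact hc.continuousAt.tendsto.comp (hx.comp tendsto_fst)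
    induction k with
    | zero =>
      intro j
      simp only [pow_zero, Module.End.one_apply, Finsupp.linearCombination_single, one_smul]
      refine tendsto_const_nhds.congr' ?_
      filter_upwards [tendsto_fst.eventually (hev j)] with p hp
      rw [hJ _ _ hp]
    | succ k ih =>
      intro j
      simp only [pow_succ, Module.End.mul_apply, ladderOp_single, Complex.ofReal_zero, mul_zero,
        zero_mul, zero_smul, zero_add, map_sub, map_smul]
      exact ((hb.mul (hs j)).smul (ih (j + 1))).sub
        ((((Complex.continuous_conj.tendsto _).comp hb).mul (hs (j - 1))).smul (ih (j - 1)))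
  refine tendsto_apply_of_dense hd₀
    (A₀ := (π₀.toHom (expReal 0 (realElt 0 0 b₀))).toLinearIsometry.toContinuousLinearMap)
    (fun p => compression_norm_le _ _) (fun j => ?_) v
  -- the Taylor polynomials of order `n` approximate both sides to `ε / 3`, uniformly in `x` and `b`
  rw [Metric.tendsto_nhds]
  intro ε hε
  obtain ⟨n, hn⟩ := exists_pow_lt_of_lt_one (show 0 < ε / 3 / 2 ^ j.natAbs by positivity)
    (show (1 / 2 : ℝ) < 1 by norm_num)
  rw [lt_div_iff₀ (by positivity)] at hn
  have hbound : ∀ {y : ℝ} {b : ℂ}, ‖b‖ < 1 / 16 → |y| < 1 →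
      2 ^ j.natAbs * (4 * ‖b‖ * (1 + |y|)) ^ n < ε / 3 := by
    intro y b hb hy
    refine lt_of_le_of_lt ?_ hn
    rw [mul_comm]
    have h1 : 4 * ‖b‖ * (1 + |y|) ≤ 1 / 2 := by nlinarith [norm_nonneg b, abs_nonneg y]
    gcongr
  have e1 : ∀ᶠ p : I × ℂ in l ×ˢ 𝓝 b₀, ‖p.2‖ < 1 / 16 :=
    tendsto_snd.eventually (continuous_norm.continuousAt.eventually_lt continuousAt_const hb₀)
  have e2 : ∀ᶠ p : I × ℂ in l ×ˢ 𝓝 b₀, |x p.1| < 1 := by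
    refine tendsto_fst.eventually (hx.eventually (p := fun y => |y| < 1) ?_)
    exact continuous_abs.continuousAt.eventually_lt continuousAt_const (by simp)
  have e3 := Metric.tendsto_nhds.1 (tendsto_finsetSum (Finset.range n) fun k _ =>
    (hpow b₀ k j).const_smul ((k.factorial : ℂ)⁻¹)) (ε / 3) (by positivity)
  filter_upwards [e1, e2, e3, tendsto_fst.eventually (hev j)] with p p1 p2 p3 p4
  have t1 := (hu p.1).norm_toHom_sub_le p.2 n j
  have t2 := hu₀.norm_toHom_sub_le b₀ n j
  have t3 := hbound p1 p2
  have t4 := hbound (y := 0) hb₀ (by simp)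
  rw [compression_apply, ← hJ _ _ p4, adjoint_apply_apply, hJ _ _ p4]
  rw [← (J p.1).norm_map, map_sub, map_sum] at t1
  simp only [map_smul] at t1
  rw [← dist_eq_norm] at t1 t2
  change dist _ (π₀.toHom (expReal 0 (realElt 0 0 b₀)) (u₀ j)) < ε
  rw [dist_comm] at t2
  exact lt_of_le_of_lt (dist_triangle4 _ _ _ _) (by linarith)

/-- The restriction to small `b` is removed by writing `exp (b)` as a power of `exp (b / n)`. -/
lemma tendsto_compression_expReal {x : I → ℝ} (hx : Tendsto x l (𝓝 0))
    {π : ∀ i, UnitaryRep (realGroup (x i)) (H i)} {u : ∀ i, ℤ → H i}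
    (hu : ∀ i, HasLadder (π i) (u i))
    {π₀ : UnitaryRep (realGroup 0) H₀} {u₀ : ℤ → H₀} (hu₀ : HasLadder π₀ u₀)
    (hd₀ : DenseSpan u₀) {J : ∀ i, H i →ₗᵢ[ℂ] H₀}
    (hJ : ∀ i j, dv (x i) j ≠ 0 → J i (u i j) = u₀ j)
    (hev : ∀ j, ∀ᶠ i in l, dv (x i) j ≠ 0)
    (b₀ : ℂ) (v : H₀) :
    Tendsto (fun p : I × ℂ =>
      compression (J p.1) ((π p.1).toHom (expReal (x p.1) (realElt (x p.1) 0 p.2))) v)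
      (l ×ˢ 𝓝 b₀) (𝓝 (π₀.toHom (expReal 0 (realElt 0 0 b₀)) v)) := by
  obtain ⟨n, hn⟩ := exists_nat_gt (‖b₀‖ / (1 / 16))
  have hn0 : 0 < (n : ℝ) := lt_of_le_of_lt (by positivity) hn
  obtain ⟨m, rfl⟩ : ∃ m, n = m + 1 := ⟨n - 1, by
    have : 0 < n := by exact_mod_cast hn0
    omega⟩
  have hnc : ((m + 1 : ℕ) : ℂ) ≠ 0 := by exact_mod_cast hn0.ne'
  have hdiv : ∀ (y : ℝ) (b : ℂ), expReal y (realElt y 0 b) =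
      expReal y (realElt y 0 (b / (m + 1 : ℕ))) ^ (m + 1) := by
    intro y b
    rw [← expReal_nsmul, smul_realElt, mul_zero]
    congr 2
    rw [Complex.ofReal_natCast]
    field_simp
  have hb : ‖b₀ / (m + 1 : ℕ)‖ < 1 / 16 := by
    rw [norm_div, Complex.norm_natCast, div_lt_iff₀ hn0]
    rw [div_lt_iff₀ (by norm_num)] at hn
    linarith
  have ht : Tendsto (fun p : I × ℂ => (p.1, p.2 / ((m + 1 : ℕ) : ℂ))) (l ×ˢ 𝓝 b₀)
      (l ×ˢ 𝓝 (b₀ / (m + 1 : ℕ))) :=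
    tendsto_fst.prodMk (tendsto_snd.div_const _)
  have hs : ∀ v, Tendsto (fun p : I × ℂ => compression (J p.1) ((π p.1).toHom
      (expReal (x p.1) (realElt (x p.1) 0 (p.2 / (m + 1 : ℕ))))) v) (l ×ˢ 𝓝 b₀)
      (𝓝 (π₀.toHom (expReal 0 (realElt 0 0 (b₀ / (m + 1 : ℕ)))) v)) := fun v =>
    (tendsto_compression_expReal_small hx hu hu₀ hd₀ hJ hev hb v).comp ht
  have h1 := tendsto_compression_pow hs m v
  simp only [hdiv _ b₀, map_pow]
  refine h1.congr fun p => ?_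
  rw [hdiv _ p.2, map_pow]

lemma tendsto_compression_torus {x : I → ℝ}
    {π : ∀ i, UnitaryRep (realGroup (x i)) (H i)} {u : ∀ i, ℤ → H i}
    (hu : ∀ i, HasLadder (π i) (u i))
    {π₀ : UnitaryRep (realGroup 0) H₀} {u₀ : ℤ → H₀} (hu₀ : HasLadder π₀ u₀)
    (hd₀ : DenseSpan u₀) {J : ∀ i, H i →ₗᵢ[ℂ] H₀}
    (hJ : ∀ i j, dv (x i) j ≠ 0 → J i (u i j) = u₀ j)
    (hev : ∀ j, ∀ᶠ i in l, dv (x i) j ≠ 0)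
    (w₀ : Circle) (v : H₀) : Tendsto (fun p : I × Circle =>
      compression (J p.1) ((π p.1).toHom (torus (x p.1) p.2)) v)
      (l ×ˢ 𝓝 w₀) (𝓝 (π₀.toHom (torus 0 w₀) v)) := by
  refine tendsto_apply_of_dense hd₀
    (A₀ := (π₀.toHom (torus 0 w₀)).toLinearIsometry.toContinuousLinearMap)
    (fun p => compression_norm_le _ _) (fun j => ?_) v
  have hw : Tendsto (fun p : I × Circle => ((p.2 : ℂ) ^ (2 * j)) • u₀ j) (l ×ˢ 𝓝 w₀)
      (𝓝 (((w₀ : ℂ) ^ (2 * j)) • u₀ j)) := by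
    have h1 : Tendsto (fun p : I × Circle => (p.2 : ℂ)) (l ×ˢ 𝓝 w₀) (𝓝 (w₀ : ℂ)) :=
      (continuous_induced_dom.tendsto _).comp tendsto_snd
    exact (h1.zpow₀ _ (Or.inl (Circle.coe_ne_zero _))).smul_const _
  change Tendsto _ _ (𝓝 (π₀.toHom (torus 0 w₀) (u₀ j)))
  rw [hu₀.torus]
  refine hw.congr' ?_
  filter_upwards [tendsto_fst.eventually (hev j)] with p hp
  rw [compression_apply, ← hJ _ _ hp, adjoint_apply_apply, (hu p.1).torus, map_smul]

set_option maxHeartbeats 1000000 in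
/-- Representations with dense ladders over points `x i → 0` contract to a representation of the
motion group with a dense ladder. -/
theorem exists_contraction {x : I → ℝ} (hx : Tendsto x l (𝓝 0))
    {π : ∀ i, UnitaryRep (realGroup (x i)) (H i)} {u : ∀ i, ℤ → H i}
    (hu : ∀ i, HasLadder (π i) (u i)) (hd : ∀ i, DenseSpan (u i))
    {π₀ : UnitaryRep (realGroup 0) H₀} {u₀ : ℤ → H₀} (hu₀ : HasLadder π₀ u₀)
    (hd₀ : DenseSpan u₀) :
    ∃ J : ∀ i, H i →ₗᵢ[ℂ] H₀, ∀ (v : H₀) (S : Set (realGroup 0)), IsCompact S →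
      TendstoUniformlyOn (fun i g => J i ((π i).toHom
        (expReal (x i) (realElt (x i) 0 (transPart g)) * torus (x i) (rotPart g))
        (ContinuousLinearMap.adjoint (J i).toContinuousLinearMap v)))
      (fun g => π₀.toHom g v) l S := by
  have h0 : ∀ j, dv 0 j ≠ 0 := fun j => (dv_pos le_rfl j).ne'
  have hJ : ∀ i, ∃ J : H i →ₗᵢ[ℂ] H₀, ∀ j, dv (x i) j ≠ 0 → J (u i j) = u₀ j := by
    intro i
    exact (hd i).exists_isometry (S := {j | dv (x i) j ≠ 0}) (u' := u₀)
      (fun j hj => (hu i).eq_zero (not_not.1 hj))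
      (fun k hk j hj => by rw [(hu i).inner_eq]; simp [show dv (x i) j ≠ 0 from hj])
      (fun k hk j hj => by rw [hu₀.inner_eq]; simp [h0])
  choose J hJ using hJ
  have hev : ∀ j, ∀ᶠ i in l, dv (x i) j ≠ 0 := by
    intro j
    have hc : Continuous fun y => dv y j := by unfold dv; fun_prop
    exact (hc.continuousAt.tendsto.comp hx).eventually_ne (h0 j)
  refine ⟨J, fun v S hS => tendstoUniformlyOn_of_tendsto_prod (π₀.continuous_orbit v) (fun g => ?_)
    hS⟩
  have t1 : Tendsto (fun p : I × realGroup 0 => (p.1, transPart p.2)) (l ×ˢ 𝓝 g)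
      (l ×ˢ 𝓝 (transPart g)) :=
    tendsto_fst.prodMk ((continuous_transPart.tendsto _).comp tendsto_snd)
  have t2 : Tendsto (fun p : I × realGroup 0 => (p.1, rotPart p.2)) (l ×ˢ 𝓝 g)
      (l ×ˢ 𝓝 (rotPart g)) :=
    tendsto_fst.prodMk ((continuous_rotPart.tendsto _).comp tendsto_snd)
  have h1 := tendsto_compression_mul (K := fun p : I × realGroup 0 => H p.1) (J := fun p => J p.1)
    (V := fun p => (π p.1).toHom (expReal (x p.1) (realElt (x p.1) 0 (transPart p.2))))
    (V' := fun p => (π p.1).toHom (torus (x p.1) (rotPart p.2)))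
    (fun v => (tendsto_compression_expReal hx hu hu₀ hd₀ hJ hev _ v).comp t1)
    (fun v => (tendsto_compression_torus hu hu₀ hd₀ hJ hev _ v).comp t2) v
  rw [← map_mul, ← motion_polar] at h1
  refine h1.congr fun p => ?_
  rw [← map_mul, compression_apply]

end Contraction

end ContractionFamilies
end

noncomputable section

namespace ContractionFamilies

/-! ### The center of the enveloping algebra of the motion algebra -/

section Center

/-- The complexified Lie algebra of the motion group. -/
abbrev motionAlg := gPairs ℂ (0 : ℂ)

/-- Its enveloping algebra. -/
abbrev motionU := UniversalEnvelopingAlgebra ℂ motionAlg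

/-- The image of `H` in the enveloping algebra. -/
def uH : motionU := UniversalEnvelopingAlgebra.ι ℂ (gElt (0 : ℂ) 1 0 0)
/-- The image of `E` in the enveloping algebra. -/
def uE : motionU := UniversalEnvelopingAlgebra.ι ℂ (gElt (0 : ℂ) 0 1 0)
/-- The image of `F` in the enveloping algebra. -/
def uF : motionU := UniversalEnvelopingAlgebra.ι ℂ (gElt (0 : ℂ) 0 0 1)

lemma motionAlg_decomp (Y : motionAlg) : Y = Y.1.1 0 0 • gElt (0 : ℂ) 1 0 0 +
    Y.1.1 0 1 • gElt (0 : ℂ) 0 1 0 + Y.1.2 1 0 • gElt (0 : ℂ) 0 0 1 := by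
  obtain ⟨h1, h2, h3, h4, h5⟩ := Y.2
  apply Subtype.ext
  apply Prod.ext <;> ext i j : 1 <;> fin_cases i <;> fin_cases j <;> simp [gElt, *]

lemma gElt_lie (a b c a' b' c' : ℂ) : ⁅gElt (0 : ℂ) a b c, gElt (0 : ℂ) a' b' c'⁆ =
    gElt (0 : ℂ) 0 (2 * (a * b' - a' * b)) (2 * (a' * c - a * c')) := by
  apply Subtype.ext
  apply Prod.ext <;> ext i j : 1 <;> fin_cases i <;> fin_cases j <;>
    simp [gElt, Ring.lie_def] <;> ring

lemma uH_mul_uE : uH * uE = uE * (uH + 2) := by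
  have h := (UniversalEnvelopingAlgebra.ι ℂ).map_lie (gElt (0 : ℂ) 1 0 0) (gElt (0 : ℂ) 0 1 0)
  have e : gElt (0 : ℂ) 0 2 0 = (2 : ℂ) • gElt (0 : ℂ) 0 1 0 := by
    rw [motionAlg_decomp (gElt (0 : ℂ) 0 2 0)]; simp [gElt]
  rw [gElt_lie, LieRing.of_associative_ring_bracket] at h
  simp only [mul_zero, sub_zero, mul_one, sub_self] at h
  rw [e, map_smul, two_smul] at h
  change uE + uE = uH * uE - uE * uH at h
  rw [mul_add, mul_two, h]; abel

lemma uH_mul_uF : uH * uF = uF * (uH - 2) := by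
  have h := (UniversalEnvelopingAlgebra.ι ℂ).map_lie (gElt (0 : ℂ) 1 0 0) (gElt (0 : ℂ) 0 0 1)
  have e : gElt (0 : ℂ) 0 0 (-2) = (-2 : ℂ) • gElt (0 : ℂ) 0 0 1 := by
    rw [motionAlg_decomp (gElt (0 : ℂ) 0 0 (-2))]; simp [gElt]
  rw [gElt_lie, LieRing.of_associative_ring_bracket] at h
  simp only [mul_zero, zero_sub, mul_one, sub_self, mul_neg] at h
  rw [e, map_smul, neg_smul, two_smul] at h
  change -(uF + uF) = uH * uF - uF * uH at h
  rw [mul_sub, mul_two, sub_eq_iff_eq_add.1 h.symm]; abel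

lemma uE_mul_uF : uE * uF = uF * uE := by
  have h := (UniversalEnvelopingAlgebra.ι ℂ).map_lie (gElt (0 : ℂ) 0 1 0) (gElt (0 : ℂ) 0 0 1)
  have e : gElt (0 : ℂ) 0 0 0 = 0 := by
    rw [motionAlg_decomp (gElt (0 : ℂ) 0 0 0)]; simp [gElt]
  rw [gElt_lie, LieRing.of_associative_ring_bracket] at h
  simp only [zero_mul, mul_zero, sub_self] at h
  rw [e, map_zero] at h
  exact (sub_eq_zero.1 h.symm)

lemma uE_mul_aeval (p : ℂ[X]) : uE * aeval uH p = aeval uH (p.comp (X - 2)) * uE := by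
  induction p using Polynomial.induction_on' with
  | add p q hp hq => simp only [map_add, add_comp, mul_add, add_mul, hp, hq]
  | monomial n c =>
    have h1 : uE * uH = (uH - 2) * uE := by
      rw [sub_mul, uH_mul_uE, mul_add, mul_two, two_mul]; abel
    have h2 : ∀ n : ℕ, uE * uH ^ n = (uH - 2) ^ n * uE := fun n =>
      (SemiconjBy.pow_right h1 n)
    rw [← C_mul_X_pow_eq_monomial, map_mul, map_pow, aeval_C, aeval_X, mul_comp, C_comp,
      X_pow_comp, map_mul, map_pow, map_sub, aeval_X, aeval_C, ← mul_assoc,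
      ← Algebra.commutes, mul_assoc, h2, ← mul_assoc, map_ofNat]

lemma uF_mul_aeval (p : ℂ[X]) : uF * aeval uH p = aeval uH (p.comp (X + 2)) * uF := by
  induction p using Polynomial.induction_on' with
  | add p q hp hq => simp only [map_add, add_comp, mul_add, add_mul, hp, hq]
  | monomial n c =>
    have h1 : uF * uH = (uH + 2) * uF := by
      rw [add_mul, uH_mul_uF, mul_sub, mul_two, two_mul]; abel
    have h2 : ∀ n : ℕ, uF * uH ^ n = (uH + 2) ^ n * uF := fun n =>
      (SemiconjBy.pow_right h1 n)
    rw [← C_mul_X_pow_eq_monomial, map_mul, map_pow, aeval_C, aeval_X, mul_comp, C_comp,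
      X_pow_comp, map_mul, map_pow, map_add, aeval_X, aeval_C, ← mul_assoc,
      ← Algebra.commutes, mul_assoc, h2, ← mul_assoc, map_ofNat]

/-- The space of normally ordered polynomials `∑ p(H) E^b F^c`. -/
abbrev NormalForm := ℕ × ℕ →₀ ℂ[X]

/-- Left multiplication by `H` on normal forms. -/
def opH : NormalForm →ₗ[ℂ] NormalForm :=
  Finsupp.lsum ℂ fun k => Finsupp.lsingle k ∘ₗ LinearMap.mulLeft ℂ X

/-- Left multiplication by `E` on normal forms. -/
def opE : NormalForm →ₗ[ℂ] NormalForm :=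
  Finsupp.lsum ℂ fun k => Finsupp.lsingle (k.1 + 1, k.2) ∘ₗ (aeval (X - 2 : ℂ[X])).toLinearMap

/-- Left multiplication by `F` on normal forms. -/
def opF : NormalForm →ₗ[ℂ] NormalForm :=
  Finsupp.lsum ℂ fun k => Finsupp.lsingle (k.1, k.2 + 1) ∘ₗ (aeval (X + 2 : ℂ[X])).toLinearMap

lemma opH_single (k : ℕ × ℕ) (p : ℂ[X]) :
    opH (Finsupp.single k p) = Finsupp.single k (X * p) := by simp [opH]

lemma opE_single (k : ℕ × ℕ) (p : ℂ[X]) :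
    opE (Finsupp.single k p) = Finsupp.single (k.1 + 1, k.2) (p.comp (X - 2)) := by
  simp [opE, comp_eq_aeval]

lemma opF_single (k : ℕ × ℕ) (p : ℂ[X]) :
    opF (Finsupp.single k p) = Finsupp.single (k.1, k.2 + 1) (p.comp (X + 2)) := by
  simp [opF, comp_eq_aeval]

lemma opH_mul_opE : opH * opE = opE * opH + (2 : ℂ) • opE := by
  refine Finsupp.lhom_ext fun k p => ?_
  simp only [Module.End.mul_apply, LinearMap.add_apply, LinearMap.smul_apply, opH_single,
    opE_single, Finsupp.smul_single, ← Finsupp.single_add]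
  congr 1
  rw [mul_comp, X_comp, smul_eq_C_mul, show (C 2 : ℂ[X]) = 2 from rfl]
  ring

lemma opH_mul_opF : opH * opF = opF * opH - (2 : ℂ) • opF := by
  refine Finsupp.lhom_ext fun k p => ?_
  simp only [Module.End.mul_apply, LinearMap.sub_apply, LinearMap.smul_apply, opH_single,
    opF_single, Finsupp.smul_single, ← Finsupp.single_sub]
  congr 1
  rw [mul_comp, X_comp, smul_eq_C_mul, show (C 2 : ℂ[X]) = 2 from rfl]
  ring

lemma opE_mul_opF : opE * opF = opF * opE := by
  refine Finsupp.lhom_ext fun k p => ?_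
  simp only [Module.End.mul_apply, opE_single, opF_single, comp_assoc]
  congr 2
  simp only [add_comp, sub_comp, X_comp, ofNat_comp]
  ring

/-- The left regular representation of the motion algebra on normal forms. -/
def normalRep : motionAlg →ₗ⁅ℂ⁆ Module.End ℂ NormalForm where
  toFun Y := Y.1.1 0 0 • opH + Y.1.1 0 1 • opE + Y.1.2 1 0 • opF
  map_add' Y Z := by
    change (Y.1.1 0 0 + Z.1.1 0 0) • opH + (Y.1.1 0 1 + Z.1.1 0 1) • opE +
      (Y.1.2 1 0 + Z.1.2 1 0) • opF = _
    module
  map_smul' r Y := by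
    change (r * Y.1.1 0 0) • opH + (r * Y.1.1 0 1) • opE + (r * Y.1.2 1 0) • opF =
      r • (Y.1.1 0 0 • opH + Y.1.1 0 1 • opE + Y.1.2 1 0 • opF)
    module
  map_lie' := by
    intro Y Z
    obtain ⟨h1, h2, h3, h4, h5⟩ := Y.2
    obtain ⟨k1, k2, k3, k4, k5⟩ := Z.2
    have e1 : (⁅Y, Z⁆ : motionAlg).1.1 0 0 = 0 := by
      simp [Ring.lie_def, Matrix.mul_apply, Fin.sum_univ_two, *]; ring
    have e2 : (⁅Y, Z⁆ : motionAlg).1.1 0 1 =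
        2 * (Y.1.1 0 0 * Z.1.1 0 1 - Z.1.1 0 0 * Y.1.1 0 1) := by
      simp [Ring.lie_def, Matrix.mul_apply, Fin.sum_univ_two, *]; ring
    have e3 : (⁅Y, Z⁆ : motionAlg).1.2 1 0 =
        2 * (Z.1.1 0 0 * Y.1.2 1 0 - Y.1.1 0 0 * Z.1.2 1 0) := by
      simp [Ring.lie_def, Matrix.mul_apply, Fin.sum_univ_two, *]; ring
    rw [e1, e2, e3, LieRing.of_associative_ring_bracket]
    simp only [mul_add, add_mul, smul_mul_assoc, mul_smul_comm, opH_mul_opE, opH_mul_opF,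
      opE_mul_opF]
    module

/-- The element of the enveloping algebra given by a normal form. -/
def ofNormal : NormalForm →ₗ[ℂ] motionU :=
  Finsupp.lsum ℂ fun k =>
    LinearMap.mulRight ℂ (uE ^ k.1 * uF ^ k.2) ∘ₗ (aeval uH : ℂ[X] →ₐ[ℂ] motionU).toLinearMap

lemma ofNormal_single (k : ℕ × ℕ) (p : ℂ[X]) :
    ofNormal (Finsupp.single k p) = aeval uH p * (uE ^ k.1 * uF ^ k.2) := by
  simp [ofNormal, mul_assoc]

/-- The normal form of an element of the enveloping algebra. -/
def toNormal (u : motionU) : NormalForm :=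
  UniversalEnvelopingAlgebra.lift ℂ normalRep u (Finsupp.single (0, 0) 1)

lemma toNormal_ofNormal (v : NormalForm) : toNormal (ofNormal v) = v := by
  have hH : UniversalEnvelopingAlgebra.lift ℂ normalRep uH = opH := by
    rw [uH, UniversalEnvelopingAlgebra.lift_ι_apply]; simp [normalRep, gElt]
  have hE : UniversalEnvelopingAlgebra.lift ℂ normalRep uE = opE := by
    rw [uE, UniversalEnvelopingAlgebra.lift_ι_apply]; simp [normalRep, gElt]
  have hF : UniversalEnvelopingAlgebra.lift ℂ normalRep uF = opF := by
    rw [uF, UniversalEnvelopingAlgebra.lift_ι_apply]; simp [normalRep, gElt]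
  have hFc : ∀ c : ℕ, (opF ^ c) (Finsupp.single (0, 0) 1) = Finsupp.single (0, c) 1 := by
    intro c
    induction c with
    | zero => simp
    | succ c ih => rw [pow_succ', Module.End.mul_apply, ih, opF_single]; simp
  have hEb : ∀ b c : ℕ, (opE ^ b) (Finsupp.single (0, c) 1) = Finsupp.single (b, c) 1 := by
    intro b c
    induction b with
    | zero => simp
    | succ c ih => rw [pow_succ', Module.End.mul_apply, ih, opE_single]; simp
  have hp : ∀ (p : ℂ[X]) (k : ℕ × ℕ), aeval opH p (Finsupp.single k 1) = Finsupp.single k p := by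
    intro p k
    induction p using Polynomial.induction_on with
    | C a => simp [Module.algebraMap_end_apply, smul_eq_C_mul]
    | add p q hp hq => rw [map_add, LinearMap.add_apply, hp, hq, Finsupp.single_add]
    | monomial n a ih =>
      rw [pow_succ', ← mul_assoc, mul_comm (C a) X, mul_assoc, map_mul, Module.End.mul_apply, ih,
        aeval_X, opH_single]
  induction v using Finsupp.induction_linear with
  | zero => simp [toNormal]
  | add v w hv hw =>
    rw [map_add, toNormal, map_add, LinearMap.add_apply]
    exact congrArg₂ (· + ·) hv hw
  | single k p =>
    rw [ofNormal_single, toNormal, map_mul, map_mul, map_pow, map_pow, Module.End.mul_apply,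
      Module.End.mul_apply, hE, hF, hFc, hEb, ← aeval_algHom_apply, hH, hp]

lemma ofNormal_injective : Function.Injective ofNormal :=
  Function.LeftInverse.injective toNormal_ofNormal

lemma ofNormal_opH (v : NormalForm) : ofNormal (opH v) = uH * ofNormal v := by
  induction v using Finsupp.induction_linear with
  | zero => simp
  | add v w hv hw => simp only [map_add, hv, hw, mul_add]
  | single k p => rw [opH_single, ofNormal_single, ofNormal_single, map_mul, aeval_X, mul_assoc]

lemma ofNormal_opE (v : NormalForm) : ofNormal (opE v) = uE * ofNormal v := by
  induction v using Finsupp.induction_linear with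
  | zero => simp
  | add v w hv hw => simp only [map_add, hv, hw, mul_add]
  | single k p =>
    rw [opE_single, ofNormal_single, ofNormal_single, ← mul_assoc uE, uE_mul_aeval, mul_assoc,
      ← mul_assoc uE, ← pow_succ']

lemma ofNormal_opF (v : NormalForm) : ofNormal (opF v) = uF * ofNormal v := by
  induction v using Finsupp.induction_linear with
  | zero => simp
  | add v w hv hw => simp only [map_add, hv, hw, mul_add]
  | single k p =>
    have hc : uF * uE ^ k.1 = uE ^ k.1 * uF :=
      (show Commute uF (uE ^ k.1) from Commute.pow_right uE_mul_uF.symm _)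
    rw [opF_single, ofNormal_single, ofNormal_single, ← mul_assoc uF, uF_mul_aeval, mul_assoc,
      ← mul_assoc uF, hc, mul_assoc, ← pow_succ']

lemma adjoin_range_ι : Algebra.adjoin ℂ
    (Set.range (UniversalEnvelopingAlgebra.ι ℂ : motionAlg → motionU)) = ⊤ := by
  set A := Algebra.adjoin ℂ (Set.range (UniversalEnvelopingAlgebra.ι ℂ : motionAlg → motionU))
  have hA : ∀ Y : motionAlg, UniversalEnvelopingAlgebra.ι ℂ Y ∈ A := fun Y =>
    Algebra.subset_adjoin (Set.mem_range_self Y)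
  let j : motionAlg →ₗ⁅ℂ⁆ A :=
    { toFun Y := ⟨UniversalEnvelopingAlgebra.ι ℂ Y, hA Y⟩
      map_add' Y Z := Subtype.ext (by simp)
      map_smul' r Y := Subtype.ext (by simp)
      map_lie' := by
        intro Y Z
        refine Subtype.ext ?_
        simp [LieRing.of_associative_ring_bracket] }
  let L : motionU →ₐ[ℂ] A := UniversalEnvelopingAlgebra.lift ℂ j
  have h : (Subalgebra.val A).comp L = AlgHom.id ℂ motionU := by
    refine UniversalEnvelopingAlgebra.hom_ext (R := ℂ) (L := motionAlg) (LieHom.ext fun Y => ?_)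
    simp [L, j]
  refine eq_top_iff.2 fun u _ => ?_
  have := DFunLike.congr_fun h u
  rw [AlgHom.id_apply] at this
  rw [← this]
  exact (L u).2

lemma ofNormal_surjective : Function.Surjective ofNormal := by
  have key : ∀ u : motionU, ∀ v, ∃ w, ofNormal w = u * ofNormal v := by
    intro u
    have hu : u ∈ Algebra.adjoin ℂ
        (Set.range (UniversalEnvelopingAlgebra.ι ℂ : motionAlg → motionU)) := by
      rw [adjoin_range_ι]; trivial
    induction hu using Algebra.adjoin_induction with
    | mem u hu =>
      intro v
      obtain ⟨Y, rfl⟩ := hu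
      refine ⟨Y.1.1 0 0 • opH v + Y.1.1 0 1 • opE v + Y.1.2 1 0 • opF v, ?_⟩
      conv_rhs => rw [motionAlg_decomp Y]
      simp only [map_add, map_smul, ofNormal_opH, ofNormal_opE, ofNormal_opF, add_mul,
        smul_mul_assoc]
      rfl
    | algebraMap r => exact fun v => ⟨r • v, by rw [map_smul, Algebra.smul_def]⟩
    | add a b _ _ ha hb =>
      intro v
      obtain ⟨w, hw⟩ := ha v
      obtain ⟨w', hw'⟩ := hb v
      exact ⟨w + w', by rw [map_add, hw, hw', add_mul]⟩
    | mul a b _ _ ha hb =>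
      intro v
      obtain ⟨w, hw⟩ := hb v
      obtain ⟨w', hw'⟩ := ha w
      exact ⟨w', by rw [hw', hw, mul_assoc]⟩
  intro u
  obtain ⟨w, hw⟩ := key u (Finsupp.single (0, 0) 1)
  exact ⟨w, by rw [hw, ofNormal_single]; simp⟩

/-- Right multiplication by `H` on normal forms. -/
def opRightH : NormalForm →ₗ[ℂ] NormalForm :=
  Finsupp.lsum ℂ fun k => Finsupp.lsingle k ∘ₗ LinearMap.mulLeft ℂ (X + C (2 * k.2 - 2 * k.1 : ℂ))

/-- Right multiplication by `E` on normal forms. -/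
def opRightE : NormalForm →ₗ[ℂ] NormalForm :=
  Finsupp.lsum ℂ fun k => Finsupp.lsingle (k.1 + 1, k.2)

lemma ofNormal_opRightH (v : NormalForm) : ofNormal (opRightH v) = ofNormal v * uH := by
  have hE : ∀ b : ℕ, uE ^ b * uH = (uH - algebraMap ℂ _ (2 * b)) * uE ^ b := by
    intro b
    induction b with
    | zero => simp
    | succ b ih =>
      have h1 : uE * uH = (uH - 2) * uE := by
        rw [sub_mul, uH_mul_uE, mul_add, mul_two, two_mul]; abel
      rw [pow_succ', mul_assoc, ih, ← mul_assoc, mul_sub, h1, ← Algebra.commutes, ← sub_mul,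
        mul_assoc]
      congr 1
      simp only [Nat.cast_add, Nat.cast_one, mul_add, map_add, mul_one, map_ofNat]
      abel
  have hF : ∀ c : ℕ, uF ^ c * uH = (uH + algebraMap ℂ _ (2 * c)) * uF ^ c := by
    intro c
    induction c with
    | zero => simp
    | succ c ih =>
      have h1 : uF * uH = (uH + 2) * uF := by
        rw [add_mul, uH_mul_uF, mul_sub, mul_two, two_mul]; abel
      rw [pow_succ', mul_assoc, ih, ← mul_assoc, mul_add, h1, ← Algebra.commutes, ← add_mul,
        mul_assoc]
      congr 1
      simp only [Nat.cast_add, Nat.cast_one, mul_add, map_add, mul_one, map_ofNat]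
      abel
  induction v using Finsupp.induction_linear with
  | zero => simp
  | add v w hv hw => simp only [map_add, hv, hw, add_mul]
  | single k p =>
    have e : opRightH (Finsupp.single k p) =
        Finsupp.single k ((X + C (2 * k.2 - 2 * k.1 : ℂ)) * p) := by simp [opRightH]
    have h1 : uE ^ k.1 * (uF ^ k.2 * uH) =
        (uH + algebraMap ℂ _ (2 * k.2 - 2 * k.1)) * (uE ^ k.1 * uF ^ k.2) := by
      rw [hF, ← mul_assoc, mul_add, hE, ← Algebra.commutes, ← add_mul, mul_assoc, map_sub]
      congr 1
      abel
    rw [e, ofNormal_single, ofNormal_single, mul_assoc, mul_assoc, h1, mul_comm, map_mul, mul_assoc,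
      map_add, aeval_X, aeval_C]

lemma ofNormal_opRightE (v : NormalForm) : ofNormal (opRightE v) = ofNormal v * uE := by
  induction v using Finsupp.induction_linear with
  | zero => simp
  | add v w hv hw => simp only [map_add, hv, hw, add_mul]
  | single k p =>
    have hc : uF ^ k.2 * uE = uE * uF ^ k.2 := Commute.pow_left uE_mul_uF.symm _
    have e : opRightE (Finsupp.single k p) = Finsupp.single (k.1 + 1, k.2) p := by simp [opRightE]
    rw [e, ofNormal_single, ofNormal_single, mul_assoc, mul_assoc, hc, ← mul_assoc (uE ^ _),
      ← pow_succ]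

lemma opH_apply (v : NormalForm) (k : ℕ × ℕ) : opH v k = X * v k := by
  induction v using Finsupp.induction_linear with
  | zero => simp
  | add v w hv hw => simp only [map_add, Finsupp.add_apply, hv, hw, mul_add]
  | single l p => rw [opH_single]; by_cases h : l = k <;> simp [h]

lemma opRightH_apply (v : NormalForm) (k : ℕ × ℕ) :
    opRightH v k = (X + C (2 * k.2 - 2 * k.1 : ℂ)) * v k := by
  induction v using Finsupp.induction_linear with
  | zero => simp
  | add v w hv hw => simp only [map_add, Finsupp.add_apply, hv, hw, mul_add]
  | single l p =>
    by_cases h : l = k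
    · subst h; simp [opRightH]
    · simp [opRightH, h]

lemma opE_apply (v : NormalForm) (b c : ℕ) : opE v (b + 1, c) = (v (b, c)).comp (X - 2) := by
  induction v using Finsupp.induction_linear with
  | zero => simp
  | add v w hv hw => simp only [map_add, Finsupp.add_apply, hv, hw, add_comp]
  | single l p =>
    rw [opE_single]
    by_cases h : l = (b, c)
    · subst h; simp
    · rw [Finsupp.single_eq_of_ne' h, Finsupp.single_eq_of_ne', zero_comp]
      intro h'
      exact h (Prod.ext (by simpa using congrArg Prod.fst h') (by simpa using congrArg Prod.snd h'))

lemma opRightE_apply (v : NormalForm) (b c : ℕ) : opRightE v (b + 1, c) = v (b, c) := by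
  induction v using Finsupp.induction_linear with
  | zero => simp
  | add v w hv hw => simp only [map_add, Finsupp.add_apply, hv, hw]
  | single l p =>
    have e : opRightE (Finsupp.single l p) = Finsupp.single (l.1 + 1, l.2) p := by simp [opRightE]
    rw [e]
    by_cases h : l = (b, c)
    · subst h; simp
    · rw [Finsupp.single_eq_of_ne' h, Finsupp.single_eq_of_ne']
      intro h'
      exact h (Prod.ext (by simpa using congrArg Prod.fst h') (by simpa using congrArg Prod.snd h'))

lemma eq_C_of_comp_X_sub_two {p : ℂ[X]} (h : p.comp (X - 2) = p) : p = C (p.eval 0) := by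
  refine eq_of_infinite_eval_eq _ _ (Set.infinite_of_injective_forall_mem
    (f := fun n : ℕ => (-2 * n : ℂ)) (fun m n h => by simpa using h) fun n => ?_)
  change eval _ p = eval _ (C (eval 0 p))
  rw [eval_C]
  induction n with
  | zero => simp
  | succ n ih =>
    rw [← ih]
    conv_rhs => rw [← h]
    rw [eval_comp, eval_sub, eval_X, eval_ofNat]
    congr 1
    push_cast
    ring

/-- An element of the center has a normal form in which only the monomials `E^b F^b`, with constant
coefficients, occur: commutation with `H` forces equal exponents and commutation with `E` makes the
coefficients invariant under a translation. -/
theorem center_motionU : Subalgebra.center ℂ motionU = Algebra.adjoin ℂ {4 * uE * uF} := by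
  have h4 : (4 : motionU) = algebraMap ℂ _ 4 := (map_ofNat _ 4).symm
  refine le_antisymm (fun z hz => ?_) (Algebra.adjoin_le ?_)
  · obtain ⟨v, rfl⟩ := ofNormal_surjective z
    rw [Subalgebra.mem_center_iff] at hz
    have hH : opH v = opRightH v :=
      ofNormal_injective (by rw [ofNormal_opH, ofNormal_opRightH, hz])
    have hE : opE v = opRightE v :=
      ofNormal_injective (by rw [ofNormal_opE, ofNormal_opRightE, hz])
    rw [← v.sum_single, Finsupp.sum, map_sum]
    refine Subalgebra.sum_mem _ fun k hk => ?_
    have h1 : k.1 = k.2 := by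
      have := DFunLike.congr_fun hH k
      rw [opH_apply, opRightH_apply, add_mul, left_eq_add, mul_eq_zero, C_eq_zero] at this
      have := this.resolve_right (Finsupp.mem_support_iff.1 hk)
      have h2 : (k.2 : ℂ) = k.1 := by linear_combination this / 2
      exact_mod_cast h2.symm
    have h2 := eq_C_of_comp_X_sub_two (by
      rw [← opE_apply v k.1 k.2, hE, opRightE_apply] : (v (k.1, k.2)).comp (X - 2) = _)
    have h3 : (uE * uF) ^ k.1 ∈ Algebra.adjoin ℂ {4 * uE * uF} := by
      refine Subalgebra.pow_mem _ ?_ _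
      have e : uE * uF = (4⁻¹ : ℂ) • (4 * uE * uF) := by
        rw [h4, mul_assoc, ← Algebra.smul_def, smul_smul]; norm_num
      rw [e]
      exact Subalgebra.smul_mem _ (Algebra.self_mem_adjoin_singleton _ _) _
    rw [ofNormal_single, show v k = v (k.1, k.2) from rfl, h2, aeval_C, ← h1,
      ← (show Commute uE uF from uE_mul_uF).mul_pow, ← Algebra.smul_def]
    exact Subalgebra.smul_mem _ h3 _
  · rw [Set.singleton_subset_iff, SetLike.mem_coe]
    have hH : Commute uH (uE * uF) := by
      change uH * (uE * uF) = uE * uF * uH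
      rw [← mul_assoc, uH_mul_uE, mul_assoc, mul_assoc, add_mul, uH_mul_uF, mul_sub, mul_two,
        two_mul, sub_add_cancel]
    have hE : Commute uE (uE * uF) := (Commute.refl uE).mul_right uE_mul_uF
    have hF : Commute uF (uE * uF) := (Commute.mul_right uE_mul_uF.symm (Commute.refl uF))
    rw [Subalgebra.mem_center_iff, h4, mul_assoc]
    intro u
    suffices h : Commute u (uE * uF) from (Algebra.commute_algebraMap_right _ _).mul_right h
    have hu : u ∈ Algebra.adjoin ℂ
        (Set.range (UniversalEnvelopingAlgebra.ι ℂ : motionAlg → motionU)) := by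
      rw [adjoin_range_ι]; trivial
    induction hu using Algebra.adjoin_induction with
    | mem u hu =>
      obtain ⟨Y, rfl⟩ := hu
      rw [motionAlg_decomp Y, map_add, map_add, map_smul, map_smul, map_smul]
      exact ((hH.smul_left _).add_left (hE.smul_left _)).add_left (hF.smul_left _)
    | algebraMap r => exact Algebra.commute_algebraMap_left _ _
    | add a b _ _ ha hb => exact ha.add_left hb
    | mul a b _ _ ha hb => exact ha.mul_left hb

end Center

end ContractionFamilies
end

noncomputable section

namespace ContractionFamilies

/-! ### Multiplier representations on square integrable functions -/

open MeasureTheory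

/-- A right action `T` of `G` on `X` with a continuous multiplier `m` such that
`f ↦ m g · f ∘ T g` defines a unitary representation on `L²(X, μ)`. -/
structure Multiplier (G X : Type*) [Group G] [TopologicalSpace G] [TopologicalSpace X]
    [MeasurableSpace X] (μ : Measure X) where
  m : G → X → ℂ
  T : G → X → X
  continuous_m : Continuous fun p : G × X => m p.1 p.2
  continuous_T : Continuous fun p : G × X => T p.1 p.2
  m_one : ∀ ξ, m 1 ξ = 1
  T_one : ∀ ξ, T 1 ξ = ξ
  m_mul : ∀ g h ξ, m (g * h) ξ = m g ξ * m h (T g ξ)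
  T_mul : ∀ g h ξ, T (g * h) ξ = T h (T g ξ)
  lintegral_comp : ∀ g (f : X → ENNReal), Measurable f →
    ∫⁻ ξ, ‖m g ξ‖ₑ ^ 2 * f (T g ξ) ∂μ = ∫⁻ ξ, f ξ ∂μ

namespace Multiplier

variable {G X : Type*} [Group G] [TopologicalSpace G] [TopologicalSpace X]
    [MeasurableSpace X] {μ : Measure X} (A : Multiplier G X μ)

include A in
lemma m_ne_zero (g : G) (ξ : X) : A.m g ξ ≠ 0 := by
  have h := A.m_mul g g⁻¹ ξ
  rw [mul_inv_cancel, A.m_one] at h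
  exact left_ne_zero_of_mul (h ▸ one_ne_zero)

lemma continuous_m_apply (g : G) : Continuous (A.m g) :=
  A.continuous_m.comp (Continuous.prodMk_right g)

lemma continuous_T_apply (g : G) : Continuous (A.T g) :=
  A.continuous_T.comp (Continuous.prodMk_right g)

lemma eLpNorm_comp (g : G) {f : X → ℂ} (hf : Measurable f) :
    eLpNorm (fun ξ => A.m g ξ * f (A.T g ξ)) 2 μ = eLpNorm f 2 μ := by
  have h := A.lintegral_comp g (fun ξ => ‖f ξ‖ₑ ^ 2) (hf.enorm.pow_const 2)
  rw [eLpNorm_eq_lintegral_rpow_enorm_toReal two_ne_zero ENNReal.ofNat_ne_top,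
    eLpNorm_eq_lintegral_rpow_enorm_toReal two_ne_zero ENNReal.ofNat_ne_top]
  simp only [ENNReal.toReal_ofNat, ENNReal.rpow_ofNat, enorm_mul, mul_pow]
  rw [h]

/-- The operator `f ↦ m g · f ∘ T g` on continuous functions. -/
def contOp (g : G) (f : C(X, ℂ)) : C(X, ℂ) :=
  ⟨fun ξ => A.m g ξ * f (A.T g ξ),
    (A.continuous_m_apply g).mul (f.continuous.comp (A.continuous_T_apply g))⟩

lemma contOp_apply (g : G) (f : C(X, ℂ)) (ξ : X) :
    A.contOp g f ξ = A.m g ξ * f (A.T g ξ) := rfl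

lemma continuous_contOp (f : C(X, ℂ)) : Continuous fun g => A.contOp g f := by
  let F : C(G × X, ℂ) := ⟨fun p => A.m p.1 p.2 * f (A.T p.1 p.2),
    A.continuous_m.mul (f.continuous.comp A.continuous_T)⟩
  exact F.curry.continuous

variable [BorelSpace X]

lemma quasiMeasurePreserving (g : G) : Measure.QuasiMeasurePreserving (A.T g) μ μ := by
  refine ⟨(A.continuous_T_apply g).measurable, Measure.AbsolutelyContinuous.mk fun N hN hμ => ?_⟩
  rw [Measure.map_apply (A.continuous_T_apply g).measurable hN]
  have h := A.lintegral_comp g (N.indicator 1) (measurable_one.indicator hN)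
  rw [lintegral_indicator_one hN, hμ, lintegral_eq_zero_iff] at h
  · have h0 := ae_iff.1 h
    refine le_antisymm ((measure_mono fun ξ hξ => ?_).trans_eq h0) bot_le
    intro hcon
    simp only [Pi.zero_apply, mul_eq_zero] at hcon
    rcases hcon with hcon | hcon
    · exact A.m_ne_zero g ξ (by simpa using hcon)
    · rw [Set.indicator_of_mem (show A.T g ξ ∈ N from hξ)] at hcon
      exact one_ne_zero hcon
  · exact ((A.continuous_m_apply g).measurable.enorm.pow_const 2).mul
      ((measurable_one.indicator hN).comp (A.continuous_T_apply g).measurable)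

lemma memLp_comp (g : G) (f : Lp ℂ 2 μ) : MemLp (fun ξ => A.m g ξ * f (A.T g ξ)) 2 μ := by
  refine ⟨?_, ?_⟩
  · exact (A.continuous_m_apply g).aestronglyMeasurable.mul
      ((Lp.stronglyMeasurable f).comp_measurable
        (A.continuous_T_apply g).measurable).aestronglyMeasurable
  · rw [A.eLpNorm_comp g (Lp.stronglyMeasurable f).measurable]
    exact Lp.eLpNorm_lt_top f

/-- The operator `f ↦ m g · f ∘ T g` on `L²`. -/
def op (g : G) : Lp ℂ 2 μ →ₗᵢ[ℂ] Lp ℂ 2 μ where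
  toFun f := (A.memLp_comp g f).toLp _
  map_add' f f' := by
    refine Lp.ext ?_
    filter_upwards [(A.memLp_comp g (f + f')).coeFn_toLp, (A.memLp_comp g f).coeFn_toLp,
      (A.memLp_comp g f').coeFn_toLp, Lp.coeFn_add ((A.memLp_comp g f).toLp _)
      ((A.memLp_comp g f').toLp _),
      (A.quasiMeasurePreserving g).ae (Lp.coeFn_add f f')] with ξ h1 h2 h3 h4 h5
    rw [h1, h4, Pi.add_apply, h2, h3, h5, Pi.add_apply, mul_add]
  map_smul' c f := by
    refine Lp.ext ?_
    filter_upwards [(A.memLp_comp g (c • f)).coeFn_toLp, (A.memLp_comp g f).coeFn_toLp,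
      Lp.coeFn_smul c ((A.memLp_comp g f).toLp _),
      (A.quasiMeasurePreserving g).ae (Lp.coeFn_smul c f)] with ξ h1 h2 h3 h4
    rw [h1, RingHom.id_apply, h3, Pi.smul_apply, h2, h4, Pi.smul_apply, smul_eq_mul, smul_eq_mul]
    ring
  norm_map' f := by
    change ‖(A.memLp_comp g f).toLp _‖ = _
    rw [Lp.norm_toLp, A.eLpNorm_comp g (Lp.stronglyMeasurable f).measurable, Lp.norm_def]

lemma coeFn_op (g : G) (f : Lp ℂ 2 μ) : A.op g f =ᵐ[μ] fun ξ => A.m g ξ * f (A.T g ξ) :=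
  (A.memLp_comp g f).coeFn_toLp

lemma op_one (f : Lp ℂ 2 μ) : A.op 1 f = f := by
  refine Lp.ext ?_
  filter_upwards [A.coeFn_op 1 f] with ξ h
  rw [h, A.m_one, A.T_one, one_mul]

lemma op_mul (g h : G) (f : Lp ℂ 2 μ) : A.op (g * h) f = A.op g (A.op h f) := by
  refine Lp.ext ?_
  filter_upwards [A.coeFn_op (g * h) f, A.coeFn_op g (A.op h f),
    (A.quasiMeasurePreserving g).ae (A.coeFn_op h f)] with ξ h1 h2 h3
  rw [h1, h2, h3, A.m_mul, A.T_mul, mul_assoc]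

variable [CompactSpace X] [IsFiniteMeasure μ]

lemma op_toLp (g : G) (f : C(X, ℂ)) : A.op g (ContinuousMap.toLp 2 μ ℂ f) =
    ContinuousMap.toLp 2 μ ℂ (A.contOp g f) := by
  refine Lp.ext ?_
  filter_upwards [A.coeFn_op g (ContinuousMap.toLp 2 μ ℂ f),
    ContinuousMap.coeFn_toLp (p := 2) (𝕜 := ℂ) μ (A.contOp g f),
    (A.quasiMeasurePreserving g).ae (ContinuousMap.coeFn_toLp (p := 2) (𝕜 := ℂ) μ f)]
    with ξ h1 h2 h3
  rw [h1, h2, h3, contOp_apply]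

variable [NormalSpace X] [μ.WeaklyRegular]

/-- The unitary representation on `L²` given by a multiplier. -/
def rep : UnitaryRep G (Lp ℂ 2 μ) where
  toHom :=
    { toFun g :=
        { toFun := A.op g
          invFun := A.op g⁻¹
          map_add' := map_add _
          map_smul' := map_smul _
          left_inv f := by rw [← op_mul, inv_mul_cancel, op_one]
          right_inv f := by rw [← op_mul, mul_inv_cancel, op_one]
          norm_map' := (A.op g).norm_map }
      map_one' := LinearIsometryEquiv.ext A.op_one
      map_mul' g h := LinearIsometryEquiv.ext (A.op_mul g h) }
  continuous_orbit v := by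
    change Continuous fun g => A.op g v
    have hd := ContinuousMap.toLp_denseRange ℂ μ ℂ (p := 2) ENNReal.ofNat_ne_top
    refine continuous_of_uniform_approx_of_continuous fun s hs => ?_
    obtain ⟨ε, hε, hs⟩ := Metric.mem_uniformity_dist.1 hs
    obtain ⟨f, hf⟩ := hd.exists_dist_lt v hε
    refine ⟨fun g => A.op g (ContinuousMap.toLp 2 μ ℂ f), ?_, fun g => hs ?_⟩
    · simp only [op_toLp]
      exact (ContinuousMap.toLp 2 μ ℂ).continuous.comp (A.continuous_contOp f)
    · rwa [(A.op g).isometry.dist_eq]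

omit [BorelSpace X] [IsFiniteMeasure μ] [NormalSpace X] [μ.WeaklyRegular] in
/-- Along a one-parameter subgroup, the pointwise derivative of a continuous function, if it is
continuous, is the derivative for the uniform norm. -/
lemma hasDerivAt_contOp {c : ℝ → G} (hc : Continuous c) (hc0 : c 0 = 1)
    (hadd : ∀ s t, c (s + t) = c s * c t) (f f' : C(X, ℂ))
    (h : ∀ ξ, HasDerivAt (fun t => A.m (c t) ξ * f (A.T (c t) ξ)) (f' ξ) 0) :
    HasDerivAt (fun t => A.contOp (c t) f) f' 0 := by
  have hcont : Continuous fun t => A.contOp (c t) f' := (A.continuous_contOp f').comp hc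
  have hder : ∀ ξ s, HasDerivAt (fun t => A.contOp (c t) f ξ) (A.contOp (c s) f' ξ) s := by
    intro ξ s
    have h1 := ((h (A.T (c s) ξ)).const_mul (A.m (c s) ξ))
    have h2 : HasDerivAt (fun t => A.contOp (c (s + t)) f ξ) (A.contOp (c s) f' ξ) 0 := by
      refine h1.congr_of_eventuallyEq (Eventually.of_forall fun t => ?_)
      change A.m (c (s + t)) ξ * f (A.T (c (s + t)) ξ) = _
      rw [hadd, A.m_mul, A.T_mul, mul_assoc]
    have h3 : HasDerivAt (fun t => A.contOp (c (s + (t - s))) f ξ) (A.contOp (c s) f' ξ) s := by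
      have h2' : HasDerivAt (fun t => A.contOp (c (s + t)) f ξ) (A.contOp (c s) f' ξ) (s - s) := by
        rwa [sub_self]
      simpa using HasDerivAt.comp_sub_const s s h2'
    simpa using h3
  have key : (fun t => A.contOp (c t) f) = fun t => f + ∫ s in (0 : ℝ)..t, A.contOp (c s) f' := by
    funext t
    ext ξ
    have e1 : (∫ s in (0 : ℝ)..t, A.contOp (c s) f') ξ =
        ∫ s in (0 : ℝ)..t, A.contOp (c s) f' ξ :=
      ((ContinuousMap.evalCLM ℝ ξ).intervalIntegral_comp_comm
        (hcont.intervalIntegrable 0 t)).symm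
    rw [ContinuousMap.add_apply, e1, intervalIntegral.integral_eq_sub_of_hasDerivAt
      (fun s _ => hder ξ s) (((ContinuousMap.evalCLM ℝ ξ).continuous.comp
        hcont).intervalIntegrable 0 t), hc0]
    simp [contOp_apply, A.m_one, A.T_one]
  rw [key]
  have := (intervalIntegral.integral_hasDerivAt_right (hcont.intervalIntegrable 0 0)
    (hcont.stronglyMeasurableAtFilter _ _) hcont.continuousAt).const_add f
  have e : A.contOp (c 0) f' = f' := by
    ext ξ; simp [contOp_apply, hc0, A.m_one, A.T_one]
  rwa [e] at this

omit [μ.WeaklyRegular] [NormalSpace X] in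
lemma hasDerivAt_op {c : ℝ → G} (hc : Continuous c) (hc0 : c 0 = 1)
    (hadd : ∀ s t, c (s + t) = c s * c t) (f f' : C(X, ℂ))
    (h : ∀ ξ, HasDerivAt (fun t => A.m (c t) ξ * f (A.T (c t) ξ)) (f' ξ) 0) :
    HasDerivAt (fun t => A.op (c t) (ContinuousMap.toLp 2 μ ℂ f))
      (ContinuousMap.toLp 2 μ ℂ f') 0 := by
  simp only [op_toLp]
  exact (((ContinuousMap.toLp 2 μ ℂ).restrictScalars ℝ).hasFDerivAt (x :=
    A.contOp (c 0) f)).comp_hasDerivAt 0 (A.hasDerivAt_contOp hc hc0 hadd f f' h)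

end Multiplier

end ContractionFamilies
end

noncomputable section

namespace ContractionFamilies

open MeasureTheory AddCircle

/-! ### The model representation of the motion group -/

section OneParameter

variable {x : ℝ}

lemma hasDerivAt_expReal_entries (a : ℝ) (b : ℂ) :
    HasDerivAt (fun t : ℝ => (expReal x (t • realElt x a b)).1.1.1 0 0) (Complex.I * a) 0 ∧
    HasDerivAt (fun t : ℝ => (expReal x (t • realElt x a b)).1.1.1 0 1) b 0 := by
  obtain ⟨μ, hμ⟩ := IsAlgClosed.exists_pow_nat_eq (x * Complex.normSq b - a ^ 2 : ℂ) two_pos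
  have hs : HasDerivAt (fun t : ℝ => sinhc (t * μ) * t) 1 0 := by
    by_cases h : μ = 0
    · simp only [h, mul_zero, sinhc_zero, one_mul]
      exact Complex.ofRealCLM.hasDerivAt
    · have e : (fun t : ℝ => sinhc (t * μ) * t) = fun t : ℝ => Complex.sinh (t * μ) / μ := by
        funext t
        rw [← sinhc_mul, ← mul_assoc, mul_div_cancel_right₀ _ h]
      rw [e]
      have h1 : HasDerivAt (fun z : ℂ => z * μ) μ (0 : ℝ) := by
        simpa using (hasDerivAt_id ((0 : ℝ) : ℂ)).mul_const μ
      refine (h1.csinh.div_const μ).comp_ofReal.congr_deriv ?_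
      simp [h]
  have hc : HasDerivAt (fun t : ℝ => Complex.cosh (t * μ)) 0 0 := by
    have h1 : HasDerivAt (fun z : ℂ => z * μ) μ (0 : ℝ) := by
      simpa using (hasDerivAt_id ((0 : ℝ) : ℂ)).mul_const μ
    refine h1.ccosh.comp_ofReal.congr_deriv ?_
    simp
  have he : ∀ t : ℝ, (expReal x (t • realElt x a b)).1.1.1 0 0 =
      Complex.cosh (t * μ) + sinhc (t * μ) * t * (Complex.I * a) ∧
      (expReal x (t • realElt x a b)).1.1.1 0 1 = sinhc (t * μ) * t * b := by
    intro t
    rw [smul_realElt]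
    obtain ⟨h0, h1⟩ := expReal_realElt (x := x) (t * a) (t * b) (μ := t * μ) (by
      rw [mul_pow, hμ, Complex.normSq_mul, Complex.normSq_ofReal]; push_cast; ring)
    rw [h0, h1]
    push_cast
    constructor <;> ring
  simp only [he]
  exact ⟨(hc.add (hs.mul_const _)).congr_deriv (by ring), (hs.mul_const b).congr_deriv (by ring)⟩

lemma continuous_expReal_smul (Y : realForm x) : Continuous fun t : ℝ => expReal x (t • Y) := by
  have h : ∀ A : M2 ℂ, Continuous fun t : ℝ => NormedSpace.exp (t • A) := by
    intro A
    open scoped Matrix.Norms.Operator in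
    exact NormedSpace.exp_continuous.comp (continuous_id.smul continuous_const)
  exact Continuous.subtype_mk (((h Y.1.1).subtype_mk _).prodMk ((h Y.1.2).subtype_mk _)) _

lemma expReal_entries_zero (Y : realForm x) : (expReal x ((0 : ℝ) • Y)).1.1.1 0 0 = 1 ∧
    (expReal x ((0 : ℝ) • Y)).1.1.1 0 1 = 0 := by
  rw [zero_smul, expReal_zero]
  exact ⟨rfl, rfl⟩

end OneParameter

lemma angle_coe (θ : AddCircle (1 : ℝ)) : angle θ = toCircle θ :=
  homeomorphCircle_apply one_ne_zero θ

lemma angle_add (θ η : AddCircle (1 : ℝ)) : angle (θ + η) = angle θ * angle η := by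
  simp only [angle_coe, toCircle_add]

lemma fourier_angle (j : ℤ) (θ : AddCircle (1 : ℝ)) : fourier j θ = (angle θ : ℂ) ^ j := by
  rw [fourier_apply, toCircle_zsmul, angle_coe, Circle.coe_zpow]

lemma denseSpan_fourierLp : DenseSpan fun j : ℤ => fourierLp (T := (1 : ℝ)) 2 j :=
  span_fourierLp_closure_eq_top ENNReal.ofNat_ne_top

lemma inner_fourierLp (i j : ℤ) :
    ⟪(fourierLp 2 i : Lp ℂ 2 (haarAddCircle (T := (1 : ℝ)))), fourierLp 2 j⟫_ℂ =
      if i = j then 1 else 0 :=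
  orthonormal_iff_ite.1 orthonormal_fourier i j

lemma transPart_mul (g h : realGroup 0) :
    transPart (g * h) = transPart g + (rotPart g : ℂ) ^ 2 * transPart h ∧
      rotPart (g * h) = rotPart g * rotPart h := by
  have e : g * h = expReal 0 (realElt 0 0 (transPart g + (rotPart g : ℂ) ^ 2 * transPart h)) *
      torus 0 (rotPart g * rotPart h) := by
    conv_lhs => rw [motion_polar g, motion_polar h]
    rw [motion_add, map_mul, mul_assoc, ← mul_assoc (torus 0 _), torus_mul_expReal]
    simp only [mul_assoc]
  rw [e, transPart_mul_torus, rotPart_mul_torus]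
  exact ⟨rfl, rfl⟩

lemma transPart_one : transPart 1 = 0 := by
  change (0 : ℂ) * _ = 0
  rw [zero_mul]

lemma rotPart_one : rotPart 1 = 1 := Circle.ext rfl

/-- The action of the motion group on functions on the circle: translations act by the characters
`exp (i Im (b ζ))`, rotations by rotation. -/
def motionMultiplier : Multiplier (realGroup 0) (AddCircle (1 : ℝ)) haarAddCircle where
  m g θ := Complex.exp ((transPart g * angle θ - conj (transPart g * angle θ)) / 2)
  T g θ := θ + angle.symm (rotPart g ^ 2)
  continuous_m := by
    have h1 : Continuous fun p : realGroup 0 × AddCircle (1 : ℝ) =>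
        transPart p.1 * (angle p.2 : ℂ) :=
      (continuous_transPart.comp continuous_fst).mul
        (continuous_subtype_val.comp (angle.continuous.comp continuous_snd))
    exact (((h1.sub (Complex.continuous_conj.comp h1)).div_const 2)).cexp
  continuous_T := continuous_snd.add
    (angle.symm.continuous.comp ((continuous_rotPart.comp continuous_fst).pow 2))
  m_one θ := by simp [transPart_one]
  T_one θ := by
    have : angle.symm 1 = 0 := by
      rw [Homeomorph.symm_apply_eq, angle_coe, toCircle_zero]
    rw [rotPart_one, one_pow, this, add_zero]
  m_mul g h θ := by
    rw [← Complex.exp_add, (transPart_mul g h).1, angle_add, Homeomorph.apply_symm_apply]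
    congr 1
    push_cast
    simp only [map_add, map_mul]
    ring
  T_mul g h θ := by
    rw [(transPart_mul g h).2, add_assoc]
    congr 1
    rw [Homeomorph.symm_apply_eq, angle_add, Homeomorph.apply_symm_apply,
      Homeomorph.apply_symm_apply, mul_pow]
  lintegral_comp g f hf := by
    have h : ∀ θ : AddCircle (1 : ℝ), ‖Complex.exp ((transPart g * angle θ -
        conj (transPart g * angle θ)) / 2)‖ₑ = 1 := by
      intro θ
      rw [← ofReal_norm, Complex.norm_exp]
      simp
    simp only [h, one_pow, one_mul]
    exact lintegral_add_right_eq_self f _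

/-- The model of the spherical representation of the motion group. -/
def motionModel : UnitaryRep (realGroup 0) (Lp ℂ 2 (haarAddCircle (T := (1 : ℝ)))) :=
  motionMultiplier.rep

lemma sCoef_zero (j : ℤ) : sCoef 0 j = 1 / 2 := by simp [sCoef]

/-- In the model, translation by `b` multiplies by a character, whose derivative at `b = 0` shifts the
Fourier monomials by one in both directions with coefficient `sCoef 0 j = 1 / 2`. -/
theorem motionModel_hasLadder : HasLadder motionModel fun j : ℤ => fourierLp 2 j where
  inner_eq i j := by
    rw [inner_fourierLp]
    simp [(dv_pos le_rfl j).ne']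
  deriv a b j := by
    have key := motionMultiplier.hasDerivAt_op (continuous_expReal_smul (realElt 0 a b))
      (by rw [zero_smul, expReal_zero]) (fun s t => expReal_add_smul _ s t) (fourier j)
      ((2 * Complex.I * a * j) • fourier j + ((b * sCoef 0 j) • fourier (j + 1) -
        (conj b * sCoef 0 (j - 1)) • fourier (j - 1))) ?_
    · simp only [map_add, map_sub, map_smul] at key
      exact key
    · intro θ
      obtain ⟨h0, h1⟩ := hasDerivAt_expReal_entries (x := 0) a b
      obtain ⟨e0, e1⟩ := expReal_entries_zero (realElt 0 a b)
      set p := fun t : ℝ => (expReal 0 (t • realElt 0 a b)).1.1.1 0 0 with hp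
      set q := fun t : ℝ => (expReal 0 (t • realElt 0 a b)).1.1.1 0 1 with hq
      have hz : (angle θ : ℂ) ≠ 0 := Circle.coe_ne_zero _
      have hzc : conj (angle θ : ℂ) = (angle θ : ℂ)⁻¹ := by
        rw [← Circle.coe_inv_eq_conj, Circle.coe_inv]
      have e : ∀ t : ℝ, motionMultiplier.m (expReal 0 (t • realElt 0 a b)) θ *
          fourier j (motionMultiplier.T (expReal 0 (t • realElt 0 a b)) θ) =
          Complex.exp ((q t * p t * angle θ - conj (q t * p t * angle θ)) / 2) *
            (angle θ * p t ^ 2) ^ j := by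
        intro t
        rw [fourier_angle]
        change Complex.exp _ * ((angle (θ + angle.symm _) : Circle) : ℂ) ^ j = _
        rw [angle_add, Homeomorph.apply_symm_apply]
        rfl
      simp only [e]
      have hp0 : p 0 = 1 := e0
      have hq0 : q 0 = 0 := e1
      have d1 : HasDerivAt (fun t => q t * p t * (angle θ : ℂ)) (b * angle θ) 0 :=
        ((h1.mul h0).mul_const (angle θ : ℂ)).congr_deriv (by rw [hp0, hq0]; ring)
      have d1' : HasDerivAt (fun t => conj (q t * p t * (angle θ : ℂ))) (conj (b * angle θ)) 0 :=
        Complex.conjCLE.toContinuousLinearMap.hasFDerivAt.comp_hasDerivAt 0 d1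
      have d2 : HasDerivAt (fun t => Complex.exp ((q t * p t * angle θ -
          conj (q t * p t * angle θ)) / 2)) ((b * angle θ - conj (b * angle θ)) / 2) 0 :=
        ((d1.sub d1').div_const 2).cexp.congr_deriv (by simp [hq0])
      have d3 : HasDerivAt (fun t => (angle θ : ℂ) * p t ^ 2) (angle θ * (2 * (Complex.I * a))) 0 :=
        ((h0.pow 2).const_mul (angle θ : ℂ)).congr_deriv (by simp [hp0])
      have d4 : HasDerivAt (fun t => ((angle θ : ℂ) * p t ^ 2) ^ j)
          (2 * Complex.I * a * j * angle θ ^ j) 0 := by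
        refine ((hasDerivAt_zpow j (angle θ * p 0 ^ 2) (Or.inl (by simp [hp0, hz]))).comp
          (0 : ℝ) d3).congr_deriv ?_
        rw [hp0, one_pow, mul_one, zpow_sub_one₀ hz]
        field_simp
      refine (d2.mul d4).congr_deriv ?_
      simp only [hp0, hq0, zero_mul, map_zero, sub_self, zero_div, Complex.exp_zero, mul_one,
        one_pow, one_mul, ContinuousMap.add_apply, ContinuousMap.sub_apply,
        ContinuousMap.smul_apply, fourier_angle, sCoef_zero, smul_eq_mul, map_mul, hzc,
        zpow_sub_one₀ hz, zpow_add_one₀ hz]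
      push_cast
      ring

end ContractionFamilies
end

noncomputable section

namespace ContractionFamilies

open MeasureTheory AddCircle

/-! ### The spherical principal series -/

/-- Integrals over the circle as contour integrals. -/
lemma integral_angle (f : ℂ → ℂ) : ∫ θ, f (angle θ) ∂(haarAddCircle (T := (1 : ℝ))) =
    (2 * Real.pi * Complex.I : ℂ)⁻¹ • ∮ z in C(0, 1), z⁻¹ * f z := by
  have h1 : ∀ t : ℝ, ((angle (t : AddCircle (1 : ℝ)) : Circle) : ℂ) =
      circleMap 0 1 (2 * Real.pi * t) := by
    intro t
    rw [angle_coe, toCircle_apply_mk, Circle.coe_exp, circleMap]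
    simp
  rw [integral_haarAddCircle, inv_one, one_smul,
    ← AddCircle.intervalIntegral_preimage 1 0 fun θ => f (angle θ)]
  simp only [h1]
  rw [intervalIntegral.integral_comp_mul_left (fun s => f (circleMap 0 1 s))
    (by positivity : (2 * Real.pi : ℝ) ≠ 0), circleIntegral]
  have h2 : ∀ s : ℝ, deriv (circleMap 0 1) s • ((circleMap 0 1 s)⁻¹ * f (circleMap 0 1 s)) =
      Complex.I * f (circleMap 0 1 s) := by
    intro s
    have h3 : circleMap 0 1 s ≠ 0 := by simp [circleMap]
    rw [deriv_circleMap, smul_eq_mul]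
    field_simp
  simp only [h2, intervalIntegral.integral_const_mul, mul_zero, zero_add, mul_one, smul_eq_mul,
    Complex.real_smul]
  push_cast
  field_simp

section Moebius

variable (g h : SU11)

lemma SU11_det : g.1.1 0 0 * conj (g.1.1 0 0) - g.1.1 0 1 * conj (g.1.1 0 1) = 1 := by
  obtain ⟨h1, h2⟩ := g.2
  have hdet : g.1 0 0 * g.1 1 1 - g.1 0 1 * g.1 1 0 = 1 := by
    have := g.1.2
    rwa [Matrix.det_fin_two] at this
  rwa [h1, h2] at hdet

lemma SU11_norm_lt : ‖g.1.1 0 1‖ < ‖g.1.1 0 0‖ := by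
  have h := SU11_det g
  rw [Complex.mul_conj, Complex.mul_conj] at h
  have h' : Complex.normSq (g.1.1 0 0) - Complex.normSq (g.1.1 0 1) = 1 := by exact_mod_cast h
  rw [Complex.normSq_eq_norm_sq, Complex.normSq_eq_norm_sq] at h'
  exact lt_of_pow_lt_pow_left₀ 2 (norm_nonneg _) (by linarith)

lemma autFactor_mul (ζ : Circle) :
    autFactor (g * h) ζ = autFactor g (moebius h ζ) * autFactor h ζ := by
  have e : ((g * h : SU11) : SL2C).1 = g.1.1 * h.1.1 := rfl
  have h0 := autFactor_ne_zero h ζ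
  unfold autFactor at h0 ⊢
  rw [moebius_coe]
  change ((g * h : SU11) : SL2C).1 1 0 * _ + ((g * h : SU11) : SL2C).1 1 1 = _
  rw [e]
  simp only [Matrix.mul_apply, Fin.sum_univ_two]
  field_simp
  ring

lemma moebius_mul (ζ : Circle) : moebius (g * h) ζ = moebius g (moebius h ζ) := by
  have h0 := autFactor_ne_zero h ζ
  have h1 := autFactor_ne_zero g (moebius h ζ)
  have h2 := autFactor_mul g h ζ
  refine Circle.ext ?_
  rw [moebius_coe, moebius_coe, moebius_coe]
  unfold autFactor at h0 h1 h2
  rw [h2, moebius_coe] 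
  rw [moebius_coe] at h1
  have e : ((g * h : SU11) : SL2C).1 = g.1.1 * h.1.1 := rfl
  change (((g * h : SU11) : SL2C).1 0 0 * _ + ((g * h : SU11) : SL2C).1 0 1) / _ = _
  rw [e, div_eq_div_iff (mul_ne_zero h1 h0) h1]
  simp only [Matrix.mul_apply, Fin.sum_univ_two]
  field_simp
  ring

lemma autFactor_one (ζ : Circle) : autFactor 1 ζ = 1 := by
  change (0 : ℂ) * _ + 1 = 1
  ring

lemma moebius_one (ζ : Circle) : moebius 1 ζ = ζ := by
  refine Circle.ext ?_
  rw [moebius_coe]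
  change ((1 : ℂ) * ζ + 0) / (0 * ζ + 1) = ζ
  simp

lemma SU11_inv_entries : (g⁻¹).1.1 1 0 = -conj (g.1.1 0 1) ∧ (g⁻¹).1.1 1 1 = g.1.1 0 0 ∧
    (g⁻¹).1.1 0 0 = conj (g.1.1 0 0) ∧ (g⁻¹).1.1 0 1 = -g.1.1 0 1 := by
  obtain ⟨h1, h2⟩ := g.2
  have e : ((g⁻¹ : SU11) : SL2C).1 = g.1.1.adjugate := by
    rw [← Matrix.SpecialLinearGroup.coe_inv]; rfl
  rw [e, Matrix.adjugate_fin_two]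
  exact ⟨congrArg (-·) h1, rfl, h2, rfl⟩

lemma autFactor_inv (ζ : Circle) : autFactor g⁻¹ ζ = -conj (g.1.1 0 1) * ζ + g.1.1 0 0 := by
  obtain ⟨h1, h2, -⟩ := SU11_inv_entries g
  unfold autFactor
  exact congrArg₂ (fun p q => p * (ζ : ℂ) + q) h1 h2

lemma moebius_inv_coe (ζ : Circle) : (moebius g⁻¹ ζ : ℂ) =
    (conj (g.1.1 0 0) * ζ - g.1.1 0 1) / (-conj (g.1.1 0 1) * ζ + g.1.1 0 0) := by
  obtain ⟨h1, h2, h3, h4⟩ := SU11_inv_entries g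
  rw [moebius_coe, ← autFactor_inv]
  exact congrArg (· / autFactor g⁻¹ ζ) ((congrArg₂ (fun p q => p * (ζ : ℂ) + q) h3 h4).trans
    (sub_eq_add_neg _ _).symm)

/-- The Jacobian `|c ζ + d|⁻²` integrates Fourier monomials as expected, by the Cauchy integral
formula at the zero `-b / a` of `a ζ + b`. -/
lemma integral_moebius_pow (n : ℕ) :
    ∫ θ, ((‖autFactor g (angle θ)‖ ^ 2 : ℝ) : ℂ)⁻¹ * (moebius g (angle θ) : ℂ) ^ n
      ∂(haarAddCircle (T := (1 : ℝ))) = 0 ^ n := by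
  obtain ⟨h1, h2⟩ := g.2
  have hdet := SU11_det g
  have hlt := SU11_norm_lt g
  set a := g.1.1 0 0 with ha
  set b := g.1.1 0 1 with hb
  have ha0 : a ≠ 0 := norm_pos_iff.1 ((norm_nonneg b).trans_lt hlt)
  have hden : ∀ z : ℂ, ‖z‖ ≤ 1 → conj b * z + conj a ≠ 0 := by
    intro z hz h0
    have e : conj a = -(conj b * z) := by linear_combination h0
    have := congrArg norm e
    rw [norm_neg, norm_mul, Complex.norm_conj, Complex.norm_conj] at this
    have := mul_le_of_le_one_right (norm_nonneg b) hz
    linarith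
  have hnum : ∀ z : ℂ, ‖z‖ = 1 → a * z + b ≠ 0 := by
    intro z hz h0
    have e : a * z = -b := by linear_combination h0
    have := congrArg norm e
    rw [norm_neg, norm_mul, hz, mul_one] at this
    linarith
  have haut : ∀ ζ : Circle, autFactor g ζ = conj b * ζ + conj a := by
    intro ζ
    exact congrArg₂ (fun p q => p * (ζ : ℂ) + q) h1 h2
  have hmoeb : ∀ ζ : Circle, (moebius g ζ : ℂ) = (a * ζ + b) / (conj b * ζ + conj a) := by
    intro ζ
    rw [moebius_coe, ← haut]
    rfl
  have hsq : ∀ ζ : Circle, ((‖autFactor g ζ‖ ^ 2 : ℝ) : ℂ) =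
      (conj b * ζ + conj a) * ((a * ζ + b) * (ζ : ℂ)⁻¹) := by
    intro ζ
    rw [← Complex.normSq_eq_norm_sq, ← Complex.mul_conj, haut]
    simp only [map_add, map_mul, Complex.conj_conj]
    rw [← Circle.coe_inv_eq_conj, Circle.coe_inv]
    have := Circle.coe_ne_zero ζ
    field_simp
    ring
  -- on the unit circle the integrand is `f`, and `f z / z = F z / (z + b / a)` with `F` holomorphic on
  -- the closed disc; Cauchy's formula evaluates the integral as `F (-b / a)`
  let f : ℂ → ℂ := fun z => ((conj b * z + conj a) * ((a * z + b) * z⁻¹))⁻¹ *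
    ((a * z + b) / (conj b * z + conj a)) ^ n
  let F : ℂ → ℂ := fun z => (a * z + b) ^ n / (a * (conj b * z + conj a) ^ (n + 1))
  have e1 : ∀ θ : AddCircle (1 : ℝ), ((‖autFactor g (angle θ)‖ ^ 2 : ℝ) : ℂ)⁻¹ *
      (moebius g (angle θ) : ℂ) ^ n = f (angle θ) := by
    intro θ; rw [hsq, hmoeb]
  simp only [e1]
  have e2 : (∮ z in C(0, 1), z⁻¹ * f z) = ∮ z in C(0, 1), (z - -b / a)⁻¹ • F z := by
    refine circleIntegral.integral_congr zero_le_one fun z hz => ?_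
    have hz1 : ‖z‖ = 1 := by simpa using hz
    have hz0 : z ≠ 0 := norm_pos_iff.1 (by rw [hz1]; exact one_pos)
    have k1 := hden z hz1.le
    have k2 := hnum z hz1
    have k3 : z - -b / a = (a * z + b) / a := by field_simp; ring
    simp only [f, F, k3, smul_eq_mul, div_pow, pow_succ]
    field_simp
  have hw : -b / a ∈ Metric.ball (0 : ℂ) 1 := by
    rw [mem_ball_zero_iff, norm_div, norm_neg, div_lt_one (norm_pos_iff.2 ha0)]
    exact hlt
  have hF : DifferentiableOn ℂ F (Metric.closedBall 0 1) := by
    intro z hz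
    have hz1 : ‖z‖ ≤ 1 := by simpa using hz
    have k := hden z hz1
    refine DifferentiableAt.differentiableWithinAt ?_
    refine DifferentiableAt.div (by fun_prop) (by fun_prop) (mul_ne_zero ha0 (pow_ne_zero _ k))
  rw [integral_angle, e2, hF.circleIntegral_sub_inv_smul hw, inv_smul_smul₀ (by simp [Real.pi_ne_zero])]
  have k1 : a * (-b / a) + b = 0 := by field_simp; ring
  have k2 : conj b * (-b / a) + conj a = a⁻¹ := by
    field_simp; linear_combination hdet
  simp only [F, k1, k2]
  rcases n with _ | n
  · simp; field_simp
  · simp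

end Moebius

lemma continuous_autFactor_inv :
    Continuous fun p : SU11 × AddCircle (1 : ℝ) => autFactor p.1⁻¹ (angle p.2) := by
  have h1 : ∀ i j, Continuous fun g : SU11 => g.1.1 i j := fun i j => by
    have h3 : Continuous fun S : SL2C => S.1 := continuous_subtype_val
    exact (continuous_apply_apply i j).comp (h3.comp continuous_subtype_val)
  have h2 : Continuous fun p : SU11 × AddCircle (1 : ℝ) => ((angle p.2 : Circle) : ℂ) :=
    continuous_subtype_val.comp (angle.continuous.comp continuous_snd)
  simp only [autFactor_inv]
  exact (((Complex.continuous_conj.comp ((h1 0 1).comp continuous_fst)).neg).mul h2).add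
    ((h1 0 0).comp continuous_fst)

lemma continuous_moebius_inv :
    Continuous fun p : SU11 × AddCircle (1 : ℝ) => moebius p.1⁻¹ (angle p.2) := by
  have h := continuous_autFactor_inv
  refine (angle.continuous.comp continuous_snd).mul (Continuous.subtype_mk ?_ _)
  exact (Complex.continuous_conj.comp h).div h fun p => autFactor_ne_zero _ _

/-- The Jacobian of the action of `SU(1,1)` on the circle. -/
lemma integral_moebius (g : SU11) (f : C(AddCircle (1 : ℝ), ℂ)) :
    ∫ θ, ((‖autFactor g⁻¹ (angle θ)‖ ^ 2 : ℝ) : ℂ)⁻¹ * f (angle.symm (moebius g⁻¹ (angle θ)))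
      ∂haarAddCircle = ∫ θ, f θ ∂haarAddCircle := by
  let J : C(AddCircle (1 : ℝ), ℂ) := ⟨fun θ => ((‖autFactor g⁻¹ (angle θ)‖ ^ 2 : ℝ) : ℂ)⁻¹, by
    have h := continuous_autFactor_inv.comp (Continuous.prodMk_right g)
    refine (Complex.continuous_ofReal.comp (h.norm.pow 2)).inv₀ fun θ => ?_
    have := autFactor_ne_zero g⁻¹ (angle θ)
    simpa using this⟩
  let T : C(AddCircle (1 : ℝ), AddCircle (1 : ℝ)) := ⟨fun θ => angle.symm (moebius g⁻¹ (angle θ)),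
    angle.symm.continuous.comp (continuous_moebius_inv.comp (Continuous.prodMk_right g))⟩
  have hc2 : Continuous fun f : C(AddCircle (1 : ℝ), ℂ) =>
      ∫ θ, f θ ∂(haarAddCircle (T := (1 : ℝ))) := by
    refine (continuous_integral.comp (ContinuousMap.toLp 1 (haarAddCircle (T := (1 : ℝ)))
      ℂ).continuous).congr fun f => ?_
    exact integral_congr_ae (ContinuousMap.coeFn_toLp (p := 1) (𝕜 := ℂ) _ f)
  have hc1 : Continuous fun f : C(AddCircle (1 : ℝ), ℂ) =>
      ∫ θ, J θ * f (T θ) ∂(haarAddCircle (T := (1 : ℝ))) :=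
    hc2.comp (continuous_const.mul (ContinuousMap.continuous_precomp T))
  have hint : ∀ h : C(AddCircle (1 : ℝ), ℂ), Integrable h (haarAddCircle (T := (1 : ℝ))) :=
    fun h => h.continuous.integrable_of_hasCompactSupport (HasCompactSupport.of_compactSpace _)
  have hnat : ∀ n : ℕ, ∫ θ, J θ * fourier (n : ℤ) (T θ) ∂(haarAddCircle (T := (1 : ℝ))) =
      ∫ θ, fourier (n : ℤ) θ ∂(haarAddCircle (T := (1 : ℝ))) := by
    intro n
    have h1 := integral_moebius_pow g⁻¹ n
    have h2 := integral_moebius_pow 1 n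
    simp only [autFactor_one, moebius_one, norm_one, one_pow, Complex.ofReal_one, inv_one,
      one_mul] at h2
    simp only [fourier_angle, zpow_natCast]
    rw [h2, ← h1]
    simp [J, T]
  have key : f ∈ (Submodule.span ℂ (Set.range (fourier (T := (1 : ℝ))))).topologicalClosure := by
    rw [span_fourier_closure_eq_top]; trivial
  refine closure_minimal (s := (Submodule.span ℂ (Set.range (fourier (T := (1 : ℝ)))) :
    Set C(AddCircle (1 : ℝ), ℂ))) (t := {f | ∫ θ, J θ * f (T θ) ∂(haarAddCircle (T := (1 : ℝ))) =
      ∫ θ, f θ ∂(haarAddCircle (T := (1 : ℝ)))}) ?_ (isClosed_eq hc1 hc2) key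
  intro h hh
  induction hh using Submodule.span_induction with
  | mem h hh =>
    obtain ⟨n, rfl⟩ := hh
    obtain ⟨n, rfl | rfl⟩ := n.eq_nat_or_neg
    · exact hnat n
    · have h1 := congrArg conj (hnat n)
      rw [← integral_conj, ← integral_conj] at h1
      simp only [map_mul, ← fourier_neg] at h1
      have hJ : ∀ θ, conj (J θ) = J θ := by
        intro θ
        simp [J]
      simp only [hJ] at h1
      exact h1
  | zero => simp
  | add h h' _ _ ih ih' =>
    have e : ∀ k : C(AddCircle (1 : ℝ), ℂ), Integrable (fun θ => J θ * k (T θ))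
        (haarAddCircle (T := (1 : ℝ))) := fun k => hint (J * k.comp T)
    change ∫ θ, J θ * (h (T θ) + h' (T θ)) ∂_ = ∫ θ, (h θ + h' θ) ∂_
    simp only [mul_add]
    rw [integral_add (e h) (e h'), integral_add (hint h) (hint h')]
    exact congrArg₂ (· + ·) ih ih'
  | smul c h _ ih =>
    change ∫ θ, J θ * (c * h (T θ)) ∂_ = ∫ θ, c * h θ ∂_
    simp only [mul_left_comm _ c]
    rw [integral_const_mul, integral_const_mul]
    exact congrArg (c * ·) ih

/-- The Jacobian formula for nonnegative measurable functions. -/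
lemma lintegral_moebius (g : SU11) {f : AddCircle (1 : ℝ) → ENNReal} (hf : Measurable f) :
    ∫⁻ θ, ENNReal.ofReal (‖autFactor g⁻¹ (angle θ)‖ ^ 2)⁻¹ *
      f (angle.symm (moebius g⁻¹ (angle θ))) ∂haarAddCircle = ∫⁻ θ, f θ ∂haarAddCircle := by
  let J : AddCircle (1 : ℝ) → ℝ := fun θ => (‖autFactor g⁻¹ (angle θ)‖ ^ 2)⁻¹
  have hJ : Continuous J := by
    have h := continuous_autFactor_inv.comp (Continuous.prodMk_right g)
    refine (h.norm.pow 2).inv₀ fun θ => ?_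
    have := autFactor_ne_zero g⁻¹ (angle θ)
    simpa using this
  have hJ0 : ∀ θ, 0 ≤ J θ := fun θ => by positivity
  let T : AddCircle (1 : ℝ) → AddCircle (1 : ℝ) := fun θ => angle.symm (moebius g⁻¹ (angle θ))
  have hT : Continuous T :=
    angle.symm.continuous.comp (continuous_moebius_inv.comp (Continuous.prodMk_right g))
  have hJi : Integrable J (haarAddCircle (T := (1 : ℝ))) :=
    hJ.integrable_of_hasCompactSupport (HasCompactSupport.of_compactSpace _)
  let ν : Measure (AddCircle (1 : ℝ)) :=
    ((haarAddCircle (T := (1 : ℝ))).withDensity fun θ => ENNReal.ofReal (J θ)).map T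
  have hfin : IsFiniteMeasure ((haarAddCircle (T := (1 : ℝ))).withDensity
      fun θ => ENNReal.ofReal (J θ)) := isFiniteMeasure_withDensity_ofReal hJi.2
  have hν : ν = haarAddCircle (T := (1 : ℝ)) := by
    have hfin' : IsFiniteMeasure ν := by
      simp only [ν]; infer_instance
    refine ext_of_forall_integral_eq_of_IsFiniteMeasure fun h => ?_
    have h1 := integral_moebius g ⟨fun θ => (h θ : ℂ), Complex.continuous_ofReal.comp h.continuous⟩
    simp only [ContinuousMap.coe_mk] at h1
    rw [integral_map hT.aemeasurable h.continuous.aestronglyMeasurable,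
      integral_withDensity_eq_integral_toReal_smul hJ.measurable.ennreal_ofReal
        (Eventually.of_forall fun θ => ENNReal.ofReal_lt_top)]
    have h2 : ∫ θ, ((J θ * h (T θ) : ℝ) : ℂ) ∂(haarAddCircle (T := (1 : ℝ))) =
        ∫ θ, ((h θ : ℝ) : ℂ) ∂(haarAddCircle (T := (1 : ℝ))) := by
      rw [← h1]
      simp [J, T]
    rw [integral_complex_ofReal, integral_complex_ofReal] at h2
    simp only [ENNReal.toReal_ofReal (hJ0 _), smul_eq_mul]
    exact_mod_cast h2
  conv_rhs => rw [← hν]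
  rw [lintegral_map hf hT.measurable]
  change _ = ∫⁻ θ, (f ∘ T) θ ∂_
  rw [lintegral_withDensity_eq_lintegral_mul _
    hJ.measurable.ennreal_ofReal (hf.comp hT.measurable)]
  rfl

end ContractionFamilies
end

noncomputable section

namespace ContractionFamilies

/-! ### Ladders in the principal series -/

open MeasureTheory AddCircle

/-- The multiplier of the spherical principal series representation with parameter `ν`. -/
def principalMultiplier (ν : ℝ) : Multiplier SU11 (AddCircle (1 : ℝ)) haarAddCircle where
  m g θ := ((‖autFactor g⁻¹ (angle θ)‖ : ℝ) : ℂ) ^ (-(1 + Complex.I * ν))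
  T g θ := angle.symm (moebius g⁻¹ (angle θ))
  continuous_m := by
    refine (Complex.continuous_ofReal.comp continuous_autFactor_inv.norm).cpow continuous_const
      fun p => ?_
    exact Complex.ofReal_mem_slitPlane.2 (norm_pos_iff.2 (autFactor_ne_zero _ _))
  continuous_T := angle.symm.continuous.comp continuous_moebius_inv
  m_one θ := by simp [autFactor_one]
  T_one θ := by simp [moebius_one]
  m_mul g h θ := by
    rw [mul_inv_rev, autFactor_mul, Homeomorph.apply_symm_apply, norm_mul, mul_comm,
      Complex.ofReal_mul, Complex.mul_cpow_ofReal_nonneg (norm_nonneg _) (norm_nonneg _)]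
  T_mul g h θ := by
    rw [mul_inv_rev, moebius_mul, Homeomorph.apply_symm_apply]
  lintegral_comp g f hf := by
    rw [← lintegral_moebius g hf]
    refine lintegral_congr fun θ => ?_
    congr 1
    have hpos : 0 < ‖autFactor g⁻¹ (angle θ)‖ := norm_pos_iff.2 (autFactor_ne_zero _ _)
    rw [← ofReal_norm, ← ENNReal.ofReal_pow (norm_nonneg _), Complex.norm_cpow_eq_rpow_re_of_pos hpos]
    have : (-(1 + Complex.I * ν) : ℂ).re = -1 := by simp
    rw [this, Real.rpow_neg_one, inv_pow]

/-- The spherical principal series representation with parameter `ν`. -/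
def principalSeries (ν : ℝ) : UnitaryRep SU11 (Lp ℂ 2 (haarAddCircle (T := (1 : ℝ)))) :=
  (principalMultiplier ν).rep

lemma isSphericalPrincipalSeries_iff {H : Type*} [NormedAddCommGroup H] [InnerProductSpace ℂ H]
    (ν : ℝ) (π : UnitaryRep SU11 H) :
    IsSphericalPrincipalSeries ν π ↔ π.Equivalent (principalSeries ν) := by
  refine exists_congr fun U => forall_congr' fun g => forall_congr' fun v => ?_
  have h := (principalMultiplier ν).coeFn_op g (U v)
  constructor
  · intro h'
    exact Lp.ext (h'.trans h.symm)
  · intro h'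
    rw [h']
    exact h

section Derivative

variable {x : ℝ} (hx : 0 < x) (ν : ℝ)

/-- Scalars by which the raising operator acts on the Fourier monomials. -/
def kCoef (x ν : ℝ) (j : ℤ) : ℂ := √x * ((1 + Complex.I * ν) / 2 + j)

/-- The derivatives of the Fourier monomials in the principal series. -/
lemma principalSeries_isDerivative (a : ℝ) (b : ℂ) (j : ℤ) :
    ((principalSeries ν).comp (isoSU11 x hx)).IsDerivative (realElt x a b) (fourierLp 2 (-j))
      ((2 * Complex.I * a * j) • fourierLp 2 (-j) +
        ((b * kCoef x ν j) • fourierLp 2 (-(j + 1)) +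
          (conj b * kCoef x ν (-j)) • fourierLp 2 (-(j - 1)))) := by
  have key := (principalMultiplier ν).hasDerivAt_op
    (c := fun t : ℝ => isoSU11 x hx (expReal x (t • realElt x a b)))
    ((isoSU11 x hx).continuous_toFun.comp (continuous_expReal_smul (realElt x a b)))
    (by rw [zero_smul, expReal_zero, map_one]) (fun s t => by rw [expReal_add_smul, map_mul])
    (fourier (-j))
    ((2 * Complex.I * a * j) • fourier (-j) + ((b * kCoef x ν j) • fourier (-(j + 1)) +
        (conj b * kCoef x ν (-j)) • fourier (-(j - 1)))) ?_
  · simp only [map_add, map_smul] at key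
    exact key
  · intro θ
    obtain ⟨h0, h1⟩ := hasDerivAt_expReal_entries (x := x) a b
    obtain ⟨e0, e1⟩ := expReal_entries_zero (realElt x a b)
    set p := fun t : ℝ => (expReal x (t • realElt x a b)).1.1.1 0 0 with hp
    set q := fun t : ℝ => (expReal x (t • realElt x a b)).1.1.1 0 1 with hq
    have hp0 : p 0 = 1 := e0
    have hq0 : q 0 = 0 := e1
    set z : ℂ := (angle θ : ℂ) with hz'
    have hz : z ≠ 0 := Circle.coe_ne_zero _
    have hzc : conj z = z⁻¹ := by
      rw [hz', ← Circle.coe_inv_eq_conj, Circle.coe_inv]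
    -- the function of `t` to be differentiated is `|A|^{-(1 + iν)} (B / A)^{-j}`, where
    -- `A = p - conj (√x q) z` and `B = conj p z - √x q`
    have e : ∀ t : ℝ, (principalMultiplier ν).m (isoSU11 x hx (expReal x (t • realElt x a b))) θ *
        fourier (-j) ((principalMultiplier ν).T (isoSU11 x hx (expReal x (t • realElt x a b))) θ) =
        ((‖-conj (√x * q t) * z + p t‖ : ℝ) : ℂ) ^ (-(1 + Complex.I * ν)) *
          ((conj (p t) * z - √x * q t) / (-conj (√x * q t) * z + p t)) ^ (-j) := by
      intro t
      rw [fourier_angle]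
      change ((‖autFactor _ (angle θ)‖ : ℝ) : ℂ) ^ _ *
        ((angle (angle.symm (moebius _ (angle θ))) : Circle) : ℂ) ^ (-j) = _
      rw [Homeomorph.apply_symm_apply, moebius_inv_coe, autFactor_inv]
      rfl
    simp only [e]
    have dq : HasDerivAt (fun t => (√x : ℂ) * q t) (√x * b) 0 := h1.const_mul _
    have dqc : HasDerivAt (fun t => conj ((√x : ℂ) * q t)) (conj (√x * b)) 0 :=
      Complex.conjCLE.toContinuousLinearMap.hasFDerivAt.comp_hasDerivAt 0 dq
    have dpc : HasDerivAt (fun t => conj (p t)) (conj (Complex.I * a)) 0 :=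
      Complex.conjCLE.toContinuousLinearMap.hasFDerivAt.comp_hasDerivAt 0 h0
    have dA : HasDerivAt (fun t => -conj ((√x : ℂ) * q t) * z + p t)
        (-conj (√x * b) * z + Complex.I * a) 0 := (dqc.neg.mul_const z).add h0
    have dB : HasDerivAt (fun t => conj (p t) * z - √x * q t)
        (conj (Complex.I * a) * z - √x * b) 0 := (dpc.mul_const z).sub dq
    have hA0 : -conj ((√x : ℂ) * q 0) * z + p 0 = 1 := by rw [hq0, hp0]; simp
    have hB0 : conj (p 0) * z - √x * q 0 = z := by rw [hq0, hp0]; simp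
    have dN : HasDerivAt (fun t => ‖-conj ((√x : ℂ) * q t) * z + p t‖)
        ((-conj (√x * b) * z + Complex.I * a).re) 0 := by
      have h2 := dA.norm_sq.sqrt (by rw [hA0]; simp)
      simp only [Real.sqrt_sq (norm_nonneg _), hA0] at h2
      refine h2.congr_deriv ?_
      simp [Complex.inner]
    have dm : HasDerivAt (fun t => ((‖-conj ((√x : ℂ) * q t) * z + p t‖ : ℝ) : ℂ) ^
        (-(1 + Complex.I * ν))) (-(1 + Complex.I * ν) * (-conj (√x * b) * z + Complex.I * a).re)
        0 := by
      have h2 : HasDerivAt (fun y : ℝ => (y : ℂ) ^ (-(1 + Complex.I * ν)))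
          (-(1 + Complex.I * ν)) ‖-conj ((√x : ℂ) * q 0) * z + p 0‖ := by
        rw [hA0, norm_one]
        refine ((hasDerivAt_id ((1 : ℝ) : ℂ)).cpow_const (c := -(1 + Complex.I * ν))
          (Or.inl (by simp))).comp_ofReal.congr_deriv ?_
        simp
      exact (h2.scomp (0 : ℝ) dN).congr_deriv (by rw [Complex.real_smul, mul_comm])
    have dT : HasDerivAt (fun t => ((conj (p t) * z - √x * q t) /
        (-conj ((√x : ℂ) * q t) * z + p t)) ^ (-j))
        (-j * z ^ (-j - 1) * ((conj (Complex.I * a) * z - √x * b) -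
          z * (-conj (√x * b) * z + Complex.I * a))) 0 := by
      have h2 : HasDerivAt (fun t => (conj (p t) * z - √x * q t) /
          (-conj ((√x : ℂ) * q t) * z + p t)) ((conj (Complex.I * a) * z - √x * b) -
          z * (-conj (√x * b) * z + Complex.I * a)) 0 :=
        (dB.div dA (by rw [hA0]; exact one_ne_zero)).congr_deriv
          (by rw [hA0, hB0]; ring)
      have h3 : (conj (p 0) * z - √x * q 0) / (-conj ((√x : ℂ) * q 0) * z + p 0) = z := by
        rw [hA0, hB0, div_one]
      refine ((hasDerivAt_zpow (-j) _ (Or.inl (by rw [h3]; exact hz))).comp (0 : ℝ) h2).congr_deriv ?_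
      rw [h3]
      push_cast
      ring
    refine (dm.mul dT).congr_deriv ?_
    rw [hA0, hB0]
    have hre : (((-conj (√x * b) * z + Complex.I * a).re : ℝ) : ℂ) =
        -(√x * (conj b * z + b * z⁻¹)) / 2 := by
      rw [Complex.re_eq_add_conj]
      simp only [map_add, map_mul, map_neg, Complex.conj_conj, Complex.conj_ofReal, Complex.conj_I,
        hzc]
      ring
    rw [hre]
    simp only [ContinuousMap.add_apply, ContinuousMap.smul_apply, fourier_angle, ← hz',
      smul_eq_mul, kCoef, norm_one, Complex.ofReal_one, Complex.one_cpow, div_one, one_mul,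
      neg_add_rev, sub_eq_add_neg, zpow_add₀ hz, zpow_neg, zpow_one, map_mul,
      Complex.conj_I, Complex.conj_ofReal]
    push_cast
    field_simp
    ring

end Derivative

/-- A two-sided recursion with factors of absolute value one has a solution of absolute value one. -/
lemma exists_phases (c : ℤ → ℂ) (hc : ∀ j, ‖c j‖ = 1) :
    ∃ p : ℤ → ℂ, (∀ j, ‖p j‖ = 1) ∧ ∀ j, p (j + 1) = c j * p j := by
  have hc0 : ∀ j, c j ≠ 0 := fun j => norm_pos_iff.1 (by rw [hc]; exact one_pos)
  let p : ℤ → ℂ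
    | Int.ofNat n => ∏ i ∈ Finset.range n, c i
    | Int.negSucc n => ∏ i ∈ Finset.range (n + 1), (c (-(i + 1)))⁻¹
  refine ⟨p, ?_, ?_⟩
  · rintro (n | n)
    · change ‖∏ i ∈ Finset.range n, c i‖ = 1
      simp [hc]
    · change ‖∏ i ∈ Finset.range (n + 1), (c (-(i + 1)))⁻¹‖ = 1
      simp [hc]
  · rintro (n | n)
    · change ∏ i ∈ Finset.range (n + 1), c i = c n * ∏ i ∈ Finset.range n, c i
      rw [Finset.prod_range_succ, mul_comm]
    · rcases n with _ | n
      · change ∏ i ∈ Finset.range 0, c i = c (-1) * ∏ i ∈ Finset.range (0 + 1), (c (-(i + 1)))⁻¹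
        simp [hc0]
      · have e : (Int.negSucc (n + 1) : ℤ) = -((n + 1 : ℕ) + 1) := rfl
        change ∏ i ∈ Finset.range (n + 1), (c (-(i + 1)))⁻¹ =
          c (Int.negSucc (n + 1)) * ∏ i ∈ Finset.range (n + 1 + 1), (c (-(i + 1)))⁻¹
        rw [Finset.prod_range_succ _ (n + 1), e, mul_comm, mul_assoc, inv_mul_cancel₀ (hc0 _),
          mul_one]

/-- For `ν² = 1 / x` the Fourier monomials, multiplied by suitable phases, are a ladder. -/
theorem principalSeries_exists_hasLadder {x : ℝ} (hx : 0 < x) {ν : ℝ} (hν : x * ν ^ 2 = 1) :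
    ∃ u, HasLadder ((principalSeries ν).comp (isoSU11 x hx)) u ∧ DenseSpan u := by
  have hsq : ∀ j, sCoef x j ^ 2 = (1 + (2 * j + 1) ^ 2 * x) / 4 := by
    intro j
    rw [sCoef, div_pow, Real.sq_sqrt (by positivity)]
    norm_num
  have hspos : ∀ j, 0 < sCoef x j := by
    intro j
    unfold sCoef
    positivity
  have hsC : ∀ j, (sCoef x j : ℂ) ≠ 0 := fun j => by exact_mod_cast (hspos j).ne'
  have hxs : (√x : ℂ) ^ 2 = x := by exact_mod_cast Real.sq_sqrt hx.le
  have hνC : (x : ℂ) * ν ^ 2 = 1 := by exact_mod_cast hν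
  -- `kCoef x ν j` has absolute value `sCoef x j`, so the two differ by a phase
  have hconj : ∀ j, conj (kCoef x ν j) = -kCoef x ν (-(j + 1)) := by
    intro j
    simp only [kCoef, map_mul, map_add, map_div₀, Complex.conj_ofReal, Complex.conj_I, map_one,
      map_ofNat, map_intCast]
    push_cast
    ring
  have hk : ∀ j, kCoef x ν j * kCoef x ν (-(j + 1)) = -(sCoef x j : ℂ) ^ 2 := by
    intro j
    have e : (sCoef x j : ℂ) ^ 2 = (1 + (2 * j + 1) ^ 2 * x) / 4 := by exact_mod_cast hsq j
    rw [e]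
    simp only [kCoef]
    push_cast
    linear_combination (((1 + Complex.I * ν) / 2 + j) * ((1 + Complex.I * ν) / 2 - (j + 1))) * hxs -
      hνC / 4 + (x * ν ^ 2 / 4) * Complex.I_sq
  have hnorm : ∀ j, ‖kCoef x ν j / sCoef x j‖ = 1 := by
    intro j
    have h1 : ((‖kCoef x ν j‖ ^ 2 : ℝ) : ℂ) = (sCoef x j ^ 2 : ℝ) := by
      rw [← Complex.normSq_eq_norm_sq, ← Complex.mul_conj, hconj, mul_neg, hk, neg_neg]
      push_cast
      rfl
    have h2 : ‖kCoef x ν j‖ ^ 2 = sCoef x j ^ 2 := by exact_mod_cast h1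
    rw [norm_div, Complex.norm_real, Real.norm_of_nonneg (hspos j).le, div_eq_one_iff_eq (hspos j).ne']
    exact (pow_left_inj₀ (norm_nonneg _) (hspos j).le two_ne_zero).1 h2
  obtain ⟨p, hp, hrec⟩ := exists_phases _ hnorm
  have hp0 : ∀ j, p j ≠ 0 := fun j => norm_pos_iff.1 (by rw [hp]; exact one_pos)
  have hup : ∀ j, p j * kCoef x ν j = sCoef x j * p (j + 1) := by
    intro j
    rw [hrec]
    field_simp [hsC j]
  have hdown : ∀ j, p (j + 1) * kCoef x ν (-(j + 1)) = -(sCoef x j * p j) := by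
    intro j
    have h1 := hup j
    have h2 := hk j
    refine mul_left_cancel₀ (hsC j) ?_
    linear_combination p j * h2 - kCoef x ν (-(j + 1)) * h1
  refine ⟨fun j => p j • fourierLp 2 (-j), ⟨fun i j => ?_, fun a b j => ?_⟩, ?_⟩
  · rw [inner_smul_left, inner_smul_right, inner_fourierLp]
    by_cases h : i = j
    · subst h
      rw [if_pos rfl, if_pos ⟨rfl, (dv_pos hx.le i).ne'⟩, mul_one, Complex.conj_mul', hp]
      norm_num
    · simp [h]
  · have h1 := (principalSeries_isDerivative hx ν a b j).smul (p j)
    have h2 := hup j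
    have h3 := hdown (j - 1)
    rw [sub_add_cancel] at h3
    have e : p j • ((2 * Complex.I * a * j) • (fourierLp 2 (-j) :
        Lp ℂ 2 (haarAddCircle (T := (1 : ℝ)))) + ((b * kCoef x ν j) • fourierLp 2 (-(j + 1)) +
          (conj b * kCoef x ν (-j)) • fourierLp 2 (-(j - 1)))) =
        (2 * Complex.I * a * j) • p j • fourierLp 2 (-j) +
        ((b * sCoef x j) • p (j + 1) • fourierLp 2 (-(j + 1)) -
          (conj b * sCoef x (j - 1)) • p (j - 1) • fourierLp 2 (-(j - 1))) := by
      linear_combination (norm := module)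
        congrArg (fun z : ℂ => (b * z) • (fourierLp 2 (-(j + 1)) :
          Lp ℂ 2 (haarAddCircle (T := (1 : ℝ))))) h2 +
        congrArg (fun z : ℂ => (conj b * z) • (fourierLp 2 (-(j - 1)) :
          Lp ℂ 2 (haarAddCircle (T := (1 : ℝ))))) h3
    rw [← e]
    exact h1
  · refine eq_top_iff.2 (denseSpan_fourierLp.ge.trans (Submodule.topologicalClosure_mono ?_))
    rw [Submodule.span_le]
    rintro _ ⟨j, rfl⟩
    have h1 : p (-j) • (fourierLp 2 (-(-j)) : Lp ℂ 2 (haarAddCircle (T := (1 : ℝ)))) ∈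
        Submodule.span ℂ (Set.range fun j => p j •
          (fourierLp 2 (-j) : Lp ℂ 2 (haarAddCircle (T := (1 : ℝ))))) :=
      Submodule.subset_span ⟨-j, rfl⟩
    rw [neg_neg] at h1
    exact (Submodule.smul_mem_iff _ (hp0 _)).1 h1

/-- The Casimir over `x` acts on the constant function in the principal series by `-(1 + ν²)`. -/
lemma principalSeries_casimir {x : ℝ} (hx : 0 < x) {ν c : ℝ}
    (h : ((principalSeries ν).comp (isoSU11 x hx)).CasimirActsBy c) : c = -(1 + ν ^ 2) := by
  have hd := principalSeries_isDerivative hx ν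
  have hxs : (√x : ℂ) ^ 2 = x := by exact_mod_cast Real.sq_sqrt hx.le
  have hxC : (x : ℂ) ≠ 0 := by exact_mod_cast hx.ne'
  have key := h (fourierLp 2 (-0)) _ _ _ _ _ _ (hd 1 0 0) ((((hd 1 0 0).smul _).add
    (((hd 1 0 (0 + 1)).smul _).add ((hd 1 0 (0 - 1)).smul _))))
    (hd 0 1 0) ((((hd 0 1 0).smul _).add
    (((hd 0 1 (0 + 1)).smul _).add ((hd 0 1 (0 - 1)).smul _))))
    (hd 0 Complex.I 0) ((((hd 0 Complex.I 0).smul _).add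
    (((hd 0 Complex.I (0 + 1)).smul _).add ((hd 0 Complex.I (0 - 1)).smul _))))
  have h2 := congrArg (fun f : Lp ℂ 2 (haarAddCircle (T := (1 : ℝ))) =>
    ⟪(fourierLp 2 0 : Lp ℂ 2 (haarAddCircle (T := (1 : ℝ)))), f⟫_ℂ) key
  simp only [inner_add_right, inner_neg_right, inner_smul_right, inner_fourierLp] at h2
  simp [kCoef] at h2
  have hx1 : (x : ℂ)⁻¹ * x = 1 := inv_mul_cancel₀ hxC
  have h3 : (c : ℂ) = -(1 + ν ^ 2) := by
    linear_combination -h2 + (x : ℂ)⁻¹ * (2 * ((1 + Complex.I * ν) / 2) *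
      ((1 + Complex.I * ν) / 2 - 1) * (1 - Complex.I ^ 2)) * hxs +
      (2 * ((1 + Complex.I * ν) / 2) * ((1 + Complex.I * ν) / 2 - 1) * (1 - Complex.I ^ 2)) * hx1 +
      (ν ^ 2 * (2 - Complex.I ^ 2) + 1) / 2 * Complex.I_sq
  exact_mod_cast h3

/-- A representation with a dense ladder over `x > 0` is the principal series representation with
`ν² = 1 / x`. -/
theorem HasLadder.isSphericalPrincipalSeries {x : ℝ} (hx : 0 < x) {H : Type*}
    [NormedAddCommGroup H] [InnerProductSpace ℂ H] [CompleteSpace H]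
    {π : UnitaryRep (realGroup x) H} {u : ℤ → H} (hu : HasLadder π u) (hd : DenseSpan u) {ν : ℝ}
    (hν : x * ν ^ 2 = 1) : IsSphericalPrincipalSeries ν (π.comp (isoSU11 x hx).symm) := by
  obtain ⟨u', hu', hd'⟩ := principalSeries_exists_hasLadder hx hν
  obtain ⟨U, hU⟩ := hu.equivalent hd hu' hd'
  refine (isSphericalPrincipalSeries_iff ν _).2 ⟨U, fun g v => ?_⟩
  have h1 := hU ((isoSU11 x hx).symm g) v
  refine h1.trans ?_
  change (principalSeries ν).toHom ((isoSU11 x hx) ((isoSU11 x hx).symm g)) (U v) = _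
  rw [ContinuousMulEquiv.apply_symm_apply]

lemma UnitaryRep.Equivalent.comp {G G' H H' : Type*} [Group G] [TopologicalSpace G] [Group G']
    [TopologicalSpace G'] [NormedAddCommGroup H] [InnerProductSpace ℂ H] [NormedAddCommGroup H']
    [InnerProductSpace ℂ H'] {π : UnitaryRep G H} {π' : UnitaryRep G H'} (h : π.Equivalent π')
    (j : G' ≃ₜ* G) : (π.comp j).Equivalent (π'.comp j) := by
  obtain ⟨U, hU⟩ := h
  exact ⟨U, fun g v => hU (j g) v⟩

lemma UnitaryRep.Equivalent.symm {G H H' : Type*} [Group G] [TopologicalSpace G]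
    [NormedAddCommGroup H] [InnerProductSpace ℂ H] [NormedAddCommGroup H']
    [InnerProductSpace ℂ H'] {π : UnitaryRep G H} {π' : UnitaryRep G H'} (h : π.Equivalent π') :
    π'.Equivalent π := by
  obtain ⟨U, hU⟩ := h
  refine ⟨U.symm, fun g v => ?_⟩
  rw [LinearIsometryEquiv.symm_apply_eq, hU, LinearIsometryEquiv.apply_symm_apply]

lemma HasLadder.of_equivalent {x : ℝ} {H H' : Type*} [NormedAddCommGroup H]
    [InnerProductSpace ℂ H] [NormedAddCommGroup H'] [InnerProductSpace ℂ H']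
    {π : UnitaryRep (realGroup x) H} {π' : UnitaryRep (realGroup x) H'} (h : π.Equivalent π')
    (hl : ∃ u, HasLadder π' u ∧ DenseSpan u) : ∃ u, HasLadder π u ∧ DenseSpan u := by
  obtain ⟨U, hU⟩ := h.symm
  obtain ⟨u, hu, hd⟩ := hl
  refine ⟨fun j => U (u j), ?_, hd.map U fun _ => rfl⟩
  have h1 := hu.transport U (u' := fun j => U (u j)) fun j => rfl
  have h2 : π'.transport U = π := by
    refine UnitaryRep.ext fun g v => ?_
    rw [UnitaryRep.transport_apply, hU, LinearIsometryEquiv.apply_symm_apply]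
  rwa [h2] at h1

/-- The principal series with parameter `ν` has a dense ladder over `x > 0` exactly for
`ν² = 1 / x`. -/
theorem IsSphericalPrincipalSeries.exists_hasLadder_iff {x : ℝ} (hx : 0 < x) {H : Type*}
    [NormedAddCommGroup H] [InnerProductSpace ℂ H] {τ : UnitaryRep SU11 H} {ν : ℝ}
    (h : IsSphericalPrincipalSeries ν τ) :
    (∃ u, HasLadder (τ.comp (isoSU11 x hx)) u ∧ DenseSpan u) ↔ x * ν ^ 2 = 1 := by
  have h1 := ((isSphericalPrincipalSeries_iff ν τ).1 h).comp (isoSU11 x hx)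
  constructor
  · intro h2
    obtain ⟨u, hu, hd⟩ := HasLadder.of_equivalent h1.symm h2
    have h3 := principalSeries_casimir hx (hu.casimirActsBy hd hx)
    have : (x + 1) / x = 1 + ν ^ 2 := by rw [neg_div] at h3; linarith
    rw [div_eq_iff hx.ne'] at this
    linarith
  · intro hν
    exact HasLadder.of_equivalent h1 (principalSeries_exists_hasLadder hx hν)

end ContractionFamilies
end

noncomputable section

namespace ContractionFamilies

/-! ### Spherical representations of the motion group -/

/-- Vectors of different weights are orthogonal. -/
lemma UnitaryRep.IsDerivative.inner_eq_zero {x : ℝ} {H : Type*} [NormedAddCommGroup H]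
    [InnerProductSpace ℂ H] {π : UnitaryRep (realGroup x) H} {v w : H} {k l : ℤ}
    (hv : π.IsDerivative (realElt x 1 0) v ((Complex.I * k) • v))
    (hw : π.IsDerivative (realElt x 1 0) w ((Complex.I * l) • w)) (h : k ≠ l) :
    ⟪v, w⟫_ℂ = 0 := by
  have h1 := hv.inner_left hw
  rw [inner_smul_left, inner_smul_right, map_mul, Complex.conj_I, map_intCast] at h1
  have h2 : (Complex.I * ((l : ℂ) - k)) * ⟪v, w⟫_ℂ = 0 := by linear_combination h1
  refine (mul_eq_zero.1 h2).resolve_left (mul_ne_zero Complex.I_ne_zero (sub_ne_zero.2 ?_))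
  exact_mod_cast h.symm

/-- In an irreducible representation a ladder is dense. -/
lemma HasLadder.denseSpan_of_isIrreducible {x : ℝ} {H : Type*} [NormedAddCommGroup H]
    [InnerProductSpace ℂ H] [CompleteSpace H] {π : UnitaryRep (realGroup x) H} {u : ℤ → H}
    (hu : HasLadder π u) (hirr : π.IsIrreducible) : DenseSpan u := by
  refine (hirr.2 _ (Submodule.isClosed_topologicalClosure _)
    fun g w hw => hu.closure_invariant g hw).resolve_left fun h0 => ?_
  have h1 : u 0 ∈ (Submodule.span ℂ (Set.range u)).topologicalClosure :=
    Submodule.le_topologicalClosure _ (Submodule.subset_span ⟨0, rfl⟩)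
  rw [h0, Submodule.mem_bot] at h1
  exact hu.ne_zero (by rw [dv_zero]; exact one_ne_zero) h1

section Motion

open MeasureTheory
open scoped ContDiff Convolution

variable {H : Type*} [NormedAddCommGroup H] [InnerProductSpace ℂ H]
  (π : UnitaryRep (realGroup 0) H)

/-- The action of the translation by `c`. -/
def UnitaryRep.transl (c : ℂ) : H ≃ₗᵢ[ℂ] H := π.toHom (expReal 0 (realElt 0 0 c))

lemma transl_add (b c : ℂ) (v : H) : π.transl (b + c) v = π.transl b (π.transl c v) := by
  rw [UnitaryRep.transl, motion_add, UnitaryRep.toHom_mul]; rfl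

lemma transl_zero (v : H) : π.transl 0 v = v := by
  have h : realElt 0 0 (0 : ℂ) = (0 : ℝ) • realElt 0 0 (0 : ℂ) := by
    rw [smul_realElt]; simp
  rw [UnitaryRep.transl, h, zero_smul, expReal_zero, UnitaryRep.toHom_one]

lemma torus_transl (w : Circle) (c : ℂ) (v : H) : π.toHom (torus 0 w) (π.transl c v) =
    π.transl ((w : ℂ) ^ 2 * c) (π.toHom (torus 0 w) v) := by
  rw [UnitaryRep.transl, ← UnitaryRep.toHom_mul, torus_mul_expReal, UnitaryRep.toHom_mul]; rfl

lemma continuous_transl (v : H) : Continuous fun c => π.transl c v := by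
  have h : ∀ A : ℂ → M2 ℂ, Continuous A → Continuous fun c => NormedSpace.exp (A c) := by
    intro A hA
    open scoped Matrix.Norms.Operator in
    exact NormedSpace.exp_continuous.comp hA
  have h : Continuous fun c : ℂ => expReal 0 (realElt 0 0 c) := by
    refine Continuous.subtype_mk (((h (fun c => (realElt 0 0 c).1.1) ?_).subtype_mk _).prodMk
      ((h (fun c => (realElt 0 0 c).1.2) ?_).subtype_mk _)) _ <;>
    · refine continuous_matrix fun i j => ?_
      fin_cases i <;> fin_cases j <;> simp [realElt, gElt] <;> fun_prop
  exact (π.continuous_orbit v).comp h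

/-- Vectors on which the translations act smoothly and the rotations with weight `2k`. -/
structure IsSmoothWeight (k : ℤ) (v : H) : Prop where
  smooth : ContDiff ℝ ∞ fun c => π.transl c v
  weight : ∀ w : Circle, π.toHom (torus 0 w) v = ((w : ℂ) ^ (2 * k)) • v

/-- The derivative in the direction of a translation. -/
def translDeriv (b : ℂ) (v : H) : H := fderiv ℝ (fun c => π.transl c v) 0 b

/-- The holomorphic part of the derivative in the direction of the translations. -/
def raiseOp (v : H) : H :=
  (2⁻¹ : ℂ) • (translDeriv π 1 v - Complex.I • translDeriv π Complex.I v)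

/-- The negative of the antiholomorphic part of the derivative in the direction of the
translations. -/
def lowerOp (v : H) : H :=
  (-2⁻¹ : ℂ) • (translDeriv π 1 v + Complex.I • translDeriv π Complex.I v)

variable {π} {v w : H} {k l : ℤ}

lemma translDeriv_eq (b : ℂ) :
    translDeriv π b v = b • raiseOp π v - conj b • lowerOp π v := by
  have e : b = b.re • (1 : ℂ) + b.im • Complex.I := by
    simp
  have h : translDeriv π b v =
      b.re • translDeriv π 1 v + b.im • translDeriv π Complex.I v := by
    conv_lhs => rw [e]
    simp only [translDeriv, map_add, map_smul]
  have hb : b = b.re + b.im * Complex.I := (Complex.re_add_im b).symm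
  have hb' : conj b = b.re - b.im * Complex.I := by
    apply Complex.ext <;> simp
  rw [h, hb', raiseOp, lowerOp]
  nth_rw 3 [hb]
  simp only [← Complex.coe_smul]
  linear_combination (norm := module)
    congrArg (fun z : ℂ => (z * b.im) • translDeriv π Complex.I v) Complex.I_mul_I

lemma transl_translDeriv (hv : ContDiff ℝ ∞ fun c => π.transl c v) (b c : ℂ) :
    π.transl c (translDeriv π b v) = fderiv ℝ (fun c => π.transl c v) c b := by
  have h1 : (fun h => π.transl (c + h) v) = fun h => π.transl c (π.transl h v) :=
    funext fun h => transl_add π c h v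
  have h2 := fderiv_comp_add_left (𝕜 := ℝ) (f := fun c => π.transl c v) (x := 0) c
  rw [h1, add_zero] at h2
  rw [← h2]
  have h3 := ((π.transl c).toContinuousLinearEquiv.toContinuousLinearMap.restrictScalars
    ℝ).hasFDerivAt.comp (0 : ℂ) ((hv.differentiable (by simp)) 0).hasFDerivAt
  exact (DFunLike.congr_fun h3.fderiv b).symm

lemma smooth_translDeriv (hv : ContDiff ℝ ∞ fun c => π.transl c v) (b : ℂ) :
    ContDiff ℝ ∞ fun c => π.transl c (translDeriv π b v) := by
  simp only [transl_translDeriv hv]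
  exact (hv.fderiv_right (m := ∞) le_rfl).clm_apply contDiff_const

/-- The second derivatives of a smooth vector along the translations are symmetric. -/
lemma translDeriv_comm (hv : ContDiff ℝ ∞ fun c => π.transl c v) (b c : ℂ) :
    translDeriv π b (translDeriv π c v) = translDeriv π c (translDeriv π b v) := by
  have h : ∀ b c : ℂ, translDeriv π b (translDeriv π c v) =
      fderiv ℝ (fderiv ℝ fun c => π.transl c v) 0 b c := by
    intro b c
    unfold translDeriv
    have e := funext (transl_translDeriv hv c)
    unfold translDeriv at e
    rw [e]
    have hd : DifferentiableAt ℝ (fderiv ℝ fun c => π.transl c v) 0 :=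
      ((hv.fderiv_right (m := ∞) le_rfl).differentiable (by simp)) 0
    rw [fderiv_clm_apply hd (differentiableAt_const c)]
    simp
  rw [h, h]
  exact (hv.contDiffAt.isSymmSndFDerivAt (by
    simpa using WithTop.coe_le_coe.2 (le_top : (2 : ℕ∞) ≤ ⊤))) b c

lemma isDerivative_transl (hv : ContDiff ℝ ∞ fun c => π.transl c v) (b : ℂ) :
    π.IsDerivative (realElt 0 0 b) v (translDeriv π b v) := by
  have h1 : HasDerivAt (fun t : ℝ => (t : ℂ) * b) b 0 := by
    simpa using Complex.ofRealCLM.hasDerivAt.mul_const b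
  have h2 : HasFDerivAt (fun c => π.transl c v) (fderiv ℝ (fun c => π.transl c v) 0)
      (((0 : ℝ) : ℂ) * b) := by
    rw [Complex.ofReal_zero, zero_mul]
    exact ((hv.differentiable (by simp)) 0).hasFDerivAt
  have h3 := h2.comp_hasDerivAt (0 : ℝ) h1
  unfold UnitaryRep.IsDerivative
  simp only [smul_realElt, mul_zero]
  exact h3

lemma translDeriv_add (hv : ContDiff ℝ ∞ fun c => π.transl c v)
    (hw : ContDiff ℝ ∞ fun c => π.transl c w) (b : ℂ) :
    translDeriv π b (v + w) = translDeriv π b v + translDeriv π b w := by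
  unfold translDeriv
  simp only [map_add]
  rw [fderiv_fun_add (hv.differentiable (by simp) 0) (hw.differentiable (by simp) 0)]
  rfl

lemma translDeriv_smul (hv : ContDiff ℝ ∞ fun c => π.transl c v) (a b : ℂ) :
    translDeriv π b (a • v) = a • translDeriv π b v := by
  unfold translDeriv
  simp only [map_smul]
  rw [fderiv_fun_const_smul (hv.differentiable (by simp) 0)]
  rfl

lemma contDiff_transl_comb (hv : ContDiff ℝ ∞ fun c => π.transl c v)
    (hw : ContDiff ℝ ∞ fun c => π.transl c w) (a b : ℂ) :
    ContDiff ℝ ∞ fun c => π.transl c (a • (v + b • w)) := by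
  simp only [map_add, map_smul]
  exact contDiff_const.smul (hv.add (contDiff_const.smul hw))

lemma IsSmoothWeight.torus_translDeriv (hv : IsSmoothWeight π k v) (u : Circle) (b : ℂ) :
    π.toHom (torus 0 u) (translDeriv π b v) =
      ((u : ℂ) ^ (2 * k)) • translDeriv π ((u : ℂ) ^ 2 * b) v := by
  have h1 := isDerivative_transl hv.smooth b
  have h2 := (isDerivative_transl hv.smooth ((u : ℂ) ^ 2 * b)).smul ((u : ℂ) ^ (2 * k))
  have h3 := ((π.toHom (torus 0 u)).toContinuousLinearEquiv.toContinuousLinearMap.restrictScalars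
    ℝ).hasFDerivAt.comp_hasDerivAt (0 : ℝ) h1
  refine HasDerivAt.unique h3 (HasDerivAt.congr_of_eventuallyEq h2 (.of_forall fun t => ?_))
  change π.toHom (torus 0 u) (π.toHom (expReal 0 (t • realElt 0 0 b)) v) = _
  simp only [smul_realElt, mul_zero]
  rw [← UnitaryRep.toHom_mul, torus_mul_expReal, UnitaryRep.toHom_mul, hv.weight]
  congr 4
  ring

lemma IsSmoothWeight.raise (hv : IsSmoothWeight π k v) :
    IsSmoothWeight π (k + 1) (raiseOp π v) := by
  refine ⟨?_, fun u => ?_⟩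
  · have := contDiff_transl_comb (smooth_translDeriv hv.smooth 1)
      (smooth_translDeriv hv.smooth Complex.I) 2⁻¹ (-Complex.I)
    simpa only [raiseOp, sub_eq_add_neg, neg_smul] using this
  · have hu : (u : ℂ) ≠ 0 := Circle.coe_ne_zero u
    have e : ∀ b : ℂ, π.toHom (torus 0 u) (translDeriv π b v) = _ := hv.torus_translDeriv u
    conv_lhs => rw [raiseOp, map_smul, map_sub, map_smul, e, e,
      translDeriv_eq, translDeriv_eq ((u : ℂ) ^ 2 * Complex.I)]
    have e2 : (u : ℂ) ^ (2 * 1 : ℤ) = (u : ℂ) ^ 2 := zpow_ofNat _ 2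
    rw [mul_add, zpow_add₀ hu, e2]
    simp only [map_mul, Complex.conj_I, mul_one]
    linear_combination (norm := module) congrArg (fun z : ℂ => (-2⁻¹ * (u : ℂ) ^ (2 * k) * z) •
      ((u : ℂ) ^ 2 • raiseOp π v +
        conj ((u : ℂ) ^ 2) • lowerOp π v)) Complex.I_mul_I

lemma IsSmoothWeight.lower (hv : IsSmoothWeight π k v) :
    IsSmoothWeight π (k - 1) (lowerOp π v) := by
  refine ⟨?_, fun u => ?_⟩
  · exact contDiff_transl_comb (smooth_translDeriv hv.smooth 1)
      (smooth_translDeriv hv.smooth Complex.I) (-2⁻¹) Complex.I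
  · have hu : (u : ℂ) ≠ 0 := Circle.coe_ne_zero u
    have hc : conj (u : ℂ) = (u : ℂ)⁻¹ := by rw [← Circle.coe_inv_eq_conj, Circle.coe_inv]
    have e : ∀ b : ℂ, π.toHom (torus 0 u) (translDeriv π b v) = _ := hv.torus_translDeriv u
    conv_lhs => rw [lowerOp, map_smul, map_add, map_smul, e, e,
      translDeriv_eq, translDeriv_eq ((u : ℂ) ^ 2 * Complex.I)]
    have e2 : (u : ℂ) ^ (2 * 1 : ℤ) = (u : ℂ) ^ 2 := zpow_ofNat _ 2
    rw [mul_sub, zpow_sub₀ hu, e2]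
    simp only [map_mul, Complex.conj_I, mul_one, map_pow, hc, div_eq_mul_inv, ← inv_pow]
    linear_combination (norm := module) congrArg (fun z : ℂ => (-2⁻¹ * (u : ℂ) ^ (2 * k) * z) •
      ((u : ℂ) ^ 2 • raiseOp π v +
        ((u : ℂ)⁻¹ ^ 2) • lowerOp π v)) Complex.I_mul_I

lemma IsSmoothWeight.translDeriv_sq (hπ : π.MotionCasimirActsBy (-1))
    (hv : IsSmoothWeight π k v) : translDeriv π 1 (translDeriv π 1 v) +
      translDeriv π Complex.I (translDeriv π Complex.I v) = -v := by
  have h0 := UnitaryRep.isDerivative_of_weight hv.weight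
  have hs := smooth_translDeriv hv.smooth
  have := hπ v _ _ _ _ _ _ h0 (h0.smul _) (isDerivative_transl hv.smooth 1)
    (isDerivative_transl (hs 1) 1) (isDerivative_transl hv.smooth Complex.I)
    (isDerivative_transl (hs Complex.I) Complex.I)
  simpa using this

/-- On smooth weight vectors the equation `4EF = -1` says that the raising and the lowering operator
are inverse to each other up to the factor `4`. -/
lemma IsSmoothWeight.raise_lower (hπ : π.MotionCasimirActsBy (-1))
    (hv : IsSmoothWeight π k v) : (4 : ℂ) • raiseOp π (lowerOp π v) = v ∧
      (4 : ℂ) • lowerOp π (raiseOp π v) = v := by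
  have hs := smooth_translDeriv hv.smooth
  have hc := hv.translDeriv_sq hπ
  have hi : ∀ b : ℂ, ContDiff ℝ ∞ fun c => π.transl c (b • translDeriv π Complex.I v) :=
    fun b => by
      simp only [map_smul]
      exact contDiff_const.smul (hs Complex.I)
  have hl : ∀ b : ℂ, ContDiff ℝ ∞ fun c => π.transl c
      (translDeriv π 1 v + b • translDeriv π Complex.I v) := fun b => by
    simp only [map_add]
    exact (hs 1).add (hi b)
  have key : ∀ a b c : ℂ, translDeriv π c (a • (translDeriv π 1 v + b • translDeriv π Complex.I v))
      = a • (translDeriv π c (translDeriv π 1 v) +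
        b • translDeriv π c (translDeriv π Complex.I v)) := fun a b c => by
    rw [translDeriv_smul (hl b), translDeriv_add (hs 1) (hi b), translDeriv_smul (hs Complex.I)]
  have hcomm := translDeriv_comm hv.smooth Complex.I 1
  constructor
  · rw [raiseOp, lowerOp, key, key, hcomm]
    linear_combination (norm := module) -hc + congrArg (fun z : ℂ =>
      z • translDeriv π Complex.I (translDeriv π Complex.I v)) Complex.I_mul_I
  · rw [lowerOp, raiseOp, sub_eq_add_neg, ← neg_smul,
      key, key, hcomm]
    linear_combination (norm := module) -hc + congrArg (fun z : ℂ =>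
      z • translDeriv π Complex.I (translDeriv π Complex.I v)) Complex.I_mul_I

lemma inner_raiseOp (hv : ContDiff ℝ ∞ fun c => π.transl c v)
    (hw : ContDiff ℝ ∞ fun c => π.transl c w) : ⟪raiseOp π v, w⟫_ℂ = ⟪v, lowerOp π w⟫_ℂ := by
  have h := fun b => (isDerivative_transl hv b).inner_left (isDerivative_transl hw b)
  rw [raiseOp, lowerOp, inner_smul_left, inner_sub_left, inner_smul_left, inner_smul_right,
    inner_add_right, inner_smul_right, h, h, Complex.conj_I]
  simp only [map_inv₀, map_ofNat]
  ring

lemma IsSmoothWeight.norm_raiseOp (hπ : π.MotionCasimirActsBy (-1))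
    (hv : IsSmoothWeight π k v) : ‖(2 : ℂ) • raiseOp π v‖ = ‖v‖ := by
  have h1 := inner_raiseOp hv.smooth hv.raise.smooth
  have h2 : (4 : ℂ) * ⟪raiseOp π v, raiseOp π v⟫_ℂ = ⟪v, v⟫_ℂ := by
    rw [h1, ← inner_smul_right, (hv.raise_lower hπ).2]
  have h3 : (4 : ℝ) * ‖raiseOp π v‖ ^ 2 = ‖v‖ ^ 2 := by
    rw [inner_self_eq_norm_sq_to_K, inner_self_eq_norm_sq_to_K] at h2
    apply Complex.ofReal_injective
    push_cast
    exact h2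
  rw [norm_smul, Complex.norm_ofNat, ← sq_eq_sq₀ (by positivity) (by positivity), ← h3]
  ring

lemma IsSmoothWeight.inner_eq_zero (hv : IsSmoothWeight π k v) (hw : IsSmoothWeight π l w)
    (h : k ≠ l) : ⟪v, w⟫_ℂ = 0 :=
  (UnitaryRep.isDerivative_of_weight hv.weight).inner_eq_zero
    (UnitaryRep.isDerivative_of_weight hw.weight) (by omega)

/-- A smooth weight vector is differentiable for the whole real Lie algebra: an element of the motion
group is a translation times a rotation, and the rotation acts by a scalar. -/
lemma IsSmoothWeight.isDerivative (hv : IsSmoothWeight π k v) (a : ℝ) (b : ℂ) :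
    π.IsDerivative (realElt 0 a b) v ((2 * Complex.I * a * k) • v + translDeriv π b v) := by
  obtain ⟨h0, h1⟩ := hasDerivAt_expReal_entries (x := 0) a b
  obtain ⟨e0, e1⟩ := expReal_entries_zero (realElt 0 a b)
  have hg : ∀ t : ℝ, π.toHom (expReal 0 (t • realElt 0 a b)) v =
      ((expReal 0 (t • realElt 0 a b)).1.1.1 0 0 ^ (2 * k)) •
        π.transl ((expReal 0 (t • realElt 0 a b)).1.1.1 0 1 *
          (expReal 0 (t • realElt 0 a b)).1.1.1 0 0) v := fun t => by
    conv_lhs => rw [motion_polar (expReal 0 (t • realElt 0 a b)), UnitaryRep.toHom_mul, hv.weight,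
      map_smul]
    rfl
  unfold UnitaryRep.IsDerivative
  simp only [hg]
  set p := fun t : ℝ => (expReal 0 (t • realElt 0 a b)).1.1.1 0 0
  set q := fun t : ℝ => (expReal 0 (t • realElt 0 a b)).1.1.1 0 1
  have hp0 : p 0 = 1 := e0
  have hq0 : q 0 = 0 := e1
  have h2 : HasFDerivAt (fun c => π.transl c v) (fderiv ℝ (fun c => π.transl c v) 0)
      (q 0 * p 0) := by
    rw [hq0, zero_mul]
    exact ((hv.smooth.differentiable (by simp)) 0).hasFDerivAt
  have h3 := h2.comp_hasDerivAt (0 : ℝ) (h1.mul h0)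
  have h4 : HasDerivAt (fun t => p t ^ (2 * k)) (((2 * k : ℤ) : ℂ) * p 0 ^ (2 * k - 1) *
      (Complex.I * a)) 0 :=
    (hasDerivAt_zpow (2 * k) (p 0) (Or.inl (by rw [hp0]; exact one_ne_zero))).comp (0 : ℝ) h0
  refine (h4.smul h3).congr_deriv ?_
  change p 0 ^ (2 * k) • fderiv ℝ (fun c => π.transl c v) 0 (b * p 0 + q 0 * (Complex.I * a)) +
    _ • π.transl (q 0 * p 0) v = _
  rw [hp0, hq0, one_zpow, one_zpow, mul_one, zero_mul, add_zero, one_smul, zero_mul, transl_zero]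
  rw [add_comm]
  congr 2
  push_cast
  ring

/-- The sequence obtained from `v` by the normalized raising and lowering operators. -/
def ladderSeq (π : UnitaryRep (realGroup 0) H) (v : H) : ℤ → H
  | .ofNat n => (fun w => (2 : ℂ) • raiseOp π w)^[n] v
  | .negSucc n => (fun w => (2 : ℂ) • lowerOp π w)^[n + 1] v

lemma IsSmoothWeight.smul (hv : IsSmoothWeight π k v) (a : ℂ) : IsSmoothWeight π k (a • v) := by
  refine ⟨?_, fun u => ?_⟩
  · simp only [map_smul]
    exact contDiff_const.smul hv.smooth
  · rw [map_smul, hv.weight, smul_comm]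

lemma raiseOp_smul (hv : IsSmoothWeight π k v) (a : ℂ) :
    raiseOp π (a • v) = a • raiseOp π v := by
  simp only [raiseOp, translDeriv_smul hv.smooth]
  module

lemma lowerOp_smul (hv : IsSmoothWeight π k v) (a : ℂ) :
    lowerOp π (a • v) = a • lowerOp π v := by
  simp only [lowerOp, translDeriv_smul hv.smooth]
  module

lemma ladderSeq_spec (hπ : π.MotionCasimirActsBy (-1)) (hv : IsSmoothWeight π 0 v) (j : ℤ) :
    IsSmoothWeight π j (ladderSeq π v j) ∧
      ladderSeq π v (j + 1) = (2 : ℂ) • raiseOp π (ladderSeq π v j) := by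
  have hpos : ∀ n : ℕ, IsSmoothWeight π n ((fun w => (2 : ℂ) • raiseOp π w)^[n] v) := fun n => by
    induction n with
    | zero => exact hv
    | succ n ih => rw [Function.iterate_succ_apply']; exact_mod_cast ih.raise.smul 2
  have hneg : ∀ n : ℕ, IsSmoothWeight π (-n) ((fun w => (2 : ℂ) • lowerOp π w)^[n] v) := fun n => by
    induction n with
    | zero => simpa using hv
    | succ n ih =>
      rw [Function.iterate_succ_apply', Nat.cast_succ, neg_add]
      exact ih.lower.smul 2
  cases j with
  | ofNat n => exact ⟨hpos n, Function.iterate_succ_apply' _ _ _⟩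
  | negSucc n =>
    refine ⟨hneg (n + 1), ?_⟩
    have h1 : ladderSeq π v (Int.negSucc n + 1) = (fun w => (2 : ℂ) • lowerOp π w)^[n] v := by
      cases n with
      | zero => rfl
      | succ n => rfl
    rw [h1]
    change _ = (2 : ℂ) • raiseOp π ((fun w => (2 : ℂ) • lowerOp π w)^[n + 1] v)
    rw [Function.iterate_succ_apply', raiseOp_smul (hneg n).lower, smul_smul]
    norm_num
    exact ((hneg n).raise_lower hπ).1.symm

/-- The vectors obtained from a smooth `U(1)`-fixed unit vector by the raising and lowering operators,
scaled to length one, form a ladder. -/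
theorem ladderSeq_hasLadder (hπ : π.MotionCasimirActsBy (-1)) (hv : IsSmoothWeight π 0 v)
    (hn : ‖v‖ = 1) : HasLadder π (ladderSeq π v) := by
  have hs := ladderSeq_spec hπ hv
  have hnorm : ∀ j, ‖ladderSeq π v j‖ = 1 := fun j => by
    have hstep : ∀ j, ‖ladderSeq π v (j + 1)‖ = ‖ladderSeq π v j‖ := fun j => by
      rw [(hs j).2, (hs j).1.norm_raiseOp hπ]
    induction j using Int.induction_on with
    | zero => exact hn
    | succ n ih => rw [hstep, ih]
    | pred n ih => rw [← ih, ← hstep, sub_add_cancel]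
  refine ⟨fun i j => ?_, fun a b j => ?_⟩
  · simp only [(dv_pos le_rfl j).ne', ne_eq, not_false_eq_true, and_true]
    split_ifs with h
    · rw [h, inner_self_eq_norm_sq_to_K, hnorm]; simp
    · exact (hs i).1.inner_eq_zero (hs j).1 h
  · refine HasDerivAt.congr_deriv ((hs j).1.isDerivative a b) ?_
    have h1 : (2 : ℂ) • lowerOp π (ladderSeq π v j) = ladderSeq π v (j - 1) := by
      have := ((hs (j - 1)).1.raise_lower hπ).2
      have e := (hs (j - 1)).2
      rw [sub_add_cancel] at e
      rw [e, lowerOp_smul (hs (j - 1)).1.raise, smul_smul]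
      norm_num
      exact this
    rw [translDeriv_eq, sCoef_zero, sCoef_zero, ← h1, (hs j).2]
    push_cast
    module

end Motion

section Smoothing

open MeasureTheory
open scoped ContDiff Convolution

variable {H : Type*} [NormedAddCommGroup H] [InnerProductSpace ℂ H] [CompleteSpace H]
  (π : UnitaryRep (realGroup 0) H)

/-- Averaging a `U(1)`-fixed vector against a smooth radial function of small support gives a
nonzero smooth `U(1)`-fixed vector. -/
theorem exists_isSmoothWeight (h : π.HasWeight (torus 0) 0) :
    ∃ v, ‖v‖ = 1 ∧ IsSmoothWeight π 0 v := by
  obtain ⟨v₀, hv₀, hw⟩ := h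
  have hc := continuous_transl π v₀
  have hpos : ∀ᶠ t in 𝓝 (0 : ℂ), 0 < (⟪v₀, π.transl (-t) v₀⟫_ℂ).re := by
    have h1 : Continuous fun t : ℂ => (⟪v₀, π.transl (-t) v₀⟫_ℂ).re :=
      Complex.continuous_re.comp (continuous_const.inner (hc.comp continuous_neg))
    refine h1.continuousAt.eventually (lt_mem_nhds ?_)
    simp only [neg_zero, transl_zero]
    exact (inner_self_nonneg (𝕜 := ℂ)).lt_of_ne' fun h0 => hv₀
      (norm_eq_zero.1 (sq_eq_zero_iff.1 ((inner_self_eq_norm_sq (𝕜 := ℂ) v₀).symm.trans h0)))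
  -- average `v₀` over translations against a smooth radial function supported near `0`
  obtain ⟨δ, hδ, hball⟩ := Metric.eventually_nhds_iff.1 hpos
  set f : ℂ → ℝ := fun t => Real.smoothTransition (1 - (2 / δ) ^ 2 * ‖t‖ ^ 2) with hf
  have hf0 : ∀ t, 0 ≤ f t := fun t => Real.smoothTransition.nonneg _
  have hfs : ∀ t, δ / 2 ≤ ‖t‖ → f t = 0 := fun t ht => by
    refine Real.smoothTransition.zero_of_nonpos ?_
    have : (2 / δ * (δ / 2)) ^ 2 ≤ (2 / δ * ‖t‖) ^ 2 := by gcongr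
    rw [div_mul_div_cancel₀ hδ.ne', mul_pow] at this
    norm_num at this
    linarith
  have hfc : HasCompactSupport f := by
    refine HasCompactSupport.intro (isCompact_closedBall (0 : ℂ) (δ / 2)) fun t ht => hfs t ?_
    rw [mem_closedBall_zero_iff, not_le] at ht
    exact ht.le
  have hfd : ContDiff ℝ ∞ f :=
    Real.smoothTransition.contDiff.comp (contDiff_const.sub (contDiff_const.mul
      (contDiff_norm_sq ℝ)))
  have hint : Integrable fun t => f t • π.transl (-t) v₀ :=
    (hfd.continuous.smul (hc.comp continuous_neg)).integrable_of_hasCompactSupport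
      hfc.smul_right
  set v := ∫ t, f t • π.transl (-t) v₀ with hv
  have htr : ∀ c, π.transl c v = ∫ t, f t • π.transl (c - t) v₀ := fun c => by
    have := ((π.transl c).toContinuousLinearEquiv.toContinuousLinearMap).integral_comp_comm hint
    rw [hv]
    refine Eq.trans this.symm (integral_congr_ae (.of_forall fun t => ?_))
    change π.transl c (f t • π.transl (-t) v₀) = _
    rw [← Complex.coe_smul, map_smul, Complex.coe_smul, ← transl_add, ← sub_eq_add_neg]
  -- the orbit of `v` is the convolution of a smooth function with the orbit of `v₀`
  have hsm : ContDiff ℝ ∞ fun c => π.transl c v := by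
    have := hfc.contDiff_convolution_left (ContinuousLinearMap.lsmul ℝ ℝ) hfd
      (hc.locallyIntegrable (μ := volume))
    convert this using 1
    exact funext htr
  -- `v` is fixed by the rotations since `f` is radial and `v₀` is fixed
  have hrot : ∀ u : Circle, π.toHom (torus 0 u) v = v := fun u => by
    have h1 := ((π.toHom (torus 0 u)).toContinuousLinearEquiv.toContinuousLinearMap).integral_comp_comm
      hint
    have h2 : π.toHom (torus 0 u) v = ∫ t, f (rotation (u ^ 2) t) •
        π.transl (-(rotation (u ^ 2) t)) v₀ := by
      rw [hv]
      refine Eq.trans h1.symm (integral_congr_ae (.of_forall fun t => ?_))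
      change π.toHom (torus 0 u) (f t • π.transl (-t) v₀) = _
      have h3 : π.toHom (torus 0 u) v₀ = v₀ := by simpa using hw u
      have h4 : f (rotation (u ^ 2) t) = f t := by simp only [hf, LinearIsometryEquiv.norm_map]
      rw [← Complex.coe_smul, map_smul, Complex.coe_smul, torus_transl, h3]
      beta_reduce
      rw [h4]
      simp only [rotation_apply, mul_neg, Circle.coe_pow]
    rw [h2]
    exact (rotation (u ^ 2)).measurePreserving.integral_comp
      (rotation (u ^ 2)).toHomeomorph.measurableEmbedding (fun t => f t • π.transl (-t) v₀)
  -- `⟪v₀, v⟫` has positive real part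
  have hne : v ≠ 0 := fun h0 => by
    have h1 := ((Complex.reCLM.comp ((innerSL ℂ v₀).restrictScalars ℝ))).integral_comp_comm hint
    have h2 : ∀ t, (Complex.reCLM.comp ((innerSL ℂ v₀).restrictScalars ℝ))
        (f t • π.transl (-t) v₀) = f t * (⟪v₀, π.transl (-t) v₀⟫_ℂ).re := fun t => by
      rw [map_smul]; rfl
    rw [← hv, h0, map_zero] at h1
    simp only [h2] at h1
    refine (Continuous.integral_pos_of_hasCompactSupport_nonneg_nonzero (x := (0 : ℂ))
      (μ := volume) ?_ hfc.mul_right ?_ ?_).ne' h1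
    · exact hfd.continuous.mul (Complex.continuous_re.comp
        (continuous_const.inner (hc.comp continuous_neg)))
    · intro t
      by_cases ht : δ / 2 ≤ ‖t‖
      · simp [hfs t ht]
      · exact mul_nonneg (hf0 t) (hball (by rw [dist_zero_right]; linarith)).le
    · have : f 0 = 1 := by simp [hf, Real.smoothTransition.one]
      change f 0 * _ ≠ 0
      rw [this, one_mul]
      exact (hball (by simpa using hδ)).ne'
  have key : IsSmoothWeight π 0 v := ⟨hsm, fun u => by simpa using hrot u⟩
  exact ⟨_, norm_smul_inv_norm (𝕜 := ℂ) hne, key.smul _⟩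

/-- The irreducible spherical representation of the motion group on which `4EF` acts as `-1`. -/
theorem exists_hasLadder_motion (hirr : π.IsIrreducible) (h : π.HasWeight (torus 0) 0)
    (hπ : π.MotionCasimirActsBy (-1)) : ∃ u, HasLadder π u ∧ DenseSpan u := by
  obtain ⟨v, hn, hv⟩ := exists_isSmoothWeight π h
  have hu := ladderSeq_hasLadder hπ hv hn
  exact ⟨_, hu, hu.denseSpan_of_isIrreducible hirr⟩

end Smoothing

end ContractionFamilies
end

noncomputable section

namespace ContractionFamilies

/-! ### Highest weight vectors -/

section HighestWeight

variable {x : ℝ} {H V : Type*} [NormedAddCommGroup H] [InnerProductSpace ℂ H] [AddCommGroup V]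
  [Module ℂ V]

/-- The map `Φ` from `V` to the representation space intertwines operators `h, e, f` on `V`, with
`[h, f] = -2f` and `[e, f] = h`, with the derivative of `π`. For `x < 0` the sections `H, E, F` act
through `h`, `√(-x) e` and `-√(-x) f`, so the last relation is `[E, F] = x H`. -/
structure IsSl2Map (π : UnitaryRep (realGroup x) H) (Φ : V →ₗ[ℂ] H) (h e f : V →ₗ[ℂ] V) :
    Prop where
  deriv : ∀ (a : ℝ) (b : ℂ) (v : V), π.IsDerivative (realElt x a b) (Φ v)
    (Φ ((Complex.I * a) • h v + (√(-x) * b) • e v - (√(-x) * conj b) • f v))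
  h_f : ∀ v, h (f v) = f (h v) - (2 : ℂ) • f v
  e_f : ∀ v, e (f v) = f (e v) + h v

namespace IsSl2Map

variable {π : UnitaryRep (realGroup x) H} {Φ : V →ₗ[ℂ] H} {h e f : V →ₗ[ℂ] V}
  (hΦ : IsSl2Map π Φ h e f) (hx : x < 0)

include hΦ hx

/-- By unitarity `e` and `f` are adjoint to each other: the derivatives in the directions `1` and `i`
are both skew. -/
lemma inner_e (v w : V) : ⟪Φ v, Φ (e w)⟫_ℂ = ⟪Φ (f v), Φ w⟫_ℂ := by
  have hy : ((√(-x) : ℝ) : ℂ) ≠ 0 := by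
    exact_mod_cast (Real.sqrt_pos.2 (neg_pos.2 hx)).ne'
  have h1 := (hΦ.deriv 0 1 v).inner_left (hΦ.deriv 0 1 w)
  have h2 := (hΦ.deriv 0 Complex.I v).inner_left (hΦ.deriv 0 Complex.I w)
  simp only [Complex.ofReal_zero, mul_zero, zero_smul, zero_add, map_sub, map_smul, inner_sub_left,
    inner_sub_right, inner_smul_left, inner_smul_right, map_mul, Complex.conj_I, map_one, mul_one,
    Complex.conj_ofReal, map_neg] at h1 h2
  have h3 : (2 * ((√(-x) : ℝ) : ℂ)) * (⟪Φ v, Φ (e w)⟫_ℂ - ⟪Φ (f v), Φ w⟫_ℂ) = 0 := by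
    linear_combination h1 - Complex.I * h2 +
      √(-x) * (⟪Φ v, Φ (e w)⟫_ℂ + ⟪Φ v, Φ (f w)⟫_ℂ - ⟪Φ (f v), Φ w⟫_ℂ -
        ⟪Φ (e v), Φ w⟫_ℂ) * Complex.I_mul_I
  exact sub_eq_zero.1 ((mul_eq_zero.1 h3).resolve_left (mul_ne_zero two_ne_zero hy))

lemma f_eq_zero {v : V} (hv : Φ v = 0) : Φ (f v) = 0 := by
  rw [← inner_self_eq_zero (𝕜 := ℂ), ← hΦ.inner_e hx, hv, inner_zero_left]

lemma f_congr {v w : V} (hv : Φ v = Φ w) : Φ (f v) = Φ (f w) := by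
  rw [← sub_eq_zero, ← map_sub, ← map_sub]
  exact hΦ.f_eq_zero hx (by rw [map_sub, hv, sub_self])

variable {p : V} {N : ℤ} (hp : Φ (h p) = (N : ℂ) • Φ p) (he : Φ (e p) = 0)

include hp

lemma h_iterate (n : ℕ) : Φ (h (f^[n] p)) = ((N : ℂ) - 2 * n) • Φ (f^[n] p) := by
  induction n with
  | zero => simpa using hp
  | succ n ih =>
    rw [Function.iterate_succ_apply', hΦ.h_f, map_sub, map_smul]
    rw [hΦ.f_congr hx (w := ((N : ℂ) - 2 * n) • f^[n] p) (by rw [ih, map_smul]), map_smul,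
      map_smul]
    push_cast
    module

include he

lemma e_iterate_succ (n : ℕ) :
    Φ (e (f^[n + 1] p)) = ((n + 1 : ℂ) * (N - n)) • Φ (f^[n] p) := by
  have key : Φ (f (e (f^[n] p))) = ((n : ℂ) * (N - n + 1)) • Φ (f^[n] p) := by
    induction n with
    | zero => simpa using hΦ.f_eq_zero hx he
    | succ n ih =>
      have h1 : Φ (e (f (f^[n] p))) = Φ (((n + 1 : ℂ) * (N - n)) • f^[n] p) := by
        rw [hΦ.e_f, map_add, ih, hΦ.h_iterate hx hp, map_smul]
        module
      rw [Function.iterate_succ_apply', hΦ.f_congr hx h1, map_smul, map_smul]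
      push_cast
      module
  rw [Function.iterate_succ_apply', hΦ.e_f, map_add, key, hΦ.h_iterate hx hp]
  module

/-- The squared lengths of the vectors `f ^ n p` for a highest weight vector `p` of weight `N`. -/
lemma norm_iterate_succ (n : ℕ) :
    ‖Φ (f^[n + 1] p)‖ ^ 2 = ((n + 1 : ℝ) * (N - n)) * ‖Φ (f^[n] p)‖ ^ 2 := by
  have h1 := hΦ.inner_e hx (f^[n] p) (f^[n + 1] p)
  rw [hΦ.e_iterate_succ hx hp he, inner_smul_right, ← Function.iterate_succ_apply' f,
    inner_self_eq_norm_sq_to_K, inner_self_eq_norm_sq_to_K] at h1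
  apply Complex.ofReal_injective
  push_cast
  exact h1.symm

lemma weight_nonneg (h0 : Φ p ≠ 0) : 0 ≤ N := by
  have h1 := hΦ.norm_iterate_succ hx hp he 0
  have h2 : 0 < ‖Φ p‖ ^ 2 := by positivity
  have h3 : (0 : ℝ) ≤ N * ‖Φ p‖ ^ 2 := by
    have : (0 : ℝ) ≤ ‖Φ (f^[0 + 1] p)‖ ^ 2 := by positivity
    rw [h1] at this
    simpa using this
  exact_mod_cast nonneg_of_mul_nonneg_left h3 h2

end IsSl2Map

/-- A highest weight vector of weight `2m` generates a ladder over the point `-(2m+1)⁻²`. -/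
theorem IsSl2Map.exists_hasLadder {m : ℕ} {π : UnitaryRep (realGroup (discretePoint m)) H}
    {Φ : V →ₗ[ℂ] H} {h e f : V →ₗ[ℂ] V} (hΦ : IsSl2Map π Φ h e f) {p : V}
    (hp : Φ (h p) = (2 * m : ℂ) • Φ p) (he : Φ (e p) = 0) (h0 : Φ p ≠ 0) :
    ∃ u, HasLadder π u := by
  have hx := discretePoint_neg m
  set y := √(-discretePoint m) with hy
  have hm : (0 : ℝ) < 2 * m + 1 := by positivity
  have hy2 : y ^ 2 = ((2 * (m : ℝ) + 1) ^ 2)⁻¹ := by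
    rw [hy, Real.sq_sqrt (neg_pos.2 hx).le, discretePoint, neg_neg]
  have hp' : Φ (h p) = ((2 * m : ℤ) : ℂ) • Φ p := by rw [hp]; push_cast; rfl
  have hN := hΦ.norm_iterate_succ hx hp' he
  push_cast at hN
  -- positivity of the length of `f^[n + 1] p` ends the string after `2m + 1` vectors
  have hzero : ∀ n : ℕ, 2 * m < n → Φ (f^[n] p) = 0 := fun n hn => by
    have h1 : (0 : ℝ) ≤ ‖Φ (f^[n + 1] p)‖ ^ 2 := by positivity
    rw [hN] at h1
    have h2 : (2 * m : ℝ) - n < 0 := sub_neg.2 (by exact_mod_cast hn)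
    have h3 : ((n : ℝ) + 1) * (2 * m - n) < 0 := mul_neg_of_pos_of_neg (by positivity) h2
    by_contra hne
    have : 0 < ‖Φ (f^[n] p)‖ ^ 2 := by positivity
    linarith [mul_neg_of_neg_of_pos h3 this]
  have hne : ∀ n : ℕ, n ≤ 2 * m → Φ (f^[n] p) ≠ 0 := fun n => by
    induction n with
    | zero => exact fun _ => h0
    | succ n ih =>
      intro hn hcon
      have h1 := hN n
      rw [hcon, norm_zero, zero_pow two_ne_zero] at h1
      have h2 : (0 : ℝ) < 2 * m - n := sub_pos.2 (by exact_mod_cast hn)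
      have h3 := norm_pos_iff.2 (ih (by omega))
      have : (0 : ℝ) < (n + 1) * (2 * m - n) * ‖Φ (f^[n] p)‖ ^ 2 := by positivity
      exact this.ne h1
  -- the normalization of the coefficients of the ladder
  have hs : ∀ n : ℕ, y * ‖Φ (f^[n + 1] p)‖ =
      sCoef (discretePoint m) (m - n - 1) * ‖Φ (f^[n] p)‖ := fun n => by
    rcases le_or_gt n (2 * m) with hn | hn
    · have hn' : (0 : ℝ) ≤ 2 * m - n := sub_nonneg.2 (by exact_mod_cast hn)
      have e : 1 + (2 * ((m : ℝ) - n - 1) + 1) ^ 2 * discretePoint m =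
          4 * ((n + 1) * (2 * m - n)) / (2 * (m : ℝ) + 1) ^ 2 := by
        rw [discretePoint_factor]
        ring
      rw [← sq_eq_sq₀ (by positivity) (mul_nonneg (sCoef_nonneg _ _) (norm_nonneg _)), mul_pow,
        mul_pow, hN, hy2, sCoef, div_pow]
      push_cast
      rw [Real.sq_sqrt (by rw [e]; positivity), e]
      field_simp
      ring
    · rw [hzero n hn, hzero (n + 1) (by omega)]
      simp
  -- the normalized vectors; beyond the end of the string `c n` is `0⁻¹ = 0`, next to a zero vector
  set c : ℕ → ℂ := fun n => ((‖Φ (f^[n] p)‖⁻¹ : ℝ) : ℂ) with hc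
  set u : ℤ → H := fun j =>
    if j ≤ m then c (m - j).toNat • Φ (f^[(m - j).toNat] p) else 0 with hu
  have hun : ∀ n : ℕ, u (m - n) = c n • Φ (f^[n] p) := fun n => by
    have : ((m : ℤ) - (m - n)).toNat = n := by omega
    simp only [hu]
    rw [if_pos (by omega), this]
  have hlow : ∀ n : ℕ, (y * c n) • Φ (f^[n + 1] p) =
      (sCoef (discretePoint m) (m - n - 1) : ℂ) • u (m - n - 1) := fun n => by
    have e1 : (m : ℤ) - n - 1 = m - (n + 1 : ℕ) := by push_cast; ring
    have h1 := hs n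
    rw [e1] at h1 ⊢
    rw [hun, smul_smul]
    by_cases hz : Φ (f^[n + 1] p) = 0
    · rw [hz, smul_zero, smul_zero]
    have hz' : Φ (f^[n] p) ≠ 0 := fun hcon => hz (by
      rw [Function.iterate_succ_apply']; exact hΦ.f_eq_zero hx hcon)
    congr 1
    have h2 := norm_ne_zero_iff.2 hz
    have h3 := norm_ne_zero_iff.2 hz'
    simp only [hc, ← Complex.ofReal_mul]
    congr 1
    field_simp
    linarith
  have hup : ∀ n : ℕ, (y * c (n + 1)) • Φ (e (f^[n + 1] p)) =
      (sCoef (discretePoint m) (m - n - 1) : ℂ) • u (m - n) := fun n => by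
    rw [hΦ.e_iterate_succ hx hp' he, hun, smul_smul, smul_smul]
    by_cases hz' : Φ (f^[n] p) = 0
    · rw [hz', smul_zero, smul_zero]
    congr 1
    have h1 := hs n
    have h2 := hN n
    have h3 := norm_ne_zero_iff.2 hz'
    have e2 : ((((2 * m : ℤ) : ℂ)) - n) = ((2 * m - n : ℝ) : ℂ) := by push_cast; ring
    have e3 : ((n : ℂ) + 1) = ((n + 1 : ℝ) : ℂ) := by push_cast; ring
    rw [e2, e3]
    simp only [hc, ← Complex.ofReal_mul]
    congr 1
    by_cases hz : Φ (f^[n + 1] p) = 0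
    · rw [hz, norm_zero, mul_zero] at h1
      rw [hz, (mul_eq_zero.1 h1.symm).resolve_right h3]
      simp
    have h4 := norm_ne_zero_iff.2 hz
    field_simp
    refine mul_left_cancel₀ h3 ?_
    linear_combination (-y) * h2 + ‖Φ (f^[n + 1] p)‖ * h1
  have hpos : ∀ j : ℤ, m < j → u j = 0 := fun j hj => if_neg (by omega)
  have hderiv : ∀ (a : ℝ) (b : ℂ) (j : ℤ), π.IsDerivative (realElt _ a b) (u j)
      ((2 * Complex.I * a * j) • u j + ((b * sCoef (discretePoint m) j) • u (j + 1) -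
        (conj b * sCoef (discretePoint m) (j - 1)) • u (j - 1))) := by
    intro a b j
    rcases lt_or_ge (m : ℤ) j with hj | hj
    · have hsm : (sCoef (discretePoint m) (j - 1) : ℂ) • u (j - 1) = 0 := by
        rcases lt_or_eq_of_le (show (m : ℤ) ≤ j - 1 by omega) with hj' | hj'
        · rw [hpos _ hj', smul_zero]
        · have := discretePoint_factor m m
          rw [← hj', sCoef]
          push_cast
          rw [this]
          simp
      rw [hpos j hj, hpos (j + 1) (by omega), mul_smul _ _ (u (j - 1)), hsm]
      simpa using UnitaryRep.isDerivative_zero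
    · obtain ⟨n, hn⟩ := Int.eq_ofNat_of_zero_le (show 0 ≤ (m : ℤ) - j by omega)
      obtain rfl : j = m - n := by omega
      have h1 := (hΦ.deriv a b (f^[n] p)).smul (c n)
      rw [← hun] at h1
      refine HasDerivAt.congr_deriv h1 ?_
      have h2 := hlow n
      have h3 : (y * c n) • Φ (e (f^[n] p)) =
          (sCoef (discretePoint m) (m - n) : ℂ) • u (m - n + 1) := by
        cases n with
        | zero =>
          rw [hpos _ (by simp)]
          simp [he]
        | succ n =>
          have e1 : (m : ℤ) - (n + 1 : ℕ) = m - n - 1 := by push_cast; ring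
          rw [hup, e1, sub_add_cancel]
      simp only [map_add, map_sub, map_smul, hΦ.h_iterate hx hp']
      rw [← Function.iterate_succ_apply' f]
      rw [hun]
      push_cast
      linear_combination (norm := module) b • h3 - conj b • h2
  refine ⟨u, fun i j => ?_, hderiv⟩
  by_cases hij : i = j
  · subst hij
    simp only [true_and]
    rcases lt_or_ge (m : ℤ) i with hj | hj
    · rw [hpos i hj, inner_zero_left, dv_discretePoint_eq_zero (by omega)]
      simp
    · obtain ⟨n, hn⟩ := Int.eq_ofNat_of_zero_le (show 0 ≤ (m : ℤ) - i by omega)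
      obtain rfl : i = m - n := by omega
      rw [hun]
      rcases le_or_gt n (2 * m) with h | h
      · rw [if_pos (dv_discretePoint_pos (by omega)).ne', inner_smul_left, inner_smul_right,
          inner_self_eq_norm_sq_to_K]
        have := norm_ne_zero_iff.2 (hne n h)
        simp only [hc, Complex.conj_ofReal]
        have h3 : ((‖Φ (f^[n] p)‖ : ℝ) : ℂ) ≠ 0 := by exact_mod_cast this
        change _ * (_ * ((‖Φ (f^[n] p)‖ : ℝ) : ℂ) ^ 2) = 1
        push_cast
        field_simp
      · rw [hzero n h, smul_zero, inner_zero_left, dv_discretePoint_eq_zero (by omega)]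
        simp
  · rw [if_neg (fun hcon => hij hcon.1)]
    have hw : ∀ j, π.IsDerivative (realElt _ 1 0) (u j) ((Complex.I * (2 * j : ℤ)) • u j) :=
      fun j => HasDerivAt.congr_deriv (hderiv 1 0 j) (by
        simp only [map_zero, zero_mul, zero_smul, sub_self, add_zero]
        push_cast
        congr 1
        ring)
    exact (hw i).inner_eq_zero (hw j) (by omega)

end HighestWeight

end ContractionFamilies
end

noncomputable section

namespace ContractionFamilies

/-! ### Polynomial functions on `SU(2)` -/

section SU2

open MeasureTheory

lemma SU2_inv_coe (g : SU2) : ((g⁻¹ : SU2) : M2 ℂ) = star (g : M2 ℂ) := rfl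

instance : IsTopologicalGroup SU2 where
  continuous_inv := Continuous.subtype_mk (continuous_subtype_val.star) _

lemma SU2_det (g : SU2) : Complex.normSq (g.1 0 0) + Complex.normSq (g.1 0 1) = 1 := by
  obtain ⟨h1, h2, h3⟩ := (mem_SU2_iff g.1).1 g.2
  rw [Matrix.det_fin_two, h1, h2, mul_neg, sub_neg_eq_add, Complex.mul_conj, Complex.mul_conj] at h3
  exact_mod_cast h3

instance : CompactSpace SU2 := by
  have hK : IsCompact {M : M2 ℂ | ∀ i ∈ (Set.univ : Set (Fin 2)), M i ∈
      {r : Fin 2 → ℂ | ∀ j ∈ (Set.univ : Set (Fin 2)), r j ∈ Metric.closedBall (0 : ℂ) 1}} :=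
    isCompact_univ_pi fun _ => isCompact_univ_pi fun _ => isCompact_closedBall _ _
  refine isCompact_iff_compactSpace.1
    (hK.of_isClosed_subset (t := (SU2 : Set (M2 ℂ))) ?_ ?_)
  · have : (SU2 : Set (M2 ℂ)) = {M | M 1 0 = -conj (M 0 1)} ∩ ({M | M 1 1 = conj (M 0 0)} ∩
        {M | M.det = 1}) := by
      ext M
      exact mem_SU2_iff M
    rw [this]
    have hc : ∀ i j, Continuous fun M : M2 ℂ => M i j := fun i j => continuous_id.matrix_elem i j
    exact (isClosed_eq (hc _ _) (Complex.continuous_conj.comp (hc _ _)).neg).inter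
      ((isClosed_eq (hc _ _) (Complex.continuous_conj.comp (hc _ _))).inter
        (isClosed_eq continuous_id.matrix_det continuous_const))
  · intro M hM i _ j _
    rw [mem_closedBall_zero_iff]
    obtain ⟨h1, h2, h3⟩ := (mem_SU2_iff M).1 hM
    have hd := SU2_det ⟨M, hM⟩
    simp only [Complex.normSq_eq_norm_sq] at hd
    have e0 : ‖M 0 0‖ ≤ 1 := by nlinarith [norm_nonneg (M 0 0), sq_nonneg ‖M 0 1‖]
    have e1 : ‖M 0 1‖ ≤ 1 := by nlinarith [norm_nonneg (M 0 1), sq_nonneg ‖M 0 0‖]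
    fin_cases i <;> fin_cases j <;> simp [h1, h2, e0, e1]

instance : MeasurableSpace SU2 := borel SU2
instance : BorelSpace SU2 := ⟨rfl⟩

/-- The action of `SU(2)` on functions on itself by left translation. -/
def leftMultiplier : Multiplier SU2 SU2 (Measure.haar : Measure SU2) where
  m _ _ := 1
  T g ξ := g⁻¹ * ξ
  continuous_m := continuous_const
  continuous_T := continuous_fst.inv.mul continuous_snd
  m_one _ := rfl
  T_one ξ := by rw [inv_one, one_mul]
  m_mul _ _ _ := (mul_one _).symm
  T_mul g h ξ := by rw [mul_inv_rev, mul_assoc]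
  lintegral_comp g f _ := by
    simp only [enorm_one, one_pow, one_mul]
    exact lintegral_mul_left_eq_self f g⁻¹

/-- Polynomials in the entries of a two by two matrix. -/
abbrev MatPoly := MvPolynomial (Fin 2 × Fin 2) ℂ

/-- The polynomial function on `SU(2)` given by a polynomial in the entries. -/
def polyFun : MatPoly →ₐ[ℂ] C(SU2, ℂ) :=
  MvPolynomial.aeval fun ij => ⟨fun g => g.1 ij.1 ij.2,
    (continuous_id.matrix_elem ij.1 ij.2).comp continuous_subtype_val⟩

lemma polyFun_X (ij : Fin 2 × Fin 2) (g : SU2) : polyFun (MvPolynomial.X ij) g = g.1 ij.1 ij.2 := by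
  simp [polyFun]

open MvPolynomial in
/-- The derivation by which `H` acts on polynomials. -/
def polyH : Derivation ℂ MatPoly MatPoly :=
  mkDerivation ℂ fun ij => if ij.1 = 0 then -X ij else X ij

open MvPolynomial in
/-- The derivation by which `E` acts on polynomials. -/
def polyE : Derivation ℂ MatPoly MatPoly :=
  mkDerivation ℂ fun ij => if ij.1 = 0 then -X (1, ij.2) else 0

open MvPolynomial in
/-- The derivation by which `-F` acts on polynomials. -/
def polyF : Derivation ℂ MatPoly MatPoly :=
  mkDerivation ℂ fun ij => if ij.1 = 0 then 0 else -X (0, ij.2)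

lemma polyH_polyE (p : MatPoly) : polyH (polyE p) = polyE (polyH p) + (2 : ℂ) • polyE p := by
  have h : ⁅polyH, polyE⁆ = (2 : ℂ) • polyE := by
    refine MvPolynomial.derivation_ext fun ⟨i, j⟩ => ?_
    fin_cases i <;> simp [Derivation.commutator_apply, polyH, polyE, two_smul, sub_eq_add_neg]
  have := DFunLike.congr_fun h p
  rw [Derivation.commutator_apply, sub_eq_iff_eq_add'] at this
  exact this

lemma polyH_polyF (p : MatPoly) : polyH (polyF p) = polyF (polyH p) - (2 : ℂ) • polyF p := by
  have h : ⁅polyH, polyF⁆ = -((2 : ℂ) • polyF) := by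
    refine MvPolynomial.derivation_ext fun ⟨i, j⟩ => ?_
    fin_cases i <;> simp [Derivation.commutator_apply, polyH, polyF, two_smul]
  have := DFunLike.congr_fun h p
  rw [Derivation.commutator_apply, sub_eq_iff_eq_add'] at this
  exact this.trans (sub_eq_add_neg _ _).symm

lemma polyE_polyF (p : MatPoly) : polyE (polyF p) = polyF (polyE p) + polyH p := by
  have h : ⁅polyE, polyF⁆ = polyH := by
    refine MvPolynomial.derivation_ext fun ⟨i, j⟩ => ?_
    fin_cases i <;> simp [Derivation.commutator_apply, polyH, polyE, polyF]
  have := DFunLike.congr_fun h p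
  rw [Derivation.commutator_apply, sub_eq_iff_eq_add'] at this
  exact this

/-- The monomials are weight vectors, and they are annihilated by a power of `E`. -/
lemma monomial_weight {q : MatPoly} (hq : q ∈ Submonoid.closure (Set.range MvPolynomial.X)) :
    (∃ k : ℤ, polyH q = (k : ℂ) • q) ∧ ∃ n : ℕ, polyE^[n] q = 0 := by
  induction hq using Submonoid.closure_induction_right with
  | one => exact ⟨⟨0, by simp⟩, 1, by simp⟩
  | mul_right q hq y hy ih =>
    obtain ⟨⟨k, hk⟩, n, hn⟩ := ih
    obtain ⟨⟨i, j⟩, rfl⟩ := hy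
    fin_cases i
    · refine ⟨⟨k - 1, ?_⟩, n + 1, ?_⟩
      · rw [Derivation.leibniz, hk]
        simp [polyH, add_smul, mul_comm, sub_eq_add_neg, add_comm]
      · have key : ∀ n : ℕ, polyE^[n + 1] (q * MvPolynomial.X (0, j)) =
            polyE^[n + 1] q * MvPolynomial.X (0, j) -
              (n + 1 : ℂ) • (polyE^[n] q * MvPolynomial.X (1, j)) := fun n => by
          induction n with
          | zero => simp [polyE]; ring
          | succ n ih =>
            rw [Function.iterate_succ_apply', ih, Function.iterate_succ_apply' _ (n + 1),
              Function.iterate_succ_apply' _ n, map_sub, Derivation.map_smul, Derivation.leibniz,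
              Derivation.leibniz]
            simp [polyE]
            simp only [MvPolynomial.smul_eq_C_mul]
            simp
            ring
        have h0 : polyE^[n + 1] q = 0 := by
          rw [Function.iterate_succ_apply', hn, map_zero]
        change polyE^[n + 1] (q * MvPolynomial.X (0, j)) = 0
        rw [key, hn, h0]
        simp
    · refine ⟨⟨k + 1, ?_⟩, n, ?_⟩
      · rw [Derivation.leibniz, hk]
        simp [polyH, add_smul, mul_comm, add_comm]
      · have key : ∀ n : ℕ, polyE^[n] (q * MvPolynomial.X (1, j)) =
            polyE^[n] q * MvPolynomial.X (1, j) := fun n => by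
          induction n with
          | zero => rfl
          | succ n ih =>
            rw [Function.iterate_succ_apply', ih, Function.iterate_succ_apply', Derivation.leibniz]
            simp [polyE, mul_comm]
        change polyE^[n] (q * MvPolynomial.X (1, j)) = 0
        rw [key, hn, zero_mul]

lemma hasDerivAt_entry {x : ℝ} (hx : x < 0) (a : ℝ) (b : ℂ) (ij : Fin 2 × Fin 2) (ξ : SU2) :
    HasDerivAt (fun t : ℝ =>
      ((isoSU2 x hx (expReal x (t • realElt x a b)))⁻¹ * ξ).1 ij.1 ij.2)
      (polyFun ((Complex.I * a) • polyH (.X ij) + (√(-x) * b) • polyE (.X ij) -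
        (√(-x) * conj b) • polyF (.X ij)) ξ) 0 := by
  obtain ⟨h0, h1⟩ := hasDerivAt_expReal_entries (x := x) a b
  have h1 := h1.const_mul ((√(-x) : ℝ) : ℂ)
  have conjD : ∀ {φ : ℝ → ℂ} {c : ℂ}, HasDerivAt φ c 0 →
      HasDerivAt (fun t => conj (φ t)) (conj c) 0 := fun hφ =>
    (Complex.conjCLE.toContinuousLinearMap.hasFDerivAt).comp_hasDerivAt (0 : ℝ) hφ
  obtain ⟨i, j⟩ := ij
  fin_cases i
  · have h2 := ((conjD h0).mul_const (ξ.1 0 j)).sub (h1.mul_const (ξ.1 1 j))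
    refine (h2.congr_deriv ?_).congr_of_eventuallyEq (.of_forall fun t => ?_)
    · simp [polyH, polyE, polyF, polyFun_X]
      ring
    · obtain ⟨e1, -, -⟩ := (mem_SU2_iff _).1 (isoSU2 x hx (expReal x (t • realElt x a b))).2
      obtain ⟨e2, e3⟩ := isoSU2_entries hx (expReal x (t • realElt x a b))
      change (((isoSU2 x hx (expReal x (t • realElt x a b)))⁻¹ : SU2).1 * ξ.1) 0 j = _
      rw [SU2_inv_coe, Matrix.mul_apply, Fin.sum_univ_two, Matrix.star_apply, Matrix.star_apply,
        e1, e2, e3]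
      simp [sub_eq_add_neg]
  · have h2 := ((conjD h1).mul_const (ξ.1 0 j)).add (h0.mul_const (ξ.1 1 j))
    refine (h2.congr_deriv ?_).congr_of_eventuallyEq (.of_forall fun t => ?_)
    · simp [polyH, polyE, polyF, polyFun_X]
      ring
    · obtain ⟨-, e1, -⟩ := (mem_SU2_iff _).1 (isoSU2 x hx (expReal x (t • realElt x a b))).2
      obtain ⟨e2, e3⟩ := isoSU2_entries hx (expReal x (t • realElt x a b))
      change (((isoSU2 x hx (expReal x (t • realElt x a b)))⁻¹ : SU2).1 * ξ.1) 1 j = _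
      rw [SU2_inv_coe, Matrix.mul_apply, Fin.sum_univ_two, Matrix.star_apply, Matrix.star_apply,
        e1, e2, e3]
      simp

/-- The derivative of a polynomial function under left translation. -/
lemma hasDerivAt_polyFun {x : ℝ} (hx : x < 0) (a : ℝ) (b : ℂ) (p : MatPoly) (ξ : SU2) :
    HasDerivAt (fun t : ℝ => polyFun p ((isoSU2 x hx (expReal x (t • realElt x a b)))⁻¹ * ξ))
      (polyFun ((Complex.I * a) • polyH p + (√(-x) * b) • polyE p -
        (√(-x) * conj b) • polyF p) ξ) 0 := by
  induction p using MvPolynomial.induction_on with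
  | C c =>
    refine ((hasDerivAt_const (0 : ℝ) c).congr_deriv ?_).congr_of_eventuallyEq
      (.of_forall fun t => ?_)
    · rw [← MvPolynomial.algebraMap_eq]
      simp
    · rw [← MvPolynomial.algebraMap_eq, AlgHom.commutes]
      rfl
  | add p q hp hq =>
    refine ((hp.add hq).congr_deriv ?_).congr_of_eventuallyEq (.of_forall fun t => ?_)
    · simp only [map_add, map_sub, map_smul, smul_add, ContinuousMap.add_apply,
        ContinuousMap.sub_apply, ContinuousMap.smul_apply, smul_eq_mul]
      ring
    · simp
  | mul_X p ij hp =>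
    have h1 := hp.mul (hasDerivAt_entry hx a b ij ξ)
    refine (h1.congr_deriv ?_).congr_of_eventuallyEq (.of_forall fun t => ?_)
    · rw [zero_smul, expReal_zero, map_one, inv_one, one_mul]
      simp only [Derivation.leibniz, map_add, map_sub, map_smul, smul_eq_mul, map_mul,
        ContinuousMap.add_apply, ContinuousMap.sub_apply, ContinuousMap.smul_apply,
        ContinuousMap.mul_apply, polyFun_X]
      ring
    · simp [polyFun_X]

/-- An equivariant map from functions on `SU(2)` gives a map of polynomials as in `IsSl2Map`. -/
theorem isSl2Map_polyFun {x : ℝ} (hx : x < 0) {H : Type*} [NormedAddCommGroup H]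
    [InnerProductSpace ℂ H] {τ : UnitaryRep SU2 H} (T : C(SU2, ℂ) →L[ℂ] H)
    (hT : ∀ g f, τ.toHom g (T f) = T (leftMultiplier.contOp g f)) :
    IsSl2Map (τ.comp (isoSU2 x hx)) (T.toLinearMap ∘ₗ polyFun.toLinearMap) polyH.toLinearMap
      polyE.toLinearMap polyF.toLinearMap where
  deriv a b p := by
    have h1 := leftMultiplier.hasDerivAt_contOp (c := fun t : ℝ =>
      isoSU2 x hx (expReal x (t • realElt x a b)))
      ((isoSU2 x hx).continuous.comp (continuous_expReal_smul _))
      (by rw [zero_smul, expReal_zero, map_one])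
      (fun s t => by rw [expReal_add_smul, map_mul]) (polyFun p) _ (fun ξ => by
        simpa only [leftMultiplier, one_mul] using hasDerivAt_polyFun hx a b p ξ)
    have h2 := (T.restrictScalars ℝ).hasFDerivAt.comp_hasDerivAt (0 : ℝ) h1
    refine HasDerivAt.congr_of_eventuallyEq h2 (.of_forall fun t => ?_)
    exact hT _ _
  h_f := polyH_polyF
  e_f := polyE_polyF

end SU2

end ContractionFamilies
end

noncomputable section

namespace ContractionFamilies

/-! ### The irreducible representations of `SU(2)` -/

section SU2

open MeasureTheory

lemma UnitaryRep.IsIrreducible.comp {G G' H : Type*} [Group G] [TopologicalSpace G] [Group G']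
    [TopologicalSpace G'] [NormedAddCommGroup H] [InnerProductSpace ℂ H] {π : UnitaryRep G H}
    (h : π.IsIrreducible) (j : G' ≃ₜ* G) : (π.comp j).IsIrreducible :=
  ⟨h.1, fun W hW hinv => h.2 W hW fun g v hv => by
    have := hinv (j.symm g) v hv
    change π.toHom (j (j.symm g)) v ∈ W at this
    rwa [ContinuousMulEquiv.apply_symm_apply] at this⟩

lemma isoSU2_torus {x : ℝ} (hx : x < 0) (w : Circle) : isoSU2 x hx (torus x w) = torusSU2 w := by
  obtain ⟨h0, h1⟩ := isoSU2_entries hx (torus x w)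
  refine SU2_ext (h0.trans ?_) (h1.trans ?_) <;> simp [torus_apply, torusSU2, diagMat]

/-- In the regular representation, a power of a matrix entry generates the representation of
highest weight `2m`. -/
theorem exists_model_discretePoint (m : ℕ) :
    ∃ (H : Type) (_ : NormedAddCommGroup H) (_ : InnerProductSpace ℂ H) (_ : CompleteSpace H)
      (π : UnitaryRep (realGroup (discretePoint m)) H) (u : ℤ → H),
      HasLadder π u ∧ DenseSpan u := by
  have hΦ := isSl2Map_polyFun (discretePoint_neg m) (τ := leftMultiplier.rep)
    (ContinuousMap.toLp 2 Measure.haar ℂ) (fun g f => leftMultiplier.op_toLp g f)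
  have hw : polyH (MvPolynomial.X (1, 0) ^ (2 * m)) =
      (2 * m : ℂ) • (MvPolynomial.X (1, 0) ^ (2 * m) : MatPoly) := by
    rcases Nat.eq_zero_or_pos m with rfl | hm
    · simp
    · simp only [Derivation.leibniz_pow, polyH, MvPolynomial.mkDerivation_X, one_ne_zero, if_false,
        smul_eq_mul]
      rw [← pow_succ, Nat.sub_add_cancel (by omega), ← Nat.cast_smul_eq_nsmul ℂ]
      push_cast
      rfl
  obtain ⟨u, hu⟩ := hΦ.exists_hasLadder (p := MvPolynomial.X (1, 0) ^ (2 * m)) (by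
      rw [← map_smul, ← hw]
      rfl) (by
      simp [Derivation.leibniz_pow, polyE]) (fun h0 => by
      have h1 := ContinuousMap.toLp_injective (p := 2) (𝕜 := ℂ) (Measure.haar : Measure SU2)
        (h0.trans (map_zero _).symm)
      have hw : (!![0, 1; -1, 0] : M2 ℂ) ∈ SU2 := by
        rw [mem_SU2_iff]; simp [Matrix.det_fin_two]
      have h2 := DFunLike.congr_fun h1 ⟨_, hw⟩
      simp [polyFun_X] at h2)
  obtain ⟨W, hW, π', u', hu', hd', -, -⟩ := hu.exists_restrict
  exact ⟨W, inferInstance, inferInstance, hW, π', u', hu', hd'⟩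

variable {H : Type*} [NormedAddCommGroup H] [InnerProductSpace ℂ H]

/-- The central element `-1` acts trivially on an irreducible representation with an even
weight. -/
lemma toHom_neg_one {τ : UnitaryRep SU2 H} (hirr : τ.IsIrreducible) {k : ℤ}
    (hk : τ.HasWeight torusSU2 (2 * k)) (v : H) : τ.toHom (torusSU2 (-1)) v = v := by
  obtain ⟨v₀, hv₀, hw⟩ := hk
  set W : Submodule ℂ H := LinearMap.eqLocus (τ.toHom (torusSU2 (-1))).toLinearEquiv.toLinearMap
    LinearMap.id with hW
  have hcomm : ∀ g : SU2, torusSU2 (-1) * g = g * torusSU2 (-1) := fun g => by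
    refine SU2_ext ?_ ?_ <;>
      simp [torusSU2, diagMat, Matrix.mul_apply, Fin.sum_univ_two]
  have hmem : ∀ w, w ∈ W ↔ τ.toHom (torusSU2 (-1)) w = w := fun w => Iff.rfl
  rcases hirr.2 W (isClosed_eq (τ.toHom _).continuous continuous_id) (fun g w hw => by
    rw [hmem] at hw ⊢
    rw [← UnitaryRep.toHom_mul, hcomm, UnitaryRep.toHom_mul, hw]) with h | h
  · have h1 : v₀ ∈ W := by
      rw [hmem, hw]
      simp [zpow_mul]
    rw [h, Submodule.mem_bot] at h1
    exact absurd h1 hv₀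
  · exact (hmem v).1 (h ▸ trivial)

/-- Over `-(2m+1)⁻²` the nonzero ladder vectors are those with `|j| ≤ m`, so `2m` is the highest
weight. -/
lemma HasLadder.isGreatest_weight {m : ℕ} {π : UnitaryRep (realGroup (discretePoint m)) H}
    {u : ℤ → H} (hu : HasLadder π u) (hd : DenseSpan u) :
    IsGreatest {k : ℤ | (π.comp (isoSU2 _ (discretePoint_neg m)).symm).HasWeight torusSU2 k}
      (2 * m) := by
  have htor : ∀ w, (isoSU2 _ (discretePoint_neg m)).symm (torusSU2 w) =
      ContractionFamilies.torus _ w := fun w => by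
    rw [← isoSU2_torus (discretePoint_neg m)]
    exact ContinuousMulEquiv.symm_apply_apply _ _
  constructor
  · refine ⟨u m, hu.ne_zero (dv_discretePoint_pos (by omega)).ne', fun w => ?_⟩
    change π.toHom ((isoSU2 _ (discretePoint_neg m)).symm (torusSU2 w)) _ = _
    rw [htor, hu.torus]
  · rintro k ⟨v, hv, hw⟩
    have hw' : ∀ w, π.toHom (ContractionFamilies.torus _ w) v = ((w : ℂ) ^ k) • v := fun w => by
      rw [← htor]
      exact hw w
    by_contra hlt
    refine hv (hd.eq_zero fun j => ?_)
    rcases le_or_gt j.natAbs m with hj | hj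
    · exact (UnitaryRep.isDerivative_of_weight fun w => hu.torus w j).inner_eq_zero
        (UnitaryRep.isDerivative_of_weight hw') (by omega)
    · rw [hu.eq_zero (dv_discretePoint_eq_zero hj), inner_zero_left]

lemma integrable_smul_orbit (τ : UnitaryRep SU2 H) (v : H) (f : C(SU2, ℂ)) :
    Integrable (fun g => f g • τ.toHom g v) Measure.haar :=
  (f.continuous.smul (τ.continuous_orbit v)).integrable_of_hasCompactSupport
    (HasCompactSupport.of_compactSpace _)

/-- The vectors `∫ f(g) τ(g) v dg`, as a function of `f`. -/
def averageCLM (τ : UnitaryRep SU2 H) (v : H) : C(SU2, ℂ) →L[ℂ] H :=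
  LinearMap.mkContinuous
    { toFun f := ∫ g, f g • τ.toHom g v ∂Measure.haar
      map_add' f f' := by
        rw [← integral_add (integrable_smul_orbit τ v f) (integrable_smul_orbit τ v f')]
        simp only [ContinuousMap.add_apply, add_smul]
      map_smul' c f := by
        rw [RingHom.id_apply, ← integral_smul]
        simp only [ContinuousMap.smul_apply, smul_assoc] }
    (‖v‖ * (Measure.haar : Measure SU2).real Set.univ) fun f => by
      refine (norm_integral_le_of_norm_le_const (C := ‖f‖ * ‖v‖) (.of_forall fun g => ?_)).trans
        (by ring_nf; rfl)
      rw [norm_smul, LinearIsometryEquiv.norm_map]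
      exact mul_le_mul_of_nonneg_right (f.norm_coe_le_norm g) (norm_nonneg _)

lemma averageCLM_apply (τ : UnitaryRep SU2 H) (v : H) (f : C(SU2, ℂ)) :
    averageCLM τ v f = ∫ g, f g • τ.toHom g v ∂Measure.haar := rfl

variable [CompleteSpace H]

lemma toHom_averageCLM (τ : UnitaryRep SU2 H) (v : H) (h : SU2) (f : C(SU2, ℂ)) :
    τ.toHom h (averageCLM τ v f) = averageCLM τ v (leftMultiplier.contOp h f) := by
  have h1 := ((τ.toHom h).toContinuousLinearEquiv.toContinuousLinearMap).integral_comp_comm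
    (integrable_smul_orbit τ v f)
  rw [averageCLM_apply, averageCLM_apply]
  refine Eq.trans h1.symm (Eq.trans (integral_congr_ae (.of_forall fun g => ?_))
    (integral_mul_left_eq_self (fun g => leftMultiplier.contOp h f g • τ.toHom g v) h))
  change τ.toHom h (f g • τ.toHom g v) = (1 * f (h⁻¹ * (h * g))) • τ.toHom (h * g) v
  rw [map_smul, inv_mul_cancel_left, one_mul, UnitaryRep.toHom_mul]

/-- The polynomial functions on `SU(2)`, which are dense by the theorem of Stone and
Weierstrass. -/
def polySubalgebra : StarSubalgebra ℂ C(SU2, ℂ) :=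
  { polyFun.range with
    star_mem' := by
      rintro _ ⟨p, rfl⟩
      change star (polyFun p) ∈ polyFun.range
      induction p using MvPolynomial.induction_on with
      | C c =>
        refine ⟨MvPolynomial.C (conj c), ?_⟩
        rw [← MvPolynomial.algebraMap_eq]
        ext g
        simp [Algebra.algebraMap_eq_smul_one]
      | add p q hp hq => rw [map_add, star_add]; exact add_mem hp hq
      | mul_X p ij hp =>
        rw [map_mul, star_mul']
        refine mul_mem hp ?_
        obtain ⟨i, j⟩ := ij
        fin_cases i <;> fin_cases j
        · refine ⟨.X (1, 1), ContinuousMap.ext fun g => ?_⟩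
          exact (polyFun_X _ g).trans ((((mem_SU2_iff _).1 g.2).2.1).trans
            (congrArg conj (polyFun_X (0, 0) g).symm))
        · refine ⟨-.X (1, 0), ContinuousMap.ext fun g => ?_⟩
          have := ((mem_SU2_iff _).1 g.2).1
          simp [polyFun_X, this]
        · refine ⟨-.X (0, 1), ContinuousMap.ext fun g => ?_⟩
          have := ((mem_SU2_iff _).1 g.2).1
          simp [polyFun_X, this]
        · refine ⟨.X (0, 0), ContinuousMap.ext fun g => ?_⟩
          have := ((mem_SU2_iff _).1 g.2).2.1
          simp [polyFun_X, this] }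

lemma polySubalgebra_dense : polySubalgebra.topologicalClosure = ⊤ := by
  refine ContinuousMap.starSubalgebra_topologicalClosure_eq_top_of_separatesPoints _ ?_
  intro g g' hne
  by_contra hcon
  push Not at hcon
  have key : ∀ ij : Fin 2 × Fin 2, g.1 ij.1 ij.2 = g'.1 ij.1 ij.2 := fun ij => by
    have := hcon _ ⟨polyFun (.X ij), ⟨.X ij, rfl⟩, rfl⟩
    exact (polyFun_X ij g).symm.trans (this.trans (polyFun_X ij g'))
  exact hne (SU2_ext (key (0, 0)) (key (0, 1)))

/-- Some monomial has a nonzero average. -/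
lemma exists_monomial_average_ne_zero (τ : UnitaryRep SU2 H) {v : H} (hv : v ≠ 0) :
    ∃ q ∈ Submonoid.closure (Set.range (MvPolynomial.X : Fin 2 × Fin 2 → MatPoly)),
      averageCLM τ v (polyFun q) ≠ 0 := by
  by_contra! hcon
  have h1 : (averageCLM τ v).toLinearMap ∘ₗ polyFun.toLinearMap = 0 := by
    refine LinearMap.ext_on (s := (Submonoid.closure (Set.range
      (MvPolynomial.X : Fin 2 × Fin 2 → MatPoly)) : Set MatPoly)) ?_ hcon
    rw [← Algebra.adjoin_eq_span, MvPolynomial.adjoin_range_X, Algebra.top_toSubmodule]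
  have h2 : ∀ f : C(SU2, ℂ), averageCLM τ v f = 0 := fun f => by
    have hf : f ∈ polySubalgebra.topologicalClosure := by rw [polySubalgebra_dense]; trivial
    have hcl : closure (polySubalgebra : Set C(SU2, ℂ)) ⊆ {f | averageCLM τ v f = 0} :=
      closure_minimal (by
        rintro _ ⟨p, rfl⟩
        exact LinearMap.congr_fun h1 p) (isClosed_eq (averageCLM τ v).continuous continuous_const)
    exact hcl hf
  have hc : Continuous fun g => ⟪v, τ.toHom g v⟫_ℂ :=
    continuous_const.inner (τ.continuous_orbit v)
  have h3 := h2 ⟨fun g => conj ⟪v, τ.toHom g v⟫_ℂ, Complex.continuous_conj.comp hc⟩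
  have h4 := ((innerSL ℂ v)).integral_comp_comm (integrable_smul_orbit τ v
    ⟨fun g => conj ⟪v, τ.toHom g v⟫_ℂ, Complex.continuous_conj.comp hc⟩)
  rw [← averageCLM_apply, h3, map_zero] at h4
  have h5 : ∀ g : SU2, innerSL ℂ v (conj ⟪v, τ.toHom g v⟫_ℂ • τ.toHom g v) =
      ((Complex.normSq ⟪v, τ.toHom g v⟫_ℂ : ℝ) : ℂ) := fun g => by
    rw [map_smul, smul_eq_mul, mul_comm]
    exact Complex.mul_conj _
  simp only [ContinuousMap.coe_mk, h5, integral_complex_ofReal] at h4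
  refine (Continuous.integral_pos_of_hasCompactSupport_nonneg_nonzero (x := (1 : SU2))
    (μ := Measure.haar) (Complex.continuous_normSq.comp hc) (HasCompactSupport.of_compactSpace _)
    (fun g => Complex.normSq_nonneg _) ?_).ne' (by exact_mod_cast h4)
  change Complex.normSq ⟪v, τ.toHom 1 v⟫_ℂ ≠ 0
  rw [UnitaryRep.toHom_one]
  simpa using hv

/-- An irreducible representation of `SU(2)` with an even weight is given by a ladder. -/
theorem exists_hasLadder_SU2 {τ : UnitaryRep SU2 H} (hirr : τ.IsIrreducible) {k : ℤ}
    (hk : τ.HasWeight torusSU2 (2 * k)) :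
    ∃ (m : ℕ) (u : ℤ → H), HasLadder (τ.comp (isoSU2 _ (discretePoint_neg m))) u ∧
      DenseSpan u := by
  obtain ⟨v, hv, -⟩ := id hk
  have hT := toHom_averageCLM τ v
  have hΦ := fun {x : ℝ} (hx : x < 0) => isSl2Map_polyFun hx (averageCLM τ v) hT
  obtain ⟨q, hq, hne⟩ := exists_monomial_average_ne_zero τ hv
  obtain ⟨⟨l, hl⟩, n, hn⟩ := monomial_weight hq
  -- the last nonzero vector obtained by applying `E`
  have hex : ∃ n, averageCLM τ v (polyFun (polyE^[n] q)) = 0 :=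
    ⟨n, by rw [hn, map_zero, map_zero]⟩
  classical
  obtain ⟨r, hr⟩ : ∃ r, Nat.find hex = r + 1 :=
    Nat.exists_eq_succ_of_ne_zero fun h => hne (by
      have := Nat.find_spec hex
      rwa [h] at this)
  have he := Nat.find_spec hex
  have h0 := Nat.find_min hex (m := r) (by omega)
  rw [hr, Function.iterate_succ_apply'] at he
  set p := polyE^[r] q with hp
  have hpw : ∀ n : ℕ, polyH (polyE^[n] q) = ((l + 2 * n : ℤ) : ℂ) • polyE^[n] q := fun n => by
    induction n with
    | zero => simpa using hl
    | succ n ih =>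
      rw [Function.iterate_succ_apply', polyH_polyE, ih, Derivation.map_smul]
      push_cast
      module
  set N := l + 2 * (r : ℤ) with hN
  have hw : averageCLM τ v (polyFun (polyH p)) = (N : ℂ) • averageCLM τ v (polyFun p) := by
    rw [hpw, map_smul, map_smul]
  have hx : (-1 : ℝ) < 0 := by norm_num
  have hpos : 0 ≤ N := (hΦ hx).weight_nonneg hx hw he h0
  have heven : Even N := by
    have h1 := (hΦ hx).deriv 1 0 p
    simp only [map_zero, mul_zero, zero_smul, add_zero, sub_zero, Complex.ofReal_one, mul_one,
      map_smul] at h1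
    have h2 : (τ.comp (isoSU2 (-1) hx)).IsDerivative (realElt (-1) 1 0)
        (averageCLM τ v (polyFun p)) ((Complex.I * N) • averageCLM τ v (polyFun p)) := by
      rw [mul_smul, ← hw]
      exact h1
    have h3 := h2.toHom_torus (-1)
    change τ.toHom (isoSU2 (-1) hx (torus (-1) (-1))) _ = _ at h3
    rw [isoSU2_torus, toHom_neg_one hirr hk] at h3
    by_contra hodd
    rw [Int.not_even_iff_odd] at hodd
    have h4 : ((-1 : Circle) : ℂ) ^ N = -1 := by
      rw [Circle.coe_neg, Circle.coe_one, hodd.neg_one_zpow]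
    rw [h4, neg_smul, one_smul, eq_neg_iff_add_eq_zero, ← two_smul ℂ] at h3
    exact h0 ((smul_eq_zero.1 h3).resolve_left two_ne_zero)
  obtain ⟨m, hm⟩ : ∃ m : ℕ, N = 2 * m := by
    obtain ⟨c, hc⟩ := heven
    exact ⟨c.toNat, by omega⟩
  obtain ⟨u, hu⟩ := (hΦ (discretePoint_neg m)).exists_hasLadder (p := p) (by
    refine hw.trans ?_
    rw [hm]
    push_cast
    rfl) he h0
  exact ⟨m, u, hu, hu.denseSpan_of_isIrreducible (hirr.comp _)⟩

/-- The irreducible representation of highest weight `2m` is given by a ladder over the point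
`-(2m+1)⁻²`. -/
theorem exists_hasLadder_of_isGreatest {τ : UnitaryRep SU2 H} (hirr : τ.IsIrreducible) {m : ℕ}
    (hm : IsGreatest {k : ℤ | τ.HasWeight torusSU2 k} (2 * m)) :
    ∃ u, HasLadder (τ.comp (isoSU2 _ (discretePoint_neg m))) u ∧ DenseSpan u := by
  obtain ⟨m', u, hu, hd⟩ := exists_hasLadder_SU2 hirr hm.1
  have e : (τ.comp (isoSU2 _ (discretePoint_neg m'))).comp (isoSU2 _ (discretePoint_neg m')).symm
      = τ := UnitaryRep.ext fun g v => by
    change τ.toHom (isoSU2 _ (discretePoint_neg m') ((isoSU2 _ (discretePoint_neg m')).symm g)) v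
      = _
    rw [ContinuousMulEquiv.apply_symm_apply]
  have h := hu.isGreatest_weight hd
  rw [e] at h
  have : m' = m := by
    have := h.unique hm
    omega
  subst this
  exact ⟨u, hu, hd⟩

end SU2

end ContractionFamilies
end

noncomputable section

namespace ContractionFamilies

/-! ### The representations attached to the Jantzen quotients -/

open HCFamily

/-- Over each point of the half-line `x ≥ 0` and over each point `-(2m+1)⁻²` there is a unitary
representation given by a dense ladder. -/
theorem exists_model {x : ℝ} (hx : IsSpecialPoint x) :
    ∃ (H : Type) (_ : NormedAddCommGroup H) (_ : InnerProductSpace ℂ H) (_ : CompleteSpace H)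
      (π : UnitaryRep (realGroup x) H) (u : ℤ → H), HasLadder π u ∧ DenseSpan u := by
  rcases hx with hx | ⟨m, rfl⟩
  · rcases hx.eq_or_lt with rfl | hx
    · exact ⟨_, inferInstance, inferInstance, inferInstance, motionModel, _,
        motionModel_hasLadder, denseSpan_fourierLp⟩
    · obtain ⟨u, hu, hd⟩ := principalSeries_exists_hasLadder hx (ν := (√x)⁻¹) (by
        rw [inv_pow, Real.sq_sqrt hx.le, mul_inv_cancel₀ hx.ne'])
      exact ⟨_, inferInstance, inferInstance, inferInstance, _, u, hu, hd⟩
  · exact exists_model_discretePoint m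

lemma casimir_eq_iff {x : ℝ} (hx : 0 < x) (ν : ℝ) :
    -(1 + ν ^ 2) = -(x + 1) / x ↔ x * ν ^ 2 = 1 := by
  rw [eq_div_iff hx.ne']
  constructor <;> intro h <;> linarith

variable {F : HCFamily.{u}} (hF : F.IsContractionFamily) (φ : F.Intertwiner)

include hF

/-- The Casimir `-(1 + ν²)` is `-(1 + x) / x` for `ν² = 1 / x`, so `ν = 0` does not occur. -/
theorem principalSeries_occurs_iff {H : Type*} [NormedAddCommGroup H] [InnerProductSpace ℂ H]
    (τ : UnitaryRep SU11 H) (ν : ℝ) (hτ : IsSphericalPrincipalSeries ν τ) :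
    (∃ (x : ℝ) (hx : 0 < x), IsJantzenRep φ x (τ.comp (isoSU11 x hx))) ↔ ν ≠ 0 := by
  constructor
  · rintro ⟨x, hx, h⟩ rfl
    have := (hτ.exists_hasLadder_iff hx).1 ((isJantzenRep_iff hF φ (Or.inl hx.le) _).1 h)
    simp at this
  · intro hν
    have hx : 0 < (ν ^ 2)⁻¹ := by positivity
    exact ⟨_, hx, (isJantzenRep_iff hF φ (Or.inl hx.le) _).2
      ((hτ.exists_hasLadder_iff hx).2 (inv_mul_cancel₀ (by positivity)))⟩

/-- The family `π_{1/ε}` occurs at `x = ε²` and contracts to the representation at `0` as `ε → 0`. -/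
theorem contraction_SU11 {H₀ : Type*} [NormedAddCommGroup H₀] [InnerProductSpace ℂ H₀]
    [CompleteSpace H₀] (π₀ : UnitaryRep (realGroup 0) H₀) (hπ₀ : IsJantzenRep φ 0 π₀)
    (H : Set.Ioi (0 : ℝ) → Type v) [∀ ε, NormedAddCommGroup (H ε)]
    [∀ ε, InnerProductSpace ℂ (H ε)] [∀ ε, CompleteSpace (H ε)] (τ : ∀ ε, UnitaryRep SU11 (H ε))
    (hτ : ∀ ε : Set.Ioi (0 : ℝ), IsSphericalPrincipalSeries (1 / (ε : ℝ)) (τ ε)) :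
    (∀ ε : Set.Ioi (0 : ℝ), IsJantzenRep φ ((ε : ℝ) ^ 2)
      ((τ ε).comp (isoSU11 _ (pow_pos ε.2 2)))) ∧
    ContractsTo (comap (fun ε : Set.Ioi (0 : ℝ) => (ε : ℝ)) (𝓝 0))
      (fun ε => contractSU11 (ε : ℝ)) τ π₀ := by
  have hl : ∀ ε : Set.Ioi (0 : ℝ), ∃ u, HasLadder ((τ ε).comp (isoSU11 _ (pow_pos ε.2 2))) u ∧
      DenseSpan u := fun ε => ((hτ ε).exists_hasLadder_iff _).2 (by
    have : (ε : ℝ) ≠ 0 := ne_of_gt ε.2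
    field_simp)
  refine ⟨fun ε => (isJantzenRep_iff hF φ (Or.inl (pow_pos ε.2 2).le) _).2 (hl ε), ?_⟩
  choose u hu hd using hl
  obtain ⟨u₀, hu₀, hd₀⟩ := (isJantzenRep_iff hF φ (Or.inl le_rfl) π₀).1 hπ₀
  have hx : Tendsto (fun ε : Set.Ioi (0 : ℝ) => (ε : ℝ) ^ 2)
      (comap (fun ε : Set.Ioi (0 : ℝ) => (ε : ℝ)) (𝓝 0)) (𝓝 0) := by
    simpa using (tendsto_comap (f := fun ε : Set.Ioi (0 : ℝ) => (ε : ℝ)) (x := 𝓝 0)).pow 2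
  obtain ⟨J, hJ⟩ := exists_contraction hx hu hd hu₀ hd₀
  refine ⟨J, fun v S hS => ?_⟩
  have e : ∀ (ε : Set.Ioi (0 : ℝ)) (g : realGroup 0), contractSU11 (ε : ℝ) g = _ :=
    fun ε g => contractSU11_eq ε.2 g
  simp only [e]
  exact hJ v S hS

/-- The representations of highest weight `2m` occur at `x = -(2m+1)⁻²` and contract to the
representation at `0` as `m → ∞`. -/
theorem contraction_SU2 {H₀ : Type*} [NormedAddCommGroup H₀] [InnerProductSpace ℂ H₀]
    [CompleteSpace H₀] (π₀ : UnitaryRep (realGroup 0) H₀) (hπ₀ : IsJantzenRep φ 0 π₀)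
    (H : ℕ → Type v) [∀ m, NormedAddCommGroup (H m)] [∀ m, InnerProductSpace ℂ (H m)]
    [∀ m, CompleteSpace (H m)] (τ : ∀ m, UnitaryRep SU2 (H m))
    (hτ : ∀ m : ℕ, (τ m).IsIrreducible ∧
      IsGreatest {k : ℤ | (τ m).HasWeight torusSU2 k} (2 * m)) :
    (∀ m, IsJantzenRep φ (discretePoint m) ((τ m).comp (isoSU2 _ (discretePoint_neg m)))) ∧
    ContractsTo atTop (fun m : ℕ => contractSU2 (1 / (2 * (m : ℝ) + 1))) τ π₀ := by
  have hl := fun m => exists_hasLadder_of_isGreatest (hτ m).1 (hτ m).2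
  refine ⟨fun m => (isJantzenRep_iff hF φ (Or.inr ⟨m, rfl⟩) _).2 (hl m), ?_⟩
  choose u hu hd using hl
  obtain ⟨u₀, hu₀, hd₀⟩ := (isJantzenRep_iff hF φ (Or.inl le_rfl) π₀).1 hπ₀
  have hsq : ∀ m : ℕ, discretePoint m = -(1 / (2 * (m : ℝ) + 1)) ^ 2 := fun m => by
    rw [discretePoint, one_div, inv_pow]
  have h1 : Tendsto (fun m : ℕ => 1 / (2 * (m : ℝ) + 1)) atTop (𝓝 0) := by
    refine Tendsto.div_atTop tendsto_const_nhds (tendsto_atTop_add_const_right _ _ ?_)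
    exact tendsto_natCast_atTop_atTop.const_mul_atTop two_pos
  have hx : Tendsto discretePoint atTop (𝓝 0) := by
    rw [show discretePoint = fun m : ℕ => -(1 / (2 * (m : ℝ) + 1)) ^ 2 from funext hsq]
    simpa using (h1.pow 2).neg
  obtain ⟨J, hJ⟩ := exists_contraction hx hu hd hu₀ hd₀
  refine ⟨J, fun v S hS => ?_⟩
  have e : ∀ (m : ℕ) (g : realGroup 0), contractSU2 (1 / (2 * (m : ℝ) + 1)) g = _ :=
    fun m g => contractSU2_eq (by positivity) (discretePoint_neg m) (hsq m) g
  simp only [e]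
  exact hJ v S hS

/-- The spherical irreducible representation of the motion group on which `4EF` acts as `-1` is
the representation attached to the Jantzen quotient at `0`, and it is unique. -/
theorem motion_representation {H : Type*} [NormedAddCommGroup H] [InnerProductSpace ℂ H]
    [CompleteSpace H] (π : UnitaryRep (realGroup 0) H) (hπ : IsJantzenRep φ 0 π) :
    (π.IsIrreducible ∧ π.HasWeight (torus 0) 0 ∧ π.MotionCasimirActsBy (-1)) ∧
      ∀ (H' : Type v) [NormedAddCommGroup H'] [InnerProductSpace ℂ H'] [CompleteSpace H']
        (π' : UnitaryRep (realGroup 0) H'), π'.IsIrreducible → π'.HasWeight (torus 0) 0 →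
        π'.MotionCasimirActsBy (-1) → π'.Equivalent π := by
  obtain ⟨u, hu, hd⟩ := (isJantzenRep_iff hF φ (Or.inl le_rfl) π).1 hπ
  refine ⟨⟨hu.isIrreducible hd (isUnitaryPoint_of_nonneg le_rfl),
    ⟨u 0, hu.ne_zero (by rw [dv_zero]; exact one_ne_zero), fun w => by
      simpa using hu.torus w 0⟩, hu.motionCasimirActsBy hd⟩, ?_⟩
  intro H' _ _ _ π' h1 h2 h3
  obtain ⟨u', hu', hd'⟩ := exists_hasLadder_motion π' h1 h2 h3
  exact hu'.equivalent hd' hu hd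

end ContractionFamilies
end

theorem mainTheorem1 :
    (∃ F : HCFamily.{0}, F.IsContractionFamily) ∧
    ∀ F : HCFamily.{u}, F.IsContractionFamily →
    Nonempty F.Intertwiner ∧ ∀ φ : F.Intertwiner,
    -- infinitesimally unitary Jantzen quotients integrate uniquely to the completion
    (∀ (x : ℝ) (n : ℤ) (B : SesqForm (JQuot φ x n)), IsInfUnitary φ x n → IsJantzenForm φ x n B →
      IsPosDef B → ∀ (H : Type v) [NormedAddCommGroup H] [InnerProductSpace ℂ H] [CompleteSpace H]
        (ι : JQuot φ x n →ₗ[ℂ] H), IsCompletion B ι →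
        ∃! π : UnitaryRep (realGroup x) H, Integrates φ x n ι π) ∧
    -- (a)
    ((∀ (x : ℝ) (hx : 0 < x), (∃! n : ℤ, IsInfUnitary φ x n) ∧
        ∀ (H : Type v) [NormedAddCommGroup H] [InnerProductSpace ℂ H] [CompleteSpace H]
          (π : UnitaryRep (realGroup x) H), IsJantzenRep φ x π →
          π.CasimirActsBy (-(x + 1) / x) ∧
          ∀ ν : ℝ, -(1 + ν ^ 2) = -(x + 1) / x →
            IsSphericalPrincipalSeries ν (π.comp (isoSU11 x hx).symm)) ∧
      (∀ (H : Type v) [NormedAddCommGroup H] [InnerProductSpace ℂ H] [CompleteSpace H]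
          (τ : UnitaryRep SU11 H) (ν : ℝ), IsSphericalPrincipalSeries ν τ →
          ((∃ (x : ℝ) (hx : 0 < x), IsJantzenRep φ x (τ.comp (isoSU11 x hx))) ↔ ν ≠ 0))) ∧
    -- (b)
    ((∃! n : ℤ, Nontrivial (JQuot φ (0 : ℝ) n)) ∧
      (∀ n : ℤ, Nontrivial (JQuot φ (0 : ℝ) n) → IsInfUnitary φ 0 n) ∧
      Subalgebra.center ℂ (UniversalEnvelopingAlgebra ℂ (gPairs ℂ (0 : ℂ))) =
        Algebra.adjoin ℂ {4 * UniversalEnvelopingAlgebra.ι ℂ (gElt (0 : ℂ) 0 1 0) *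
          UniversalEnvelopingAlgebra.ι ℂ (gElt (0 : ℂ) 0 0 1)} ∧
      ∀ (H : Type v) [NormedAddCommGroup H] [InnerProductSpace ℂ H] [CompleteSpace H]
        (π : UnitaryRep (realGroup 0) H), IsJantzenRep φ 0 π →
        (π.IsIrreducible ∧ π.HasWeight (torus 0) 0 ∧ π.MotionCasimirActsBy (-1)) ∧
        ∀ (H' : Type v) [NormedAddCommGroup H'] [InnerProductSpace ℂ H'] [CompleteSpace H']
          (π' : UnitaryRep (realGroup 0) H'), π'.IsIrreducible → π'.HasWeight (torus 0) 0 →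
          π'.MotionCasimirActsBy (-1) → π'.Equivalent π) ∧
    -- (c)
    ((∀ x : ℝ, x < 0 → ∀ n : ℤ, IsInfUnitary φ x n → ∃ m : ℕ, x = discretePoint m) ∧
      (∀ m : ℕ, (∃! n : ℤ, IsInfUnitary φ (discretePoint m) n) ∧
        ∀ (H : Type v) [NormedAddCommGroup H] [InnerProductSpace ℂ H] [CompleteSpace H]
          (π : UnitaryRep (realGroup (discretePoint m)) H), IsJantzenRep φ (discretePoint m) π →
          (π.comp (isoSU2 _ (discretePoint_neg m)).symm).IsIrreducible ∧
          IsGreatest {k : ℤ | (π.comp (isoSU2 _ (discretePoint_neg m)).symm).HasWeight torusSU2 k}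
            (2 * m)) ∧
      (∀ (H : Type v) [NormedAddCommGroup H] [InnerProductSpace ℂ H] [CompleteSpace H]
          (τ : UnitaryRep SU2 H), τ.IsIrreducible → τ.HasWeight torusSU2 0 →
          ∃ m : ℕ, IsJantzenRep φ (discretePoint m)
            (τ.comp (isoSU2 _ (discretePoint_neg m))))) ∧
    -- (d)
    (∀ (H₀ : Type v) [NormedAddCommGroup H₀] [InnerProductSpace ℂ H₀] [CompleteSpace H₀]
        (π₀ : UnitaryRep (realGroup 0) H₀), IsJantzenRep φ 0 π₀ →
      (∀ (H : Set.Ioi (0 : ℝ) → Type v) [∀ ε, NormedAddCommGroup (H ε)]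
          [∀ ε, InnerProductSpace ℂ (H ε)] [∀ ε, CompleteSpace (H ε)]
          (τ : ∀ ε, UnitaryRep SU11 (H ε)),
          (∀ ε : Set.Ioi (0 : ℝ), IsSphericalPrincipalSeries (1 / (ε : ℝ)) (τ ε)) →
          (∀ ε : Set.Ioi (0 : ℝ), IsJantzenRep φ ((ε : ℝ) ^ 2) ((τ ε).comp (isoSU11 _ (pow_pos ε.2 2)))) ∧
          ContractsTo (comap (fun ε : Set.Ioi (0 : ℝ) => (ε : ℝ)) (𝓝 0))
            (fun ε => contractSU11 (ε : ℝ)) τ π₀) ∧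
      (∀ (H : ℕ → Type v) [∀ m, NormedAddCommGroup (H m)]
          [∀ m, InnerProductSpace ℂ (H m)] [∀ m, CompleteSpace (H m)]
          (τ : ∀ m, UnitaryRep SU2 (H m)),
          (∀ m : ℕ, (τ m).IsIrreducible ∧ IsGreatest {k : ℤ | (τ m).HasWeight torusSU2 k} (2 * m)) →
          (∀ m, IsJantzenRep φ (discretePoint m) ((τ m).comp (isoSU2 _ (discretePoint_neg m)))) ∧
          ContractsTo atTop (fun m : ℕ => contractSU2 (1 / (2 * (m : ℝ) + 1))) τ π₀)) := by
  refine ⟨⟨modelFamily, modelFamily_isContractionFamily⟩, fun F hF => ?_⟩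
  obtain ⟨b, hb⟩ := hF.exists_isStandard
  refine ⟨⟨stdIntertwiner hb⟩, fun φ => ⟨?_, ⟨?_, ?_⟩, ⟨?_, ?_, center_motionU, ?_⟩, ⟨?_, ?_, ?_⟩,
    ?_⟩⟩
  · intro x n B hn hB hpos H _ _ _ ι hι
    obtain ⟨H', _, _, _, π', u', hu', hd'⟩ := exists_model (isSpecialPoint_of_isInfUnitary hF φ hn)
    exact existsUnique_integrates hF φ hn hB hpos hι hu' hd'
  · intro x hx
    refine ⟨existsUnique_isInfUnitary hF φ (Or.inl hx.le), fun H _ _ _ π hπ => ?_⟩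
    obtain ⟨u, hu, hd⟩ := (isJantzenRep_iff hF φ (Or.inl hx.le) π).1 hπ
    exact ⟨hu.casimirActsBy hd hx, fun ν hν =>
      hu.isSphericalPrincipalSeries hx hd ((casimir_eq_iff hx ν).1 hν)⟩
  · intro H _ _ _ τ ν hτ
    exact principalSeries_occurs_iff hF φ τ ν hτ
  · obtain ⟨n, hn, huniq⟩ := exists_nontrivial_of_nonneg hF φ (le_refl (0 : ℝ))
    exact ⟨n, hn.1, fun n' => huniq n'⟩
  · intro n hn
    obtain ⟨n₀, hn₀, huniq⟩ := exists_nontrivial_of_nonneg hF φ (le_refl (0 : ℝ))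
    rwa [huniq n hn]
  · intro H _ _ _ π hπ
    exact motion_representation hF φ π hπ
  · intro x hx n hn
    exact (isSpecialPoint_of_isInfUnitary hF φ hn).resolve_left hx.not_ge
  · intro m
    refine ⟨existsUnique_isInfUnitary hF φ (Or.inr ⟨m, rfl⟩), fun H _ _ _ π hπ => ?_⟩
    obtain ⟨u, hu, hd⟩ := (isJantzenRep_iff hF φ (Or.inr ⟨m, rfl⟩) π).1 hπ
    exact ⟨(hu.isIrreducible hd (isUnitaryPoint_discretePoint m)).comp _,
      hu.isGreatest_weight hd⟩
  · intro H _ _ _ τ hirr hw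
    obtain ⟨m, u, hu, hd⟩ := exists_hasLadder_SU2 (k := 0) hirr hw
    exact ⟨m, (isJantzenRep_iff hF φ (Or.inr ⟨m, rfl⟩) _).2 ⟨u, hu, hd⟩⟩
  · intro H₀ _ _ _ π₀ hπ₀
    refine ⟨?_, ?_⟩
    · intro H _ _ _ τ hτ
      exact contraction_SU11 hF φ π₀ hπ₀ H τ hτ
    · intro H _ _ _ τ hτ
      exact contraction_SU2 hF φ π₀ hπ₀ H τ hτ
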